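/- \textbf{Setting.} Let $N\in\mathbb N$. For $k=1,\dots,N$ let $h_{0,k}\ge 0$ on $\mathfrak K_k$ be either multiplication by $|p|^2/2$ on $L^2(\mathbb R^{d})$, $d\ge 3$ ($d$ may depend on $k$), or $h_{0,k}=\|A_{G}\|\mathbb 1-A_{G}$ on $\ell^2(VG)$, where $A_G$ is the adjacency operator of an undirected connected graph $G=G_k$ with countably infinitely many vertices, bounded degree, no loops and no multiple edges. The Perron--Frobenius weight $v_k$ is, in the first case, the Dirac delta $\langle v_k,\psi\rangle=\psi(0)$, with domain $\mathcal D(v_k)$ the $\psi\in L^2$ that agree a.e. with a function continuous at $0$; in the second case a function $v_k:VG\to(0,\infty)$ with $\sum_{y\sim x}v_k(y)=\mathrm{spr}(A_G)\,v_k(x)$ for all $x$, with $\mathcal D(v_k)=\{\psi:\sum_x v_k(x)|\psi(x)|<\infty\}$ and $\langle v_k,\psi\rangle=\sum_x v_k(x)\psi(x)$. On $\mathcal K=\mathbb C\oplus\bigoplus_{k=1}^N\mathfrak K_k$ let $h(c,\psi)=\bigl(\Omega c+\lambda\sum_k\langle g_k,\psi_k\rangle,\ (h_{0,k}\psi_k+\lambda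 c\,g_k)_k\bigr)$ with $\Omega,\lambda>0$, $g_k\in\mathfrak K_k$, and put $h_{0,0}=\bigoplus_k h_{0,k}$, $g=(g_k)_k$, with spectral measure $E_0$ of $h_{0,0}$. The Weyl algebra $\mathcal W(\mathcal K)$ is the C*-algebra generated by unitaries $W(f)$ with $W(f)^*=W(-f)$, $W(f)W(f')=e^{-\frac i2\mathrm{Im}\langle f,f'\rangle}W(f+f')$, and $\alpha_t(W(f))=W(e^{ith}f)$. Let $\beta_k>0$, $\mu_k\le0$, $\mathcal N_k(x)=(e^{\beta_k(x-\mu_k)}-1)^{-1}$, and let $\Theta_k:\mathbb C\to\mathbb R$ be real linear, $\Theta_k=0$ if $\mu_k<0$. The initial state $\omega_0$ is a product state: for $c\in\mathbb C$ and $\psi_k\in\mathcal D(v_k)\cap\mathcal D((e^{\beta_k(h_{0,k}-\mu_k)}-1)^{-1/2})$, $$\omega_0(W(c,\psi))=\omega_0(W(c,0))\prod_k\omega_0(W((\psi_k))),\qquad \omega_0(W((\psi_k)))=e^{-\frac12\langle\psi_k,(\mathcal N_k(h_{0,k})+\frac12)\psi_k\rangle}\,e^{i\Theta_k(\langle v_k,\psi_k\rangle)},$$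 where $(\psi_k)$ is the vector of $\mathcal K$ whose $\mathfrak K_k$-component is $\psi_k$ and whose other components vanish. \textbf{Conditions.} A pair $\psi,\xi\in\mathfrak K_k$ satisfies (Abs) if $\sup_{\nu\in\mathbb R,\varepsilon>0}|\langle\psi,(\nu-h_{0,k}\pm i\varepsilon)^{-1}\xi\rangle|<\infty$. Assume: (A) $(g_k,g_k)$ satisfies (Abs) for all $k$; (B) with $\eta(z)=z-\Omega-\lambda^2\int(z-\nu)^{-1}\,d\langle g,E_0(\nu)g\rangle$ and $\eta_\pm(x)=\lim_{\varepsilon\downarrow0}\eta(x\pm i\varepsilon)$ one has $1/\eta_+\in L^\infty(\mathbb R)$; (C) all moments below exist ($\omega_0$ is smooth on the small system) and $|\omega_0(a^{\natural_1}\cdots a^{\natural_n})|\le n!\,K_n$ for all $n$ and all choices $a^{\natural_j}\in\{a((1,0)),a^\dagger((1,0))\}$, where $K_n>0$ and $K_{n+1}/K_n\to0$; (D) $g_k\in\mathcal D(v_k)\cap\mathcal D((e^{\beta_kh_{0,k}}-1)^{-1/2})$ for all $k$. Let $\mathfrak k$ be the set of $\psi=(\psi_k)_k$ such that, for every $k$,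 $(\psi_k,g_k)$ satisfies (Abs) and $\psi_k\in\mathcal D(v_k)\cap\mathcal D((e^{\beta_kh_{0,k}}-1)^{-1/2})$. For $f=(c,\psi)$ with $c\in\mathbb C$, $\psi\in\mathfrak k$ put $$F(\nu;f)=c+\lambda\lim_{\varepsilon\downarrow0}\langle g,(\nu-h_{0,0}-i\varepsilon)^{-1}\psi\rangle,\qquad \varphi_l(f)=\psi_l+\lambda\,\frac{F(h_{0,l};f)}{\eta_-(h_{0,l})}\,g_l,$$ $$\langle v_l,\varphi_l(f)\rangle:=\langle v_l,\psi_l\rangle+\frac{\lambda c\,\langle v_l,g_l\rangle}{\eta(0)}-\frac{\lambda^2}{\eta(0)}\langle v_l,g_l\rangle\,\langle g,h_{0,0}^{-1}\psi\rangle,$$ $$S(f)=\sum_{l=1}^N\langle\varphi_l(f),(\mathcal N_l(h_{0,l})+\tfrac12)\varphi_l(f)\rangle,\qquad \Lambda(f)=\sum_{l=1}^N\Theta_l(\langle v_l,\varphi_l(f)\rangle),$$ where $\langle g,h_{0,0}^{-1}\psi\rangle$ means $\langle h_{0,0}^{-1/2}g,h_{0,0}^{-1/2}\psi\rangle$. \textbf{Theorem.}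 Under (A)--(D), for all $c\in\mathbb C$, $\psi\in\mathfrak k$ and $f=(c,\psi)$ these quantities are well defined (the boundary values exist for a.e. $\nu$, $g_l$ is in the domain of $(F(\cdot;f)/\eta_-)(h_{0,l})$, $\varphi_l(f)\in\mathcal D((e^{\beta_lh_{0,l}}-1)^{-1/2})$ and $\eta(0)\ne0$) and $$\lim_{t\to+\infty}\omega_0\circ\alpha_t(W(f))=\exp\{-\tfrac12S(f)+i\Lambda(f)\}.$$ Consequently $\mathbb C\oplus\mathfrak k$ is a complex subspace of $\mathcal K$, and there is a state $\omega_+$ on the Weyl algebra $\mathcal W(\mathbb C\oplus\mathfrak k)$ with $\omega_+(W(f))=\exp\{-\frac12S(f)+i\Lambda(f)\}$ for $f\in\mathbb C\oplus\mathfrak k$; it is quasi-free (of the form $e^{-\frac12 s(f,f)+i\ell(f)}$ with a symmetric real bilinear form $s$ and a real linear functional $\ell$), $\omega_0\circ\alpha_t(a)\to\omega_+(a)$ for all $a\in\mathcal W(\mathbb C\oplus\mathfrak k)$, and $\omega_+$ is the unique non-equilibrium steady state there, i.e. the unique state that is a weak-$*$ limit point of $\frac1T\int_0^T\omega_0\circ\alpha_t\,dt$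 as $T\to\infty$. -/

import Mathlib

open MeasureTheory Filter Topology
open scoped ComplexOrder InnerProductSpace ENNReal

noncomputable section

namespace BoseNESS

/-! ### Functional calculus of a self-adjoint operator -/

section Operators

variable {E : Type} [NormedAddCommGroup E] [InnerProductSpace ℂ E]

open Classical in
/-- `(z - h)⁻¹ ψ`: the vector `ξ` in the domain of `h` with `z ξ - h ξ = ψ`. -/
def resolventVec (h : E →ₗ.[ℂ] E) (z : ℂ) (ψ : E) : E :=
  if H : ∃ ξ : h.domain, z • (ξ : E) - h ξ = ψ then (H.choose : E) else 0

/-- The spectral representation of a self-adjoint operator `h` on the cyclic subspace of `g`.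
The finite measure `μ` is `⟨g, E(·) g⟩` with `E` the spectral measure of `h`, and `J m` is the
vector `m(h) g = ∫ m(ν) dE(ν) g`. Both are determined by the requirement that `J` is isometric
and sends `ν ↦ (z - ν)⁻¹` to `(z - h)⁻¹ g` for every non-real `z`. -/
structure SpectralRep (h : E →ₗ.[ℂ] E) (g : E) where
  μ : Measure ℝ
  finite : IsFiniteMeasure μ
  J : Lp ℂ 2 μ →ₗᵢ[ℂ] E
  map_resolvent : ∀ z : ℂ, z.im ≠ 0 → ∀ F : Lp ℂ 2 μ,
    (F =ᵐ[μ] fun ν : ℝ => (z - (ν : ℂ))⁻¹) → J F = resolventVec h z g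

open Classical in
/-- The measure `⟨g, E(·) g⟩`, where `E` is the spectral measure of `h`. -/
def spectralMeasure (h : E →ₗ.[ℂ] E) (g : E) : Measure ℝ :=
  if H : Nonempty (SpectralRep h g) then H.some.μ else 0

open Classical in
/-- The vector `m(h) g`; the vector `g` is in the domain of `m(h)` iff `m` is square integrable
with respect to `⟨g, E(·) g⟩`. -/
def spectralApply (h : E →ₗ.[ℂ] E) (m : ℝ → ℂ) (g : E) : E :=
  if H : Nonempty (SpectralRep h g) then
    if Hm : MemLp m 2 H.some.μ then H.some.J (Hm.toLp m) else 0
  else 0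

/-- `U` is the strongly continuous one-parameter unitary group whose generator is `i h`
(the domain of the generator is exactly the domain of `h`). -/
structure IsUnitaryGroupOf (h : E →ₗ.[ℂ] E) (U : ℝ → E ≃ₗᵢ[ℂ] E) : Prop where
  zero : U 0 = LinearIsometryEquiv.refl ℂ E
  add : ∀ s t f, U (s + t) f = U s (U t f)
  continuous : ∀ f, Continuous fun t => U t f
  generator : ∀ f ξ : E, (f, ξ) ∈ h.graph ↔ HasDerivAt (fun t => U t f) (Complex.I • ξ) 0

open Classical in
/-- The unitary group `e^{ith}` of a self-adjoint operator `h`. -/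
def unitaryGroup (h : E →ₗ.[ℂ] E) : ℝ → E ≃ₗᵢ[ℂ] E :=
  if H : ∃ U, IsUnitaryGroupOf h U then H.choose else fun _ => LinearIsometryEquiv.refl ℂ E

/-- Condition (Abs) for a pair of vectors:
`sup_{ν ∈ ℝ, ε > 0} |⟨ψ, (ν - h ± iε)⁻¹ ξ⟩| < ∞`. -/
def Abs (h : E →ₗ.[ℂ] E) (ψ ξ : E) : Prop :=
  ∃ C : ℝ, ∀ ν ε : ℝ, 0 < ε →
    ‖⟪ψ, resolventVec h ((ν : ℂ) + ε * Complex.I) ξ⟫_ℂ‖ ≤ C ∧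
    ‖⟪ψ, resolventVec h ((ν : ℂ) - ε * Complex.I) ξ⟫_ℂ‖ ≤ C

/-- The domain of `(e^{β (h - μ)} - 1)^{-1/2}`. In `[0, ∞]` one has `0⁻¹ = ∞`. -/
def boseDomain (h : E →ₗ.[ℂ] E) (β μ : ℝ) : Set E :=
  {ψ | ∫⁻ ν, (ENNReal.ofReal (Real.exp (β * (ν - μ)) - 1))⁻¹ ∂(spectralMeasure h ψ) < ∞}

/-- The Bose distribution `𝒩(x) = (e^{β (x - μ)} - 1)⁻¹`. -/
def bose (β μ x : ℝ) : ℝ := (Real.exp (β * (x - μ)) - 1)⁻¹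

/-- The quadratic form `⟨ψ, (𝒩(h) + 1/2) ψ⟩`. -/
def boseForm (h : E →ₗ.[ℂ] E) (β μ : ℝ) (ψ : E) : ℝ :=
  ∫ ν, (bose β μ ν + 1 / 2) ∂(spectralMeasure h ψ)

/-- `⟨g, h⁻¹ ψ⟩`, read as `⟨h^{-1/2} g, h^{-1/2} ψ⟩` for `g`, `ψ` in the domain of `h^{-1/2}`. -/
def invForm (h : E →ₗ.[ℂ] E) (g ψ : E) : ℂ :=
  ⟪spectralApply h (fun ν => ((Real.sqrt ν)⁻¹ : ℝ)) g,
    spectralApply h (fun ν => ((Real.sqrt ν)⁻¹ : ℝ)) ψ⟫_ℂ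

end Operators

/-! ### The reservoirs -/

/-- Square-integrable functions on `ℝ^d`. -/
abbrev EuclSpace (d : ℕ) : Type := Lp ℂ 2 (volume : Measure (EuclideanSpace ℝ (Fin d)))

/-- The function `|p|²/2 · ψ(p)`. -/
def kinetic {d : ℕ} (ψ : EuclSpace d) (p : EuclideanSpace ℝ (Fin d)) : ℂ :=
  ((‖p‖ ^ 2 / 2 : ℝ) : ℂ) * ψ p

theorem kinetic_add {d : ℕ} (a b : EuclSpace d) :
    kinetic (a + b) =ᵐ[volume] kinetic a + kinetic b := by
  filter_upwards [Lp.coeFn_add a b] with p hp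
  simp only [kinetic, hp, Pi.add_apply, mul_add]

theorem kinetic_smul {d : ℕ} (c : ℂ) (a : EuclSpace d) :
    kinetic (c • a) =ᵐ[volume] c • kinetic a := by
  filter_upwards [Lp.coeFn_smul c a] with p hp
  simp only [kinetic, hp, Pi.smul_apply, smul_eq_mul, mul_left_comm]

/-- The maximal domain of the operator of multiplication by `|p|²/2`. -/
def euclDomain (d : ℕ) : Submodule ℂ (EuclSpace d) where
  carrier := {ψ | MemLp (kinetic ψ) 2 volume}
  zero_mem' := by
    have h := kinetic_smul (0 : ℂ) (0 : EuclSpace d)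
    rw [zero_smul, zero_smul] at h
    exact (memLp_congr_ae h).2 MemLp.zero
  add_mem' ha hb := (memLp_congr_ae (kinetic_add _ _)).2 (MemLp.add ha hb)
  smul_mem' c _ ha := (memLp_congr_ae (kinetic_smul c _)).2 (MemLp.const_smul ha c)

/-- The operator of multiplication by `|p|²/2`. -/
def euclHam (d : ℕ) : EuclSpace d →ₗ.[ℂ] EuclSpace d where
  domain := euclDomain d
  toFun :=
    { toFun := fun ψ => MemLp.toLp (kinetic (ψ : EuclSpace d)) ψ.2
      map_add' := fun a b =>
        Lp.ext ((MemLp.coeFn_toLp (a + b).2).trans ((kinetic_add _ _).trans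
          (((MemLp.coeFn_toLp a.2).add (MemLp.coeFn_toLp b.2)).symm.trans
            (Lp.coeFn_add _ _).symm)))
      map_smul' := fun c a =>
        Lp.ext ((MemLp.coeFn_toLp (c • a).2).trans ((kinetic_smul c _).trans
          (((MemLp.coeFn_toLp a.2).const_smul c).symm.trans (Lp.coeFn_smul c _).symm))) }

/-- The domain of the Dirac delta at `0`: the functions that agree almost everywhere with a
function continuous at `0`. -/
def diracDomain (d : ℕ) : Set (EuclSpace d) :=
  {ψ | ∃ a : ℂ, Tendsto ψ (𝓝 0 ⊓ ae volume) (𝓝 a)}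

/-- The value at `0` of an element of `diracDomain`. -/
def diracValue (d : ℕ) (ψ : EuclSpace d) : ℂ := limUnder (𝓝 0 ⊓ ae volume) ψ

/-- Square-summable functions on a set `V` of vertices. -/
abbrev VertexSpace (V : Type) : Type := lp (fun _ : V => ℂ) 2

open Classical in
/-- `A` is the adjacency operator of `G`: `⟨δ_x, A δ_y⟩` is `1` if `x ∼ y` and `0` otherwise. -/
def IsAdjacencyOperator {V : Type} (G : SimpleGraph V) (A : VertexSpace V →L[ℂ] VertexSpace V) :
    Prop :=
  ∀ x y : V, ⟪(lp.single 2 x (1 : ℂ) : VertexSpace V), A (lp.single 2 y (1 : ℂ))⟫_ℂ =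
    if G.Adj x y then 1 else 0

open Classical in
/-- The adjacency operator, which is bounded for graphs of bounded degree. -/
def adjacencyOperator {V : Type} (G : SimpleGraph V) : VertexSpace V →L[ℂ] VertexSpace V :=
  if H : ∃ A, IsAdjacencyOperator G A then H.choose else 0

/-- An infinite connected graph of bounded degree on a countable set of vertices, without loops
and multiple edges, together with a Perron-Frobenius weight of its adjacency operator. -/
structure PFGraph where
  V : Type
  countable : Countable V
  infinite : Infinite V
  G : SimpleGraph V
  connected : G.Connected
  bounded_degree : ∃ D : ℕ, ∀ x, (G.neighborSet x).encard ≤ D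
  v : V → ℝ
  v_pos : ∀ x, 0 < v x
  v_eigen : ∀ x, ∑ᶠ y ∈ G.neighborSet x, v y =
    (spectralRadius ℂ (adjacencyOperator G)).toReal * v x

/-- The one-particle Hamiltonian `‖A_G‖ 1 - A_G`. -/
def graphHam (Γ : PFGraph) : VertexSpace Γ.V →ₗ.[ℂ] VertexSpace Γ.V :=
  LinearMap.toPMap
    (((‖adjacencyOperator Γ.G‖ : ℂ) • ContinuousLinearMap.id ℂ (VertexSpace Γ.V)
      - adjacencyOperator Γ.G : VertexSpace Γ.V →L[ℂ] VertexSpace Γ.V) :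
      VertexSpace Γ.V →ₗ[ℂ] VertexSpace Γ.V) ⊤

/-- A reservoir: free particles in `ℝ^d`, `d ≥ 3`, in the momentum representation, or particles
on a graph with a chosen Perron-Frobenius weight. -/
inductive Reservoir where
  | euclidean (d : ℕ) (hd : 3 ≤ d) : Reservoir
  | graph (Γ : PFGraph) : Reservoir

namespace Reservoir

/-- The one-particle Hilbert space of a reservoir. -/
def Space : Reservoir → Type
  | euclidean d _ => EuclSpace d
  | graph Γ => VertexSpace Γ.V

instance : (R : Reservoir) → NormedAddCommGroup R.Space
  | euclidean d _ => inferInstanceAs (NormedAddCommGroup (EuclSpace d))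
  | graph Γ => inferInstanceAs (NormedAddCommGroup (VertexSpace Γ.V))

instance : (R : Reservoir) → InnerProductSpace ℂ R.Space
  | euclidean d _ => inferInstanceAs (InnerProductSpace ℂ (EuclSpace d))
  | graph Γ => inferInstanceAs (InnerProductSpace ℂ (VertexSpace Γ.V))

/-- The one-particle Hamiltonian of a reservoir. -/
def ham : (R : Reservoir) → R.Space →ₗ.[ℂ] R.Space
  | euclidean d _ => euclHam d
  | graph Γ => graphHam Γ

/-- The domain of the Perron-Frobenius weight `v`. -/
def weightDomain : (R : Reservoir) → Set R.Space
  | euclidean d _ => diracDomain d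
  | graph Γ => {ψ : VertexSpace Γ.V | Summable fun x => Γ.v x * ‖ψ x‖}

/-- The pairing `⟨v, ψ⟩` with the Perron-Frobenius weight. -/
def weight : (R : Reservoir) → R.Space → ℂ
  | euclidean d _ => diracValue d
  | graph Γ => fun ψ : VertexSpace Γ.V => ∑' x, (Γ.v x : ℂ) * ψ x

end Reservoir

/-! ### Weyl CCR algebras -/

section Weyl

variable {K : Type} [NormedAddCommGroup K] [InnerProductSpace ℂ K]

/-- Square-summable functions on the set `K`. -/
abbrev RegSpace (K : Type) : Type := lp (fun _ : K => ℂ) 2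

/-- The operator `(T ξ)(x) = u(x) ξ(e(x))`, for a bijection `e` and unimodular `u`. -/
def twistedPerm {K : Type} (e : K ≃ K) (u : K → Circle) : RegSpace K →ₗᵢ[ℂ] RegSpace K where
  toFun ξ := ⟨fun x => (u x : ℂ) * ξ (e x), by
    refine memℓp_gen ?_
    have h := (lp.memℓp ξ).summable (by simp)
    simpa [Function.comp_def, Circle.norm_coe] using h.comp_injective e.injective⟩
  map_add' ξ ζ := by ext x; exact mul_add _ _ _
  map_smul' c ξ := by ext x; exact mul_left_comm _ _ _
  norm_map' ξ := by
    rw [lp.norm_eq_tsum_rpow (by simp), lp.norm_eq_tsum_rpow (by simp)]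
    congr 1
    rw [← e.tsum_eq fun x => ‖ξ x‖ ^ (2 : ℝ≥0∞).toReal]
    refine tsum_congr fun x => ?_
    simp [Circle.norm_coe]

/-- The symplectic form `σ(f, g) = Im ⟨f, g⟩`. -/
def symp (f g : K) : ℝ := (⟪f, g⟫_ℂ).im

/-- The Weyl unitaries in the regular representation on `ℓ²(K)`:
`(W(f) ξ)(x) = e^{-iσ(f,x)/2} ξ(x - f)`. -/
def weyl (f : K) : RegSpace K →L[ℂ] RegSpace K :=
  (twistedPerm (Equiv.subRight f) fun x => Circle.exp (-(symp f x) / 2)).toContinuousLinearMap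

theorem weyl_apply (f : K) (ξ : RegSpace K) (x : K) :
    weyl f ξ x = (Circle.exp (-(symp f x) / 2) : ℂ) * ξ (x - f) := rfl

theorem symp_add_left (f g x : K) : symp (f + g) x = symp f x + symp g x := by
  simp [symp]

theorem symp_sub_right (f x y : K) : symp f (x - y) = symp f x - symp f y := by
  simp [symp]

theorem symp_swap (f g : K) : symp g f = -symp f g := by
  unfold symp
  rw [← inner_conj_symm g f, Complex.conj_im]

theorem weyl_zero : weyl (0 : K) = 1 := by
  ext ξ x
  rw [weyl_apply]
  simp [symp]

/-- The Weyl relation `W(f) W(g) = e^{-iσ(f,g)/2} W(f + g)`. -/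
theorem weyl_mul (f g : K) :
    weyl f * weyl g = (Circle.exp (-(symp f g) / 2) : ℂ) • weyl (f + g) := by
  ext ξ x
  have h : Circle.exp (-(symp f x) / 2) * Circle.exp (-(symp g (x - f)) / 2) =
      Circle.exp (-(symp f g) / 2) * Circle.exp (-(symp (f + g) x) / 2) := by
    rw [← Circle.exp_add, ← Circle.exp_add, symp_sub_right, symp_add_left, symp_swap f g]
    congr 1
    ring
  have h' := congrArg (fun z : Circle => (z : ℂ)) h
  simp only [Circle.coe_mul] at h'
  change (Circle.exp (-(symp f x) / 2) : ℂ) * ((Circle.exp (-(symp g (x - f)) / 2) : ℂ) *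
    ξ (x - f - g)) = (Circle.exp (-(symp f g) / 2) : ℂ) *
    ((Circle.exp (-(symp (f + g) x) / 2) : ℂ) * ξ (x - (f + g)))
  rw [← mul_assoc, ← mul_assoc, h', sub_sub]

theorem inner_weyl (f : K) (ξ ζ : RegSpace K) : ⟪weyl f ξ, weyl f ζ⟫_ℂ = ⟪ξ, ζ⟫_ℂ :=
  LinearIsometry.inner_map_map _ _ _

theorem weyl_mul_neg (f : K) : weyl f * weyl (-f) = 1 := by
  rw [weyl_mul, add_neg_cancel, weyl_zero]
  have : symp f (-f) = 0 := by
    simp only [symp, inner_neg_right, Complex.neg_im, neg_eq_zero]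
    exact inner_self_im (𝕜 := ℂ) f
  simp [this]

/-- The Weyl relation `W(f)* = W(-f)`. -/
theorem star_weyl (f : K) : star (weyl f) = weyl (-f) := by
  have h1 : star (weyl f) * weyl f = 1 := by
    rw [ContinuousLinearMap.star_eq_adjoint]
    refine ContinuousLinearMap.ext fun ξ => ext_inner_right ℂ fun ζ => ?_
    simp only [mul_apply_eq_comp, ContinuousLinearMap.adjoint_inner_left, inner_weyl,
      one_apply_eq_self]
  calc star (weyl f) = star (weyl f) * (weyl f * weyl (-f)) := by rw [weyl_mul_neg, mul_one]
    _ = weyl (-f) := by rw [← mul_assoc, h1, one_mul]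

/-- The Weyl CCR algebra over a subspace `D` of `K`: the C*-algebra generated by the unitaries
`W(f)`, `f ∈ D`. (The symplectic form is non-degenerate on complex subspaces, so this C*-algebra
is, up to isomorphism, the only one generated by unitaries obeying the Weyl relations.) -/
def weylAlgebra (D : Set K) : StarSubalgebra ℂ (RegSpace K →L[ℂ] RegSpace K) :=
  (StarAlgebra.adjoin ℂ (weyl '' D)).topologicalClosure

theorem weyl_mem {D : Set K} {f : K} (hf : f ∈ D) : weyl f ∈ weylAlgebra D :=
  StarSubalgebra.le_topologicalClosure _ (StarAlgebra.subset_adjoin ℂ _ ⟨f, hf, rfl⟩)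

theorem weylAlgebra_mono {D D' : Set K} (h : D ⊆ D') : weylAlgebra D ≤ weylAlgebra D' :=
  StarSubalgebra.topologicalClosure_mono (StarAlgebra.adjoin_mono (Set.image_mono h))

/-- The Weyl unitary `W(f)` as an element of the Weyl CCR algebra over `K`. -/
def W (f : K) : weylAlgebra (Set.univ : Set K) := ⟨weyl f, weyl_mem (Set.mem_univ f)⟩

/-- A state on a C*-algebra of operators. -/
structure IsState {A : StarSubalgebra ℂ (RegSpace K →L[ℂ] RegSpace K)} (ω : A →L[ℂ] ℂ) :
    Prop where
  nonneg : ∀ a : A, 0 ≤ ω (star a * a)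
  one : ω 1 = 1

/-- The permutation operator `(Γ_U ξ)(x) = ξ(U⁻¹ x)` on `ℓ²(K)` of a unitary `U`. -/
def permOp (U : K ≃ₗᵢ[ℂ] K) : RegSpace K →L[ℂ] RegSpace K :=
  (twistedPerm U.symm.toEquiv fun _ => 1).toContinuousLinearMap

theorem permOp_mul_symm (U : K ≃ₗᵢ[ℂ] K) : permOp U * permOp U.symm = 1 := by
  ext ξ x
  change ((1 : Circle) : ℂ) * (((1 : Circle) : ℂ) * ξ (U.symm.symm (U.symm x))) = ξ x
  simp

theorem star_permOp (U : K ≃ₗᵢ[ℂ] K) : star (permOp U) = permOp U.symm := by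
  have h1 : star (permOp U) * permOp U = 1 := by
    rw [ContinuousLinearMap.star_eq_adjoint]
    refine ContinuousLinearMap.ext fun ξ => ext_inner_right ℂ fun ζ => ?_
    simp only [mul_apply_eq_comp, ContinuousLinearMap.adjoint_inner_left,
      one_apply_eq_self]
    exact LinearIsometry.inner_map_map _ _ _
  calc star (permOp U) = star (permOp U) * (permOp U * permOp U.symm) := by
        rw [permOp_mul_symm, mul_one]
    _ = permOp U.symm := by rw [← mul_assoc, h1, one_mul]

theorem permOp_symm_mul (U : K ≃ₗᵢ[ℂ] K) : permOp U.symm * permOp U = 1 :=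
  permOp_mul_symm U.symm

/-- Conjugation by `Γ_U` on the bounded operators on `ℓ²(K)`. -/
def conjPerm (U : K ≃ₗᵢ[ℂ] K) :
    (RegSpace K →L[ℂ] RegSpace K) →⋆ₐ[ℂ] (RegSpace K →L[ℂ] RegSpace K) where
  toFun a := permOp U * a * permOp U.symm
  map_one' := by rw [mul_one, permOp_mul_symm]
  map_mul' a b := by
    calc permOp U * (a * b) * permOp U.symm
        = permOp U * a * 1 * b * permOp U.symm := by simp only [mul_assoc, one_mul]
      _ = _ := by rw [← permOp_symm_mul U]; simp only [mul_assoc]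
  map_zero' := by simp
  map_add' a b := by simp [mul_add, add_mul]
  commutes' r := by
    rw [← Algebra.commutes, mul_assoc, permOp_mul_symm, mul_one]
  map_star' a := by
    rw [star_mul, star_mul, star_permOp, star_permOp, mul_assoc]
    rfl

theorem conjPerm_weyl (U : K ≃ₗᵢ[ℂ] K) (f : K) : conjPerm U (weyl f) = weyl (U f) := by
  ext ξ x
  change ((1 : Circle) : ℂ) * ((Circle.exp (-(symp f (U.symm x)) / 2) : ℂ) *
    (((1 : Circle) : ℂ) * ξ (U.symm.symm (U.symm x - f)))) =
    (Circle.exp (-(symp (U f) x) / 2) : ℂ) * ξ (x - U f)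
  have h : symp (U f) x = symp f (U.symm x) := by
    unfold symp
    rw [← U.inner_map_map f (U.symm x), U.apply_symm_apply]
  rw [h]
  simp [map_sub]

theorem conjPerm_continuous (U : K ≃ₗᵢ[ℂ] K) : Continuous (conjPerm U) := by
  change Continuous fun a => permOp U * a * permOp U.symm
  fun_prop

theorem conjPerm_mem (U : K ≃ₗᵢ[ℂ] K) {a : RegSpace K →L[ℂ] RegSpace K}
    (ha : a ∈ weylAlgebra (Set.univ : Set K)) :
    conjPerm U a ∈ weylAlgebra (Set.univ : Set K) := by
  have h1 : StarAlgebra.adjoin ℂ (weyl '' (Set.univ : Set K)) ≤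
      (weylAlgebra (Set.univ : Set K)).comap (conjPerm U) := by
    refine StarAlgebra.adjoin_le ?_
    rintro _ ⟨f, -, rfl⟩
    change conjPerm U (weyl f) ∈ weylAlgebra (Set.univ : Set K)
    rw [conjPerm_weyl]
    exact weyl_mem (Set.mem_univ _)
  have h2 : IsClosed (((weylAlgebra (Set.univ : Set K)).comap (conjPerm U) :
      StarSubalgebra ℂ (RegSpace K →L[ℂ] RegSpace K)) : Set (RegSpace K →L[ℂ] RegSpace K)) :=
    (StarSubalgebra.isClosed_topologicalClosure _).preimage (conjPerm_continuous U)
  exact StarSubalgebra.topologicalClosure_minimal h1 h2 ha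

/-- The quasi-free (Bogoliubov) automorphism of the Weyl CCR algebra with
`W(f) ↦ W(U f)`. -/
def bogoliubov (U : K ≃ₗᵢ[ℂ] K) :
    weylAlgebra (Set.univ : Set K) →⋆ₐ[ℂ] weylAlgebra (Set.univ : Set K) :=
  ((conjPerm U).comp (weylAlgebra (Set.univ : Set K)).subtype).codRestrict _
    fun a => conjPerm_mem U a.2

theorem bogoliubov_W (U : K ≃ₗᵢ[ℂ] K) (f : K) : bogoliubov U (W f) = W (U f) :=
  Subtype.ext (conjPerm_weyl U f)

/-- `s ↦ ω(W(s₁ f₁) ⋯ W(sₙ fₙ))`. -/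
def correlation (ω : weylAlgebra (Set.univ : Set K) →L[ℂ] ℂ) {n : ℕ} (f : Fin n → K)
    (s : Fin n → ℝ) : ℂ :=
  ω (List.ofFn fun j => W ((s j : ℂ) • f j)).prod

/-- `ω(Ψ(f₁) ⋯ Ψ(fₙ)) = (-i)ⁿ ∂_{s₁} ⋯ ∂_{sₙ} ω(W(s₁ f₁) ⋯ W(sₙ fₙ))` at `s = 0`, the moments of
the field operators `Ψ(f)`, where `W(f) = e^{iΨ(f)}`. -/
def fieldMoment (ω : weylAlgebra (Set.univ : Set K) →L[ℂ] ℂ) {n : ℕ} (f : Fin n → K) : ℂ :=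
  (-Complex.I) ^ n * iteratedFDeriv ℝ n (correlation ω f) 0 fun j => Pi.single j 1

/-- `ω(a^{♮₁} ⋯ a^{♮ₙ})`, where `a^{♮ⱼ}` is the creation operator
`a†(e) = (Ψ(e) - iΨ(ie))/√2` if `dag j` is true and the annihilation operator
`a(e) = (Ψ(e) + iΨ(ie))/√2` otherwise. -/
def ladderMoment (ω : weylAlgebra (Set.univ : Set K) →L[ℂ] ℂ) (e : K) {n : ℕ}
    (dag : Fin n → Bool) : ℂ :=
  ((Real.sqrt 2 : ℂ)⁻¹) ^ n * ∑ q : Fin n → Bool,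
    (∏ j, if q j then (if dag j then -Complex.I else Complex.I) else 1) *
      fieldMoment ω fun j => if q j then Complex.I • e else e

end Weyl

/-! ### The coupled model -/

/-- A one-level system of energy `Ω` coupled with strength `lam` and form factors `g k` to `N`
reservoirs with inverse temperatures `β k`, chemical potentials `μ k` and phase functionals
`Θ k`. -/
structure Model (N : ℕ) where
  res : Fin N → Reservoir
  Ω : ℝ
  Ω_pos : 0 < Ω
  lam : ℝ
  lam_pos : 0 < lam
  g : ∀ k, (res k).Space
  β : Fin N → ℝ
  β_pos : ∀ k, 0 < β k
  μ : Fin N → ℝ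
  μ_nonpos : ∀ k, μ k ≤ 0
  Θ : Fin N → ℂ →ₗ[ℝ] ℝ
  Θ_eq_zero : ∀ k, μ k < 0 → Θ k = 0

namespace Model

variable {N : ℕ} (M : Model N)

/-- The Hilbert space `⊕ₖ 𝔎ₖ` of the reservoirs. -/
abbrev ResSpace : Type := PiLp 2 fun k => (M.res k).Space

/-- The one-particle Hilbert space `𝒦 = ℂ ⊕ (⊕ₖ 𝔎ₖ)`. -/
abbrev OneParticle : Type := WithLp 2 (ℂ × M.ResSpace)

/-- The vector `(c, ψ₁, …, ψ_N)`. -/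
def vec (c : ℂ) (ψ : ∀ k, (M.res k).Space) : M.OneParticle :=
  WithLp.toLp 2 (c, WithLp.toLp 2 ψ)

/-- The one-particle Hamiltonian of the `k`-th reservoir. -/
abbrev h0 (k : Fin N) : (M.res k).Space →ₗ.[ℂ] (M.res k).Space := (M.res k).ham

/-- The coupled one-particle Hamiltonian
`h (c, ψ) = (Ω c + λ ∑ₖ ⟨gₖ, ψₖ⟩, (h₀ₖ ψₖ + λ c gₖ)ₖ)`. -/
def h : M.OneParticle →ₗ.[ℂ] M.OneParticle where
  domain :=
    { carrier := {f | ∀ k, f.snd k ∈ (M.h0 k).domain}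
      zero_mem' := fun k => (M.h0 k).domain.zero_mem
      add_mem' := fun ha hb k => (M.h0 k).domain.add_mem (ha k) (hb k)
      smul_mem' := fun c _ ha k => (M.h0 k).domain.smul_mem c (ha k) }
  toFun :=
    { toFun := fun f => M.vec
        ((M.Ω : ℂ) * (f : M.OneParticle).fst +
          M.lam * ∑ k, ⟪M.g k, (f : M.OneParticle).snd k⟫_ℂ)
        fun k => M.h0 k ⟨(f : M.OneParticle).snd k, f.2 k⟩ +
          ((M.lam : ℂ) * (f : M.OneParticle).fst) • M.g k
      map_add' := by
        intro a b
        refine WithLp.ofLp_injective 2 (Prod.ext ?_ (WithLp.ofLp_injective 2 (funext fun k => ?_)))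
        · simp only [vec, Submodule.coe_add, WithLp.add_fst, WithLp.add_snd, PiLp.add_apply,
            inner_add_right, Finset.sum_add_distrib, WithLp.ofLp_add, Prod.fst_add]
          ring
        · have := (M.h0 k).map_add ⟨(a : M.OneParticle).snd k, a.2 k⟩
            ⟨(b : M.OneParticle).snd k, b.2 k⟩
          simp only [vec, WithLp.ofLp_add, Prod.snd_add, Pi.add_apply]
          change (M.h0 k) (⟨_, a.2 k⟩ + ⟨_, b.2 k⟩) + ((M.lam : ℂ) *
            ((a : M.OneParticle).fst + (b : M.OneParticle).fst)) • M.g k = _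
          rw [this, mul_add, add_smul]
          abel
      map_smul' := by
        intro c a
        refine WithLp.ofLp_injective 2 (Prod.ext ?_ (WithLp.ofLp_injective 2 (funext fun k => ?_)))
        · simp only [vec, Submodule.coe_smul, WithLp.smul_fst, WithLp.smul_snd, PiLp.smul_apply,
            inner_smul_right, ← Finset.mul_sum, WithLp.ofLp_smul, Prod.smul_fst, smul_eq_mul,
            RingHom.id_apply]
          ring
        · have := (M.h0 k).map_smul c ⟨(a : M.OneParticle).snd k, a.2 k⟩
          simp only [vec, WithLp.ofLp_smul, Prod.smul_snd, Pi.smul_apply, RingHom.id_apply]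
          change (M.h0 k) (c • ⟨_, a.2 k⟩) + ((M.lam : ℂ) *
            (c * (a : M.OneParticle).fst)) • M.g k = _
          rw [this, smul_add, smul_smul]
          congr 2
          ring }

/-- The Heisenberg time evolution: `α_t(W(f)) = W(e^{ith} f)`. -/
def α (t : ℝ) : weylAlgebra (Set.univ : Set M.OneParticle) →⋆ₐ[ℂ]
    weylAlgebra (Set.univ : Set M.OneParticle) :=
  bogoliubov (unitaryGroup M.h t)

/-- `η(z) = z - Ω - λ² ∫ (z - ν)⁻¹ d⟨g, E₀(ν) g⟩`. -/
def η (z : ℂ) : ℂ :=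
  z - M.Ω - (M.lam : ℂ) ^ 2 * ∑ k, ∫ ν : ℝ, (z - (ν : ℂ))⁻¹ ∂(spectralMeasure (M.h0 k) (M.g k))

/-- `η₊(x) = lim_{ε ↓ 0} η(x + iε)`. -/
def ηPlus (x : ℝ) : ℂ := limUnder (𝓝[>] (0 : ℝ)) fun ε => M.η ((x : ℂ) + ε * Complex.I)

/-- `η₋(x) = lim_{ε ↓ 0} η(x - iε)`. -/
def ηMinus (x : ℝ) : ℂ := limUnder (𝓝[>] (0 : ℝ)) fun ε => M.η ((x : ℂ) - ε * Complex.I)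

/-- Condition (A): the pair `(g, g)` has condition (Abs). -/
def CondA : Prop := ∀ k, Abs (M.h0 k) (M.g k) (M.g k)

/-- Condition (B): `1/η₊` is in `L^∞(ℝ)`. -/
def CondB : Prop := (∀ᵐ x : ℝ, M.ηPlus x ≠ 0) ∧ MemLp (fun x => (M.ηPlus x)⁻¹) ⊤ volume

/-- Condition (C): `|ω(a^{♮₁} ⋯ a^{♮ₙ})| ≤ n! Kₙ` with `Kₙ₊₁/Kₙ → 0`, for the creation and
annihilation operators of the small system. The first clause says that `ω` is smooth on the
small system, so that these moments exist. -/
def CondC (ω : weylAlgebra (Set.univ : Set M.OneParticle) →L[ℂ] ℂ) : Prop :=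
  (∀ (n : ℕ) (c : Fin n → ℂ), ContDiff ℝ (⊤ : ℕ∞) (correlation ω fun j => M.vec (c j) 0)) ∧
  ∃ K : ℕ → ℝ, (∀ n, 0 < K n) ∧ Tendsto (fun n => K (n + 1) / K n) atTop (𝓝 0) ∧
    ∀ (n : ℕ) (dag : Fin n → Bool), ‖ladderMoment ω (M.vec 1 0) dag‖ ≤ n.factorial * K n

/-- Condition (D): `gₖ` is in the domains of `vₖ` and of `(e^{βₖ h₀ₖ} - 1)^{-1/2}`. -/
def CondD : Prop := ∀ k, M.g k ∈ (M.res k).weightDomain ∩ boseDomain (M.h0 k) (M.β k) 0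

/-- `ω` is an initial state: a product of a state of the small system and of states of the
reservoirs with
`ω(W((ψₖ))) = exp(-½ ⟨ψₖ, (𝒩ₖ(h₀ₖ) + ½) ψₖ⟩) e^{iΘₖ(⟨vₖ, ψₖ⟩)}`
for `ψₖ` in the domains of `vₖ` and of `(e^{βₖ (h₀ₖ - μₖ)} - 1)^{-1/2}`. The values of `ω` on
`W(f)` for other vectors `f` are not restricted: any state on the Weyl algebra over these domains
extends to a state on the Weyl algebra over `𝒦`. -/
structure IsInitialState (ω : weylAlgebra (Set.univ : Set M.OneParticle) →L[ℂ] ℂ) : Prop where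
  isState : IsState ω
  product : ∀ (c : ℂ) (ψ : ∀ k, (M.res k).Space),
    (∀ k, ψ k ∈ (M.res k).weightDomain ∩ boseDomain (M.h0 k) (M.β k) (M.μ k)) →
    ω (W (M.vec c ψ)) = ω (W (M.vec c 0)) * ∏ k, ω (W (M.vec 0 (Pi.single k (ψ k))))
  reservoir : ∀ (k : Fin N) (ψ : (M.res k).Space),
    ψ ∈ (M.res k).weightDomain ∩ boseDomain (M.h0 k) (M.β k) (M.μ k) →
    ω (W (M.vec 0 (Pi.single k ψ))) =
      Complex.exp (-(1 / 2) * (boseForm (M.h0 k) (M.β k) (M.μ k) ψ : ℂ)) *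
        Complex.exp (Complex.I * (M.Θ k ((M.res k).weight ψ) : ℂ))

/-- The set of all `(c, ψ)` with `c ∈ ℂ` and `ψ ∈ 𝔨`: every pair `(ψₖ, gₖ)` has condition (Abs),
and `ψₖ` is in the domains of `vₖ` and of `(e^{βₖ h₀ₖ} - 1)^{-1/2}`. -/
def goodVectors : Set M.OneParticle :=
  {f | ∀ k, Abs (M.h0 k) (f.snd k) (M.g k) ∧
    f.snd k ∈ (M.res k).weightDomain ∩ boseDomain (M.h0 k) (M.β k) 0}

/-- `c + λ ⟨g, (ν - h₀₀ - iε)⁻¹ ψ⟩`. -/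
def Freg (f : M.OneParticle) (ν ε : ℝ) : ℂ :=
  f.fst + M.lam * ∑ k, ⟪M.g k, resolventVec (M.h0 k) ((ν : ℂ) - ε * Complex.I) (f.snd k)⟫_ℂ

/-- `F(ν; f) = c + λ ⟨g, (ν - h₀₀ - i0)⁻¹ ψ⟩`. -/
def F (f : M.OneParticle) (ν : ℝ) : ℂ := limUnder (𝓝[>] (0 : ℝ)) fun ε => M.Freg f ν ε

/-- `φ_l(f) = ψ_l + λ (F(·; f)/η₋)(h₀₀) g_l`. -/
def φ (f : M.OneParticle) (l : Fin N) : (M.res l).Space :=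
  f.snd l + (M.lam : ℂ) • spectralApply (M.h0 l) (fun ν => M.F f ν / M.ηMinus ν) (M.g l)

/-- `S(f) = ∑_l ⟨φ_l(f), (𝒩_l(h₀_l) + ½) φ_l(f)⟩`. -/
def S (f : M.OneParticle) : ℝ := ∑ l, boseForm (M.h0 l) (M.β l) (M.μ l) (M.φ f l)

/-- `⟨v_l, φ_l(f)⟩ = ⟨v_l, ψ_l⟩ + λ c ⟨v_l, g_l⟩/η(0) - λ² ⟨v_l, g_l⟩ ⟨g, h₀₀⁻¹ ψ⟩/η(0)`. -/
def weightφ (f : M.OneParticle) (l : Fin N) : ℂ :=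
  (M.res l).weight (f.snd l) + M.lam * f.fst * (M.res l).weight (M.g l) / M.η 0
    - (M.lam : ℂ) ^ 2 / M.η 0 * (M.res l).weight (M.g l) *
      ∑ k, invForm (M.h0 k) (M.g k) (f.snd k)

/-- `Λ(f) = ∑_l Θ_l(⟨v_l, φ_l(f)⟩)`. -/
def Λ (f : M.OneParticle) : ℝ := ∑ l, M.Θ l (M.weightφ f l)

/-- The objects in the formulas for `S(f)` and `Λ(f)` are well defined: the boundary values exist
almost everywhere, `g_l` is in the domain of `(F(·; f)/η₋)(h₀₀)`, `φ_l(f)` is in the form domain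
of `𝒩_l(h₀_l)`, and `η(0) ≠ 0`. -/
structure WellDefined (f : M.OneParticle) : Prop where
  F_lim : ∀ᵐ ν : ℝ, Tendsto (fun ε => M.Freg f ν ε) (𝓝[>] 0) (𝓝 (M.F f ν))
  η_lim : ∀ᵐ ν : ℝ,
    Tendsto (fun ε : ℝ => M.η ((ν : ℂ) - ε * Complex.I)) (𝓝[>] 0) (𝓝 (M.ηMinus ν))
  memLp : ∀ l, MemLp (fun ν => M.F f ν / M.ηMinus ν) 2 (spectralMeasure (M.h0 l) (M.g l))
  φ_mem : ∀ l, M.φ f l ∈ boseDomain (M.h0 l) (M.β l) 0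
  η_zero : M.η 0 ≠ 0

/-- The Weyl CCR algebra over `ℂ ⊕ 𝔨`. -/
abbrev goodAlgebra : StarSubalgebra ℂ
    (RegSpace M.OneParticle →L[ℂ] RegSpace M.OneParticle) := weylAlgebra M.goodVectors

/-- The restriction of `ω ∘ α_t` to the Weyl CCR algebra over `ℂ ⊕ 𝔨`. -/
def evolved (ω : weylAlgebra (Set.univ : Set M.OneParticle) →L[ℂ] ℂ) (t : ℝ)
    (a : M.goodAlgebra) : ℂ :=
  ω (M.α t (StarSubalgebra.inclusion (weylAlgebra_mono (Set.subset_univ _)) a))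

/-- A non-equilibrium steady state: a state that is a weak-* limit point of the averages
`T⁻¹ ∫₀ᵀ ω ∘ α_t dt` as `T → ∞`. -/
def IsNESS (ω : weylAlgebra (Set.univ : Set M.OneParticle) →L[ℂ] ℂ)
    (ρ : M.goodAlgebra →L[ℂ] ℂ) : Prop :=
  IsState ρ ∧ MapClusterPt (fun a => ρ a) atTop
    fun (T : ℝ) (a : M.goodAlgebra) => (T : ℂ)⁻¹ * ∫ t in (0 : ℝ)..T, M.evolved ω t a

/-- A state on the Weyl CCR algebra over `ℂ ⊕ 𝔨` is quasi-free if `ω(W(f)) = e^{iℓ(f) - s(f,f)/2}`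
for a real linear functional `ℓ` and a symmetric real bilinear form `s` on the vector space
`ℂ ⊕ 𝔨`. -/
def IsQuasiFree (ρ : M.goodAlgebra →L[ℂ] ℂ) : Prop :=
  ∃ D : Submodule ℂ M.OneParticle, (D : Set M.OneParticle) = M.goodVectors ∧
  ∃ (s : D →ₗ[ℝ] D →ₗ[ℝ] ℝ) (ℓ : D →ₗ[ℝ] ℝ), (∀ f f', s f f' = s f' f) ∧
    ∀ (f : D) (hf : (f : M.OneParticle) ∈ M.goodVectors),
      ρ ⟨weyl (f : M.OneParticle), weyl_mem hf⟩ =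
        Complex.exp (-(1 / 2) * (s f f : ℂ) + Complex.I * (ℓ f : ℂ))

end Model

end BoseNESS

end

noncomputable section

namespace BoseNESS

open Complex (I)

section

/-! ### Bounded holomorphic functions in the upper half-plane -/

section HalfPlane

theorem norm_dslope_div_le {K : ℂ → ℂ} {B R : ℝ} (hB : ∀ z : ℂ, 0 ≤ z.im → ‖K z‖ ≤ B)
    (hR : 1 < R) {z : ℂ} (hz : 0 ≤ z.im) (hzR : R ≤ ‖z‖) :
    ‖dslope K I z / (z + I)‖ ≤ 2 * B / (R ^ 2 - 1) := by
  have hne : z ≠ I := by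
    rintro rfl
    simp at hzR
    linarith
  have h1 : ‖K z - K I‖ ≤ 2 * B := by
    have := norm_sub_le (K z) (K I)
    have := hB z hz
    have := hB I (by simp)
    linarith
  have h2 : R ^ 2 - 1 ≤ ‖(z - I) * (z + I)‖ := by
    have : (z - I) * (z + I) = z ^ 2 + 1 := by
      linear_combination -Complex.I_sq
    rw [this]
    have h3 := norm_sub_norm_le (z ^ 2) (-1)
    rw [norm_pow, norm_neg, norm_one, sub_neg_eq_add] at h3
    have : R ^ 2 ≤ ‖z‖ ^ 2 := by gcongr
    linarith
  have h0 : 0 < R ^ 2 - 1 := by nlinarith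
  rw [dslope_of_ne _ hne, slope_def_field, div_div, norm_div]
  gcongr
  exact (norm_nonneg _).trans h1

/-- The Poisson formula at the point `i`. -/
theorem integral_poisson_at_I {K : ℂ → ℂ} {δ B : ℝ} (hδ : 0 < δ)
    (hd : DifferentiableOn ℂ K {z | -δ < z.im}) (hB : ∀ z : ℂ, 0 ≤ z.im → ‖K z‖ ≤ B) :
    ∫ r : ℝ, (((1 + r ^ 2)⁻¹ : ℝ) : ℂ) * K r = Real.pi * K I := by
  set f : ℂ → ℂ := fun z => dslope K I z / (z + I) with hf
  have hopen : IsOpen {z : ℂ | -δ < z.im} := isOpen_lt continuous_const Complex.continuous_im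
  have hIm : I ∈ {z : ℂ | -δ < z.im} := by simp; linarith
  have hdf : DifferentiableOn ℂ f {z | 0 ≤ z.im} := by
    refine DifferentiableOn.div
      (((Complex.differentiableOn_dslope (hopen.mem_nhds hIm)).2 hd).mono fun z hz => ?_)
      (by fun_prop) fun z hz h0 => ?_
    · simp only [Set.mem_ofPred_eq] at hz ⊢; linarith
    · have := congrArg Complex.im h0
      simp at this hz
      linarith
  have hreal : ∀ r : ℝ, f r = (((1 + r ^ 2)⁻¹ : ℝ) : ℂ) * (K r - K I) := by
    intro r
    have hne : (r : ℂ) ≠ I := by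
      intro h
      have := congrArg Complex.im h
      simp at this
    have e : ((r : ℂ) - I) * (r + I) = 1 + (r : ℂ) ^ 2 := by
      linear_combination -Complex.I_sq
    rw [hf]
    simp only
    rw [dslope_of_ne _ hne, slope_def_field, div_div, e]
    push_cast
    rw [div_eq_mul_inv, mul_comm]
  have hKc : Continuous fun r : ℝ => K r := by
    refine ContinuousOn.comp_continuous hd.continuousOn (by fun_prop) fun r => ?_
    simpa using hδ
  have hint0 : Integrable fun r : ℝ => (((1 + r ^ 2)⁻¹ : ℝ) : ℂ) :=
    integrable_inv_one_add_sq.ofReal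
  have hintK : Integrable fun r : ℝ => (((1 + r ^ 2)⁻¹ : ℝ) : ℂ) * K r :=
    hint0.mul_bdd hKc.aestronglyMeasurable
      (Eventually.of_forall fun r => hB r (by simp))
  have hintf : Integrable fun r : ℝ => f r := by
    refine (hintK.sub (hint0.mul_const (K I))).congr (Eventually.of_forall fun r => ?_)
    simp only [Pi.sub_apply, hreal]
    ring
  have hB0 : 0 ≤ B := (norm_nonneg _).trans (hB I (by simp))
  have hbound : ∀ R : ℝ, 1 < R → ‖∫ r in (-R)..R, f r‖ ≤ 8 * B * R / (R ^ 2 - 1) := by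
    intro R hR
    have h0 : 0 < R ^ 2 - 1 := by nlinarith
    have hrect := Complex.integral_boundary_rect_eq_zero_of_differentiableOn f ⟨-R, 0⟩ ⟨R, R⟩
      (hdf.mono fun z hz => by
        have := hz.2
        simp only [Set.mem_preimage, Set.uIcc_of_le (by linarith : (0:ℝ) ≤ R)] at this
        exact this.1)
    simp only [Complex.ofReal_zero, zero_mul, add_zero] at hrect
    have hn : ∀ z : ℂ, 0 ≤ z.im → R ≤ ‖z‖ → ‖f z‖ ≤ 2 * B / (R ^ 2 - 1) :=
      fun z hz hzR => norm_dslope_div_le hB hR hz hzR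
    have e1 : ‖∫ x in (-R)..R, f (x + R * I)‖ ≤ 2 * B / (R ^ 2 - 1) * |R - -R| := by
      refine intervalIntegral.norm_integral_le_of_norm_le_const fun x _ => hn _ (by simp; linarith) ?_
      have := Complex.abs_im_le_norm (x + R * I)
      simp at this
      exact (le_abs_self R).trans this
    have e2 : ‖∫ y in (0:ℝ)..R, f (R + y * I)‖ ≤ 2 * B / (R ^ 2 - 1) * |R - 0| := by
      refine intervalIntegral.norm_integral_le_of_norm_le_const fun y hy => hn _ ?_ ?_
      · rw [Set.uIoc_of_le (by linarith)] at hy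
        simpa using hy.1.le
      · have := Complex.abs_re_le_norm (R + y * I)
        simp at this
        exact (le_abs_self R).trans this
    have e3 : ‖∫ y in (0:ℝ)..R, f ((-R : ℝ) + y * I)‖ ≤ 2 * B / (R ^ 2 - 1) * |R - 0| := by
      refine intervalIntegral.norm_integral_le_of_norm_le_const fun y hy => hn _ ?_ ?_
      · rw [Set.uIoc_of_le (by linarith)] at hy
        simpa using hy.1.le
      · have := Complex.abs_re_le_norm ((-R : ℝ) + y * I)
        simp at this
        refine (le_abs_self R).trans ?_
        simpa using this
    have key : ∫ x in (-R)..R, f x = (∫ x in (-R)..R, f (x + R * I))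
        - I • (∫ y in (0:ℝ)..R, f (R + y * I))
        + I • (∫ y in (0:ℝ)..R, f ((-R : ℝ) + y * I)) := by
      linear_combination hrect
    rw [key]
    calc _ ≤ ‖∫ x in (-R)..R, f (x + R * I)‖
          + ‖∫ y in (0:ℝ)..R, f (R + y * I)‖
          + ‖∫ y in (0:ℝ)..R, f ((-R : ℝ) + y * I)‖ := by
          refine (norm_add_le _ _).trans (add_le_add ((norm_sub_le _ _).trans ?_) ?_)
          · simp
          · simp
      _ ≤ _ := by
          refine (add_le_add (add_le_add e1 e2) e3).trans (le_of_eq ?_)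
          rw [abs_of_pos (by linarith : 0 < R - -R), abs_of_pos (by linarith : 0 < R - 0)]
          field_simp
          ring
  have hlim1 : Tendsto (fun R : ℝ => ∫ r in (-R)..R, f r) atTop (𝓝 (∫ r : ℝ, f r)) :=
    intervalIntegral_tendsto_integral hintf tendsto_neg_atTop_atBot tendsto_id
  have hlim2 : Tendsto (fun R : ℝ => 8 * B * R / (R ^ 2 - 1)) atTop (𝓝 0) := by
    have h1 : Tendsto (fun R : ℝ => 8 * B * (2 / R)) atTop (𝓝 (8 * B * 0)) :=
      (tendsto_const_nhds.div_atTop tendsto_id).const_mul _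
    rw [mul_zero] at h1
    refine tendsto_of_tendsto_of_tendsto_of_le_of_le' tendsto_const_nhds h1 ?_ ?_
    · filter_upwards [eventually_gt_atTop 1] with R hR
      have h0 : 0 < R ^ 2 - 1 := by nlinarith
      positivity
    · filter_upwards [eventually_gt_atTop 2] with R hR
      have h0 : 0 < R ^ 2 - 1 := by nlinarith
      rw [mul_div_assoc]
      gcongr 8 * B * ?_
      rw [div_le_div_iff₀ h0 (by linarith)]
      nlinarith
  have hzero : ∫ r : ℝ, f r = 0 := by
    refine tendsto_nhds_unique hlim1 (squeeze_zero_norm' ?_ hlim2)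
    filter_upwards [eventually_gt_atTop 1] with R hR using hbound R hR
  have e : ∫ r : ℝ, f r = (∫ r : ℝ, (((1 + r ^ 2)⁻¹ : ℝ) : ℂ) * K r) -
      ∫ r : ℝ, (((1 + r ^ 2)⁻¹ : ℝ) : ℂ) * K I := by
    rw [← integral_sub hintK (hint0.mul_const _)]
    refine integral_congr_ae (Eventually.of_forall fun r => ?_)
    simp only [hreal]
    ring
  rw [hzero, integral_mul_const, integral_complex_ofReal, integral_univ_inv_one_add_sq] at e
  exact (sub_eq_zero.1 e.symm)

/-- The Poisson formula for a bounded holomorphic function in the upper half-plane. -/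
theorem integral_poisson {H : ℂ → ℂ} {B : ℝ} (hd : DifferentiableOn ℂ H {z | 0 < z.im})
    (hB : ∀ z : ℂ, 0 < z.im → ‖H z‖ ≤ B) (x : ℝ) {y ε : ℝ} (hy : 0 < y) (hε : 0 < ε) :
    ∫ r : ℝ, (((1 + r ^ 2)⁻¹ : ℝ) : ℂ) * H (((x + y * r : ℝ) : ℂ) + ε * I) =
      Real.pi * H (x + ((y + ε : ℝ) : ℂ) * I) := by
  have him : ∀ z : ℂ, ((x : ℂ) + ε * I + y * z).im = ε + y * z.im := by
    intro z; simp
  have h := integral_poisson_at_I (K := fun z => H ((x : ℂ) + ε * I + y * z))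
    (δ := ε / y) (B := B) (by positivity) ?_ ?_
  · convert h using 1
    · refine integral_congr_ae (Eventually.of_forall fun r => ?_)
      simp only
      congr 2
      push_cast
      ring
    · congr 2
      push_cast
      ring
  · refine hd.comp (by fun_prop) fun z hz => ?_
    simp only [Set.mem_ofPred_eq, him] at hz ⊢
    have := mul_lt_mul_of_pos_left hz hy
    have e : y * -(ε / y) = -ε := by field_simp
    linarith
  · intro z hz
    refine hB _ ?_
    rw [him]
    positivity

end HalfPlane

end

section

section HalfPlane

variable {H : ℂ → ℂ} {B : ℝ}

theorem continuousOn_halfPlane_comp (hd : DifferentiableOn ℂ H {z | 0 < z.im}) {X : Type*}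
    [TopologicalSpace X] {u : X → ℂ} {s : Set X} (hu : ContinuousOn u s)
    (hs : ∀ x ∈ s, 0 < (u x).im) : ContinuousOn (fun x => H (u x)) s :=
  hd.continuousOn.comp hu hs

/-- Boundary values bound a bounded holomorphic function in the upper half-plane. -/
theorem norm_le_of_ae_boundary_le {C : ℝ} (hd : DifferentiableOn ℂ H {z | 0 < z.im})
    (hB : ∀ z : ℂ, 0 < z.im → ‖H z‖ ≤ B)
    (hC : ∀ᵐ x : ℝ, ∃ w : ℂ, ‖w‖ ≤ C ∧
      Tendsto (fun ε : ℝ => H ((x : ℂ) + ε * I)) (𝓝[>] 0) (𝓝 w))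
    {z : ℂ} (hz : 0 < z.im) : ‖H z‖ ≤ C := by
  have hmp : ∀ᵐ r : ℝ, ∃ w : ℂ, ‖w‖ ≤ C ∧ Tendsto
      (fun ε : ℝ => H (((z.re + z.im * r : ℝ) : ℂ) + ε * I)) (𝓝[>] 0) (𝓝 w) := by
    have hq : Measure.QuasiMeasurePreserving (fun r : ℝ => z.re + z.im * r) volume volume := by
      have h1 : Measure.QuasiMeasurePreserving (fun r : ℝ => z.im * r) volume volume := by
        refine ⟨by fun_prop, ?_⟩
        rw [Real.map_volume_mul_left hz.ne']
        exact Measure.smul_absolutelyContinuous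
      exact (measurePreserving_add_left volume z.re).quasiMeasurePreserving.comp h1
    exact hq.ae hC
  have hC0 : 0 ≤ C := by
    obtain ⟨r, w, hw, -⟩ := hmp.exists
    exact (norm_nonneg _).trans hw
  choose! w hw hlim using fun (r : ℝ) (hr : ∃ w : ℂ, ‖w‖ ≤ C ∧ Tendsto
      (fun ε : ℝ => H (((z.re + z.im * r : ℝ) : ℂ) + ε * I)) (𝓝[>] 0) (𝓝 w)) => hr
  have hcont : ∀ ε : ℝ, 0 < ε →
      Continuous fun r : ℝ => H (((z.re + z.im * r : ℝ) : ℂ) + ε * I) := by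
    intro ε hε
    rw [← continuousOn_univ]
    refine continuousOn_halfPlane_comp hd (by fun_prop) fun r _ => ?_
    simpa using hε
  have h1 : Tendsto (fun ε : ℝ => ∫ r : ℝ, (((1 + r ^ 2)⁻¹ : ℝ) : ℂ) *
      H (((z.re + z.im * r : ℝ) : ℂ) + ε * I)) (𝓝[>] 0)
      (𝓝 (∫ r : ℝ, (((1 + r ^ 2)⁻¹ : ℝ) : ℂ) * w r)) := by
    refine tendsto_integral_filter_of_dominated_convergence
      (fun r : ℝ => (1 + r ^ 2)⁻¹ * B) ?_ ?_ (integrable_inv_one_add_sq.mul_const B) ?_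
    · filter_upwards [self_mem_nhdsWithin] with ε hε
      refine Continuous.aestronglyMeasurable (Continuous.mul ?_ (hcont ε hε))
      refine Complex.continuous_ofReal.comp (Continuous.inv₀ (by fun_prop) fun r => by positivity)
    · filter_upwards [self_mem_nhdsWithin] with ε hε
      refine Eventually.of_forall fun r => ?_
      rw [norm_mul, Complex.norm_real, Real.norm_of_nonneg (by positivity)]
      gcongr
      exact hB _ (by simpa using hε)
    · filter_upwards [hmp] with r hr
      exact (hlim r hr).const_mul _
  have h2 : Tendsto (fun ε : ℝ => (Real.pi : ℂ) * H (z.re + ((z.im + ε : ℝ) : ℂ) * I))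
      (𝓝[>] 0) (𝓝 (Real.pi * H z)) := by
    refine Tendsto.const_mul _ ?_
    have hz' : z = z.re + ((z.im + 0 : ℝ) : ℂ) * I := by simp
    have hca : ContinuousAt H (z.re + ((z.im + 0 : ℝ) : ℂ) * I) := by
      rw [← hz']
      exact (hd.differentiableAt ((isOpen_lt continuous_const
        Complex.continuous_im).mem_nhds hz)).continuousAt
    have : ContinuousAt (fun ε : ℝ => H (z.re + ((z.im + ε : ℝ) : ℂ) * I)) 0 :=
      ContinuousAt.comp (g := H) (f := fun ε : ℝ => (z.re : ℂ) + ((z.im + ε : ℝ) : ℂ) * I)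
        hca (by fun_prop)
    exact (this.tendsto.mono_left nhdsWithin_le_nhds).trans
      (le_of_eq (congrArg (fun u => 𝓝 (H u)) hz'.symm))
  have h3 : (Real.pi : ℂ) * H z = ∫ r : ℝ, (((1 + r ^ 2)⁻¹ : ℝ) : ℂ) * w r := by
    refine tendsto_nhds_unique h2 (h1.congr' ?_)
    filter_upwards [self_mem_nhdsWithin] with ε hε
    exact integral_poisson hd hB z.re hz hε
  have h4 : ‖(Real.pi : ℂ) * H z‖ ≤ Real.pi * C := by
    rw [h3]
    refine (norm_integral_le_of_norm_le (integrable_inv_one_add_sq.mul_const C) ?_).trans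
      (le_of_eq ?_)
    · filter_upwards [hmp] with r hr
      rw [norm_mul, Complex.norm_real, Real.norm_of_nonneg (by positivity)]
      gcongr
      exact hw r hr
    · rw [integral_mul_const, integral_univ_inv_one_add_sq]
  rw [norm_mul, Complex.norm_real, Real.norm_of_nonneg Real.pi_pos.le] at h4
  exact le_of_mul_le_mul_left h4 Real.pi_pos

theorem hasDerivAt_inv_one_add_sq (r : ℝ) :
    HasDerivAt (fun r : ℝ => (((1 + r ^ 2)⁻¹ : ℝ) : ℂ)) (((-(2 * r) / (1 + r ^ 2) ^ 2 : ℝ) : ℂ)) r := by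
  have h : HasDerivAt (fun r : ℝ => 1 + r ^ 2) (2 * r) r := by
    simpa using (hasDerivAt_pow 2 r).const_add 1
  exact (h.inv (by positivity)).ofReal_comp

theorem abs_poisson_deriv_mul_le (r : ℝ) :
    |(-(2 * r) / (1 + r ^ 2) ^ 2)| * |r| ≤ 2 * (1 + r ^ 2)⁻¹ := by
  have h0 : (0 : ℝ) < 1 + r ^ 2 := by positivity
  rw [abs_div, abs_neg, abs_mul, abs_of_pos (by positivity : (0:ℝ) < (1 + r ^ 2) ^ 2), abs_two,
    div_mul_eq_mul_div, mul_assoc, abs_mul_abs_self, div_le_iff₀ (by positivity)]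
  field_simp
  nlinarith [sq_nonneg r]

/-- The Poisson formula, integrated by parts: it involves only the primitive of `H` on a
horizontal line. -/
theorem integral_poisson_deriv (hd : DifferentiableOn ℂ H {z | 0 < z.im})
    (hB : ∀ z : ℂ, 0 < z.im → ‖H z‖ ≤ B) (x : ℝ) {y ε : ℝ} (hy : 0 < y) (hε : 0 < ε) :
    Real.pi * H (x + ((y + ε : ℝ) : ℂ) * I) =
      -∫ r : ℝ, ((-(2 * r) / (1 + r ^ 2) ^ 2 : ℝ) : ℂ) *
        ((∫ s in x..(x + y * r), H ((s : ℂ) + ε * I)) / y) := by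
  rw [← integral_poisson hd hB x hy hε]
  have hc : Continuous fun s : ℝ => H ((s : ℂ) + ε * I) := by
    rw [← continuousOn_univ]
    exact continuousOn_halfPlane_comp hd (by fun_prop) fun r _ => by simpa using hε
  have hB0 : 0 ≤ B := (norm_nonneg _).trans (hB I (by simp))
  have hv : ∀ r : ℝ, HasDerivAt
      (fun r : ℝ => (∫ s in x..(x + y * r), H ((s : ℂ) + ε * I)) / y)
      (H (((x + y * r : ℝ) : ℂ) + ε * I)) r := by
    intro r
    have h1 := intervalIntegral.integral_hasDerivAt_right (hc.intervalIntegrable x (x + y * r))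
      (hc.stronglyMeasurableAtFilter _ _) hc.continuousAt
    have h2 : HasDerivAt (fun r : ℝ => x + y * r) y r := by
      simpa using ((hasDerivAt_id r).const_mul y).const_add x
    have h3 := (h1.scomp r h2).div_const (y : ℂ)
    refine HasDerivAt.congr_deriv h3 ?_
    rw [Complex.real_smul]
    field_simp
  have hvb : ∀ r : ℝ, ‖(∫ s in x..(x + y * r), H ((s : ℂ) + ε * I)) / y‖ ≤ B * |r| := by
    intro r
    have h1 : ‖∫ s in x..(x + y * r), H ((s : ℂ) + ε * I)‖ ≤ B * |x + y * r - x| :=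
      intervalIntegral.norm_integral_le_of_norm_le_const fun s _ => hB _ (by simpa using hε)
    rw [norm_div, Complex.norm_real, Real.norm_of_nonneg hy.le, div_le_iff₀ hy]
    refine h1.trans (le_of_eq ?_)
    rw [add_sub_cancel_left, abs_mul, abs_of_pos hy]
    ring
  have hvc : Continuous fun r : ℝ => (∫ s in x..(x + y * r), H ((s : ℂ) + ε * I)) / y :=
    continuous_iff_continuousAt.2 fun r => (hv r).continuousAt
  have hk : Continuous fun r : ℝ => (((1 + r ^ 2)⁻¹ : ℝ) : ℂ) :=
    Complex.continuous_ofReal.comp (Continuous.inv₀ (by fun_prop) fun r => by positivity)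
  have hk' : Continuous fun r : ℝ => ((-(2 * r) / (1 + r ^ 2) ^ 2 : ℝ) : ℂ) :=
    Complex.continuous_ofReal.comp (Continuous.div (by fun_prop) (by fun_prop)
      fun r => by positivity)
  have hbd : ∀ r : ℝ, ‖(((1 + r ^ 2)⁻¹ : ℝ) : ℂ) *
      ((∫ s in x..(x + y * r), H ((s : ℂ) + ε * I)) / y)‖ ≤ B * |r|⁻¹ := by
    intro r
    rw [norm_mul, Complex.norm_real, Real.norm_of_nonneg (by positivity)]
    refine (mul_le_mul_of_nonneg_left (hvb r) (by positivity)).trans ?_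
    rcases eq_or_ne r 0 with rfl | hr
    · simp
    · have hr' : 0 < |r| := abs_pos.2 hr
      rw [mul_left_comm]
      gcongr
      rw [inv_mul_le_iff₀ (by positivity), ← div_eq_mul_inv, le_div_iff₀ hr', ← sq, sq_abs]
      linarith
  have key := integral_mul_deriv_eq_deriv_mul (a' := 0) (b' := 0)
    (fun r _ => hasDerivAt_inv_one_add_sq r) (fun r _ => hv r) ?_ ?_ ?_ ?_
  · rw [key]; simp
  · refine (integrable_inv_one_add_sq.ofReal (𝕜 := ℂ)).mul_bdd (c := B) ?_
      (Eventually.of_forall fun r => hB _ (by simpa using hε))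
    exact (hc.comp (by fun_prop : Continuous fun r : ℝ => x + y * r)).aestronglyMeasurable
  · refine ((integrable_inv_one_add_sq.const_mul 2).mul_const B).mono'
      (hk'.mul hvc).aestronglyMeasurable (Eventually.of_forall fun r => ?_)
    simp only [Pi.mul_apply]
    rw [norm_mul, Complex.norm_real, Real.norm_eq_abs]
    calc _ ≤ |(-(2 * r) / (1 + r ^ 2) ^ 2)| * (B * |r|) := by gcongr; exact hvb r
      _ = (|(-(2 * r) / (1 + r ^ 2) ^ 2)| * |r|) * B := by ring
      _ ≤ _ := mul_le_mul_of_nonneg_right (abs_poisson_deriv_mul_le r) hB0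
  · refine squeeze_zero_norm hbd ?_
    simpa using (tendsto_inv_atTop_zero.comp tendsto_abs_atBot_atTop).const_mul B
  · refine squeeze_zero_norm hbd ?_
    simpa using (tendsto_inv_atTop_zero.comp tendsto_abs_atTop_atTop).const_mul B

/-- The primitives of `H` on horizontal lines converge as the lines approach the real axis. -/
theorem exists_tendsto_primitive (hd : DifferentiableOn ℂ H {z | 0 < z.im})
    (hB : ∀ z : ℂ, 0 < z.im → ‖H z‖ ≤ B) (x x' : ℝ) :
    ∃ w, Tendsto (fun ε : ℝ => ∫ s in x..x', H ((s : ℂ) + ε * I)) (𝓝[>] 0) (𝓝 w) := by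
  have hint : ∀ x : ℝ, IntervalIntegrable (fun y : ℝ => H (x + y * I)) volume 0 1 := by
    intro x
    rw [intervalIntegrable_iff_integrableOn_Ioc_of_le zero_le_one]
    refine IntegrableOn.of_bound (by simp) ?_ B ?_
    · refine ContinuousOn.aestronglyMeasurable ?_ measurableSet_Ioc
      exact continuousOn_halfPlane_comp hd (by fun_prop) fun y hy => by simpa using hy.1
    · filter_upwards [ae_restrict_mem measurableSet_Ioc] with y hy
      exact hB _ (by simpa using hy.1)
  have hlim : ∀ x : ℝ, Tendsto (fun ε : ℝ => ∫ y in ε..1, H (x + y * I)) (𝓝[>] 0)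
      (𝓝 (∫ y in (0:ℝ)..1, H (x + y * I))) := by
    intro x
    have h1 := intervalIntegral.continuousOn_primitive_interval_left
      ((intervalIntegrable_iff' (by simp)).1 (hint x))
    have h2 := (h1 0 (by simp)).tendsto
    refine h2.mono_left ?_
    rw [Set.uIcc_of_le zero_le_one]
    exact nhdsWithin_le_of_mem (Icc_mem_nhdsGT one_pos)
  refine ⟨_, Tendsto.congr' ?_ (((tendsto_const_nhds (x := ∫ s in x..x', H ((s : ℂ) + I))).sub
    ((hlim x').const_smul I)).add ((hlim x).const_smul I))⟩
  filter_upwards [Ioo_mem_nhdsGT (zero_lt_one' ℝ)] with ε hε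
  have hrect := Complex.integral_boundary_rect_eq_zero_of_differentiableOn H ⟨x, ε⟩ ⟨x', 1⟩
      (hd.mono fun z hz => by
        have := hz.2
        simp only [Set.mem_preimage, Set.uIcc_of_le hε.2.le] at this
        exact hε.1.trans_le this.1)
  simp only [Complex.ofReal_one, one_mul] at hrect
  linear_combination -hrect

/-- Fatou's theorem: a bounded holomorphic function in the upper half-plane has vertical
boundary values almost everywhere. -/
theorem ae_exists_boundary_value (hd : DifferentiableOn ℂ H {z | 0 < z.im})
    (hB : ∀ z : ℂ, 0 < z.im → ‖H z‖ ≤ B) :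
    ∀ᵐ x : ℝ, ∃ w : ℂ,
      Tendsto (fun ε : ℝ => H ((x : ℂ) + ε * I)) (𝓝[>] 0) (𝓝 w) := by
  have hB0 : 0 ≤ B := (norm_nonneg _).trans (hB I (by simp))
  choose Φ hΦ using exists_tendsto_primitive hd hB
  have hΦb : ∀ x x', ‖Φ x x'‖ ≤ B * |x' - x| := by
    intro x x'
    refine le_of_tendsto (hΦ x x').norm ?_
    filter_upwards [self_mem_nhdsWithin] with ε hε
    exact intervalIntegral.norm_integral_le_of_norm_le_const fun s _ => hB _ (by simpa using hε)
  have hc : ∀ ε : ℝ, 0 < ε → Continuous fun s : ℝ => H ((s : ℂ) + ε * I) := by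
    intro ε hε
    rw [← continuousOn_univ]
    exact continuousOn_halfPlane_comp hd (by fun_prop) fun r _ => by simpa using hε
  have hΦa : ∀ x x', Φ x x' = Φ 0 x' - Φ 0 x := by
    intro x x'
    refine tendsto_nhds_unique (hΦ x x') (((hΦ 0 x').sub (hΦ 0 x)).congr' ?_)
    filter_upwards [self_mem_nhdsWithin] with ε hε
    exact intervalIntegral.integral_interval_sub_left ((hc ε hε).intervalIntegrable _ _)
      ((hc ε hε).intervalIntegrable _ _)
  have hlip : LipschitzWith ⟨B, hB0⟩ (Φ 0) := by
    refine LipschitzWith.of_dist_le_mul fun x x' => ?_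
    rw [dist_eq_norm, ← hΦa, Real.dist_eq]
    exact hΦb _ _
  have hrep : ∀ x y : ℝ, 0 < y → Real.pi * H (x + y * I) =
      -∫ r : ℝ, ((-(2 * r) / (1 + r ^ 2) ^ 2 : ℝ) : ℂ) * (Φ x (x + y * r) / y) := by
    intro x y hy
    have hca : ContinuousAt H (x + y * I) :=
      (hd.differentiableAt ((isOpen_lt continuous_const
        Complex.continuous_im).mem_nhds (by simpa using hy))).continuousAt
    have h1 : Tendsto (fun ε : ℝ => (Real.pi : ℂ) * H (x + ((y + ε : ℝ) : ℂ) * I))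
        (𝓝[>] 0) (𝓝 (Real.pi * H (x + y * I))) := by
      refine Tendsto.const_mul _ (hca.tendsto.comp ?_)
      have : Continuous fun ε : ℝ => (x : ℂ) + ((y + ε : ℝ) : ℂ) * I := by fun_prop
      have := this.tendsto 0
      simp only [add_zero] at this
      exact this.mono_left nhdsWithin_le_nhds
    have h2 : Tendsto (fun ε : ℝ => -∫ r : ℝ, ((-(2 * r) / (1 + r ^ 2) ^ 2 : ℝ) : ℂ) *
        ((∫ s in x..(x + y * r), H ((s : ℂ) + ε * I)) / y)) (𝓝[>] 0)
        (𝓝 (-∫ r : ℝ, ((-(2 * r) / (1 + r ^ 2) ^ 2 : ℝ) : ℂ) * (Φ x (x + y * r) / y))) := by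
      refine Tendsto.neg (tendsto_integral_filter_of_dominated_convergence
        (fun r : ℝ => 2 * (1 + r ^ 2)⁻¹ * B) ?_ ?_
        ((integrable_inv_one_add_sq.const_mul 2).mul_const B) ?_)
      · filter_upwards [self_mem_nhdsWithin] with ε hε
        have hv : Continuous fun r : ℝ => ∫ s in x..(x + y * r), H ((s : ℂ) + ε * I) :=
          (intervalIntegral.continuous_primitive
            (fun a b => (hc ε hε).intervalIntegrable a b) x).comp (by fun_prop)
        refine Continuous.aestronglyMeasurable (Continuous.mul ?_ (hv.div_const _))
        exact Complex.continuous_ofReal.comp (Continuous.div (by fun_prop) (by fun_prop)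
          fun r => by positivity)
      · filter_upwards [self_mem_nhdsWithin] with ε hε
        refine Eventually.of_forall fun r => ?_
        have h1 : ‖∫ s in x..(x + y * r), H ((s : ℂ) + ε * I)‖ ≤ B * |x + y * r - x| :=
          intervalIntegral.norm_integral_le_of_norm_le_const fun s _ => hB _ (by simpa using hε)
        rw [add_sub_cancel_left, abs_mul, abs_of_pos hy] at h1
        rw [norm_mul, Complex.norm_real, Real.norm_eq_abs, norm_div, Complex.norm_real,
          Real.norm_of_nonneg hy.le]
        calc _ ≤ |(-(2 * r) / (1 + r ^ 2) ^ 2)| * (B * (y * |r|) / y) := by gcongr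
          _ = (|(-(2 * r) / (1 + r ^ 2) ^ 2)| * |r|) * B := by field_simp
          _ ≤ _ := mul_le_mul_of_nonneg_right (abs_poisson_deriv_mul_le r) hB0
      · exact Eventually.of_forall fun r => ((hΦ x (x + y * r)).div_const _).const_mul _
    refine tendsto_nhds_unique h1 (h2.congr' ?_)
    filter_upwards [self_mem_nhdsWithin] with ε hε
    exact (integral_poisson_deriv hd hB x hy hε).symm
  filter_upwards [hlip.ae_differentiableAt] with x hx
  set D := deriv (Φ 0) x
  refine ⟨(Real.pi : ℂ)⁻¹ * -∫ r : ℝ, ((-(2 * r) / (1 + r ^ 2) ^ 2 : ℝ) : ℂ) * (r * D), ?_⟩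
  have h3 : Tendsto (fun y : ℝ => (Real.pi : ℂ)⁻¹ *
      -∫ r : ℝ, ((-(2 * r) / (1 + r ^ 2) ^ 2 : ℝ) : ℂ) * (Φ x (x + y * r) / y)) (𝓝[>] 0)
      (𝓝 ((Real.pi : ℂ)⁻¹ *
        -∫ r : ℝ, ((-(2 * r) / (1 + r ^ 2) ^ 2 : ℝ) : ℂ) * (r * D))) := by
    refine Tendsto.const_mul _ (Tendsto.neg (tendsto_integral_filter_of_dominated_convergence
        (fun r : ℝ => 2 * (1 + r ^ 2)⁻¹ * B) ?_ ?_
        ((integrable_inv_one_add_sq.const_mul 2).mul_const B) ?_))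
    · refine Eventually.of_forall fun y => Continuous.aestronglyMeasurable (Continuous.mul ?_ ?_)
      · exact Complex.continuous_ofReal.comp (Continuous.div (by fun_prop) (by fun_prop)
          fun r => by positivity)
      · simp only [hΦa x]
        exact ((hlip.continuous.comp (by fun_prop)).sub continuous_const).div_const _
    · filter_upwards [self_mem_nhdsWithin] with y (hy : 0 < y)
      refine Eventually.of_forall fun r => ?_
      have h1 := hΦb x (x + y * r)
      rw [add_sub_cancel_left, abs_mul, abs_of_pos hy] at h1
      rw [norm_mul, Complex.norm_real, Real.norm_eq_abs, norm_div, Complex.norm_real,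
        Real.norm_of_nonneg hy.le]
      calc _ ≤ |(-(2 * r) / (1 + r ^ 2) ^ 2)| * (B * (y * |r|) / y) := by gcongr
        _ = (|(-(2 * r) / (1 + r ^ 2) ^ 2)| * |r|) * B := by field_simp
        _ ≤ _ := mul_le_mul_of_nonneg_right (abs_poisson_deriv_mul_le r) hB0
    · refine Eventually.of_forall fun r => Tendsto.const_mul _ ?_
      have hh : HasDerivAt (fun y : ℝ => Φ 0 (x + y * r)) (r • D) 0 := by
        have h1 : HasDerivAt (fun y : ℝ => x + y * r) r 0 := by
          simpa using ((hasDerivAt_id (0:ℝ)).mul_const r).const_add x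
        have h2 : HasDerivAt (Φ 0) D (x + 0 * r) := by
          rw [zero_mul, add_zero]
          exact hx.hasDerivAt
        exact h2.scomp 0 h1
      have h4 := hh.tendsto_slope_zero_right
      simp only [zero_add, zero_mul, add_zero] at h4
      refine Tendsto.congr' ?_ h4
      filter_upwards with y
      rw [hΦa x, Complex.real_smul, Complex.ofReal_inv]
      ring
  refine h3.congr' ?_
  filter_upwards [self_mem_nhdsWithin] with y (hy : 0 < y)
  rw [← hrep x y hy, ← mul_assoc, inv_mul_cancel₀ (by exact_mod_cast Real.pi_ne_zero), one_mul]

end HalfPlane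

end

section

/-! ### Plancherel's theorem for integrable functions -/

section Plancherel

open scoped FourierTransform

theorem fourier_toLp_ae_eq {u : ℝ → ℂ} (h1 : Integrable u) (h2 : MemLp u 2) :
    (𝓕 (h2.toLp u) : Lp ℂ 2 (volume : Measure ℝ)) =ᵐ[volume] 𝓕 u := by
  have hcont : Continuous (𝓕 u : ℝ → ℂ) :=
    VectorFourier.fourierIntegral_continuous Real.continuous_fourierChar
      (by exact continuous_inner) h1
  refine ae_eq_of_integral_contDiff_smul_eq
    ((Lp.memLp (𝓕 (h2.toLp u) : Lp ℂ 2 (volume : Measure ℝ))).locallyIntegrable (by norm_num))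
    hcont.locallyIntegrable fun g hg hgc => ?_
  have hg₁ : HasCompactSupport (Complex.ofRealCLM ∘ g) := hgc.comp_left rfl
  have hg₂ : ContDiff ℝ (⊤ : ℕ∞) (Complex.ofRealCLM ∘ g) := by fun_prop
  set G := hg₁.toSchwartzMap hg₂ with hG
  have e1 : ∫ x, g x • (𝓕 (h2.toLp u) : Lp ℂ 2 (volume : Measure ℝ)) x =
      Lp.toTemperedDistribution (𝓕 (h2.toLp u)) G := by
    rw [Lp.toTemperedDistribution_apply]
    rfl
  rw [e1, ← Lp.fourier_toTemperedDistribution_eq]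
  have e2 : (𝓕 (Lp.toTemperedDistribution (h2.toLp u))) G =
      Lp.toTemperedDistribution (h2.toLp u) (𝓕 G) := by
    simp
  rw [e2, Lp.toTemperedDistribution_apply]
  have e3 := VectorFourier.integral_fourierIntegral_smul_eq_flip (L := innerₗ ℝ)
      (μ := volume) (ν := volume) Real.continuous_fourierChar continuous_inner
      (G.integrable (μ := volume)) h1
  have e4 : ∫ x, (𝓕 G) x • (h2.toLp u) x = ∫ x, (𝓕 G) x • u x := by
    refine integral_congr_ae ?_
    filter_upwards [h2.coeFn_toLp] with x hx
    rw [hx]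
  rw [e4]
  calc ∫ x, (𝓕 G) x • u x = ∫ ξ, (VectorFourier.fourierIntegral Real.fourierChar volume (innerₗ ℝ) G ξ) • u ξ := by
        refine integral_congr_ae (Eventually.of_forall fun x => ?_)
        simp only [SchwartzMap.fourier_coe]
        rfl
    _ = ∫ x, G x • (VectorFourier.fourierIntegral Real.fourierChar volume (innerₗ ℝ).flip u x) := e3
    _ = ∫ x, g x • 𝓕 u x := by
        refine integral_congr_ae (Eventually.of_forall fun x => ?_)
        simp only [flip_innerₗ]
        rfl

/-- Plancherel's theorem. -/
theorem lintegral_fourier_sq {u : ℝ → ℂ} (h1 : Integrable u) (h2 : MemLp u 2) :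
    ∫⁻ ν : ℝ, ‖∫ s : ℝ, Complex.exp (-(I * s * ν)) * u s‖ₑ ^ 2 =
      ENNReal.ofReal (2 * Real.pi) * ∫⁻ s, ‖u s‖ₑ ^ 2 := by
  have hpi : (0 : ℝ) < 2 * Real.pi := by positivity
  have e1 : ∀ ν : ℝ, ∫ s : ℝ, Complex.exp (-(I * s * ν)) * u s =
      𝓕 u (ν * (2 * Real.pi)⁻¹) := by
    intro ν
    rw [Real.fourier_real_eq_integral_exp_smul]
    refine integral_congr_ae (Eventually.of_forall fun s => ?_)
    simp only [smul_eq_mul]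
    congr 2
    push_cast
    field_simp
  have e2 : ∫⁻ w : ℝ, ‖𝓕 u w‖ₑ ^ 2 = ∫⁻ s, ‖u s‖ₑ ^ 2 := by
    have h3 : ∀ v : Lp ℂ 2 (volume : Measure ℝ), ∫⁻ s, ‖v s‖ₑ ^ 2 = ‖v‖ₑ ^ 2 := by
      intro v
      rw [Lp.enorm_def, eLpNorm_eq_lintegral_rpow_enorm_toReal (by norm_num) (by norm_num)]
      simp only [ENNReal.toReal_ofNat, ENNReal.rpow_two]
      rw [← ENNReal.rpow_two, ← ENNReal.rpow_mul]
      norm_num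
    have h4 : ‖(𝓕 (h2.toLp u) : Lp ℂ 2 (volume : Measure ℝ))‖ₑ = ‖h2.toLp u‖ₑ := by
      rw [← ofReal_norm, ← ofReal_norm, Lp.norm_fourier_eq]
    calc ∫⁻ w : ℝ, ‖𝓕 u w‖ₑ ^ 2 =
        ∫⁻ w : ℝ, ‖(𝓕 (h2.toLp u) : Lp ℂ 2 (volume : Measure ℝ)) w‖ₑ ^ 2 := by
          refine lintegral_congr_ae ?_
          filter_upwards [fourier_toLp_ae_eq h1 h2] with w hw
          rw [hw]
      _ = ∫⁻ s, ‖(h2.toLp u) s‖ₑ ^ 2 := by rw [h3, h3, h4]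
      _ = _ := by
          refine lintegral_congr_ae ?_
          filter_upwards [h2.coeFn_toLp] with w hw
          rw [hw]
  simp only [e1]
  have hcont : Continuous (𝓕 u : ℝ → ℂ) :=
    VectorFourier.fourierIntegral_continuous Real.continuous_fourierChar
      (by exact continuous_inner) h1
  have hm : Measurable fun w : ℝ => ‖𝓕 u w‖ₑ ^ 2 := by
    exact (hcont.measurable.enorm).pow_const 2
  have e3 := lintegral_map (μ := volume) hm (measurable_mul_const ((2 * Real.pi)⁻¹))
  rw [Real.map_volume_mul_right (by positivity), lintegral_smul_measure, e2] at e3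
  rw [← e3]
  simp [abs_of_pos hpi]

end Plancherel

/-! ### Smoothing with the Poisson kernel -/

section Smoothing

theorem integral_mul_poisson (φ : ℝ → ℝ) (ν : ℝ) {ε : ℝ} (hε : 0 < ε) :
    ∫ x : ℝ, φ x * (ε / ((x - ν) ^ 2 + ε ^ 2)) = ∫ r : ℝ, φ (ν + ε * r) * (1 + r ^ 2)⁻¹ := by
  have h1 : ∫ x : ℝ, φ x * (ε / ((x - ν) ^ 2 + ε ^ 2)) =
      ∫ x : ℝ, φ (ν + x) * (ε / (x ^ 2 + ε ^ 2)) := by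
    rw [← integral_add_left_eq_self (μ := volume) _ ν]
    simp
  have h2 := Measure.integral_comp_mul_left (fun x : ℝ => φ (ν + x) * (ε / (x ^ 2 + ε ^ 2))) ε
  rw [h1]
  have h3 : ∫ r : ℝ, φ (ν + ε * r) * (1 + r ^ 2)⁻¹ =
      ε * ∫ x : ℝ, φ (ν + ε * x) * (ε / ((ε * x) ^ 2 + ε ^ 2)) := by
    rw [← integral_const_mul]
    refine integral_congr_ae (Eventually.of_forall fun r => ?_)
    simp only
    have : (ε * r) ^ 2 + ε ^ 2 = ε ^ 2 * (1 + r ^ 2) := by ring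
    rw [this]
    have : (1 + r ^ 2) ≠ 0 := by positivity
    field_simp
  rw [h3, h2, abs_of_pos (by positivity), smul_eq_mul, ← mul_assoc, mul_inv_cancel₀ hε.ne', one_mul]

theorem tendsto_integral_mul_poisson {φ : ℝ → ℝ} (hφ : Continuous φ) {C : ℝ}
    (hC : ∀ x, |φ x| ≤ C) (ν : ℝ) :
    Tendsto (fun ε : ℝ => ∫ x : ℝ, φ x * (ε / ((x - ν) ^ 2 + ε ^ 2))) (𝓝[>] 0)
      (𝓝 (Real.pi * φ ν)) := by
  have h1 : Tendsto (fun ε : ℝ => ∫ r : ℝ, φ (ν + ε * r) * (1 + r ^ 2)⁻¹) (𝓝[>] 0)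
      (𝓝 (∫ r : ℝ, φ ν * (1 + r ^ 2)⁻¹)) := by
    refine tendsto_integral_filter_of_dominated_convergence
      (fun r : ℝ => C * (1 + r ^ 2)⁻¹) ?_ ?_ (integrable_inv_one_add_sq.const_mul C) ?_
    · refine Eventually.of_forall fun ε => Continuous.aestronglyMeasurable ?_
      exact (hφ.comp (by fun_prop)).mul (Continuous.inv₀ (by fun_prop) fun r => by positivity)
    · refine Eventually.of_forall fun ε => Eventually.of_forall fun r => ?_
      rw [norm_mul, Real.norm_eq_abs, Real.norm_of_nonneg (by positivity)]
      gcongr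
      exact hC _
    · refine Eventually.of_forall fun r => Tendsto.mul_const _ ?_
      have : Continuous fun ε : ℝ => φ (ν + ε * r) := hφ.comp (by fun_prop)
      have := this.tendsto 0
      simp only [zero_mul, add_zero] at this
      exact this.mono_left nhdsWithin_le_nhds
  rw [integral_const_mul, integral_univ_inv_one_add_sq, mul_comm] at h1
  refine h1.congr' ?_
  filter_upwards [self_mem_nhdsWithin] with ε hε
  exact (integral_mul_poisson φ ν hε).symm

theorem abs_integral_mul_poisson_le {φ : ℝ → ℝ} {C : ℝ}
    (hC : ∀ x, |φ x| ≤ C) (ν : ℝ) {ε : ℝ} (hε : 0 < ε) :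
    |∫ x : ℝ, φ x * (ε / ((x - ν) ^ 2 + ε ^ 2))| ≤ Real.pi * C := by
  rw [integral_mul_poisson φ ν hε, ← Real.norm_eq_abs]
  refine (norm_integral_le_of_norm_le (integrable_inv_one_add_sq.const_mul C)
    (Eventually.of_forall fun r => ?_)).trans (le_of_eq ?_)
  · rw [norm_mul, Real.norm_eq_abs, Real.norm_of_nonneg (by positivity)]
    gcongr
    exact hC _
  · rw [integral_const_mul, integral_univ_inv_one_add_sq, mul_comm]

/-- Poisson integrals of a complex measure converge to it vaguely. -/
theorem tendsto_poisson_smoothing (μ : Measure ℝ) [IsFiniteMeasure μ] {n : ℝ → ℂ}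
    (hn : Integrable n μ) {φ : ℝ → ℝ} (hφ : Continuous φ) (hφc : HasCompactSupport φ) :
    Tendsto (fun ε : ℝ => ∫ x : ℝ, (φ x : ℂ) *
      ∫ ν, ((ε / ((x - ν) ^ 2 + ε ^ 2) : ℝ) : ℂ) * n ν ∂μ) (𝓝[>] 0)
      (𝓝 (Real.pi * ∫ ν, (φ ν : ℂ) * n ν ∂μ)) := by
  obtain ⟨C, hC⟩ := hφc.exists_bound_of_continuous hφ
  simp only [Real.norm_eq_abs] at hC
  have hφi : Integrable φ := hφ.integrable_of_hasCompactSupport hφc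
  have hswap : ∀ ε : ℝ, 0 < ε → ∫ x : ℝ, (φ x : ℂ) *
      ∫ ν, ((ε / ((x - ν) ^ 2 + ε ^ 2) : ℝ) : ℂ) * n ν ∂μ =
      ∫ ν, ((∫ x : ℝ, φ x * (ε / ((x - ν) ^ 2 + ε ^ 2)) : ℝ) : ℂ) * n ν ∂μ := by
    intro ε hε
    have h1 : ∀ x : ℝ, (φ x : ℂ) * ∫ ν, ((ε / ((x - ν) ^ 2 + ε ^ 2) : ℝ) : ℂ) * n ν ∂μ =
        ∫ ν, (φ x : ℂ) * (((ε / ((x - ν) ^ 2 + ε ^ 2) : ℝ) : ℂ) * n ν) ∂μ :=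
      fun x => (integral_const_mul _ _).symm
    have hint : Integrable (Function.uncurry fun (x ν : ℝ) =>
        (φ x : ℂ) * (((ε / ((x - ν) ^ 2 + ε ^ 2) : ℝ) : ℂ) * n ν)) (volume.prod μ) := by
      have h2 := (hφi.ofReal (𝕜 := ℂ)).mul_prod hn
      have h3 : Continuous fun p : ℝ × ℝ => ((ε / ((p.1 - p.2) ^ 2 + ε ^ 2) : ℝ) : ℂ) :=
        Complex.continuous_ofReal.comp (Continuous.div (by fun_prop) (by fun_prop)
          fun p => by positivity)
      refine (h2.bdd_mul (c := ε⁻¹) h3.aestronglyMeasurable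
        (Eventually.of_forall fun p => ?_)).congr (Eventually.of_forall fun p => ?_)
      · rw [Complex.norm_real, Real.norm_of_nonneg (by positivity), div_le_iff₀ (by positivity)]
        field_simp
        nlinarith [sq_nonneg (p.1 - p.2)]
      · exact mul_left_comm _ _ _
    simp only [h1]
    rw [integral_integral_swap hint]
    refine integral_congr_ae (Eventually.of_forall fun ν => ?_)
    simp only [← mul_assoc]
    rw [integral_mul_const]
    congr 1
    rw [← integral_complex_ofReal]
    simp
  rw [← integral_const_mul]
  refine Tendsto.congr' (f₁ := fun ε : ℝ =>
      ∫ ν, ((∫ x : ℝ, φ x * (ε / ((x - ν) ^ 2 + ε ^ 2)) : ℝ) : ℂ) * n ν ∂μ) ?_ ?_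
  · filter_upwards [self_mem_nhdsWithin] with ε hε
    exact (hswap ε hε).symm
  · refine tendsto_integral_filter_of_dominated_convergence
      (fun ν => Real.pi * C * ‖n ν‖) ?_ ?_ (hn.norm.const_mul _) ?_
    · filter_upwards [self_mem_nhdsWithin] with ε hε
      refine AEStronglyMeasurable.mul ?_ hn.aestronglyMeasurable
      have : StronglyMeasurable fun ν : ℝ => ∫ x : ℝ, φ x * (ε / ((x - ν) ^ 2 + ε ^ 2)) := by
        refine StronglyMeasurable.integral_prod_right
          (f := fun ν x : ℝ => φ x * (ε / ((x - ν) ^ 2 + ε ^ 2))) (Continuous.stronglyMeasurable ?_)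
        exact (hφ.comp continuous_snd).mul (Continuous.div (by fun_prop) (by fun_prop)
          fun p => by have : 0 < ε := hε; positivity)
      exact (Complex.continuous_ofReal.comp_stronglyMeasurable this).aestronglyMeasurable
    · filter_upwards [self_mem_nhdsWithin] with ε hε
      refine Eventually.of_forall fun ν => ?_
      rw [norm_mul, Complex.norm_real, Real.norm_eq_abs]
      gcongr
      exact abs_integral_mul_poisson_le hC ν hε
    · refine Eventually.of_forall fun ν => ?_
      rw [← mul_assoc]
      refine Tendsto.mul_const _ ?_
      have := (Complex.continuous_ofReal.tendsto _).comp (tendsto_integral_mul_poisson hφ hC ν)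
      simpa [Function.comp_def] using this

end Smoothing

end

section

section Resolvents

theorem norm_inv_sub_ofReal_sq (x ε ν : ℝ) :
    ‖(((x : ℂ) + ε * I) - ν)⁻¹‖ ^ 2 = ((x - ν) ^ 2 + ε ^ 2)⁻¹ := by
  rw [norm_inv, inv_pow, ← Complex.normSq_eq_norm_sq, Complex.normSq_apply]
  simp
  ring

theorem sub_ofReal_ne_zero {z : ℂ} (hz : z.im ≠ 0) (ν : ℝ) : z - (ν : ℂ) ≠ 0 := by
  intro h
  have := congrArg Complex.im h
  simp at this
  exact hz this

theorem norm_inv_sub_ofReal_le {z : ℂ} (hz : z.im ≠ 0) (ν : ℝ) : ‖(z - (ν : ℂ))⁻¹‖ ≤ |z.im|⁻¹ := by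
  rw [norm_inv]
  refine inv_anti₀ (abs_pos.2 hz) ?_
  have := Complex.abs_im_le_norm (z - (ν : ℂ))
  simpa using this

theorem continuous_inv_sub_ofReal {z : ℂ} (hz : z.im ≠ 0) :
    Continuous fun ν : ℝ => (z - (ν : ℂ))⁻¹ :=
  Continuous.inv₀ (by fun_prop) (sub_ofReal_ne_zero hz)

theorem memLp_inv_sub_ofReal (μ : Measure ℝ) [IsFiniteMeasure μ] {z : ℂ} (hz : z.im ≠ 0) :
    MemLp (fun ν : ℝ => (z - (ν : ℂ))⁻¹) 2 μ :=
  MemLp.of_bound (continuous_inv_sub_ofReal hz).aestronglyMeasurable _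
    (Eventually.of_forall (norm_inv_sub_ofReal_le hz))

theorem continuous_poissonKernel (x : ℝ) {ε : ℝ} (hε : 0 < ε) :
    Continuous fun ν : ℝ => ((x - ν) ^ 2 + ε ^ 2)⁻¹ :=
  Continuous.inv₀ (by fun_prop) fun ν => by positivity

/-- A finite measure on the line is determined by its Poisson integrals. -/
theorem measure_eq_of_poisson_eq {μ μ' : Measure ℝ} [IsFiniteMeasure μ] [IsFiniteMeasure μ']
    (h : ∀ x ε : ℝ, 0 < ε →
      ∫ ν, ((x - ν) ^ 2 + ε ^ 2)⁻¹ ∂μ = ∫ ν, ((x - ν) ^ 2 + ε ^ 2)⁻¹ ∂μ') : μ = μ' := by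
  refine Measure.ext_of_integral_eq_on_compactlySupported fun φ => ?_
  have h1 := tendsto_poisson_smoothing μ (n := fun _ => 1) (integrable_const _) φ.continuous
    φ.hasCompactSupport
  have h2 := tendsto_poisson_smoothing μ' (n := fun _ => 1) (integrable_const _) φ.continuous
    φ.hasCompactSupport
  have h3 : (Real.pi : ℂ) * ∫ ν, (φ ν : ℂ) * 1 ∂μ = Real.pi * ∫ ν, (φ ν : ℂ) * 1 ∂μ' := by
    refine tendsto_nhds_unique h1 (h2.congr' ?_)
    filter_upwards [self_mem_nhdsWithin] with ε hε
    congr 1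
    ext x
    congr 1
    simp only [mul_one, div_eq_mul_inv, Complex.ofReal_mul]
    rw [integral_const_mul, integral_const_mul, integral_complex_ofReal, integral_complex_ofReal,
      h x ε hε]
  have h4 := mul_left_cancel₀ (by exact_mod_cast Real.pi_ne_zero) h3
  simp only [mul_one] at h4
  rw [integral_complex_ofReal, integral_complex_ofReal] at h4
  exact_mod_cast h4

/-- A finite measure on the line with bounded Poisson integrals has a bounded density. -/
theorem measure_le_of_poisson_le {μ : Measure ℝ} [IsFiniteMeasure μ] {C : ℝ}
    (h : ∀ x ε : ℝ, 0 < ε → ∫ ν, ε / ((x - ν) ^ 2 + ε ^ 2) ∂μ ≤ C) :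
    μ ≤ ENNReal.ofReal (C / Real.pi) • volume := by
  have hC0 : 0 ≤ C := by
    refine le_trans ?_ (h 0 1 one_pos)
    exact integral_nonneg fun ν => by positivity
  have key : ∀ φ : ℝ → ℝ, Continuous φ → HasCompactSupport φ → (∀ x, 0 ≤ φ x) →
      ∫ ν, φ ν ∂μ ≤ C / Real.pi * ∫ x, φ x := by
    intro φ hφ hφc hφ0
    have h1 := tendsto_poisson_smoothing μ (n := fun _ => 1) (integrable_const _) hφ hφc
    have h2 : ‖(Real.pi : ℂ) * ∫ ν, (φ ν : ℂ) * 1 ∂μ‖ ≤ C * ∫ x, φ x := by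
      refine le_of_tendsto h1.norm ?_
      filter_upwards [self_mem_nhdsWithin] with ε (hε : 0 < ε)
      rw [← integral_const_mul]
      refine norm_integral_le_of_norm_le
        ((hφ.integrable_of_hasCompactSupport hφc).const_mul C) (Eventually.of_forall fun x => ?_)
      simp only [mul_one]
      rw [integral_complex_ofReal, ← Complex.ofReal_mul, Complex.norm_real, norm_mul,
        Real.norm_of_nonneg (hφ0 x), mul_comm]
      gcongr
      · exact hφ0 x
      · rw [Real.norm_of_nonneg (integral_nonneg fun ν => by positivity)]
        exact h x ε hε
    simp only [mul_one] at h2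
    rw [integral_complex_ofReal, ← Complex.ofReal_mul, Complex.norm_real, norm_mul,
      Real.norm_of_nonneg Real.pi_pos.le, Real.norm_of_nonneg (integral_nonneg hφ0)] at h2
    rw [div_mul_eq_mul_div, le_div_iff₀ Real.pi_pos]
    linarith
  have hcomp : ∀ K : Set ℝ, IsCompact K → μ K ≤ (ENNReal.ofReal (C / Real.pi) • volume) K := by
    intro K hK
    rw [Measure.smul_apply, smul_eq_mul]
    have hopen : ∀ V : Set ℝ, K ⊆ V → IsOpen V → volume V ≠ ∞ →
        μ K ≤ ENNReal.ofReal (C / Real.pi) * volume V := by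
      intro V hKV hV hVf
      obtain ⟨f, hf1, hf2, hf3, hf4⟩ := exists_continuousMap_one_of_isCompact_subset_isOpen hK hV hKV
      have h5 := key f f.continuous hf2 fun x => (hf4 x).1
      have h6 : (μ K).toReal ≤ ∫ ν, f ν ∂μ := by
        rw [← measureReal_def, ← integral_indicator_one hK.measurableSet]
        refine integral_mono_of_nonneg
          (Eventually.of_forall fun x => Set.indicator_nonneg (fun _ _ => zero_le_one) _)
          (f.continuous.integrable_of_hasCompactSupport hf2) (Eventually.of_forall fun x => ?_)
        by_cases hx : x ∈ K
        · simp [hx, hf1 hx]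
        · simp [hx, (hf4 x).1]
      have h7 : ∫ x, f x ≤ (volume V).toReal := by
        rw [← measureReal_def, ← integral_indicator_one hV.measurableSet]
        refine integral_mono_of_nonneg (Eventually.of_forall fun x => (hf4 x).1)
          (IntegrableOn.integrable_indicator (integrableOn_const hVf) hV.measurableSet)
          (Eventually.of_forall fun x => ?_)
        by_cases hx : x ∈ V
        · simp [hx, (hf4 x).2]
        · have : x ∉ tsupport f := fun h => hx (hf3 h)
          simp [hx, image_eq_zero_of_notMem_tsupport this]
      rw [← ENNReal.ofReal_toReal (measure_ne_top μ K), ← ENNReal.ofReal_toReal hVf,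
        ← ENNReal.ofReal_mul (by positivity)]
      refine ENNReal.ofReal_le_ofReal (h6.trans (h5.trans ?_))
      gcongr
    have hr := hK.measure_lt_top (μ := (volume : Measure ℝ))
    refine ENNReal.le_of_forall_pos_le_add fun δ hδ _ => ?_
    have hδ' : (0 : ℝ) < δ / (C / Real.pi + 1) := by
      have : (0:ℝ) < δ := hδ
      positivity
    obtain ⟨V, hKV, hV, hle⟩ := K.exists_isOpen_le_add volume
      (ε := ENNReal.ofReal (δ / (C / Real.pi + 1))) (by simpa using hδ')
    have hVf : volume V ≠ ∞ := (hle.trans_lt (by finiteness)).ne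
    refine (hopen V hKV hV hVf).trans ((mul_le_mul_right hle _).trans ?_)
    rw [mul_add]
    gcongr
    rw [← ENNReal.ofReal_mul (by positivity), ← ENNReal.ofReal_coe_nnreal]
    refine ENNReal.ofReal_le_ofReal ?_
    have h0 : 0 ≤ C / Real.pi := by positivity
    rw [mul_div_assoc', div_le_iff₀ (by positivity)]
    have : (0:ℝ) ≤ δ := δ.2
    nlinarith
  refine Measure.le_intro fun s hs _ => ?_
  refine le_of_forall_lt fun c hc => ?_
  obtain ⟨K, hKs, hK, hcK⟩ := hs.exists_lt_isCompact hc
  exact hcK.trans_le ((hcomp K hK).trans (measure_mono hKs))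

theorem poisson_eq_inv_sub (x ν : ℝ) {ε : ℝ} (hε : 0 < ε) :
    ((ε / ((x - ν) ^ 2 + ε ^ 2) : ℝ) : ℂ) = (2 * I)⁻¹ *
      (((x : ℂ) + ((-ε : ℝ) : ℂ) * I - ν)⁻¹ - ((x : ℂ) + (ε : ℂ) * I - ν)⁻¹) := by
  have h1 := sub_ofReal_ne_zero (z := (x : ℂ) + ((-ε : ℝ) : ℂ) * I) (by simpa using hε.ne') ν
  have h2 := sub_ofReal_ne_zero (z := (x : ℂ) + (ε : ℂ) * I) (by simpa using hε.ne') ν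
  have h3 : ((x : ℂ) - ν) ^ 2 + (ε : ℂ) ^ 2 = ((x : ℂ) + ((-ε : ℝ) : ℂ) * I - ν) *
      ((x : ℂ) + (ε : ℂ) * I - ν) := by
    push_cast
    linear_combination (ε : ℂ) ^ 2 * Complex.I_sq
  push_cast at h1 h2 h3 ⊢
  rw [h3, inv_sub_inv h1 h2]
  field_simp
  ring_nf

/-- An integrable function whose Cauchy transform vanishes near the real axis is zero. -/
theorem ae_eq_zero_of_cauchy_eq_zero (μ : Measure ℝ) [IsFiniteMeasure μ] {n : ℝ → ℂ}
    (hn : Integrable n μ) {ε₀ : ℝ} (hε₀ : 0 < ε₀)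
    (h : ∀ z : ℂ, z.im ≠ 0 → |z.im| < ε₀ → ∫ ν : ℝ, (z - (ν : ℂ))⁻¹ * n ν ∂μ = 0) :
    n =ᵐ[μ] 0 := by
  refine ae_eq_zero_of_integral_contDiff_smul_eq_zero hn.locallyIntegrable fun φ hφ hφc => ?_
  have h1 := tendsto_poisson_smoothing μ hn hφ.continuous hφc
  have h2 : (Real.pi : ℂ) * ∫ ν, (φ ν : ℂ) * n ν ∂μ = 0 := by
    refine tendsto_nhds_unique h1 (tendsto_const_nhds.congr' ?_)
    filter_upwards [Ioo_mem_nhdsGT hε₀] with ε hε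
    have h3 : ∀ x : ℝ, ∫ ν, ((ε / ((x - ν) ^ 2 + ε ^ 2) : ℝ) : ℂ) * n ν ∂μ = 0 := by
      intro x
      have hz1 : ((x : ℂ) + ((-ε : ℝ) : ℂ) * I).im ≠ 0 := by simpa using hε.1.ne'
      have hz2 : ((x : ℂ) + (ε : ℂ) * I).im ≠ 0 := by simpa using hε.1.ne'
      have hi : ∀ z : ℂ, z.im ≠ 0 → Integrable (fun ν : ℝ => (z - (ν : ℂ))⁻¹ * n ν) μ :=
        fun z hz => hn.bdd_mul (continuous_inv_sub_ofReal hz).aestronglyMeasurable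
          (Eventually.of_forall (norm_inv_sub_ofReal_le hz))
      simp only [poisson_eq_inv_sub x _ hε.1, mul_assoc, sub_mul]
      rw [integral_const_mul, integral_sub (hi _ hz1) (hi _ hz2), h _ hz1, h _ hz2]
      · simp
      · simpa [abs_of_pos hε.1] using hε.2
      · simpa [abs_of_pos hε.1] using hε.2
    simp only [h3, mul_zero, integral_zero]
  have h5 := (mul_eq_zero.1 h2).resolve_left (by exact_mod_cast Real.pi_ne_zero)
  simpa [Complex.real_smul] using h5

/-- Finite linear combinations of the functions `ν ↦ (z - ν)⁻¹` with `z` non-real. -/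
abbrev ResComb : Type := {z : ℂ // z.im ≠ 0} →₀ ℂ

namespace ResComb

/-- The function `ν ↦ ∑ r(z) (z - ν)⁻¹`. -/
def fn (r : ResComb) (ν : ℝ) : ℂ := r.sum fun z a => a * (z.1 - (ν : ℂ))⁻¹

theorem continuous_fn (r : ResComb) : Continuous r.fn :=
  continuous_finsetSum _ fun z _ => (continuous_inv_sub_ofReal z.2).const_mul _

theorem memLp_fn (r : ResComb) (μ : Measure ℝ) [IsFiniteMeasure μ] : MemLp r.fn 2 μ :=
  memLp_finsetSum _ fun z _ => (memLp_inv_sub_ofReal μ z.2).const_mul _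

/-- The linear combinations of the functions `ν ↦ (z - ν)⁻¹`, with `z` close to the real axis,
are dense in `L²`. -/
theorem exists_eLpNorm_sub_lt (μ : Measure ℝ) [IsFiniteMeasure μ] {n : ℝ → ℂ}
    (hn : MemLp n 2 μ) {ε₀ : ℝ} (hε₀ : 0 < ε₀) {δ : ℝ≥0∞} (hδ : δ ≠ 0) :
    ∃ r : ResComb, (∀ z ∈ r.support, |z.1.im| < ε₀) ∧ eLpNorm (n - r.fn) 2 μ < δ := by
  let v : {z : ℂ // z.im ≠ 0 ∧ |z.im| < ε₀} → Lp ℂ 2 μ :=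
    fun z => (memLp_inv_sub_ofReal μ z.2.1).toLp _
  have hdense : (Submodule.span ℂ (Set.range v)).topologicalClosure = ⊤ := by
    rw [Submodule.topologicalClosure_eq_top_iff, Submodule.eq_bot_iff]
    intro k hk
    have hk1 : Integrable k μ := (Lp.memLp k).integrable (by norm_num)
    refine (Lp.eq_zero_iff_ae_eq_zero).2 (ae_eq_zero_of_cauchy_eq_zero μ hk1 hε₀ ?_)
    intro z hz hz'
    have hc : (starRingEnd ℂ z).im ≠ 0 ∧ |(starRingEnd ℂ z).im| < ε₀ := by
      simpa using ⟨hz, hz'⟩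
    have h1 := (Submodule.mem_orthogonal _ _).1 hk (v ⟨_, hc⟩)
      (Submodule.subset_span ⟨_, rfl⟩)
    rw [L2.inner_def] at h1
    rw [← h1]
    refine integral_congr_ae ?_
    filter_upwards [(memLp_inv_sub_ofReal μ hc.1).coeFn_toLp] with ν hν
    simp only [v, hν, RCLike.inner_apply, map_inv₀, map_sub, Complex.conj_conj,
      Complex.conj_ofReal]
    ring
  have hmem : hn.toLp n ∈ closure (Submodule.span ℂ (Set.range v) : Set (Lp ℂ 2 μ)) := by
    rw [← Submodule.topologicalClosure_coe, hdense]
    trivial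
  obtain ⟨w, hw, hlt⟩ := EMetric.mem_closure_iff.1 hmem δ (pos_iff_ne_zero.2 hδ)
  obtain ⟨c, rfl⟩ := (Finsupp.mem_span_range_iff_exists_finsupp).1 hw
  let i : {z : ℂ // z.im ≠ 0 ∧ |z.im| < ε₀} ↪ {z : ℂ // z.im ≠ 0} :=
    ⟨fun z => ⟨z.1, z.2.1⟩, fun a b hab => Subtype.ext
      (congrArg (fun y : {z : ℂ // z.im ≠ 0} => y.1) hab)⟩
  refine ⟨c.embDomain i, ?_, ?_⟩
  · intro z hz
    rw [Finsupp.support_embDomain, Finset.mem_map] at hz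
    obtain ⟨a, -, rfl⟩ := hz
    exact a.2.2
  · have hfn : ∀ ν, fn (c.embDomain i) ν = c.sum fun z a => a * (z.1 - (ν : ℂ))⁻¹ := by
      intro ν
      rw [fn, Finsupp.sum_embDomain]
      rfl
    rw [Lp.edist_def] at hlt
    refine lt_of_le_of_lt (le_of_eq (eLpNorm_congr_ae ?_)) hlt
    have h2 : (c.sum fun j a => a • v j : Lp ℂ 2 μ) =ᵐ[μ]
        fun ν => c.sum fun z a => a * (z.1 - (ν : ℂ))⁻¹ := by
      have h3 := Lp.coeFn_finsetSum c.support fun j => c j • v j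
      have h4 : ∀ᵐ ν ∂μ, ∀ j ∈ c.support, (c j • v j : Lp ℂ 2 μ) ν =
          c j * (j.1 - (ν : ℂ))⁻¹ := by
        refine (eventually_all_finset c.support).2 fun j _ => ?_
        filter_upwards [Lp.coeFn_smul (c j) (v j),
          (memLp_inv_sub_ofReal μ j.2.1).coeFn_toLp] with ν h5 h6
        rw [h5, Pi.smul_apply, h6, smul_eq_mul]
      filter_upwards [h3, h4] with ν h5 h6
      simp only [Finsupp.sum]
      rw [h5]
      simp only [Finset.sum_apply]
      exact Finset.sum_congr rfl h6
    filter_upwards [hn.coeFn_toLp, h2] with ν h5 h6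
    simp only [Pi.sub_apply, h5, h6, hfn]

end ResComb

end Resolvents

end

section

/-! ### Spectral theory of a self-adjoint operator -/

section SquareIntegrable

variable {X : Type*} [MeasurableSpace X] {μ : Measure X}

theorem enorm_toLp_sq {k : X → ℂ} (hk : MemLp k 2 μ) :
    ‖hk.toLp k‖ₑ ^ 2 = ∫⁻ x, ‖k x‖ₑ ^ 2 ∂μ := by
  rw [Lp.enorm_toLp, eLpNorm_eq_lintegral_rpow_enorm_toReal (by norm_num) (by norm_num)]
  simp only [ENNReal.toReal_ofNat, ENNReal.rpow_two]
  rw [← ENNReal.rpow_two, ← ENNReal.rpow_mul]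
  norm_num

theorem norm_toLp_sq {k : X → ℂ} (hk : MemLp k 2 μ) :
    ‖hk.toLp k‖ ^ 2 = ∫ x, ‖k x‖ ^ 2 ∂μ := by
  rw [integral_eq_lintegral_of_nonneg_ae (Eventually.of_forall fun x => by positivity)
    (by exact hk.aestronglyMeasurable.norm.pow 2)]
  have : ∀ x, ENNReal.ofReal (‖k x‖ ^ 2) = ‖k x‖ₑ ^ 2 := fun x => by
    rw [ENNReal.ofReal_pow (norm_nonneg _), ofReal_norm]
  simp only [this]
  rw [← enorm_toLp_sq hk, ENNReal.toReal_pow, toReal_enorm]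

theorem inner_toLp {k n : X → ℂ} (hk : MemLp k 2 μ) (hn : MemLp n 2 μ) :
    ⟪hk.toLp k, hn.toLp n⟫_ℂ = ∫ x, (starRingEnd ℂ) (k x) * n x ∂μ := by
  rw [L2.inner_def]
  refine integral_congr_ae ?_
  filter_upwards [hk.coeFn_toLp, hn.coeFn_toLp] with x h1 h2
  rw [h1, h2, RCLike.inner_apply, mul_comm]

theorem memLp_two_add_measure {k : X → ℂ} {μ' : Measure X} (h : MemLp k 2 μ) (h' : MemLp k 2 μ') :
    MemLp k 2 (μ + μ') := by
  rw [memLp_two_iff_integrable_sq_norm (h.1.add_measure h'.1)]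
  exact ((memLp_two_iff_integrable_sq_norm h.1).1 h).add_measure
    ((memLp_two_iff_integrable_sq_norm h'.1).1 h')

end SquareIntegrable

variable {E : Type} [NormedAddCommGroup E] [InnerProductSpace ℂ E]

namespace IsUnitaryGroupOf

variable {h : E →ₗ.[ℂ] E} {U : ℝ → E ≃ₗᵢ[ℂ] E}

theorem apply_neg_apply (H : IsUnitaryGroupOf h U) (t : ℝ) (f : E) : U (-t) (U t f) = f := by
  rw [← H.add, neg_add_cancel, H.zero]
  rfl

theorem apply_apply_neg (H : IsUnitaryGroupOf h U) (t : ℝ) (f : E) : U t (U (-t) f) = f := by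
  rw [← H.add, add_neg_cancel, H.zero]
  rfl

theorem inner_apply_left (H : IsUnitaryGroupOf h U) (t : ℝ) (f f' : E) :
    ⟪U t f, f'⟫_ℂ = ⟪f, U (-t) f'⟫_ℂ := by
  rw [← (U t).inner_map_map f, H.apply_apply_neg]

theorem hasDerivAt_apply {L : Type} [NormedAddCommGroup L] [InnerProductSpace ℂ L]
    (V : E ≃ₗᵢ[ℂ] L) {u : ℝ → E} {u' : E} {t : ℝ} (hu : HasDerivAt u u' t) :
    HasDerivAt (fun s => V (u s)) (V u') t := by
  have h1 : HasFDerivAt (fun f : E => V f)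
      ((V.toContinuousLinearEquiv : E →L[ℂ] L).restrictScalars ℝ) (u t) :=
    ((V.toContinuousLinearEquiv : E →L[ℂ] L).restrictScalars ℝ).hasFDerivAt
  exact h1.comp_hasDerivAt t hu

theorem map_mem_graph (H : IsUnitaryGroupOf h U) {f ξ : E} (hf : (f, ξ) ∈ h.graph) (t : ℝ) :
    (U t f, U t ξ) ∈ h.graph := by
  rw [H.generator] at hf ⊢
  have h1 := hasDerivAt_apply (U t) hf
  rw [map_smul] at h1
  refine h1.congr_of_eventuallyEq (Eventually.of_forall fun s => ?_)
  simp only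
  rw [← H.add, ← H.add, add_comm]

theorem hasDerivAt (H : IsUnitaryGroupOf h U) {f ξ : E} (hf : (f, ξ) ∈ h.graph) (t : ℝ) :
    HasDerivAt (fun s => U s f) (I • U t ξ) t := by
  have h0 := (H.generator f ξ).1 hf
  have h1 : HasDerivAt (fun s => U (s - t) f) (I • ξ) t := by
    have h2 : HasDerivAt (fun s : ℝ => s - t) 1 t := (hasDerivAt_id t).sub_const t
    have h3 : HasDerivAt (fun s => U s f) (I • ξ) (t - t) := by rwa [sub_self]
    simpa [Function.comp_def] using HasDerivAt.scomp (h := fun s : ℝ => s - t) t h3 h2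
  have h4 := hasDerivAt_apply (U t) h1
  rw [map_smul] at h4
  refine h4.congr_of_eventuallyEq (Eventually.of_forall fun s => ?_)
  simp only
  rw [← H.add, add_sub_cancel]

end IsUnitaryGroupOf

/-- `h` is a self-adjoint operator with spectrum in `[0, ∞)` and `U t = e^{ith}`. -/
structure IsSpectral (h : E →ₗ.[ℂ] E) (U : ℝ → E ≃ₗᵢ[ℂ] E) : Prop where
  group : IsUnitaryGroupOf h U
  symm : ∀ x y : h.domain, ⟪h x, (y : E)⟫_ℂ = ⟪(x : E), h y⟫_ℂ
  surj : ∀ z : ℂ, z.im ≠ 0 → ∀ ψ : E, ∃ ξ : h.domain, z • (ξ : E) - h ξ = ψ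
  rep : ∀ g : E, ∃ R : SpectralRep h g, R.μ (Set.Iio 0) = 0 ∧
    ∀ (t : ℝ) (F : Lp ℂ 2 R.μ), (F =ᵐ[R.μ] fun ν : ℝ => Complex.exp (I * t * ν)) →
      R.J F = U t g

namespace ResComb

/-- The vector `∑ r(z) (z - h)⁻¹ ψ`. -/
def op (h : E →ₗ.[ℂ] E) (r : ResComb) (ψ : E) : E := r.sum fun z a => a • resolventVec h z.1 ψ

theorem exists_seq (μ : Measure ℝ) [IsFiniteMeasure μ] {n : ℝ → ℂ} (hn : MemLp n 2 μ)
    {ε₀ : ℝ} (hε₀ : 0 < ε₀) : ∃ r : ℕ → ResComb,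
      (∀ j, ∀ z ∈ (r j).support, |z.1.im| < ε₀) ∧
      Tendsto (fun j => eLpNorm (n - (r j).fn) 2 μ) atTop (𝓝 0) := by
  choose r hr hlt using fun j : ℕ => exists_eLpNorm_sub_lt μ hn hε₀
    (δ := ((j : ℝ≥0∞) + 1)⁻¹) (by simp)
  refine ⟨r, hr, tendsto_of_tendsto_of_tendsto_of_le_of_le tendsto_const_nhds ?_
    (fun _ => zero_le) fun j => (hlt j).le⟩
  have := ENNReal.tendsto_inv_nat_nhds_zero.comp (tendsto_add_atTop_nat 1)
  simpa [Function.comp_def] using this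

end ResComb

theorem SpectralRep.J_fn {h : E →ₗ.[ℂ] E} {g : E} (R : SpectralRep h g) (r : ResComb)
    {F : Lp ℂ 2 R.μ} (hF : F =ᵐ[R.μ] r.fn) : R.J F = r.op h g := by
  have := R.finite
  have h1 : F = r.sum fun z a => a • (memLp_inv_sub_ofReal R.μ z.2).toLp _ := by
    refine Lp.ext (hF.trans ?_)
    have h3 := Lp.coeFn_finsetSum r.support
      fun j => r j • (memLp_inv_sub_ofReal R.μ j.2).toLp _
    have h4 : ∀ᵐ ν ∂(R.μ), ∀ j ∈ r.support, (r j • (memLp_inv_sub_ofReal R.μ j.2).toLp _ :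
        Lp ℂ 2 R.μ) ν = r j * (j.1 - (ν : ℂ))⁻¹ := by
      refine (eventually_all_finset r.support).2 fun j _ => ?_
      filter_upwards [Lp.coeFn_smul (r j) ((memLp_inv_sub_ofReal R.μ j.2).toLp _),
        (memLp_inv_sub_ofReal R.μ j.2).coeFn_toLp] with ν h5 h6
      rw [h5, Pi.smul_apply, h6, smul_eq_mul]
    filter_upwards [h3, h4] with ν h5 h6
    simp only [Finsupp.sum, ResComb.fn]
    rw [h5]
    simp only [Finset.sum_apply]
    exact (Finset.sum_congr rfl h6).symm
  rw [h1, ResComb.op, Finsupp.sum, Finsupp.sum, map_sum]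
  refine Finset.sum_congr rfl fun z _ => ?_
  rw [map_smul, R.map_resolvent z.1 z.2 _ (memLp_inv_sub_ofReal R.μ z.2).coeFn_toLp]

theorem SpectralRep.integral_poisson_eq {h : E →ₗ.[ℂ] E} {g : E} (R : SpectralRep h g) (x : ℝ)
    {ε : ℝ} (hε : 0 < ε) : ∫ ν, ((x - ν) ^ 2 + ε ^ 2)⁻¹ ∂(R.μ) =
      ‖resolventVec h ((x : ℂ) + ε * I) g‖ ^ 2 := by
  have := R.finite
  have hz : ((x : ℂ) + ε * I).im ≠ 0 := by simpa using hε.ne'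
  rw [← R.map_resolvent _ hz _ (memLp_inv_sub_ofReal R.μ hz).coeFn_toLp, R.J.norm_map,
    norm_toLp_sq]
  simp only [norm_inv_sub_ofReal_sq]

theorem SpectralRep.enorm_J_sub_op {h : E →ₗ.[ℂ] E} {g : E} (R : SpectralRep h g) {n : ℝ → ℂ}
    (hn : MemLp n 2 R.μ) (r : ResComb) :
    ‖R.J (hn.toLp n) - r.op h g‖ₑ = eLpNorm (n - r.fn) 2 R.μ := by
  have := R.finite
  rw [← R.J_fn r (r.memLp_fn R.μ).coeFn_toLp, ← map_sub, ← MemLp.toLp_sub,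
    ← Lp.enorm_toLp (hn.sub (r.memLp_fn R.μ))]
  rw [← ofReal_norm, ← ofReal_norm, R.J.norm_map]

/-- `h` is symmetric. -/
def IsSymm (h : E →ₗ.[ℂ] E) : Prop := ∀ x y : h.domain, ⟪h x, (y : E)⟫_ℂ = ⟪(x : E), h y⟫_ℂ

namespace IsSymm

variable {h : E →ₗ.[ℂ] E}

theorem inner_self_im (H : IsSymm h) (x : h.domain) : (⟪(x : E), h x⟫_ℂ).im = 0 := by
  have h1 := H x x
  rw [← inner_conj_symm] at h1
  exact Complex.conj_eq_iff_im.1 h1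

theorem im_mul_norm_sq (H : IsSymm h) (z : ℂ) (x : h.domain) :
    (⟪(x : E), z • (x : E) - h x⟫_ℂ).im = z.im * ‖(x : E)‖ ^ 2 := by
  rw [inner_sub_right, inner_smul_right, Complex.sub_im, H.inner_self_im, sub_zero,
    inner_self_eq_norm_sq_to_K, Complex.mul_im]
  simp [← Complex.ofReal_pow]

theorem resolventVec_eq (H : IsSymm h) {z : ℂ} (hz : z.im ≠ 0) {ψ : E} {ξ : h.domain}
    (e : z • (ξ : E) - h ξ = ψ) : resolventVec h z ψ = ξ := by
  have hex : ∃ ξ : h.domain, z • (ξ : E) - h ξ = ψ := ⟨ξ, e⟩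
  rw [resolventVec, dif_pos hex]
  have h1 := hex.choose_spec
  set ζ := hex.choose
  have h2 : z • ((ζ - ξ : h.domain) : E) - h (ζ - ξ) = 0 := by
    rw [LinearPMap.map_sub, Submodule.coe_sub, smul_sub, sub_sub_sub_comm, h1, e, sub_self]
  have h3 := H.im_mul_norm_sq z (ζ - ξ)
  rw [h2, inner_zero_right, Complex.zero_im] at h3
  have h4 := (mul_eq_zero.1 h3.symm).resolve_left hz
  have h5 : ((ζ - ξ : h.domain) : E) = 0 := by simpa using h4
  rw [Submodule.coe_sub] at h5
  exact sub_eq_zero.1 h5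

end IsSymm

namespace IsSpectral

variable {h : E →ₗ.[ℂ] E} {U : ℝ → E ≃ₗᵢ[ℂ] E}

theorem im_mul_norm_sq (H : IsSpectral h U) (z : ℂ) (x : h.domain) :
    (⟪(x : E), z • (x : E) - h x⟫_ℂ).im = z.im * ‖(x : E)‖ ^ 2 :=
  IsSymm.im_mul_norm_sq H.symm z x

theorem resolventVec_eq (H : IsSpectral h U) {z : ℂ} (hz : z.im ≠ 0) {ψ : E} {ξ : h.domain}
    (e : z • (ξ : E) - h ξ = ψ) : resolventVec h z ψ = ξ :=
  IsSymm.resolventVec_eq H.symm hz e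

theorem exists_resolvent (H : IsSpectral h U) {z : ℂ} (hz : z.im ≠ 0) (ψ : E) :
    ∃ ξ : h.domain, (ξ : E) = resolventVec h z ψ ∧ z • (ξ : E) - h ξ = ψ := by
  obtain ⟨ξ, hξ⟩ := H.surj z hz ψ
  exact ⟨ξ, (H.resolventVec_eq hz hξ).symm, hξ⟩

theorem resolventVec_add (H : IsSpectral h U) {z : ℂ} (hz : z.im ≠ 0) (ψ ξ : E) :
    resolventVec h z (ψ + ξ) = resolventVec h z ψ + resolventVec h z ξ := by
  obtain ⟨a, ha, ha'⟩ := H.exists_resolvent hz ψ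
  obtain ⟨b, hb, hb'⟩ := H.exists_resolvent hz ξ
  rw [← ha, ← hb, H.resolventVec_eq hz (ξ := a + b)]
  · rfl
  · rw [LinearPMap.map_add, Submodule.coe_add, smul_add, add_sub_add_comm, ha', hb']

theorem resolventVec_smul (H : IsSpectral h U) {z : ℂ} (hz : z.im ≠ 0) (c : ℂ) (ψ : E) :
    resolventVec h z (c • ψ) = c • resolventVec h z ψ := by
  obtain ⟨a, ha, ha'⟩ := H.exists_resolvent hz ψ
  rw [← ha, H.resolventVec_eq hz (ξ := c • a)]
  · rfl
  · rw [LinearPMap.map_smul, Submodule.coe_smul, smul_comm, ← smul_sub, ha']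

theorem resolventVec_sub (H : IsSpectral h U) {z : ℂ} (hz : z.im ≠ 0) (ψ ξ : E) :
    resolventVec h z (ψ - ξ) = resolventVec h z ψ - resolventVec h z ξ := by
  rw [sub_eq_add_neg, ← neg_one_smul ℂ ξ, H.resolventVec_add hz, H.resolventVec_smul hz,
    neg_one_smul, sub_eq_add_neg]

theorem norm_resolventVec_le (H : IsSpectral h U) {z : ℂ} (hz : z.im ≠ 0) (ψ : E) :
    ‖resolventVec h z ψ‖ ≤ |z.im|⁻¹ * ‖ψ‖ := by
  obtain ⟨a, ha, ha'⟩ := H.exists_resolvent hz ψ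
  rw [← ha]
  have h1 := H.im_mul_norm_sq z a
  rw [ha'] at h1
  have h2 : |z.im| * ‖(a : E)‖ ^ 2 ≤ ‖(a : E)‖ * ‖ψ‖ := by
    rw [← abs_of_nonneg (sq_nonneg ‖(a : E)‖), ← abs_mul, ← h1]
    exact (Complex.abs_im_le_norm _).trans (norm_inner_le_norm _ _)
  have hz' : 0 < |z.im| := abs_pos.2 hz
  rw [inv_mul_eq_div, le_div_iff₀ hz']
  rcases eq_or_lt_of_le (norm_nonneg (a : E)) with h0 | h0
  · rw [← h0, zero_mul]; exact norm_nonneg _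
  · nlinarith

theorem inner_resolventVec (H : IsSpectral h U) {z : ℂ} (hz : z.im ≠ 0) (ψ ξ : E) :
    ⟪ψ, resolventVec h z ξ⟫_ℂ = ⟪resolventVec h ((starRingEnd ℂ) z) ψ, ξ⟫_ℂ := by
  obtain ⟨a, ha, ha'⟩ := H.exists_resolvent hz ξ
  obtain ⟨b, hb, hb'⟩ := H.exists_resolvent (z := (starRingEnd ℂ) z) (by simpa using hz) ψ
  rw [← ha, ← hb, ← ha', ← hb', inner_sub_left, inner_sub_right, inner_smul_left,
    inner_smul_right, Complex.conj_conj, H.symm]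

theorem resolventVec_identity (H : IsSpectral h U) {z w : ℂ} (hz : z.im ≠ 0) (hw : w.im ≠ 0)
    (ψ : E) : resolventVec h z ψ - resolventVec h w ψ =
      (w - z) • resolventVec h z (resolventVec h w ψ) := by
  obtain ⟨a, ha, ha'⟩ := H.exists_resolvent hw ψ
  have h1 : resolventVec h z (ψ + (z - w) • (a : E)) = a := by
    refine H.resolventVec_eq hz ?_
    rw [← ha', sub_smul]
    abel
  rw [H.resolventVec_add hz, H.resolventVec_smul hz] at h1
  rw [← ha]
  rw [eq_sub_of_add_eq h1]
  module

theorem apply_resolventVec (H : IsSpectral h U) {z : ℂ} (hz : z.im ≠ 0) (t : ℝ) (ψ : E) :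
    U t (resolventVec h z ψ) = resolventVec h z (U t ψ) := by
  obtain ⟨a, ha, ha'⟩ := H.exists_resolvent hz ψ
  have h1 := H.group.map_mem_graph (h.mem_graph a) t
  obtain ⟨b, hb, hb'⟩ := (LinearPMap.mem_graph_iff h).1 h1
  simp only at hb hb'
  rw [← ha, H.resolventVec_eq hz (ξ := b), hb]
  rw [hb', hb, ← ha', map_sub, map_smul]

theorem nonempty_rep (H : IsSpectral h U) (g : E) : Nonempty (SpectralRep h g) :=
  let ⟨R, _⟩ := H.rep g
  ⟨R⟩

theorem spectralMeasure_eq (H : IsSpectral h U) {g : E} (R : SpectralRep h g) :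
    spectralMeasure h g = R.μ := by
  have hne := H.nonempty_rep g
  rw [spectralMeasure, dif_pos hne]
  have := hne.some.finite
  have := R.finite
  refine measure_eq_of_poisson_eq fun x ε hε => ?_
  rw [hne.some.integral_poisson_eq x hε, R.integral_poisson_eq x hε]

theorem isFiniteMeasure (H : IsSpectral h U) (g : E) : IsFiniteMeasure (spectralMeasure h g) := by
  obtain ⟨R⟩ := H.nonempty_rep g
  rw [H.spectralMeasure_eq R]
  exact R.finite

theorem spectralMeasure_Iio (H : IsSpectral h U) (g : E) :
    spectralMeasure h g (Set.Iio 0) = 0 := by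
  obtain ⟨R, hR, -⟩ := H.rep g
  rw [H.spectralMeasure_eq R, hR]

theorem ae_nonneg (H : IsSpectral h U) (g : E) : ∀ᵐ ν ∂(spectralMeasure h g), 0 ≤ ν := by
  rw [ae_iff]
  simp only [not_le]
  exact H.spectralMeasure_Iio g

theorem enorm_spectralApply_sub_op (H : IsSpectral h U) {g : E} {n : ℝ → ℂ}
    (hn : MemLp n 2 (spectralMeasure h g)) (r : ResComb) :
    ‖spectralApply h n g - r.op h g‖ₑ = eLpNorm (n - r.fn) 2 (spectralMeasure h g) := by
  have hne := H.nonempty_rep g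
  have e := H.spectralMeasure_eq hne.some
  rw [e] at hn ⊢
  rw [spectralApply, dif_pos hne, dif_pos hn, hne.some.enorm_J_sub_op]

theorem tendsto_op (H : IsSpectral h U) {g : E} {n : ℝ → ℂ}
    (hn : MemLp n 2 (spectralMeasure h g)) {r : ℕ → ResComb}
    (hr : Tendsto (fun j => eLpNorm (n - (r j).fn) 2 (spectralMeasure h g)) atTop (𝓝 0)) :
    Tendsto (fun j => (r j).op h g) atTop (𝓝 (spectralApply h n g)) := by
  rw [tendsto_iff_edist_tendsto_0]
  refine hr.congr fun j => ?_
  rw [edist_comm, edist_eq_enorm_sub, H.enorm_spectralApply_sub_op hn]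

theorem tendsto_op_of_le (H : IsSpectral h U) {g : E} {n : ℝ → ℂ} {μ : Measure ℝ}
    (hμ : spectralMeasure h g ≤ μ) (hn : MemLp n 2 μ) {r : ℕ → ResComb}
    (hr : Tendsto (fun j => eLpNorm (n - (r j).fn) 2 μ) atTop (𝓝 0)) :
    Tendsto (fun j => (r j).op h g) atTop (𝓝 (spectralApply h n g)) :=
  H.tendsto_op (hn.mono_measure hμ) (tendsto_of_tendsto_of_tendsto_of_le_of_le tendsto_const_nhds
    hr (fun _ => zero_le) fun _ => eLpNorm_mono_measure _ hμ)

theorem J_eq_spectralApply (H : IsSpectral h U) {g : E} (R : SpectralRep h g) {n : ℝ → ℂ}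
    (hn : MemLp n 2 R.μ) : R.J (hn.toLp n) = spectralApply h n g := by
  have := R.finite
  have e := H.spectralMeasure_eq R
  obtain ⟨r, -, hr⟩ := ResComb.exists_seq R.μ hn one_pos
  refine tendsto_nhds_unique (f := fun j => (r j).op h g) (l := atTop) ?_
    (H.tendsto_op_of_le e.le hn hr)
  rw [tendsto_iff_edist_tendsto_0]
  refine hr.congr fun j => ?_
  rw [edist_comm, edist_eq_enorm_sub, R.enorm_J_sub_op hn]

theorem spectralApply_exp (H : IsSpectral h U) (g : E) (t : ℝ) :
    spectralApply h (fun ν : ℝ => Complex.exp (I * t * ν)) g = U t g := by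
  obtain ⟨R, -, hR⟩ := H.rep g
  have := R.finite
  have hm : MemLp (fun ν : ℝ => Complex.exp (I * t * ν)) 2 R.μ := by
    refine MemLp.of_bound (Continuous.aestronglyMeasurable (by fun_prop)) 1
      (Eventually.of_forall fun ν => ?_)
    rw [Complex.norm_exp]
    simp
  rw [← H.J_eq_spectralApply R hm]
  exact hR t _ hm.coeFn_toLp

theorem spectralApply_inv_sub (H : IsSpectral h U) (g : E) {z : ℂ} (hz : z.im ≠ 0) :
    spectralApply h (fun ν : ℝ => (z - (ν : ℂ))⁻¹) g = resolventVec h z g := by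
  obtain ⟨R, -, hR⟩ := H.rep g
  have := R.finite
  rw [← H.J_eq_spectralApply R (memLp_inv_sub_ofReal R.μ hz)]
  exact R.map_resolvent z hz _ (memLp_inv_sub_ofReal R.μ hz).coeFn_toLp

theorem spectralApply_congr (H : IsSpectral h U) {g : E} {n n' : ℝ → ℂ}
    (e : n =ᵐ[spectralMeasure h g] n') : spectralApply h n g = spectralApply h n' g := by
  have hne := H.nonempty_rep g
  rw [H.spectralMeasure_eq hne.some] at e
  rw [spectralApply, spectralApply, dif_pos hne, dif_pos hne]
  by_cases hn : MemLp n 2 hne.some.μ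
  · have hn' := (memLp_congr_ae e).1 hn
    rw [dif_pos hn, dif_pos hn', (MemLp.toLp_eq_toLp_iff hn hn').2 e]
  · have hn' : ¬ MemLp n' 2 hne.some.μ := fun h => hn ((memLp_congr_ae e).2 h)
    rw [dif_neg hn, dif_neg hn']

theorem spectralApply_fun_add (H : IsSpectral h U) {g : E} {n n' : ℝ → ℂ}
    (hn : MemLp n 2 (spectralMeasure h g)) (hn' : MemLp n' 2 (spectralMeasure h g)) :
    spectralApply h (fun ν => n ν + n' ν) g = spectralApply h n g + spectralApply h n' g := by
  obtain ⟨R⟩ := H.nonempty_rep g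
  rw [H.spectralMeasure_eq R] at hn hn'
  rw [← H.J_eq_spectralApply R hn, ← H.J_eq_spectralApply R hn', ← map_add, ← MemLp.toLp_add,
    H.J_eq_spectralApply R (hn.add hn')]
  rfl

theorem spectralApply_fun_smul (H : IsSpectral h U) {g : E} {n : ℝ → ℂ}
    (hn : MemLp n 2 (spectralMeasure h g)) (c : ℂ) :
    spectralApply h (fun ν => c * n ν) g = c • spectralApply h n g := by
  obtain ⟨R⟩ := H.nonempty_rep g
  rw [H.spectralMeasure_eq R] at hn
  rw [← H.J_eq_spectralApply R hn, ← map_smul, ← MemLp.toLp_const_smul,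
    H.J_eq_spectralApply R (hn.const_smul c)]
  rfl

theorem inner_spectralApply (H : IsSpectral h U) {g : E} {n n' : ℝ → ℂ}
    (hn : MemLp n 2 (spectralMeasure h g)) (hn' : MemLp n' 2 (spectralMeasure h g)) :
    ⟪spectralApply h n g, spectralApply h n' g⟫_ℂ =
      ∫ ν, (starRingEnd ℂ) (n ν) * n' ν ∂(spectralMeasure h g) := by
  obtain ⟨R⟩ := H.nonempty_rep g
  rw [H.spectralMeasure_eq R] at hn hn' ⊢
  rw [← H.J_eq_spectralApply R hn, ← H.J_eq_spectralApply R hn', R.J.inner_map_map,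
    inner_toLp hn hn']

theorem norm_spectralApply_sq (H : IsSpectral h U) {g : E} {n : ℝ → ℂ}
    (hn : MemLp n 2 (spectralMeasure h g)) :
    ‖spectralApply h n g‖ ^ 2 = ∫ ν, ‖n ν‖ ^ 2 ∂(spectralMeasure h g) := by
  obtain ⟨R⟩ := H.nonempty_rep g
  rw [H.spectralMeasure_eq R] at hn ⊢
  rw [← H.J_eq_spectralApply R hn, R.J.norm_map, norm_toLp_sq hn]

theorem integral_poisson_eq (H : IsSpectral h U) (g : E) (x : ℝ) {ε : ℝ} (hε : 0 < ε) :
    ∫ ν, ((x - ν) ^ 2 + ε ^ 2)⁻¹ ∂(spectralMeasure h g) =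
      ‖resolventVec h ((x : ℂ) + ε * I) g‖ ^ 2 := by
  obtain ⟨R⟩ := H.nonempty_rep g
  rw [H.spectralMeasure_eq R, R.integral_poisson_eq x hε]

theorem integrable_poisson (μ : Measure ℝ) [IsFiniteMeasure μ] (x : ℝ) {ε : ℝ} (hε : 0 < ε) :
    Integrable (fun ν => ((x - ν) ^ 2 + ε ^ 2)⁻¹) μ := by
  refine Integrable.of_bound (continuous_poissonKernel x hε).aestronglyMeasurable (ε ^ 2)⁻¹
    (Eventually.of_forall fun ν => ?_)
  rw [Real.norm_of_nonneg (by positivity)]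
  exact inv_anti₀ (by positivity) (by nlinarith [sq_nonneg (x - ν)])

theorem spectralMeasure_eq_of_norm (H : IsSpectral h U) (g : E) (μ : Measure ℝ)
    [IsFiniteMeasure μ] (e : ∀ x ε : ℝ, 0 < ε → ∫ ν, ((x - ν) ^ 2 + ε ^ 2)⁻¹ ∂μ =
      ‖resolventVec h ((x : ℂ) + ε * I) g‖ ^ 2) : spectralMeasure h g = μ := by
  have := H.isFiniteMeasure g
  refine measure_eq_of_poisson_eq fun x ε hε => ?_
  rw [H.integral_poisson_eq g x hε, e x ε hε]

theorem spectralMeasure_apply (H : IsSpectral h U) (t : ℝ) (g : E) :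
    spectralMeasure h (U t g) = spectralMeasure h g := by
  have := H.isFiniteMeasure g
  refine H.spectralMeasure_eq_of_norm _ _ fun x ε hε => ?_
  have hz : ((x : ℂ) + ε * I).im ≠ 0 := by simpa using hε.ne'
  rw [H.integral_poisson_eq g x hε, ← H.apply_resolventVec hz, (U t).norm_map]

theorem spectralMeasure_smul (H : IsSpectral h U) (c : ℂ) (g : E) :
    spectralMeasure h (c • g) = ENNReal.ofReal (‖c‖ ^ 2) • spectralMeasure h g := by
  have := H.isFiniteMeasure g
  have : IsFiniteMeasure (ENNReal.ofReal (‖c‖ ^ 2) • spectralMeasure h g) :=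
    Measure.smul_finite _ ENNReal.ofReal_ne_top
  refine H.spectralMeasure_eq_of_norm _ _ fun x ε hε => ?_
  have hz : ((x : ℂ) + ε * I).im ≠ 0 := by simpa using hε.ne'
  rw [integral_smul_measure, H.integral_poisson_eq g x hε, H.resolventVec_smul hz, norm_smul,
    mul_pow, ENNReal.toReal_ofReal (by positivity), smul_eq_mul]

theorem spectralMeasure_parallelogram (H : IsSpectral h U) (ψ ξ : E) :
    spectralMeasure h (ψ + ξ) + spectralMeasure h (ψ - ξ) =
      (spectralMeasure h ψ + spectralMeasure h ψ) +
        (spectralMeasure h ξ + spectralMeasure h ξ) := by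
  have := H.isFiniteMeasure ψ
  have := H.isFiniteMeasure ξ
  have := H.isFiniteMeasure (ψ + ξ)
  have := H.isFiniteMeasure (ψ - ξ)
  refine measure_eq_of_poisson_eq fun x ε hε => ?_
  have hz : ((x : ℂ) + ε * I).im ≠ 0 := by simpa using hε.ne'
  have hi := fun (μ : Measure ℝ) [IsFiniteMeasure μ] => integrable_poisson μ x hε
  rw [integral_add_measure (hi _) (hi _), integral_add_measure (hi _) (hi _),
    integral_add_measure (hi _) (hi _), integral_add_measure (hi _) (hi _),
    H.integral_poisson_eq _ x hε, H.integral_poisson_eq _ x hε, H.integral_poisson_eq _ x hε,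
    H.integral_poisson_eq _ x hε, H.resolventVec_add hz, H.resolventVec_sub hz]
  have := parallelogram_law_with_norm ℂ (resolventVec h ((x : ℂ) + ε * I) ψ)
    (resolventVec h ((x : ℂ) + ε * I) ξ)
  nlinarith

theorem spectralMeasure_add_le (H : IsSpectral h U) (ψ ξ : E) :
    spectralMeasure h (ψ + ξ) ≤ (spectralMeasure h ψ + spectralMeasure h ψ) +
        (spectralMeasure h ξ + spectralMeasure h ξ) := by
  rw [← H.spectralMeasure_parallelogram]
  exact Measure.le_add_right le_rfl

theorem memLp_add (H : IsSpectral h U) {ψ ξ : E} {n : ℝ → ℂ}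
    (h1 : MemLp n 2 (spectralMeasure h ψ)) (h2 : MemLp n 2 (spectralMeasure h ξ)) :
    MemLp n 2 (spectralMeasure h (ψ + ξ)) :=
  (memLp_two_add_measure (memLp_two_add_measure h1 h1) (memLp_two_add_measure h2 h2)).mono_measure
    (H.spectralMeasure_add_le ψ ξ)

theorem memLp_smul (H : IsSpectral h U) {ψ : E} {n : ℝ → ℂ} (c : ℂ)
    (h1 : MemLp n 2 (spectralMeasure h ψ)) : MemLp n 2 (spectralMeasure h (c • ψ)) := by
  rw [H.spectralMeasure_smul]
  exact h1.smul_measure ENNReal.ofReal_ne_top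

theorem op_add (H : IsSpectral h U) (r : ResComb) (ψ ξ : E) :
    r.op h (ψ + ξ) = r.op h ψ + r.op h ξ := by
  simp only [ResComb.op, Finsupp.sum, ← Finset.sum_add_distrib]
  refine Finset.sum_congr rfl fun z _ => ?_
  rw [H.resolventVec_add z.2, smul_add]

theorem op_smul (H : IsSpectral h U) (r : ResComb) (c : ℂ) (ψ : E) :
    r.op h (c • ψ) = c • r.op h ψ := by
  simp only [ResComb.op, Finsupp.sum, Finset.smul_sum]
  refine Finset.sum_congr rfl fun z _ => ?_
  rw [H.resolventVec_smul z.2, smul_comm]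

theorem spectralApply_add (H : IsSpectral h U) {ψ ξ : E} {n : ℝ → ℂ}
    (h1 : MemLp n 2 (spectralMeasure h ψ)) (h2 : MemLp n 2 (spectralMeasure h ξ)) :
    spectralApply h n (ψ + ξ) = spectralApply h n ψ + spectralApply h n ξ := by
  have := H.isFiniteMeasure ψ
  have := H.isFiniteMeasure ξ
  have := H.isFiniteMeasure (ψ + ξ)
  have hm := memLp_two_add_measure (memLp_two_add_measure h1 h2) (H.memLp_add h1 h2)
  obtain ⟨r, -, hr⟩ := ResComb.exists_seq _ hm one_pos
  have l1 := H.tendsto_op_of_le (g := ψ)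
    ((Measure.le_add_right le_rfl).trans (Measure.le_add_right le_rfl)) hm hr
  have l2 := H.tendsto_op_of_le (g := ξ)
    ((Measure.le_add_left le_rfl).trans (Measure.le_add_right le_rfl)) hm hr
  have l3 := H.tendsto_op_of_le (g := ψ + ξ) (Measure.le_add_left le_rfl) hm hr
  refine tendsto_nhds_unique l3 ((l1.add l2).congr fun j => ?_)
  rw [H.op_add]

theorem spectralApply_smul (H : IsSpectral h U) {ψ : E} {n : ℝ → ℂ} (c : ℂ)
    (h1 : MemLp n 2 (spectralMeasure h ψ)) :
    spectralApply h n (c • ψ) = c • spectralApply h n ψ := by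
  have := H.isFiniteMeasure ψ
  have := H.isFiniteMeasure (c • ψ)
  have hm := memLp_two_add_measure h1 (H.memLp_smul c h1)
  obtain ⟨r, -, hr⟩ := ResComb.exists_seq _ hm one_pos
  have l1 := H.tendsto_op_of_le (g := ψ) (Measure.le_add_right le_rfl) hm hr
  have l3 := H.tendsto_op_of_le (g := c • ψ) (Measure.le_add_left le_rfl) hm hr
  refine tendsto_nhds_unique l3 ((l1.const_smul c).congr fun j => ?_)
  rw [H.op_smul]

end IsSpectral

end

section

variable {E : Type} [NormedAddCommGroup E] [InnerProductSpace ℂ E]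

namespace IsSpectral

variable {h : E →ₗ.[ℂ] E} {U : ℝ → E ≃ₗᵢ[ℂ] E}

theorem spectralApply_fun_sub (H : IsSpectral h U) {g : E} {n n' : ℝ → ℂ}
    (hn : MemLp n 2 (spectralMeasure h g)) (hn' : MemLp n' 2 (spectralMeasure h g)) :
    spectralApply h (fun ν => n ν - n' ν) g = spectralApply h n g - spectralApply h n' g := by
  have h1 := H.spectralApply_fun_add hn (hn'.const_mul (-1))
  rw [H.spectralApply_fun_smul hn'] at h1
  simpa [sub_eq_add_neg] using h1

theorem enorm_spectralApply (H : IsSpectral h U) {g : E} {n : ℝ → ℂ}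
    (hn : MemLp n 2 (spectralMeasure h g)) :
    ‖spectralApply h n g‖ₑ = eLpNorm n 2 (spectralMeasure h g) := by
  obtain ⟨R⟩ := H.nonempty_rep g
  rw [H.spectralMeasure_eq R] at hn ⊢
  rw [← H.J_eq_spectralApply R hn, ← Lp.enorm_toLp hn, ← ofReal_norm, ← ofReal_norm,
    R.J.norm_map]

theorem tendsto_spectralApply (H : IsSpectral h U) {g : E} {n : ℝ → ℂ} {n' : ℕ → ℝ → ℂ}
    (hn : MemLp n 2 (spectralMeasure h g)) (hn' : ∀ j, MemLp (n' j) 2 (spectralMeasure h g))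
    (hlim : Tendsto (fun j => eLpNorm (n - n' j) 2 (spectralMeasure h g)) atTop (𝓝 0)) :
    Tendsto (fun j => spectralApply h (n' j) g) atTop (𝓝 (spectralApply h n g)) := by
  rw [tendsto_iff_edist_tendsto_0]
  refine hlim.congr fun j => ?_
  rw [edist_comm, edist_eq_enorm_sub, ← H.spectralApply_fun_sub hn (hn' j)]
  exact (H.enorm_spectralApply (hn.sub (hn' j))).symm

theorem spectralApply_fun_sum (H : IsSpectral h U) {g : E} {ι : Type*} (s : Finset ι)
    {n : ι → ℝ → ℂ} (hn : ∀ i ∈ s, MemLp (n i) 2 (spectralMeasure h g)) :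
    spectralApply h (fun ν => ∑ i ∈ s, n i ν) g = ∑ i ∈ s, spectralApply h (n i) g := by
  classical
  induction s using Finset.induction_on with
  | empty =>
    have h1 := H.spectralApply_fun_smul (g := g) (n := fun _ => 0) MemLp.zero 0
    simpa using h1
  | insert a s ha ih =>
    simp only [Finset.sum_insert ha]
    have h1 : ∀ i ∈ s, MemLp (n i) 2 (spectralMeasure h g) :=
      fun i hi => hn i (Finset.mem_insert_of_mem hi)
    rw [H.spectralApply_fun_add (hn a (Finset.mem_insert_self _ _)) (memLp_finsetSum s h1),
      ih h1]

theorem memLp_inv_sub_mul (μ : Measure ℝ) {k : ℝ → ℂ} (hk : MemLp k 2 μ) {z : ℂ} (hz : z.im ≠ 0) :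
    MemLp (fun ν : ℝ => (z - (ν : ℂ))⁻¹ * k ν) 2 μ := by
  refine MemLp.of_le_mul (c := |z.im|⁻¹) hk
    ((continuous_inv_sub_ofReal hz).aestronglyMeasurable.mul hk.1)
    (Eventually.of_forall fun ν => ?_)
  rw [norm_mul]
  gcongr
  exact norm_inv_sub_ofReal_le hz ν

theorem tendsto_resolventVec (H : IsSpectral h U) {z : ℂ} (hz : z.im ≠ 0) {ψ : E} {u : ℕ → E}
    (hu : Tendsto u atTop (𝓝 ψ)) :
    Tendsto (fun j => resolventVec h z (u j)) atTop (𝓝 (resolventVec h z ψ)) := by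
  rw [tendsto_iff_norm_sub_tendsto_zero] at hu ⊢
  have h1 := hu.const_mul (|z.im|⁻¹)
  rw [mul_zero] at h1
  refine squeeze_zero (fun _ => norm_nonneg _) (fun j => ?_) h1
  rw [← H.resolventVec_sub hz]
  exact H.norm_resolventVec_le hz _

theorem resolventVec_resolventVec (H : IsSpectral h U) {z w : ℂ} (hz : z.im ≠ 0) (hw : w.im ≠ 0)
    (hzw : z ≠ w) (g : E) : resolventVec h z (resolventVec h w g) =
      spectralApply h (fun ν : ℝ => (z - (ν : ℂ))⁻¹ * (w - (ν : ℂ))⁻¹) g := by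
  have := H.isFiniteMeasure g
  have hwz : w - z ≠ 0 := sub_ne_zero.2 hzw.symm
  have h1 := H.resolventVec_identity hz hw g
  rw [← H.spectralApply_inv_sub g hz, ← H.spectralApply_inv_sub g hw,
    ← H.spectralApply_fun_sub (memLp_inv_sub_ofReal _ hz) (memLp_inv_sub_ofReal _ hw),
    H.spectralApply_inv_sub g hw] at h1
  have h2 : resolventVec h z (resolventVec h w g) = (w - z)⁻¹ • spectralApply h
      (fun ν : ℝ => (z - (ν : ℂ))⁻¹ - (w - (ν : ℂ))⁻¹) g := by
    rw [h1, smul_smul, inv_mul_cancel₀ hwz, one_smul]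
  rw [h2, ← H.spectralApply_fun_smul (n := fun ν : ℝ => (z - (ν : ℂ))⁻¹ - (w - (ν : ℂ))⁻¹)
    ((memLp_inv_sub_ofReal _ hz).sub (memLp_inv_sub_ofReal _ hw))]
  congr 1
  ext ν
  have := sub_ofReal_ne_zero hz ν
  have := sub_ofReal_ne_zero hw ν
  field_simp
  ring

/-- The functional calculus commutes with the resolvent. -/
theorem resolventVec_spectralApply (H : IsSpectral h U) {g : E} {k : ℝ → ℂ}
    (hk : MemLp k 2 (spectralMeasure h g)) {z : ℂ} (hz : z.im ≠ 0) :
    resolventVec h z (spectralApply h k g) =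
      spectralApply h (fun ν : ℝ => (z - (ν : ℂ))⁻¹ * k ν) g := by
  have := H.isFiniteMeasure g
  obtain ⟨r, hr, hlim⟩ := ResComb.exists_seq _ hk (abs_pos.2 hz)
  have l1 := H.tendsto_resolventVec hz (H.tendsto_op hk hlim)
  have l2 : Tendsto (fun j => spectralApply h (fun ν : ℝ => (z - (ν : ℂ))⁻¹ * (r j).fn ν) g) atTop
      (𝓝 (spectralApply h (fun ν : ℝ => (z - (ν : ℂ))⁻¹ * k ν) g)) := by
    refine H.tendsto_spectralApply (memLp_inv_sub_mul _ hk hz)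
      (fun j => memLp_inv_sub_mul _ ((r j).memLp_fn _) hz) ?_
    have l3 := ENNReal.Tendsto.const_mul (a := ENNReal.ofReal |z.im|⁻¹) hlim
      (Or.inr ENNReal.ofReal_ne_top)
    rw [mul_zero] at l3
    refine tendsto_of_tendsto_of_tendsto_of_le_of_le tendsto_const_nhds l3
      (fun _ => zero_le) fun j => ?_
    refine eLpNorm_le_mul_eLpNorm_of_ae_le_mul (Eventually.of_forall fun ν => ?_) 2
    simp only [Pi.sub_apply, ← mul_sub, norm_mul]
    gcongr
    exact norm_inv_sub_ofReal_le hz ν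
  refine tendsto_nhds_unique l1 (l2.congr fun j => ?_)
  have e1 : (fun ν : ℝ => (z - (ν : ℂ))⁻¹ * (r j).fn ν) = fun ν : ℝ => ∑ w ∈ (r j).support,
      (r j) w * ((z - (ν : ℂ))⁻¹ * (w.1 - (ν : ℂ))⁻¹) := by
    ext ν
    rw [ResComb.fn, Finsupp.sum, Finset.mul_sum]
    exact Finset.sum_congr rfl fun w _ => by ring
  have hm : ∀ w : {z : ℂ // z.im ≠ 0},
      MemLp (fun ν : ℝ => (z - (ν : ℂ))⁻¹ * (w.1 - (ν : ℂ))⁻¹) 2 (spectralMeasure h g) :=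
    fun w => memLp_inv_sub_mul _ (memLp_inv_sub_ofReal _ w.2) hz
  rw [e1, H.spectralApply_fun_sum _ fun w _ => (hm w).const_mul _, ResComb.op, Finsupp.sum]
  have e2 : ∀ s : Finset {z : ℂ // z.im ≠ 0}, resolventVec h z
      (∑ w ∈ s, (r j) w • resolventVec h w.1 g) =
      ∑ w ∈ s, (r j) w • resolventVec h z (resolventVec h w.1 g) := by
    classical
    intro s
    induction s using Finset.induction_on with
    | empty => simpa using H.resolventVec_smul hz 0 (0 : E)
    | insert a s ha ih =>
      rw [Finset.sum_insert ha, Finset.sum_insert ha, H.resolventVec_add hz, ih,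
        H.resolventVec_smul hz]
  rw [e2]
  refine Finset.sum_congr rfl fun w hw => ?_
  have hne : z ≠ w.1 := by
    rintro rfl
    exact lt_irrefl _ (hr j w hw)
  rw [H.resolventVec_resolventVec hz w.2 hne, H.spectralApply_fun_smul (hm w)]

theorem spectralMeasure_spectralApply (H : IsSpectral h U) {g : E} {k : ℝ → ℂ}
    (hk : MemLp k 2 (spectralMeasure h g)) : spectralMeasure h (spectralApply h k g) =
      (spectralMeasure h g).withDensity fun ν => ‖k ν‖ₑ ^ 2 := by
  have := H.isFiniteMeasure g
  have hfin : ∫⁻ ν, ‖k ν‖ₑ ^ 2 ∂(spectralMeasure h g) ≠ ∞ := by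
    rw [← enorm_toLp_sq hk]
    finiteness
  have : IsFiniteMeasure ((spectralMeasure h g).withDensity fun ν => ‖k ν‖ₑ ^ 2) :=
    isFiniteMeasure_withDensity hfin
  refine H.spectralMeasure_eq_of_norm _ _ fun x ε hε => ?_
  have hz : ((x : ℂ) + ε * I).im ≠ 0 := by simpa using hε.ne'
  rw [H.resolventVec_spectralApply hk hz, H.norm_spectralApply_sq (memLp_inv_sub_mul _ hk hz),
    integral_withDensity_eq_integral_toReal_smul₀ (hk.1.enorm.pow_const 2)
      (Eventually.of_forall fun ν => by finiteness)]
  refine integral_congr_ae (Eventually.of_forall fun ν => ?_)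
  simp only [norm_mul, mul_pow, norm_inv_sub_ofReal_sq, ENNReal.toReal_pow, toReal_enorm,
    smul_eq_mul]
  ring

/-- `m` represents the projection of `ψ` to the cyclic subspace of `g`. -/
def IsProj (h : E →ₗ.[ℂ] E) (g ψ : E) (m : ℝ → ℂ) : Prop :=
  MemLp m 2 (spectralMeasure h g) ∧ ∀ k, MemLp k 2 (spectralMeasure h g) →
    ⟪spectralApply h k g, ψ⟫_ℂ = ∫ ν, (starRingEnd ℂ) (k ν) * m ν ∂(spectralMeasure h g)

theorem exists_isProj [CompleteSpace E] (H : IsSpectral h U) (g ψ : E) : ∃ m, IsProj h g ψ m := by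
  obtain ⟨R⟩ := H.nonempty_rep g
  set F := ContinuousLinearMap.adjoint R.J.toContinuousLinearMap ψ with hF
  refine ⟨F, ?_, fun k hk => ?_⟩
  · rw [H.spectralMeasure_eq R]
    exact Lp.memLp F
  · rw [H.spectralMeasure_eq R] at hk ⊢
    rw [← H.J_eq_spectralApply R hk]
    have h1 : ⟪R.J (hk.toLp k), ψ⟫_ℂ = ⟪hk.toLp k, F⟫_ℂ := by
      rw [hF, ContinuousLinearMap.adjoint_inner_right]
      rfl
    rw [h1, L2.inner_def]
    refine integral_congr_ae ?_
    filter_upwards [hk.coeFn_toLp] with ν hν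
    rw [hν, RCLike.inner_apply, mul_comm]

theorem IsProj.add (H : IsSpectral h U) {g ψ ξ : E} {m m' : ℝ → ℂ} (h1 : IsProj h g ψ m)
    (h2 : IsProj h g ξ m') : IsProj h g (ψ + ξ) (fun ν => m ν + m' ν) := by
  refine ⟨h1.1.add h2.1, fun k hk => ?_⟩
  rw [inner_add_right, h1.2 k hk, h2.2 k hk, ← integral_add]
  · simp only [mul_add]
  · exact (hk.star.integrable_mul h1.1)
  · exact (hk.star.integrable_mul h2.1)

theorem IsProj.smul {g ψ : E} {m : ℝ → ℂ} (h1 : IsProj h g ψ m)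
    (c : ℂ) : IsProj h g (c • ψ) (fun ν => c * m ν) := by
  refine ⟨h1.1.const_mul c, fun k hk => ?_⟩
  rw [inner_smul_right, h1.2 k hk, ← integral_const_mul]
  congr 1
  ext ν
  ring

theorem IsProj.spectralApply_self (H : IsSpectral h U) {g : E} {k : ℝ → ℂ}
    (hk : MemLp k 2 (spectralMeasure h g)) : IsProj h g (spectralApply h k g) k :=
  ⟨hk, fun _ hk' => H.inner_spectralApply hk' hk⟩

theorem spectralApply_one (H : IsSpectral h U) (g : E) : spectralApply h (fun _ => 1) g = g := by
  have h1 := H.spectralApply_exp g 0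
  simp only [Complex.ofReal_zero, mul_zero, zero_mul, Complex.exp_zero] at h1
  rw [h1, H.group.zero]
  rfl

theorem IsProj.self (H : IsSpectral h U) (g : E) : IsProj h g g (fun _ => 1) := by
  have := H.isFiniteMeasure g
  have h1 := IsProj.spectralApply_self H (g := g) (memLp_const 1)
  rwa [H.spectralApply_one] at h1

theorem IsProj.resolventVec (H : IsSpectral h U) {g ψ : E} {m : ℝ → ℂ} (h1 : IsProj h g ψ m)
    {z : ℂ} (hz : z.im ≠ 0) :
    IsProj h g (resolventVec h z ψ) (fun ν : ℝ => (z - (ν : ℂ))⁻¹ * m ν) := by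
  refine ⟨memLp_inv_sub_mul _ h1.1 hz, fun k hk => ?_⟩
  have hz' : ((starRingEnd ℂ) z).im ≠ 0 := by simpa using hz
  rw [H.inner_resolventVec hz, H.resolventVec_spectralApply hk hz',
    h1.2 _ (memLp_inv_sub_mul _ hk hz')]
  congr 1
  ext ν
  simp only [map_mul, map_inv₀, map_sub, Complex.conj_conj, Complex.conj_ofReal]
  ring

theorem IsProj.inner_resolventVec (H : IsSpectral h U) {g ψ : E} {m : ℝ → ℂ}
    (h1 : IsProj h g ψ m) {z : ℂ} (hz : z.im ≠ 0) :
    ⟪g, BoseNESS.resolventVec h z ψ⟫_ℂ =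
      ∫ ν : ℝ, (z - (ν : ℂ))⁻¹ * m ν ∂(spectralMeasure h g) := by
  have := H.isFiniteMeasure g
  have h2 := (h1.resolventVec H hz).2 (fun _ => 1) (memLp_const 1)
  rw [H.spectralApply_one] at h2
  simpa using h2

theorem memLp_exp (μ : Measure ℝ) [IsFiniteMeasure μ] (t : ℝ) :
    MemLp (fun ν : ℝ => Complex.exp (I * t * ν)) 2 μ := by
  refine MemLp.of_bound (Continuous.aestronglyMeasurable (by fun_prop)) 1
    (Eventually.of_forall fun ν => ?_)
  rw [Complex.norm_exp]
  simp

theorem IsProj.op (H : IsSpectral h U) {g ψ : E} {m : ℝ → ℂ} (h1 : IsProj h g ψ m)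
    (r : ResComb) : IsProj h g (r.op h ψ) (fun ν => r.fn ν * m ν) := by
  have key : ∀ s : Finset {z : ℂ // z.im ≠ 0}, IsProj h g
      (∑ w ∈ s, r w • BoseNESS.resolventVec h w.1 ψ)
      (fun ν => ∑ w ∈ s, r w * ((w.1 - (ν : ℂ))⁻¹ * m ν)) := by
    classical
    intro s
    induction s using Finset.induction_on with
    | empty => simpa using h1.smul 0
    | insert a s ha ih =>
      simp only [Finset.sum_insert ha]
      exact ((h1.resolventVec H a.2).smul _).add H ih
  have e1 : (fun ν => r.fn ν * m ν) =
      fun ν : ℝ => ∑ w ∈ r.support, r w * ((w.1 - (ν : ℂ))⁻¹ * m ν) := by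
    ext ν
    rw [ResComb.fn, Finsupp.sum, Finset.sum_mul]
    exact Finset.sum_congr rfl fun w _ => by ring
  rw [e1]
  exact key r.support

/-- The projection to a cyclic subspace commutes with the functional calculus. -/
theorem IsProj.spectralApply [CompleteSpace E] (H : IsSpectral h U) {g ψ : E} {m : ℝ → ℂ}
    (h1 : IsProj h g ψ m) {n : ℝ → ℝ} (hg : MemLp (fun ν => (n ν : ℂ)) 2 (spectralMeasure h g))
    (hψ : MemLp (fun ν => (n ν : ℂ)) 2 (spectralMeasure h ψ)) :
    IsProj h g (BoseNESS.spectralApply h (fun ν => (n ν : ℂ)) ψ) (fun ν => (n ν : ℂ) * m ν) := by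
  have := H.isFiniteMeasure g
  have := H.isFiniteMeasure ψ
  obtain ⟨m', hm'⟩ := H.exists_isProj g (BoseNESS.spectralApply h (fun ν => (n ν : ℂ)) ψ)
  have hsum := memLp_two_add_measure hg hψ
  obtain ⟨r, -, hr⟩ := ResComb.exists_seq _ hsum one_pos
  have lψ := H.tendsto_op_of_le (g := ψ) (Measure.le_add_left le_rfl) hsum hr
  have hr' : Tendsto (fun j => eLpNorm ((fun ν => (n ν : ℂ)) - (r j).fn) 2
      (spectralMeasure h g)) atTop (𝓝 0) :=
    tendsto_of_tendsto_of_tendsto_of_le_of_le tendsto_const_nhds hr (fun _ => zero_le)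
      fun _ => eLpNorm_mono_measure _ (Measure.le_add_right le_rfl)
  have hae : m' =ᵐ[spectralMeasure h g] fun ν => (n ν : ℂ) * m ν := by
    have hi1 : Integrable m' (spectralMeasure h g) := hm'.1.integrable (by norm_num)
    have hi2 : Integrable (fun ν => (n ν : ℂ) * m ν) (spectralMeasure h g) :=
      hg.integrable_mul h1.1
    refine ae_eq_of_integral_contDiff_smul_eq hi1.locallyIntegrable hi2.locallyIntegrable
      fun φ hφ hφc => ?_
    obtain ⟨C, hC⟩ := hφc.exists_bound_of_continuous hφ.continuous
    have hb : ∀ {k : ℝ → ℂ}, MemLp k 2 (spectralMeasure h g) →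
        MemLp (fun ν => (φ ν : ℂ) * k ν) 2 (spectralMeasure h g) := by
      intro k hk
      refine MemLp.of_le_mul (c := C) hk ((Complex.continuous_ofReal.comp
        hφ.continuous).aestronglyMeasurable.mul hk.1) (Eventually.of_forall fun ν => ?_)
      rw [norm_mul, Complex.norm_real]
      gcongr
      exact hC ν
    have hφm : MemLp (fun ν => (φ ν : ℂ)) 2 (spectralMeasure h g) := by
      simpa using hb (memLp_const (1 : ℂ))
    have e1 : ∫ ν, φ ν • m' ν ∂(spectralMeasure h g) =
        ⟪BoseNESS.spectralApply h (fun ν => (φ ν : ℂ)) g,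
          BoseNESS.spectralApply h (fun ν => (n ν : ℂ)) ψ⟫_ℂ := by
      rw [hm'.2 _ hφm]
      congr 1
      ext ν
      rw [Complex.conj_ofReal, Complex.real_smul]
    have e2 : ∫ ν, φ ν • ((n ν : ℂ) * m ν) ∂(spectralMeasure h g) =
        ⟪BoseNESS.spectralApply h (fun ν => (φ ν : ℂ) * (n ν : ℂ)) g, ψ⟫_ℂ := by
      rw [h1.2 _ (hb hg)]
      congr 1
      ext ν
      rw [map_mul, Complex.conj_ofReal, Complex.conj_ofReal, Complex.real_smul, mul_assoc]
    have hstar : ∀ j, MemLp (fun ν => (starRingEnd ℂ) ((r j).fn ν)) 2 (spectralMeasure h g) :=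
      fun j => ((r j).memLp_fn _).star
    have l1 : Tendsto (fun j => BoseNESS.spectralApply h
        (fun ν => (φ ν : ℂ) * (starRingEnd ℂ) ((r j).fn ν)) g) atTop
        (𝓝 (BoseNESS.spectralApply h (fun ν => (φ ν : ℂ) * (n ν : ℂ)) g)) := by
      refine H.tendsto_spectralApply (hb hg) (fun j => hb (hstar j)) ?_
      have l3 := ENNReal.Tendsto.const_mul (a := ENNReal.ofReal C) hr'
        (Or.inr ENNReal.ofReal_ne_top)
      rw [mul_zero] at l3
      refine tendsto_of_tendsto_of_tendsto_of_le_of_le tendsto_const_nhds l3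
        (fun _ => zero_le) fun j => ?_
      refine eLpNorm_le_mul_eLpNorm_of_ae_le_mul (Eventually.of_forall fun ν => ?_) 2
      have e3 : (n ν : ℂ) - (starRingEnd ℂ) ((r j).fn ν) =
          (starRingEnd ℂ) ((n ν : ℂ) - (r j).fn ν) := by
        rw [map_sub, Complex.conj_ofReal]
      simp only [Pi.sub_apply, ← mul_sub, norm_mul, e3, RCLike.norm_conj, Complex.norm_real]
      gcongr
      exact hC ν
    rw [e1, e2]
    refine tendsto_nhds_unique ((tendsto_const_nhds.inner lψ))
      ((l1.inner tendsto_const_nhds).congr fun j => ?_)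
    rw [(h1.op H (r j)).2 _ hφm, h1.2 _ (hb (hstar j))]
    congr 1
    ext ν
    rw [map_mul, Complex.conj_conj, mul_assoc]
  refine ⟨(memLp_congr_ae hae).1 hm'.1, fun k hk => ?_⟩
  rw [hm'.2 k hk]
  refine integral_congr_ae ?_
  filter_upwards [hae] with ν hν
  rw [hν]

end IsSpectral

end

section

theorem eLpNorm_two_sq {X : Type*} [MeasurableSpace X] (μ : Measure X) (f : X → ℂ) :
    eLpNorm f 2 μ ^ 2 = ∫⁻ x, ‖f x‖ₑ ^ 2 ∂μ := by
  rw [eLpNorm_eq_lintegral_rpow_enorm_toReal (by norm_num) (by norm_num)]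
  simp only [ENNReal.toReal_ofNat, ENNReal.rpow_two]
  rw [← ENNReal.rpow_two, ← ENNReal.rpow_mul]
  norm_num

variable {E : Type} [NormedAddCommGroup E] [InnerProductSpace ℂ E]

/-- `∫₀ᵗ e^{-isν} c(s) ds`. -/
def truncFourier (c : ℝ → ℂ) (t ν : ℝ) : ℂ :=
  ∫ s in (0 : ℝ)..t, Complex.exp (-(I * s * ν)) * c s

theorem continuous_truncFourier {c : ℝ → ℂ} (hc : Continuous c) (t : ℝ) :
    Continuous (truncFourier c t) := by
  unfold truncFourier
  refine intervalIntegral.continuous_parametric_intervalIntegral_of_continuous' ?_ 0 t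
  fun_prop

theorem norm_exp_neg_I_mul (s ν : ℝ) : ‖Complex.exp (-(I * s * ν))‖ = 1 := by
  rw [Complex.norm_exp]
  simp

theorem norm_truncFourier_le {c : ℝ → ℂ} {B : ℝ} (hB : ∀ s, ‖c s‖ ≤ B) (t ν : ℝ) :
    ‖truncFourier c t ν‖ ≤ B * |t| := by
  have h := intervalIntegral.norm_integral_le_of_norm_le_const (a := 0) (b := t) (C := B)
    (f := fun s : ℝ => Complex.exp (-(I * s * ν)) * c s) fun s _ => by
      rw [norm_mul, norm_exp_neg_I_mul, one_mul]
      exact hB s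
  simpa [truncFourier] using h

namespace IsSpectral

variable {h : E →ₗ.[ℂ] E} {U : ℝ → E ≃ₗᵢ[ℂ] E}

theorem memLp_truncFourier (μ : Measure ℝ) [IsFiniteMeasure μ] {c : ℝ → ℂ} (hc : Continuous c)
    {B : ℝ} (hB : ∀ s, ‖c s‖ ≤ B) (t : ℝ) : MemLp (truncFourier c t) 2 μ :=
  MemLp.of_bound (continuous_truncFourier hc t).aestronglyMeasurable (B * |t|)
    (Eventually.of_forall (norm_truncFourier_le hB t))

theorem integral_smul_apply_neg [CompleteSpace E] (H : IsSpectral h U) (g : E) {c : ℝ → ℂ}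
    (hc : Continuous c) {B : ℝ} (hB : ∀ s, ‖c s‖ ≤ B) (t : ℝ) :
    ∫ s in (0 : ℝ)..t, c s • U (-s) g = spectralApply h (truncFourier c t) g := by
  have := H.isFiniteMeasure g
  refine ext_inner_left ℂ fun w => ?_
  obtain ⟨m, hm⟩ := H.exists_isProj g w
  have hcont : Continuous fun s => c s • U (-s) g :=
    hc.smul ((H.group.continuous g).comp continuous_neg)
  have hm1 : Integrable m (spectralMeasure h g) := hm.1.integrable (by norm_num)
  have e1 : ⟪w, ∫ s in (0 : ℝ)..t, c s • U (-s) g⟫_ℂ =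
      ∫ s in (0 : ℝ)..t, ⟪w, c s • U (-s) g⟫_ℂ :=
    ((innerSL ℂ w).intervalIntegral_comp_comm (hcont.intervalIntegrable 0 t)).symm
  have e2 : ∀ s, ⟪w, c s • U (-s) g⟫_ℂ = ∫ ν : ℝ, Complex.exp (-(I * s * ν)) * c s *
      (starRingEnd ℂ) (m ν) ∂(spectralMeasure h g) := by
    intro s
    have h2 := hm.2 _ (memLp_exp (spectralMeasure h g) (-s))
    rw [H.spectralApply_exp] at h2
    rw [inner_smul_right, ← inner_conj_symm, h2, ← integral_conj, ← integral_const_mul]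
    congr 1
    ext ν
    rw [map_mul, Complex.conj_conj]
    push_cast
    ring_nf
  have e3 : ⟪w, spectralApply h (truncFourier c t) g⟫_ℂ =
      ∫ ν, truncFourier c t ν * (starRingEnd ℂ) (m ν) ∂(spectralMeasure h g) := by
    rw [← inner_conj_symm, hm.2 _ (memLp_truncFourier _ hc hB t), ← integral_conj]
    congr 1
    ext ν
    rw [map_mul, Complex.conj_conj]
  rw [e1, e3]
  simp only [e2, truncFourier, ← intervalIntegral.integral_mul_const]
  refine intervalIntegral_integral_swap ?_
  have hmc : Integrable (fun ν => (starRingEnd ℂ) (m ν)) (spectralMeasure h g) :=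
    (Complex.conjLIE.integrable_comp_iff (φ := m)).2 hm1
  have h3 : Integrable (fun p : ℝ × ℝ => (1 : ℂ) * (starRingEnd ℂ) (m p.2))
      ((volume.restrict (Set.uIoc 0 t)).prod (spectralMeasure h g)) := by
    refine Integrable.mul_prod (f := fun _ : ℝ => (1 : ℂ)) ?_ hmc
    exact (intervalIntegrable_const (μ := volume) (a := 0) (b := t)).def'
  simp only [one_mul] at h3
  refine (h3.bdd_mul (c := B) (f := fun p : ℝ × ℝ =>
    Complex.exp (-(I * p.1 * p.2)) * c p.1) ?_ ?_)
  · exact Continuous.aestronglyMeasurable (by fun_prop)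
  · refine Eventually.of_forall fun p => ?_
    rw [norm_mul, norm_exp_neg_I_mul, one_mul]
    exact hB _

theorem op_spectralApply (H : IsSpectral h U) {g : E} {k : ℝ → ℂ}
    (hk : MemLp k 2 (spectralMeasure h g)) (r : ResComb) :
    r.op h (spectralApply h k g) = spectralApply h (fun ν => r.fn ν * k ν) g := by
  have e1 : (fun ν => r.fn ν * k ν) =
      fun ν : ℝ => ∑ w ∈ r.support, r w * ((w.1 - (ν : ℂ))⁻¹ * k ν) := by
    ext ν
    rw [ResComb.fn, Finsupp.sum, Finset.sum_mul]
    exact Finset.sum_congr rfl fun w _ => by ring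
  rw [e1, H.spectralApply_fun_sum _ fun w _ => (memLp_inv_sub_mul _ hk w.2).const_mul _,
    ResComb.op, Finsupp.sum]
  refine Finset.sum_congr rfl fun w _ => ?_
  rw [H.spectralApply_fun_smul (memLp_inv_sub_mul _ hk w.2), H.resolventVec_spectralApply hk w.2]

theorem memLp_spectralApply_iff (H : IsSpectral h U) {g : E} {k n : ℝ → ℂ}
    (hk : MemLp k 2 (spectralMeasure h g)) (hn : Measurable n) :
    MemLp n 2 (spectralMeasure h (spectralApply h k g)) ↔
      MemLp (fun ν => n ν * k ν) 2 (spectralMeasure h g) := by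
  have e : eLpNorm n 2 (spectralMeasure h (spectralApply h k g)) ^ 2 =
      eLpNorm (fun ν => n ν * k ν) 2 (spectralMeasure h g) ^ 2 := by
    rw [eLpNorm_two_sq, eLpNorm_two_sq, H.spectralMeasure_spectralApply hk,
      lintegral_withDensity_eq_lintegral_mul₀ (hk.1.enorm.pow_const 2)
        (hn.enorm.pow_const 2).aemeasurable]
    simp only [Pi.mul_apply, enorm_mul, mul_pow, mul_comm]
  have e' := (ENNReal.pow_right_strictMono two_ne_zero).injective e
  refine ⟨fun h1 => ⟨hn.aestronglyMeasurable.mul hk.1, e' ▸ h1.2⟩,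
    fun h1 => ⟨hn.aestronglyMeasurable, ?_⟩⟩
  rw [e']
  exact h1.2

theorem spectralApply_spectralApply (H : IsSpectral h U) {g : E} {k n : ℝ → ℂ}
    (hk : MemLp k 2 (spectralMeasure h g)) (hn : Measurable n)
    (hnk : MemLp (fun ν => n ν * k ν) 2 (spectralMeasure h g)) :
    spectralApply h n (spectralApply h k g) = spectralApply h (fun ν => n ν * k ν) g := by
  have := H.isFiniteMeasure (spectralApply h k g)
  have hn' := (H.memLp_spectralApply_iff hk hn).2 hnk
  obtain ⟨r, -, hr⟩ := ResComb.exists_seq _ hn' one_pos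
  have l1 := H.tendsto_op hn' hr
  have hrk : ∀ j, MemLp (fun ν => (r j).fn ν * k ν) 2 (spectralMeasure h g) := fun j =>
    (H.memLp_spectralApply_iff hk (r j).continuous_fn.measurable).1 ((r j).memLp_fn _)
  refine tendsto_nhds_unique l1 ((H.tendsto_spectralApply (n' := fun j ν => (r j).fn ν * k ν)
    hnk hrk ?_).congr fun j => (H.op_spectralApply hk (r j)).symm)
  refine hr.congr fun j => (ENNReal.pow_right_strictMono two_ne_zero).injective ?_
  rw [eLpNorm_two_sq, eLpNorm_two_sq, H.spectralMeasure_spectralApply hk,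
    lintegral_withDensity_eq_lintegral_mul₀ (hk.1.enorm.pow_const 2)
      ((hn.sub (r j).continuous_fn.measurable).enorm.pow_const 2).aemeasurable]
  refine lintegral_congr fun ν => ?_
  simp only [Pi.mul_apply, Pi.sub_apply, ← sub_mul, enorm_mul, mul_pow]
  exact mul_comm _ _

end IsSpectral

/-! ### Bose distributions -/

theorem bose_nonneg {β μ ν : ℝ} (hβ : 0 < β) (hμ : μ ≤ 0) (hν : 0 ≤ ν) : 0 ≤ bose β μ ν := by
  have : 1 ≤ Real.exp (β * (ν - μ)) := 
    Real.one_le_exp (mul_nonneg hβ.le (by linarith))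
  exact inv_nonneg.2 (by linarith)

theorem bose_le {β μ ν : ℝ} (hβ : 0 < β) (hμ : μ ≤ 0) (hν : 0 < ν) : bose β μ ν ≤ (β * ν)⁻¹ := by
  have h1 := Real.add_one_le_exp (β * (ν - μ))
  have h2 : β * ν ≤ β * (ν - μ) := by gcongr; linarith
  exact inv_anti₀ (by positivity) (by linarith)

theorem measurable_bose (β μ : ℝ) : Measurable (bose β μ) := by
  unfold bose
  fun_prop

/-- The function `(𝒩(ν) + 1/2)^{1/2}`. -/
def sqrtBose (β μ ν : ℝ) : ℝ := Real.sqrt (bose β μ ν + 1 / 2)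

theorem measurable_sqrtBose (β μ : ℝ) : Measurable fun ν => (sqrtBose β μ ν : ℂ) := by
  have := measurable_bose β μ
  unfold sqrtBose
  fun_prop

/-- The finiteness of the quadratic form of `h⁻¹` at `ψ`. -/
def InvFinite (h : E →ₗ.[ℂ] E) (ψ : E) : Prop :=
  ∫⁻ ν, (ENNReal.ofReal ν)⁻¹ ∂(spectralMeasure h ψ) < ∞

theorem measurable_inv_ofReal : Measurable fun ν : ℝ => (ENNReal.ofReal ν)⁻¹ := by fun_prop

theorem InvFinite.ae_pos {h : E →ₗ.[ℂ] E} {ψ : E} (hψ : InvFinite h ψ) :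
    ∀ᵐ ν ∂(spectralMeasure h ψ), 0 < ν := by
  filter_upwards [ae_lt_top measurable_inv_ofReal hψ.ne] with ν hν
  simpa using hν

theorem InvFinite.integrable {h : E →ₗ.[ℂ] E} {ψ : E} (hψ : InvFinite h ψ) :
    Integrable (fun ν => ν⁻¹) (spectralMeasure h ψ) := by
  refine ⟨measurable_inv.aestronglyMeasurable, ?_⟩
  rw [HasFiniteIntegral, lintegral_congr_ae (g := fun ν => (ENNReal.ofReal ν)⁻¹)]
  · exact hψ
  · filter_upwards [hψ.ae_pos] with ν hν
    rw [← ENNReal.ofReal_inv_of_pos hν, Real.enorm_of_nonneg (by positivity)]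

theorem InvFinite.memLp_sqrt {h : E →ₗ.[ℂ] E} {ψ : E} (hψ : InvFinite h ψ) :
    MemLp (fun ν => ((Real.sqrt ν)⁻¹ : ℝ) : ℝ → ℂ) 2 (spectralMeasure h ψ) := by
  have hm : Measurable (fun ν => ((Real.sqrt ν)⁻¹ : ℝ) : ℝ → ℂ) := by fun_prop
  rw [memLp_two_iff_integrable_sq_norm hm.aestronglyMeasurable]
  refine hψ.integrable.congr ?_
  filter_upwards [hψ.ae_pos] with ν hν
  rw [Complex.norm_real, Real.norm_of_nonneg (by positivity), inv_pow, Real.sq_sqrt hν.le]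

theorem invFinite_of_boseDomain {h : E →ₗ.[ℂ] E} {U : ℝ → E ≃ₗᵢ[ℂ] E} (H : IsSpectral h U)
    {β : ℝ} (hβ : 0 < β) {ψ : E} (hψ : ψ ∈ boseDomain h β 0) : InvFinite h ψ := by
  have := H.isFiniteMeasure ψ
  have hb : ∀ᵐ ν ∂(spectralMeasure h ψ), (ENNReal.ofReal ν)⁻¹ ≤
      1 + ENNReal.ofReal (β * Real.exp β) * (ENNReal.ofReal (Real.exp (β * (ν - 0)) - 1))⁻¹ := by
    filter_upwards [H.ae_nonneg ψ] with ν hν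
    rw [sub_zero]
    rcases le_total 1 ν with h1 | h1
    · refine le_add_right ?_
      rw [ENNReal.inv_le_one]
      simpa using h1
    · refine le_add_left ?_
      rcases hν.eq_or_lt with rfl | h0
      · simp [ENNReal.mul_top, hβ, Real.exp_pos, mul_pos]
      have h2 : Real.exp (β * ν) - 1 ≤ β * Real.exp β * ν := by
        have h3 := Real.add_one_le_exp (-(β * ν))
        have h4 : Real.exp (β * ν) * Real.exp (-(β * ν)) = 1 := by
          rw [← Real.exp_add, add_neg_cancel, Real.exp_zero]
        have h5 : Real.exp (β * ν) ≤ Real.exp β := Real.exp_le_exp.2 (by nlinarith)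
        have h6 := mul_le_mul_of_nonneg_left h3 (Real.exp_pos (β * ν)).le
        rw [h4] at h6
        nlinarith [mul_le_mul_of_nonneg_left h5 (mul_pos hβ h0).le]
      have h7 : 0 < Real.exp (β * ν) - 1 := by
        have := Real.add_one_lt_exp (x := β * ν) (by positivity)
        nlinarith [mul_pos hβ h0]
      rw [← ENNReal.ofReal_inv_of_pos h0, ← ENNReal.ofReal_inv_of_pos h7,
        ← ENNReal.ofReal_mul (by positivity)]
      refine ENNReal.ofReal_le_ofReal ?_
      rw [inv_eq_one_div, ← div_eq_mul_inv, div_le_div_iff₀ h0 h7]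
      linarith
  refine (lintegral_mono_ae hb).trans_lt ?_
  rw [lintegral_add_left measurable_const, lintegral_const_mul' _ _ ENNReal.ofReal_ne_top,
    lintegral_const]
  have h2 : ∫⁻ ν, (ENNReal.ofReal (Real.exp (β * (ν - 0)) - 1))⁻¹ ∂(spectralMeasure h ψ) < ∞ := hψ
  exact ENNReal.add_lt_top.2 ⟨by finiteness, ENNReal.mul_lt_top ENNReal.ofReal_lt_top h2⟩

theorem InvFinite.mem_boseDomain {h : E →ₗ.[ℂ] E}
    {β μ : ℝ} (hβ : 0 < β) (hμ : μ ≤ 0) {ψ : E} (hψ : InvFinite h ψ) : ψ ∈ boseDomain h β μ := by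
  have hb : ∀ᵐ ν ∂(spectralMeasure h ψ), (ENNReal.ofReal (Real.exp (β * (ν - μ)) - 1))⁻¹ ≤
      ENNReal.ofReal β⁻¹ * (ENNReal.ofReal ν)⁻¹ := by
    filter_upwards [hψ.ae_pos] with ν hν
    have h1 := Real.add_one_le_exp (β * (ν - μ))
    have h2 : β * ν ≤ β * (ν - μ) := by gcongr; linarith
    rw [← ENNReal.ofReal_inv_of_pos hν, ← ENNReal.ofReal_mul (by positivity),
      ← mul_inv, ENNReal.ofReal_inv_of_pos (by positivity)]
    exact ENNReal.inv_le_inv.2 (ENNReal.ofReal_le_ofReal (by linarith))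
  refine (lintegral_mono_ae hb).trans_lt ?_
  rw [lintegral_const_mul' _ _ ENNReal.ofReal_ne_top]
  exact ENNReal.mul_lt_top ENNReal.ofReal_lt_top hψ

theorem InvFinite.integrable_bose {h : E →ₗ.[ℂ] E} {ψ : E} [IsFiniteMeasure (spectralMeasure h ψ)]
    (hψ : InvFinite h ψ) {β μ : ℝ} (hβ : 0 < β) (hμ : μ ≤ 0) :
    Integrable (fun ν => bose β μ ν + 1 / 2) (spectralMeasure h ψ) := by
  refine Integrable.add ?_ (integrable_const _)
  refine (hψ.integrable.const_mul β⁻¹).mono' (measurable_bose β μ).aestronglyMeasurable ?_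
  filter_upwards [hψ.ae_pos] with ν hν
  rw [Real.norm_of_nonneg (bose_nonneg hβ hμ hν.le), ← mul_inv]
  exact bose_le hβ hμ hν

theorem InvFinite.memLp_sqrtBose {h : E →ₗ.[ℂ] E} {ψ : E}
    [IsFiniteMeasure (spectralMeasure h ψ)]
    (hψ : InvFinite h ψ) {β μ : ℝ} (hβ : 0 < β) (hμ : μ ≤ 0) :
    MemLp (fun ν => (sqrtBose β μ ν : ℂ)) 2 (spectralMeasure h ψ) := by
  rw [memLp_two_iff_integrable_sq_norm (measurable_sqrtBose β μ).aestronglyMeasurable]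
  refine (hψ.integrable_bose hβ hμ).congr ?_
  filter_upwards [hψ.ae_pos] with ν hν
  have := bose_nonneg hβ hμ hν.le
  rw [Complex.norm_real, sqrtBose, Real.norm_of_nonneg (Real.sqrt_nonneg _),
    Real.sq_sqrt (by linarith)]

theorem InvFinite.boseForm_eq {h : E →ₗ.[ℂ] E} {U : ℝ → E ≃ₗᵢ[ℂ] E} (H : IsSpectral h U) {ψ : E}
    (hψ : InvFinite h ψ) {β μ : ℝ} (hβ : 0 < β) (hμ : μ ≤ 0) :
    boseForm h β μ ψ = ‖spectralApply h (fun ν => (sqrtBose β μ ν : ℂ)) ψ‖ ^ 2 := by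
  have := H.isFiniteMeasure ψ
  rw [H.norm_spectralApply_sq (hψ.memLp_sqrtBose hβ hμ), boseForm]
  refine integral_congr_ae ?_
  filter_upwards [hψ.ae_pos] with ν hν
  have := bose_nonneg hβ hμ hν.le
  rw [Complex.norm_real, sqrtBose, Real.norm_of_nonneg (Real.sqrt_nonneg _),
    Real.sq_sqrt (by linarith)]

theorem InvFinite.add {h : E →ₗ.[ℂ] E} {U : ℝ → E ≃ₗᵢ[ℂ] E} (H : IsSpectral h U) {ψ ξ : E}
    (hψ : InvFinite h ψ) (hξ : InvFinite h ξ) : InvFinite h (ψ + ξ) := by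
  refine (lintegral_mono' (H.spectralMeasure_add_le ψ ξ) le_rfl).trans_lt ?_
  simp only [lintegral_add_measure]
  unfold InvFinite at hψ hξ
  finiteness

theorem InvFinite.smul {h : E →ₗ.[ℂ] E} {U : ℝ → E ≃ₗᵢ[ℂ] E} (H : IsSpectral h U) {ψ : E}
    (hψ : InvFinite h ψ) (c : ℂ) : InvFinite h (c • ψ) := by
  rw [InvFinite, H.spectralMeasure_smul, lintegral_smul_measure]
  exact ENNReal.mul_lt_top ENNReal.ofReal_lt_top hψ

theorem InvFinite.apply {h : E →ₗ.[ℂ] E} {U : ℝ → E ≃ₗᵢ[ℂ] E} (H : IsSpectral h U) {ψ : E}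
    (hψ : InvFinite h ψ) (t : ℝ) : InvFinite h (U t ψ) := by
  rwa [InvFinite, H.spectralMeasure_apply]

theorem InvFinite.spectralApply {h : E →ₗ.[ℂ] E} {U : ℝ → E ≃ₗᵢ[ℂ] E} (H : IsSpectral h U)
    {g : E} {k : ℝ → ℂ} (hk : MemLp k 2 (spectralMeasure h g))
    (hk' : ∫⁻ ν, ‖k ν‖ₑ ^ 2 * (ENNReal.ofReal ν)⁻¹ ∂(spectralMeasure h g) < ∞) :
    InvFinite h (spectralApply h k g) := by
  rw [InvFinite, H.spectralMeasure_spectralApply hk,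
    lintegral_withDensity_eq_lintegral_mul₀ (hk.1.enorm.pow_const 2)
      measurable_inv_ofReal.aemeasurable]
  exact hk'

/-- `⟨g, h⁻¹ ψ⟩` in terms of the projection of `ψ` to the cyclic subspace of `g`. -/
theorem IsSpectral.IsProj.invForm_eq [CompleteSpace E] {h : E →ₗ.[ℂ] E} {U : ℝ → E ≃ₗᵢ[ℂ] E}
    (H : IsSpectral h U) {g ψ : E} {m : ℝ → ℂ} (hm : IsSpectral.IsProj h g ψ m)
    (hg : InvFinite h g) (hψ : InvFinite h ψ) :
    invForm h g ψ = ∫ ν : ℝ, (ν : ℂ)⁻¹ * m ν ∂(spectralMeasure h g) := by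
  rw [invForm, (hm.spectralApply H hg.memLp_sqrt hψ.memLp_sqrt).2 _ hg.memLp_sqrt]
  refine integral_congr_ae ?_
  filter_upwards [hg.ae_pos] with ν hν
  rw [Complex.conj_ofReal, ← mul_assoc, ← Complex.ofReal_mul, ← mul_inv,
    Real.mul_self_sqrt hν.le, Complex.ofReal_inv]

theorem IsSpectral.IsProj.memLp_inv_sqrt_mul [CompleteSpace E] {h : E →ₗ.[ℂ] E}
    {U : ℝ → E ≃ₗᵢ[ℂ] E} (H : IsSpectral h U) {g ψ : E} {m : ℝ → ℂ}
    (hm : IsSpectral.IsProj h g ψ m) (hg : InvFinite h g) (hψ : InvFinite h ψ) :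
    MemLp (fun ν => (((Real.sqrt ν)⁻¹ : ℝ) : ℂ) * m ν) 2 (spectralMeasure h g) :=
  (hm.spectralApply H hg.memLp_sqrt hψ.memLp_sqrt).1

end

section

/-! ### Direct sums -/

section DirectSum

variable {ι : Type} [Fintype ι] {E : ι → Type} [∀ i, NormedAddCommGroup (E i)]
  [∀ i, InnerProductSpace ℂ (E i)]

/-- The direct sum of operators. -/
def sumHam (h : ∀ i, E i →ₗ.[ℂ] E i) : PiLp 2 E →ₗ.[ℂ] PiLp 2 E where
  domain :=
    { carrier := {f | ∀ i, f i ∈ (h i).domain}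
      zero_mem' := fun i => (h i).domain.zero_mem
      add_mem' := fun ha hb i => (h i).domain.add_mem (ha i) (hb i)
      smul_mem' := fun c _ ha i => (h i).domain.smul_mem c (ha i) }
  toFun :=
    { toFun := fun f => WithLp.toLp 2 fun i => h i ⟨(f : PiLp 2 E) i, f.2 i⟩
      map_add' := fun a b => PiLp.ext (fun i =>
        (h i).map_add ⟨(a : PiLp 2 E) i, a.2 i⟩ ⟨(b : PiLp 2 E) i, b.2 i⟩)
      map_smul' := fun c a => PiLp.ext (fun i =>
        (h i).map_smul c ⟨(a : PiLp 2 E) i, a.2 i⟩) }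

variable {h : ∀ i, E i →ₗ.[ℂ] E i}

theorem mem_sumHam_graph {f ξ : PiLp 2 E} :
    (f, ξ) ∈ (sumHam h).graph ↔ ∀ i, (f i, ξ i) ∈ (h i).graph := by
  constructor
  · intro hf i
    obtain ⟨y, rfl, rfl⟩ := (LinearPMap.mem_graph_iff _).1 hf
    exact (LinearPMap.mem_graph_iff _).2 ⟨⟨(y : PiLp 2 E) i, y.2 i⟩, rfl, rfl⟩
  · intro hf
    choose y hy hy' using fun i => (LinearPMap.mem_graph_iff _).1 (hf i)
    refine (LinearPMap.mem_graph_iff _).2 ⟨⟨f, fun i => ?_⟩, rfl, ?_⟩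
    · have e : (y i : E i) = f i := hy i
      rw [← e]
      exact (y i).2
    · refine PiLp.ext (fun i => ?_)
      refine Eq.trans ?_ (hy' i)
      exact congrArg (h i) (Subtype.ext (hy i).symm)

theorem hasDerivAt_piLp {u : ℝ → PiLp 2 E} {u' : PiLp 2 E} {t : ℝ} :
    HasDerivAt u u' t ↔ ∀ i, HasDerivAt (fun s => u s i) (u' i) t := by
  have h1 := hasFDerivWithinAt_piLp (𝕜 := ℝ) (E := E) 2 (f := u)
    (f' := ContinuousLinearMap.toSpanSingleton ℝ u') (t := Set.univ) (y := t)
  simp only [hasFDerivWithinAt_univ] at h1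
  rw [hasDerivAt_iff_hasFDerivAt, h1]
  refine forall_congr' fun i => ?_
  rw [hasDerivAt_iff_hasFDerivAt]
  refine Eq.to_iff (congrArg (fun L => HasFDerivAt _ L t) ?_)
  ext
  simp

/-- The direct sum of unitary groups. -/
def sumGroup (U : ∀ i, ℝ → E i ≃ₗᵢ[ℂ] E i) (t : ℝ) : PiLp 2 E ≃ₗᵢ[ℂ] PiLp 2 E :=
  LinearIsometryEquiv.piLpCongrRight 2 fun i => U i t

theorem sumGroup_apply (U : ∀ i, ℝ → E i ≃ₗᵢ[ℂ] E i) (t : ℝ) (f : PiLp 2 E) (i : ι) :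
    sumGroup U t f i = U i t (f i) := rfl

theorem isUnitaryGroupOf_sum {U : ∀ i, ℝ → E i ≃ₗᵢ[ℂ] E i}
    (H : ∀ i, IsUnitaryGroupOf (h i) (U i)) : IsUnitaryGroupOf (sumHam h) (sumGroup U) where
  zero := by
    ext f i
    rw [sumGroup_apply, (H i).zero]
    rfl
  add s t f := PiLp.ext (fun i => (H i).add s t (f i))
  continuous f := by
    refine (PiLp.continuous_toLp 2 E).comp (continuous_pi fun i => (H i).continuous (f i))
  generator f ξ := by
    rw [mem_sumHam_graph, hasDerivAt_piLp]
    exact forall_congr' fun i => (H i).generator _ _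

theorem isSymm_sumHam (H : ∀ i, IsSymm (h i)) : IsSymm (sumHam h) := by
  intro x y
  rw [PiLp.inner_apply, PiLp.inner_apply]
  exact Finset.sum_congr rfl fun i _ => H i ⟨(x : PiLp 2 E) i, x.2 i⟩ ⟨(y : PiLp 2 E) i, y.2 i⟩

theorem resolventVec_sumHam (H : ∀ i, IsSymm (h i))
    (hsurj : ∀ i, ∀ z : ℂ, z.im ≠ 0 → ∀ ψ : E i, ∃ ξ : (h i).domain, z • (ξ : E i) - h i ξ = ψ)
    {z : ℂ} (hz : z.im ≠ 0) (ψ : PiLp 2 E) :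
    ∃ ξ : (sumHam h).domain, z • (ξ : PiLp 2 E) - sumHam h ξ = ψ ∧
      resolventVec (sumHam h) z ψ = ξ ∧ ∀ i, resolventVec (h i) z (ψ i) = (ξ : PiLp 2 E) i := by
  choose ξ hξ using fun i => hsurj i z hz (ψ i)
  have e : z • WithLp.toLp 2 (fun i => (ξ i : E i)) -
      sumHam h ⟨WithLp.toLp 2 (fun i => (ξ i : E i)), fun i => (ξ i).2⟩ = ψ :=
    PiLp.ext (fun i => hξ i)
  exact ⟨⟨WithLp.toLp 2 (fun i => (ξ i : E i)), fun i => (ξ i).2⟩, e,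
    (isSymm_sumHam H).resolventVec_eq hz e, fun i => (H i).resolventVec_eq hz (hξ i)⟩

/-- The restriction of a square-integrable function to a summand of a measure. -/
theorem memLp_summand {μ : ι → Measure ℝ} (F : Lp ℂ 2 (∑ i, μ i)) (i : ι) : MemLp F 2 (μ i) :=
  (Lp.memLp F).mono_measure (Finset.single_le_sum (f := μ) (fun _ _ => bot_le) (Finset.mem_univ i))

theorem ae_summand {μ : ι → Measure ℝ} {F F' : ℝ → ℂ} (e : F =ᵐ[∑ i, μ i] F') (i : ι) :
    F =ᵐ[μ i] F' :=
  e.filter_mono (ae_mono (Finset.single_le_sum (f := μ) (fun _ _ => bot_le) (Finset.mem_univ i)))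

/-- The direct sum of isometries from spaces of square-integrable functions. -/
def sumIsometry {μ : ι → Measure ℝ} (J : ∀ i, Lp ℂ 2 (μ i) →ₗᵢ[ℂ] E i) :
    Lp ℂ 2 (∑ i, μ i) →ₗᵢ[ℂ] PiLp 2 E where
  toFun F := WithLp.toLp 2 fun i => J i ((memLp_summand F i).toLp F)
  map_add' F F' := PiLp.ext fun i => by
    simp only [WithLp.ofLp_add, Pi.add_apply]
    rw [← map_add, ← MemLp.toLp_add]
    congr 1
    exact (MemLp.toLp_eq_toLp_iff _ _).2 (ae_summand (Lp.coeFn_add F F') i)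
  map_smul' c F := PiLp.ext fun i => by
    simp only [WithLp.ofLp_smul, Pi.smul_apply, RingHom.id_apply]
    rw [← map_smul, ← MemLp.toLp_const_smul]
    congr 1
    exact (MemLp.toLp_eq_toLp_iff _ _).2 (ae_summand (Lp.coeFn_smul c F) i)
  norm_map' F := by
    have e1 : ∀ G : PiLp 2 E, ‖G‖ ^ 2 = ∑ i, ‖G i‖ ^ 2 := fun G => PiLp.norm_sq_eq_of_L2 _ G
    refine (sq_eq_sq₀ (norm_nonneg _) (norm_nonneg _)).1 ?_
    have e2 : ‖F‖ ^ 2 = ∫ ν, ‖F ν‖ ^ 2 ∂(∑ i, μ i) := by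
      conv_lhs => rw [← Lp.toLp_coeFn F (Lp.memLp F)]
      exact norm_toLp_sq (Lp.memLp F)
    refine (e1 _).trans ?_
    rw [e2, integral_finsetSum_measure fun i _ =>
      (memLp_two_iff_integrable_sq_norm (memLp_summand F i).1).1 (memLp_summand F i)]
    refine Finset.sum_congr rfl fun i _ => ?_
    rw [← norm_toLp_sq (memLp_summand F i), ← (J i).norm_map]
    rfl

theorem sumIsometry_apply {μ : ι → Measure ℝ} (J : ∀ i, Lp ℂ 2 (μ i) →ₗᵢ[ℂ] E i)
    (F : Lp ℂ 2 (∑ i, μ i)) (i : ι) :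
    sumIsometry J F i = J i ((memLp_summand F i).toLp F) := rfl

/-- The direct sum of spectral representations. -/
def sumRep (H : ∀ i, IsSymm (h i))
    (hsurj : ∀ i, ∀ z : ℂ, z.im ≠ 0 → ∀ ψ : E i, ∃ ξ : (h i).domain, z • (ξ : E i) - h i ξ = ψ)
    {g : PiLp 2 E} (R : ∀ i, SpectralRep (h i) (g i)) : SpectralRep (sumHam h) g where
  μ := ∑ i, (R i).μ
  finite := by
    have := fun i => (R i).finite
    infer_instance
  J := sumIsometry fun i => (R i).J
  map_resolvent z hz F hF := by
    obtain ⟨ξ, -, e1, e2⟩ := resolventVec_sumHam H hsurj hz g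
    rw [e1]
    refine PiLp.ext fun i => ?_
    rw [sumIsometry_apply]
    refine ((R i).map_resolvent z hz _ ?_).trans (e2 i)
    exact (memLp_summand F i).coeFn_toLp.trans (ae_summand hF i)

theorem isSpectral_sum {U : ∀ i, ℝ → E i ≃ₗᵢ[ℂ] E i} (H : ∀ i, IsSpectral (h i) (U i)) :
    IsSpectral (sumHam h) (sumGroup U) where
  group := isUnitaryGroupOf_sum fun i => (H i).group
  symm := isSymm_sumHam fun i => (H i).symm
  surj z hz ψ := by
    obtain ⟨ξ, e, -⟩ := resolventVec_sumHam (fun i => (H i).symm) (fun i => (H i).surj) hz ψ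
    exact ⟨ξ, e⟩
  rep g := by
    choose R hR hR' using fun i => (H i).rep (g i)
    refine ⟨sumRep (fun i => (H i).symm) (fun i => (H i).surj) R, ?_, fun t F hF => ?_⟩
    · change (∑ i, (R i).μ) (Set.Iio 0) = 0
      simp [hR]
    · refine PiLp.ext (fun i => hR' i t _ ?_)
      exact (memLp_summand F i).coeFn_toLp.trans (ae_summand hF i)

variable {U : ∀ i, ℝ → E i ≃ₗᵢ[ℂ] E i}

theorem resolventVec_sumHam_apply (H : ∀ i, IsSpectral (h i) (U i)) {z : ℂ} (hz : z.im ≠ 0) (ψ : PiLp 2 E) (i : ι) :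
    resolventVec (sumHam h) z ψ i = resolventVec (h i) z (ψ i) := by
  obtain ⟨ξ, -, e1, e2⟩ := resolventVec_sumHam (fun i => (H i).symm) (fun i => (H i).surj) hz ψ
  rw [e1, e2]

theorem spectralMeasure_sumHam (H : ∀ i, IsSpectral (h i) (U i)) (g : PiLp 2 E) :
    spectralMeasure (sumHam h) g = ∑ i, spectralMeasure (h i) (g i) := by
  let R : ∀ i, SpectralRep (h i) (g i) := fun i => ((H i).nonempty_rep (g i)).some
  rw [(isSpectral_sum H).spectralMeasure_eq
    (sumRep (fun i => (H i).symm) (fun i => (H i).surj) R)]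
  exact Finset.sum_congr rfl fun i _ => ((H i).spectralMeasure_eq (R i)).symm

theorem spectralApply_sumHam_apply (H : ∀ i, IsSpectral (h i) (U i)) {g : PiLp 2 E} {n : ℝ → ℂ}
    (hn : MemLp n 2 (spectralMeasure (sumHam h) g)) (i : ι) :
    spectralApply (sumHam h) n g i = spectralApply (h i) n (g i) := by
  let R : ∀ i, SpectralRep (h i) (g i) := fun i => ((H i).nonempty_rep (g i)).some
  have hR := (isSpectral_sum H).spectralMeasure_eq
    (sumRep (fun i => (H i).symm) (fun i => (H i).surj) R)
  rw [hR] at hn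
  have hn' : MemLp n 2 (R i).μ := hn.mono_measure
    (Finset.single_le_sum (f := fun i => (R i).μ) (fun _ _ => bot_le) (Finset.mem_univ i))
  rw [← (isSpectral_sum H).J_eq_spectralApply _ hn, ← (H i).J_eq_spectralApply (R i) hn']
  change (R i).J _ = _
  refine congrArg (R i).J ?_
  exact (MemLp.toLp_eq_toLp_iff _ _).2 (ae_summand hn.coeFn_toLp i)

theorem invFinite_sumHam (H : ∀ i, IsSpectral (h i) (U i)) {g : PiLp 2 E} (hg : ∀ i, InvFinite (h i) (g i)) :
    InvFinite (sumHam h) g := by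
  rw [InvFinite, spectralMeasure_sumHam H, lintegral_finsetSum_measure]
  exact ENNReal.sum_lt_top.2 fun i _ => hg i

theorem invForm_sumHam (H : ∀ i, IsSpectral (h i) (U i)) {g ψ : PiLp 2 E} (hg : ∀ i, InvFinite (h i) (g i))
    (hψ : ∀ i, InvFinite (h i) (ψ i)) :
    invForm (sumHam h) g ψ = ∑ i, invForm (h i) (g i) (ψ i) := by
  rw [invForm, PiLp.inner_apply]
  refine Finset.sum_congr rfl fun i _ => ?_
  rw [invForm, spectralApply_sumHam_apply H (invFinite_sumHam H hg).memLp_sqrt,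
    spectralApply_sumHam_apply H (invFinite_sumHam H hψ).memLp_sqrt]

end DirectSum

end

section

/-! ### Bounded perturbations of unitary groups -/

section Perturbation

variable {E : Type} [NormedAddCommGroup E] [InnerProductSpace ℂ E]

theorem continuous_isometry_apply {U : ℝ → E ≃ₗᵢ[ℂ] E} (hU : ∀ f, Continuous fun t => U t f)
    {y : ℝ → E} (hy : Continuous y) : Continuous fun t => U t (y t) := by
  refine continuous_iff_continuousAt.2 fun t => ?_
  rw [ContinuousAt, tendsto_iff_norm_sub_tendsto_zero]
  have h1 := (tendsto_iff_norm_sub_tendsto_zero.1 (hy.tendsto t))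
  have h2 := (tendsto_iff_norm_sub_tendsto_zero.1 ((hU (y t)).tendsto t))
  have h3 := h1.add h2
  rw [add_zero] at h3
  refine squeeze_zero (fun _ => norm_nonneg _) (fun s => ?_) h3
  calc ‖U s (y s) - U t (y t)‖ = ‖U s (y s - y t) + (U s (y t) - U t (y t))‖ := by
        rw [map_sub]; abel_nf
    _ ≤ _ := (norm_add_le _ _).trans_eq (by rw [(U s).norm_map])

theorem hasDerivAt_isometry_apply {U : ℝ → E ≃ₗᵢ[ℂ] E} (hU : ∀ f, Continuous fun t => U t f)
    {y : ℝ → E} {y' w : E} {t : ℝ} (hy : HasDerivAt y y' t)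
    (hw : HasDerivAt (fun s => U s (y t)) w t) :
    HasDerivAt (fun s => U s (y s)) (w + U t y') t := by
  have h1 : HasDerivAt (fun s => U s (y s - y t)) (U t y') t := by
    rw [hasDerivAt_iff_tendsto_slope] at hy ⊢
    have h2 := tendsto_iff_norm_sub_tendsto_zero.1 hy
    have h3 := tendsto_iff_norm_sub_tendsto_zero.1 (((hU y').tendsto t).mono_left
      (nhdsWithin_le_nhds (s := {t}ᶜ)))
    have h4 := h2.add h3
    rw [add_zero] at h4
    rw [tendsto_iff_norm_sub_tendsto_zero]
    refine squeeze_zero (fun _ => norm_nonneg _) (fun s => ?_) h4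
    have e : slope (fun s => U s (y s - y t)) t s = U s (slope y t s) := by
      simp only [slope, vsub_eq_sub, sub_self, map_zero, sub_zero]
      exact (((U s).toLinearEquiv : E →ₗ[ℂ] E).map_smul_of_tower (s - t)⁻¹ (y s - y t)).symm
    calc ‖slope (fun s => U s (y s - y t)) t s - U t y'‖
        = ‖U s (slope y t s - y') + (U s y' - U t y')‖ := by rw [e, map_sub]; abel_nf
      _ ≤ _ := (norm_add_le _ _).trans_eq (by rw [(U s).norm_map])
  refine (hw.add h1).congr_of_eventuallyEq (Eventually.of_forall fun s => ?_)
  simp only [map_sub, Pi.add_apply]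
  abel

theorem abs_integral_exp_mul_abs_le {L : ℝ} (hL : 0 < L) (t : ℝ) :
    |∫ s in (0 : ℝ)..t, Real.exp (L * |s|)| ≤ Real.exp (L * |t|) / L := by
  have key : ∀ t : ℝ, 0 ≤ t → |∫ s in (0 : ℝ)..t, Real.exp (L * |s|)| ≤ Real.exp (L * t) / L := by
    intro t ht
    have e : ∫ s in (0 : ℝ)..t, Real.exp (L * |s|) = (Real.exp (L * t) - 1) / L := by
      rw [intervalIntegral.integral_congr (g := fun s => Real.exp (L * s))]
      · rw [intervalIntegral.integral_comp_mul_left (fun x => Real.exp x) hL.ne', integral_exp]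
        simp [div_eq_inv_mul]
      · intro s hs
        rw [Set.uIcc_of_le ht] at hs
        simp only [abs_of_nonneg hs.1]
    rw [e, abs_of_nonneg]
    · gcongr
      linarith
    · have := Real.one_le_exp (mul_nonneg hL.le ht)
      exact div_nonneg (by linarith) hL.le
  rcases le_total 0 t with ht | ht
  · simpa [abs_of_nonneg ht] using key t ht
  · have h1 := key (-t) (by linarith)
    have h2 := intervalIntegral.integral_comp_neg (a := 0) (b := t)
      (fun s => Real.exp (L * |s|))
    simp only [abs_neg, neg_zero] at h2
    rw [h2, intervalIntegral.integral_symm, abs_neg, abs_of_nonpos ht]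
    exact h1

variable [CompleteSpace E]

/-- A linear evolution equation with a bounded, strongly continuous generator has a global
solution. -/
theorem exists_solution (T : ℝ → E → E) {K : ℝ} (hK : 0 ≤ K)
    (hlip : ∀ s x y, ‖T s x - T s y‖ ≤ K * ‖x - y‖) (h0 : ∀ s, T s 0 = 0)
    (hcont : ∀ y : ℝ → E, Continuous y → Continuous fun s => T s (y s)) (f : E) :
    ∃ u : ℝ → E, u 0 = f ∧ ∀ t, HasDerivAt u (T t (u t)) t := by
  set L : ℝ := 2 * K + 1 with hL
  have hL0 : 0 < L := by positivity
  have hc : ∀ v : BoundedContinuousFunction ℝ E, Continuous fun s => T s (Real.exp (L * |s|) • v s) :=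
    fun v => hcont _ (by fun_prop)
  have hbd : ∀ (v v' : BoundedContinuousFunction ℝ E) (t : ℝ),
      ‖(∫ s in (0 : ℝ)..t, T s (Real.exp (L * |s|) • v s)) -
        ∫ s in (0 : ℝ)..t, T s (Real.exp (L * |s|) • v' s)‖ ≤
        (K / L * dist v v') * Real.exp (L * |t|) := by
    intro v v' t
    rw [← intervalIntegral.integral_sub ((hc v).intervalIntegrable _ _)
      ((hc v').intervalIntegrable _ _)]
    have hi : IntervalIntegrable (fun s => K * dist v v' * Real.exp (L * |s|)) volume 0 t :=
      Continuous.intervalIntegrable (by fun_prop) _ _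
    refine (intervalIntegral.norm_integral_le_abs_of_norm_le (Eventually.of_forall fun s => ?_)
      hi).trans ?_
    · refine (hlip s _ _).trans ?_
      rw [← smul_sub, norm_smul, Real.norm_of_nonneg (Real.exp_pos _).le, mul_assoc]
      refine mul_le_mul_of_nonneg_left ?_ hK
      rw [mul_comm]
      gcongr
      rw [← dist_eq_norm]
      exact BoundedContinuousFunction.dist_coe_le_dist s
    · rw [intervalIntegral.integral_const_mul, abs_mul, abs_of_nonneg (by positivity)]
      refine (mul_le_mul_of_nonneg_left (abs_integral_exp_mul_abs_le hL0 t) (by positivity)).trans_eq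
        ?_
      ring
  have hz : ∀ t : ℝ, ∫ s in (0 : ℝ)..t, T s (Real.exp (L * |s|) •
      (0 : BoundedContinuousFunction ℝ E) s) = 0 := by
    intro t
    simp [h0]
  have hΦ : ∀ (v : BoundedContinuousFunction ℝ E) (t : ℝ), ‖Real.exp (-(L * |t|)) •
      (f + ∫ s in (0 : ℝ)..t, T s (Real.exp (L * |s|) • v s))‖ ≤ ‖f‖ + K / L * ‖v‖ := by
    intro v t
    have h1 := hbd v 0 t
    rw [hz, sub_zero, dist_zero_right] at h1
    have h2 : Real.exp (-(L * |t|)) * Real.exp (L * |t|) = 1 := by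
      rw [← Real.exp_add, neg_add_cancel, Real.exp_zero]
    have h3 : Real.exp (-(L * |t|)) ≤ 1 := Real.exp_le_one_iff.2 (by
      have := mul_nonneg hL0.le (abs_nonneg t)
      linarith)
    rw [norm_smul, Real.norm_of_nonneg (Real.exp_pos _).le]
    calc _ ≤ Real.exp (-(L * |t|)) * (‖f‖ + K / L * ‖v‖ * Real.exp (L * |t|)) := by
          gcongr
          exact (norm_add_le _ _).trans (by gcongr)
      _ = Real.exp (-(L * |t|)) * ‖f‖ + K / L * ‖v‖ := by
          linear_combination (K / L * ‖v‖) * h2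
      _ ≤ _ := by
          gcongr
          exact mul_le_of_le_one_left (norm_nonneg _) h3
  let Φ : BoundedContinuousFunction ℝ E → BoundedContinuousFunction ℝ E := fun v =>
    BoundedContinuousFunction.ofNormedAddCommGroup (fun t => Real.exp (-(L * |t|)) •
      (f + ∫ s in (0 : ℝ)..t, T s (Real.exp (L * |s|) • v s)))
      (by
        have := intervalIntegral.continuous_primitive
          (fun a b => (hc v).intervalIntegrable a b) 0 (μ := volume)
        fun_prop) _ (hΦ v)
  have hcontr : ContractingWith (1 / 2) Φ := by
    refine ⟨by rw [← NNReal.coe_lt_coe]; norm_num, LipschitzWith.of_dist_le_mul fun v v' => ?_⟩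
    refine (BoundedContinuousFunction.dist_le (by positivity)).2 fun t => ?_
    have h1 := hbd v v' t
    have h2 : Real.exp (-(L * |t|)) * Real.exp (L * |t|) = 1 := by
      rw [← Real.exp_add, neg_add_cancel, Real.exp_zero]
    change dist (Real.exp (-(L * |t|)) • (f + _)) (Real.exp (-(L * |t|)) • (f + _)) ≤ _
    rw [dist_eq_norm, ← smul_sub, add_sub_add_left_eq_sub, norm_smul,
      Real.norm_of_nonneg (Real.exp_pos _).le]
    calc _ ≤ Real.exp (-(L * |t|)) * ((K / L * dist v v') * Real.exp (L * |t|)) := by gcongr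
      _ = K / L * dist v v' := by linear_combination (K / L * dist v v') * h2
      _ ≤ _ := by
        gcongr
        rw [div_le_iff₀ hL0]
        push_cast
        linarith
  have hfix := hcontr.fixedPoint_isFixedPt
  set v := hcontr.fixedPoint Φ
  have hv : ∀ t, Real.exp (L * |t|) • v t = f + ∫ s in (0 : ℝ)..t, T s (Real.exp (L * |s|) • v s) := by
    intro t
    have h1 : Real.exp (-(L * |t|)) • (f + ∫ s in (0 : ℝ)..t, T s (Real.exp (L * |s|) • v s)) =
        v t := congrArg (fun w : BoundedContinuousFunction ℝ E => w t) hfix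
    conv_lhs => rw [← h1]
    rw [smul_smul, ← Real.exp_add, add_neg_cancel, Real.exp_zero, one_smul]
  refine ⟨fun t => Real.exp (L * |t|) • v t, ?_, fun t => ?_⟩
  · simp only [hv 0, intervalIntegral.integral_same, add_zero]
  · have h1 := (intervalIntegral.integral_hasDerivAt_right ((hc v).intervalIntegrable 0 t)
      (hc v).stronglyMeasurable.stronglyMeasurableAtFilter (hc v).continuousAt).const_add f
    exact h1.congr_of_eventuallyEq (Eventually.of_forall hv)

section

variable {U : ℝ → E ≃ₗᵢ[ℂ] E} {V : E →L[ℂ] E} {h : E →ₗ.[ℂ] E}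

theorem norm_eq_of_hasDerivAt_symm {T : ℝ → E → E} (hT : ∀ s x, ⟪T s x, x⟫_ℂ = ⟪x, T s x⟫_ℂ)
    {u : ℝ → E} (hu : ∀ t, HasDerivAt u (I • T t (u t)) t) (t : ℝ) : ‖u t‖ = ‖u 0‖ := by
  have h1 : ∀ t, HasDerivAt (fun s => ⟪u s, u s⟫_ℂ) 0 t := by
    intro t
    have h2 := (hu t).inner ℂ (hu t)
    have e : ⟪u t, I • T t (u t)⟫_ℂ + ⟪I • T t (u t), u t⟫_ℂ = 0 := by
      rw [inner_smul_left, inner_smul_right, hT, Complex.conj_I]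
      ring
    rwa [e] at h2
  have h3 := is_const_of_deriv_eq_zero (fun t => (h1 t).differentiableAt)
    (fun t => (h1 t).deriv) t 0
  simp only [inner_self_eq_norm_sq_to_K] at h3
  have h4 : ‖u t‖ ^ 2 = ‖u 0‖ ^ 2 := by exact_mod_cast h3
  exact (sq_eq_sq₀ (norm_nonneg _) (norm_nonneg _)).1 h4

/-- A bounded symmetric perturbation of the generator of a unitary group generates a unitary
group. -/
theorem exists_isUnitaryGroupOf_perturbation (hU0 : U 0 = LinearIsometryEquiv.refl ℂ E)
    (hadd : ∀ s t f, U (s + t) f = U s (U t f)) (hU : ∀ f, Continuous fun t => U t f)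
    (hV : ∀ x y, ⟪V x, y⟫_ℂ = ⟪x, V y⟫_ℂ)
    (hh : ∀ f ξ, (f, ξ) ∈ h.graph ↔ HasDerivAt (fun t => U t f) (I • (ξ - V f)) 0) :
    ∃ Z, IsUnitaryGroupOf h Z := by
  have hneg : ∀ t f, U (-t) (U t f) = f := fun t f => by
    rw [← hadd, neg_add_cancel, hU0]
    rfl
  have hneg' : ∀ t f, U t (U (-t) f) = f := fun t f => by
    rw [← hadd, add_neg_cancel, hU0]
    rfl
  have hinner : ∀ t x y, ⟪U t x, y⟫_ℂ = ⟪x, U (-t) y⟫_ℂ := fun t x y => by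
    rw [← (U t).inner_map_map x, hneg']
  have hUneg : ∀ f, Continuous fun t => U (-t) f := fun f => (hU f).comp continuous_neg
  let T : ℝ → E → E := fun s x => U (-s) (V (U s x))
  have hTadd : ∀ s x y, T s (x + y) = T s x + T s y := fun s x y => by simp [T]
  have hTsmul : ∀ s (c : ℂ) x, T s (c • x) = c • T s x := fun s c x => by simp [T]
  have hTsub : ∀ s x y, T s (x - y) = T s x - T s y := fun s x y => by simp [T]
  have hTsymm : ∀ s x, ⟪T s x, x⟫_ℂ = ⟪x, T s x⟫_ℂ := fun s x => by
    simp only [T]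
    rw [hinner, neg_neg, hV, hinner]
  have hTcont : ∀ y : ℝ → E, Continuous y → Continuous fun s => T s (y s) := fun y hy =>
    continuous_isometry_apply hUneg (V.continuous.comp (continuous_isometry_apply hU hy))
  have hTnorm : ∀ s x, ‖T s x‖ ≤ ‖V‖ * ‖x‖ := fun s x => by
    simp only [T, (U (-s)).norm_map]
    exact (V.le_opNorm _).trans_eq (by rw [(U s).norm_map])
  choose u hu0 hu using fun f => exists_solution (fun s x => I • T s x) (norm_nonneg V)
    (fun s x y => by
      rw [← smul_sub, ← hTsub, norm_smul, Complex.norm_I, one_mul]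
      exact hTnorm s _)
    (fun s => by simp [T]) (fun y hy => (hTcont y hy).const_smul I) f
  have huniq : ∀ (f : E) (y : ℝ → E), y 0 = f → (∀ t, HasDerivAt y (I • T t (y t)) t) →
      ∀ t, y t = u f t := by
    intro f y hy0 hy t
    have h1 := norm_eq_of_hasDerivAt_symm (u := fun t => y t - u f t) hTsymm (fun t => by
      have := (hy t).sub (hu f t)
      rw [← smul_sub, ← hTsub] at this
      exact this) t
    simp only [hy0, hu0, sub_self, norm_zero] at h1
    exact sub_eq_zero.1 (norm_eq_zero.1 h1)
  let Z : ℝ → E → E := fun t f => U t (u f t)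
  have hZadd : ∀ s t f, Z (s + t) f = Z s (Z t f) := by
    intro s t f
    have h1 := huniq (Z t f) (fun s => U t (u f (s + t))) (by simp [Z]) (fun s => by
      have h2 := IsUnitaryGroupOf.hasDerivAt_apply (U t) ((hu f (s + t)).comp_add_const s t)
      convert h2 using 1
      simp only [T, map_smul]
      rw [← hadd s t, ← hadd t]
      congr 3
      ring) s
    simp only [Z]
    rw [← h1, ← hadd]
  have hZ0 : ∀ f, Z 0 f = f := fun f => by
    simp only [Z, hu0, hU0]
    rfl
  have hZlin : ∀ t, ∃ A : E →ₗᵢ[ℂ] E, ∀ f, A f = Z t f := by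
    intro t
    refine ⟨⟨⟨⟨Z t, fun f f' => ?_⟩, fun c f => ?_⟩, fun f => ?_⟩, fun f => rfl⟩
    · simp only [Z]
      rw [← map_add, ← huniq (f + f') (fun t => u f t + u f' t) (by simp [hu0])
        (fun t => by rw [hTadd, smul_add]; exact (hu f t).add (hu f' t))]
    · simp only [Z, RingHom.id_apply]
      rw [← map_smul, ← huniq (c • f) (fun t => c • u f t) (by simp [hu0])
        (fun t => by rw [hTsmul, smul_comm]; exact (hu f t).const_smul c)]
    · change ‖U t (u f t)‖ = ‖f‖
      rw [(U t).norm_map, norm_eq_of_hasDerivAt_symm hTsymm (hu f), hu0]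
  choose A hA using hZlin
  let B : ℝ → E ≃ₗᵢ[ℂ] E := fun t => LinearIsometryEquiv.ofSurjective (A t) fun f =>
    ⟨Z (-t) f, by rw [hA, ← hZadd, add_neg_cancel, hZ0]⟩
  have hB : ∀ t f, B t f = U t (u f t) := fun t f => hA t f
  refine ⟨B, ?_, ?_, ?_, ?_⟩
  · ext f
    exact (hA 0 f).trans (hZ0 f)
  · intro s t f
    rw [hB, hB, hB]
    exact hZadd s t f
  · intro f
    simp only [hB]
    exact continuous_isometry_apply hU
      (continuous_iff_continuousAt.2 fun t => (hu f t).continuousAt)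
  · intro f ξ
    rw [hh]
    have h1 : HasDerivAt (fun t => U t (u f t - f)) (I • V f) 0 := by
      have h2 := hasDerivAt_isometry_apply (w := 0) hU ((hu f 0).sub_const f) (by
        simp only [hu0, sub_self, map_zero]
        exact hasDerivAt_const _ _)
      convert h2 using 1
      simp [T, hu0, hU0]
    have e : (fun t => U t f) = fun t => B t f - U t (u f t - f) := by
      ext t
      rw [hB, map_sub]
      abel
    have e' : (fun t => B t f) = fun t => U t f + U t (u f t - f) := by
      ext t
      rw [hB, map_sub]
      abel
    constructor
    · intro h3
      rw [e']
      have h4 := h3.add h1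
      rw [← smul_add, sub_add_cancel] at h4
      exact h4
    · intro h3
      rw [e]
      have h4 := h3.sub h1
      rw [← smul_sub] at h4
      exact h4

/-- Duhamel's formula. -/
theorem IsUnitaryGroupOf.duhamel {Z : ℝ → E ≃ₗᵢ[ℂ] E} (HZ : IsUnitaryGroupOf h Z)
    (hdense : Dense (h.domain : Set E)) (hU0 : U 0 = LinearIsometryEquiv.refl ℂ E)
    (hadd : ∀ s t f, U (s + t) f = U s (U t f)) (hU : ∀ f, Continuous fun t => U t f)
    (hh : ∀ f ξ, (f, ξ) ∈ h.graph → HasDerivAt (fun t => U t f) (I • (ξ - V f)) 0)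
    (f : E) (t : ℝ) :
    U (-t) (Z t f) = f + I • ∫ s in (0 : ℝ)..t, U (-s) (V (Z s f)) := by
  have hUneg : ∀ f, Continuous fun t => U (-t) f := fun f => (hU f).comp continuous_neg
  have hcont : ∀ f, Continuous fun s => U (-s) (V (Z s f)) := fun f =>
    continuous_isometry_apply hUneg (V.continuous.comp (HZ.continuous f))
  have hdom : ∀ f ∈ h.domain,
      U (-t) (Z t f) = f + I • ∫ s in (0 : ℝ)..t, U (-s) (V (Z s f)) := by
    intro f hf
    have hd : ∀ s, HasDerivAt (fun s => U (-s) (Z s f)) (I • U (-s) (V (Z s f))) s := by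
      intro s
      have hg := h.mem_graph ⟨f, hf⟩
      have hgs := HZ.map_mem_graph hg s
      have h1 := HZ.hasDerivAt hg s
      have h2 : HasDerivAt (fun r => U (-r) (Z s f))
          (-(U (-s) (I • (Z s (h ⟨f, hf⟩) - V (Z s f))))) s := by
        have h3 := hh _ _ hgs
        have h4 : HasDerivAt (fun r : ℝ => -r + s) (-1) s := (hasDerivAt_neg s).add_const s
        have h5 : HasDerivAt (fun r => U r (Z s f))
            (I • (Z s (h ⟨f, hf⟩) - V (Z s f))) (-s + s) := by
          rwa [neg_add_cancel]
        have h6 := IsUnitaryGroupOf.hasDerivAt_apply (U (-s))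
          (HasDerivAt.scomp (h := fun r : ℝ => -r + s) s h5 h4)
        simp only [Function.comp_def, ← hadd, neg_one_smul, map_neg] at h6
        convert h6 using 4
        ring
      have h7 := hasDerivAt_isometry_apply hUneg h1 h2
      convert h7 using 1
      simp only [map_smul, map_sub, smul_sub]
      abel
    have h8 := intervalIntegral.integral_eq_sub_of_hasDerivAt (a := 0) (b := t)
      (fun s _ => hd s) (((hcont f).const_smul I).intervalIntegrable _ _)
    rw [intervalIntegral.integral_smul] at h8
    rw [h8, neg_zero, hU0, HZ.zero]
    simp
  have hint : ∀ f f', ‖(∫ s in (0 : ℝ)..t, U (-s) (V (Z s f))) -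
      ∫ s in (0 : ℝ)..t, U (-s) (V (Z s f'))‖ ≤ ‖V‖ * |t| * ‖f - f'‖ := by
    intro f f'
    rw [← intervalIntegral.integral_sub ((hcont f).intervalIntegrable _ _)
      ((hcont f').intervalIntegrable _ _)]
    have h1 := intervalIntegral.norm_integral_le_of_norm_le_const (a := 0) (b := t)
      (C := ‖V‖ * ‖f - f'‖) (f := fun s => U (-s) (V (Z s f)) - U (-s) (V (Z s f')))
      fun s _ => by
        rw [← map_sub, ← map_sub, ← map_sub, (U (-s)).norm_map]
        exact (V.le_opNorm _).trans_eq (by rw [(Z s).norm_map])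
    rw [sub_zero] at h1
    exact h1.trans_eq (by ring)
  have hc1 : Continuous fun f => U (-t) (Z t f) := (U (-t)).continuous.comp (Z t).continuous
  have hc2 : Continuous fun f => ∫ s in (0 : ℝ)..t, U (-s) (V (Z s f)) :=
    (LipschitzWith.of_dist_le_mul (K := ⟨‖V‖ * |t|, by positivity⟩) fun f f' => by
      rw [dist_eq_norm, dist_eq_norm]
      exact hint f f').continuous
  exact congrFun (Continuous.ext_on hdense hc1 (continuous_id.add (hc2.const_smul I))
    hdom) f

end

end Perturbation

theorem IsSpectral.dense_domain {E : Type} [NormedAddCommGroup E] [InnerProductSpace ℂ E]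
    [CompleteSpace E] {h : E →ₗ.[ℂ] E} {U : ℝ → E ≃ₗᵢ[ℂ] E} (H : IsSpectral h U) :
    Dense (h.domain : Set E) := by
  rw [Submodule.dense_iff_topologicalClosure_eq_top, Submodule.topologicalClosure_eq_top_iff,
    Submodule.eq_bot_iff]
  intro w hw
  have hI : I.im ≠ 0 := by simp
  have hI' : ((starRingEnd ℂ) I).im ≠ 0 := by simp
  have h1 : ∀ ψ, ⟪resolventVec h ((starRingEnd ℂ) I) w, ψ⟫_ℂ = 0 := by
    intro ψ
    rw [← H.inner_resolventVec hI]
    obtain ⟨a, ha, -⟩ := H.exists_resolvent hI ψ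
    rw [← ha]
    exact Submodule.inner_left_of_mem_orthogonal a.2 hw
  obtain ⟨b, hb, hb'⟩ := H.exists_resolvent hI' w
  have h2 : (b : E) = 0 := by
    rw [hb]
    exact inner_self_eq_zero.1 (h1 _)
  have h3 : b = 0 := Subtype.ext h2
  rw [← hb', h3]
  simp

end

section

/-! ### A level coupled to a reservoir -/

section Coupled

variable {E : Type} [NormedAddCommGroup E] [InnerProductSpace ℂ E]

/-- `h (c, ψ) = (Ω c + λ ⟨g, ψ⟩, h₀ ψ + λ c g)`. -/
def IsCoupled (h0 : E →ₗ.[ℂ] E) (g : E) (Ω lam : ℝ)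
    (h : WithLp 2 (ℂ × E) →ₗ.[ℂ] WithLp 2 (ℂ × E)) : Prop :=
  ∀ f ξ, (f, ξ) ∈ h.graph ↔ (f.snd, ξ.snd - ((lam : ℂ) * f.fst) • g) ∈ h0.graph ∧
    ξ.fst = Ω * f.fst + lam * ⟪g, f.snd⟫_ℂ

theorem hasDerivAt_withLp_prod {u : ℝ → WithLp 2 (ℂ × E)} {u' : WithLp 2 (ℂ × E)} {t : ℝ} :
    HasDerivAt u u' t ↔
      HasDerivAt (fun s => (u s).fst) u'.fst t ∧ HasDerivAt (fun s => (u s).snd) u'.snd t := by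
  constructor
  · intro h
    exact ⟨((WithLp.fstL 2 ℝ ℂ E).hasFDerivAt (x := u t)).comp_hasDerivAt t h,
      ((WithLp.sndL 2 ℝ ℂ E).hasFDerivAt (x := u t)).comp_hasDerivAt t h⟩
  · rintro ⟨h1, h2⟩
    exact ((WithLp.prodContinuousLinearEquiv 2 ℝ ℂ E).symm.toContinuousLinearMap.hasFDerivAt
      (x := ((u t).fst, (u t).snd))).comp_hasDerivAt t (h1.prodMk h2)

/-- The unitary group `(c, ψ) ↦ (c, U(t) ψ)`. -/
def freeGroup (U : ℝ → E ≃ₗᵢ[ℂ] E) (t : ℝ) : WithLp 2 (ℂ × E) ≃ₗᵢ[ℂ] WithLp 2 (ℂ × E) where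
  toLinearEquiv := WithLp.linearEquiv 2 ℂ (ℂ × E) ≪≫ₗ
    (LinearEquiv.prodCongr (LinearEquiv.refl ℂ ℂ) (U t).toLinearEquiv) ≪≫ₗ
    (WithLp.linearEquiv 2 ℂ (ℂ × E)).symm
  norm_map' f := by
    refine (sq_eq_sq₀ (norm_nonneg _) (norm_nonneg _)).1 ?_
    rw [WithLp.prod_norm_sq_eq_of_L2, WithLp.prod_norm_sq_eq_of_L2, ← (U t).norm_map f.snd]
    rfl

theorem freeGroup_fst (U : ℝ → E ≃ₗᵢ[ℂ] E) (t : ℝ) (f : WithLp 2 (ℂ × E)) :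
    (freeGroup U t f).fst = f.fst := rfl

theorem freeGroup_snd (U : ℝ → E ≃ₗᵢ[ℂ] E) (t : ℝ) (f : WithLp 2 (ℂ × E)) :
    (freeGroup U t f).snd = U t f.snd := rfl

theorem withLp_prod_ext {f f' : WithLp 2 (ℂ × E)} (h1 : f.fst = f'.fst) (h2 : f.snd = f'.snd) :
    f = f' :=
  WithLp.ofLp_injective 2 (Prod.ext h1 h2)

/-- The operator `(c, ψ) ↦ (Ω c + λ ⟨g, ψ⟩, λ c g)`. -/
def couplingOp (g : E) (Ω lam : ℝ) : WithLp 2 (ℂ × E) →L[ℂ] WithLp 2 (ℂ × E) :=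
  ((WithLp.prodContinuousLinearEquiv 2 ℂ ℂ E).symm : (ℂ × E) →L[ℂ] WithLp 2 (ℂ × E)) ∘L
    (((Ω : ℂ) • WithLp.fstL 2 ℂ ℂ E + (lam : ℂ) • (innerSL ℂ g ∘L WithLp.sndL 2 ℂ ℂ E)).prod
      (((lam : ℂ) • WithLp.fstL 2 ℂ ℂ E).smulRight g))

theorem couplingOp_fst (g : E) (Ω lam : ℝ) (f : WithLp 2 (ℂ × E)) :
    (couplingOp g Ω lam f).fst = Ω * f.fst + lam * ⟪g, f.snd⟫_ℂ := rfl

theorem couplingOp_snd (g : E) (Ω lam : ℝ) (f : WithLp 2 (ℂ × E)) :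
    (couplingOp g Ω lam f).snd = ((lam : ℂ) * f.fst) • g := rfl

theorem inner_couplingOp (g : E) (Ω lam : ℝ) (x y : WithLp 2 (ℂ × E)) :
    ⟪couplingOp g Ω lam x, y⟫_ℂ = ⟪x, couplingOp g Ω lam y⟫_ℂ := by
  rw [WithLp.prod_inner_apply, WithLp.prod_inner_apply]
  simp only [WithLp.ofLp_fst, WithLp.ofLp_snd, couplingOp_fst, couplingOp_snd, inner_smul_left,
    inner_smul_right, RCLike.inner_apply, map_add, map_mul, Complex.conj_ofReal, inner_conj_symm]
  ring

variable {h0 : E →ₗ.[ℂ] E} {U : ℝ → E ≃ₗᵢ[ℂ] E} {g : E} {Ω lam : ℝ}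
  {h : WithLp 2 (ℂ × E) →ₗ.[ℂ] WithLp 2 (ℂ × E)}

theorem IsCoupled.mem_graph_iff (hh : IsCoupled h0 g Ω lam h) (H : IsUnitaryGroupOf h0 U)
    (f ξ : WithLp 2 (ℂ × E)) : (f, ξ) ∈ h.graph ↔ HasDerivAt (fun t => freeGroup U t f)
      (I • (ξ - couplingOp g Ω lam f)) 0 := by
  rw [hh, hasDerivAt_withLp_prod, H.generator]
  simp only [freeGroup_fst, freeGroup_snd, WithLp.smul_fst, WithLp.smul_snd, WithLp.sub_fst,
    WithLp.sub_snd, couplingOp_fst, couplingOp_snd]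
  rw [and_comm]
  refine and_congr_left fun _ => ?_
  constructor
  · intro e
    rw [e, sub_self, smul_zero]
    exact hasDerivAt_const _ _
  · intro e
    have e' := e.unique (hasDerivAt_const _ _)
    rw [smul_eq_zero] at e'
    exact sub_eq_zero.1 (e'.resolve_left Complex.I_ne_zero)

theorem freeGroup_zero (H : IsUnitaryGroupOf h0 U) :
    freeGroup U 0 = LinearIsometryEquiv.refl ℂ (WithLp 2 (ℂ × E)) := by
  refine LinearIsometryEquiv.ext fun f => withLp_prod_ext rfl ?_
  rw [freeGroup_snd, H.zero]
  rfl

theorem freeGroup_add (H : IsUnitaryGroupOf h0 U) (s t : ℝ) (f : WithLp 2 (ℂ × E)) :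
    freeGroup U (s + t) f = freeGroup U s (freeGroup U t f) :=
  withLp_prod_ext rfl (H.add s t f.snd)

theorem continuous_freeGroup (H : IsUnitaryGroupOf h0 U) (f : WithLp 2 (ℂ × E)) :
    Continuous fun t => freeGroup U t f :=
  (WithLp.prod_continuous_toLp 2 ℂ E).comp (continuous_const.prodMk (H.continuous f.snd))

theorem IsCoupled.exists_group [CompleteSpace E] (hh : IsCoupled h0 g Ω lam h)
    (H : IsUnitaryGroupOf h0 U) : ∃ Z, IsUnitaryGroupOf h Z :=
  exists_isUnitaryGroupOf_perturbation (freeGroup_zero H) (freeGroup_add H)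
    (continuous_freeGroup H) (inner_couplingOp g Ω lam) (hh.mem_graph_iff H)

theorem IsCoupled.isUnitaryGroupOf [CompleteSpace E] (hh : IsCoupled h0 g Ω lam h)
    (H : IsUnitaryGroupOf h0 U) : IsUnitaryGroupOf h (unitaryGroup h) := by
  have h1 := hh.exists_group H
  rw [unitaryGroup, dif_pos h1]
  exact h1.choose_spec

theorem IsCoupled.mem_domain_iff (hh : IsCoupled h0 g Ω lam h) (f : WithLp 2 (ℂ × E)) :
    f ∈ h.domain ↔ f.snd ∈ h0.domain := by
  constructor
  · intro hf
    exact LinearPMap.mem_domain_of_mem_graph ((hh _ _).1 (h.mem_graph ⟨f, hf⟩)).1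
  · intro hf
    refine LinearPMap.mem_domain_of_mem_graph (y := WithLp.toLp 2
      ((Ω : ℂ) * f.fst + lam * ⟪g, f.snd⟫_ℂ, h0 ⟨f.snd, hf⟩ + ((lam : ℂ) * f.fst) • g))
      ((hh _ _).2 ⟨?_, rfl⟩)
    have h1 := h0.mem_graph ⟨f.snd, hf⟩
    simpa using h1

theorem IsCoupled.dense_domain [CompleteSpace E] (hh : IsCoupled h0 g Ω lam h)
    (H : IsSpectral h0 U) : Dense (h.domain : Set (WithLp 2 (ℂ × E))) := by
  have h1 := (dense_univ (X := ℂ)).prod H.dense_domain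
  have h2 := (WithLp.prodContinuousLinearEquiv 2 ℂ ℂ E).symm.surjective.denseRange.dense_image
    (WithLp.prodContinuousLinearEquiv 2 ℂ ℂ E).symm.continuous h1
  refine h2.mono ?_
  rintro _ ⟨⟨c, ψ⟩, ⟨-, hψ⟩, rfl⟩
  exact (hh.mem_domain_iff _).2 hψ

section

variable [CompleteSpace E] {Z : ℝ → WithLp 2 (ℂ × E) ≃ₗᵢ[ℂ] WithLp 2 (ℂ × E)}

theorem norm_fst_le (f : WithLp 2 (ℂ × E)) : ‖f.fst‖ ≤ ‖f‖ := by
  refine (sq_le_sq₀ (norm_nonneg _) (norm_nonneg _)).1 ?_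
  rw [WithLp.prod_norm_sq_eq_of_L2]
  exact le_add_of_nonneg_right (sq_nonneg _)

theorem norm_snd_le (f : WithLp 2 (ℂ × E)) : ‖f.snd‖ ≤ ‖f‖ := by
  refine (sq_le_sq₀ (norm_nonneg _) (norm_nonneg _)).1 ?_
  rw [WithLp.prod_norm_sq_eq_of_L2]
  exact le_add_of_nonneg_left (sq_nonneg _)

/-- The amplitude of the level. -/
def amp (Z : ℝ → WithLp 2 (ℂ × E) ≃ₗᵢ[ℂ] WithLp 2 (ℂ × E)) (f : WithLp 2 (ℂ × E)) (t : ℝ) : ℂ :=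
  (Z t f).fst

theorem norm_amp_le (f : WithLp 2 (ℂ × E)) (t : ℝ) : ‖amp Z f t‖ ≤ ‖f‖ :=
  (norm_fst_le _).trans_eq ((Z t).norm_map f)

theorem continuous_amp (HZ : IsUnitaryGroupOf h Z) (f : WithLp 2 (ℂ × E)) :
    Continuous (amp Z f) :=
  (WithLp.fstL 2 ℂ ℂ E).continuous.comp (HZ.continuous f)

theorem amp_zero (HZ : IsUnitaryGroupOf h Z) (f : WithLp 2 (ℂ × E)) : amp Z f 0 = f.fst := by
  rw [amp, HZ.zero]
  rfl

theorem amp_sub (f f' : WithLp 2 (ℂ × E)) (t : ℝ) : amp Z (f - f') t = amp Z f t - amp Z f' t := by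
  simp [amp]

theorem IsCoupled.duhamel (hh : IsCoupled h0 g Ω lam h) (H : IsSpectral h0 U)
    (HZ : IsUnitaryGroupOf h Z) (f : WithLp 2 (ℂ × E)) (t : ℝ) :
    freeGroup U (-t) (Z t f) = f + I • ∫ s in (0 : ℝ)..t,
      freeGroup U (-s) (couplingOp g Ω lam (Z s f)) :=
  HZ.duhamel (hh.dense_domain H) (freeGroup_zero H.group) (freeGroup_add H.group)
    (continuous_freeGroup H.group) (fun f ξ hf => (hh.mem_graph_iff H.group f ξ).1 hf) f t

theorem continuous_duhamel (H : IsSpectral h0 U)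
    (HZ : IsUnitaryGroupOf h Z) (f : WithLp 2 (ℂ × E)) :
    Continuous fun s => freeGroup U (-s) (couplingOp g Ω lam (Z s f)) :=
  continuous_isometry_apply (U := fun s => freeGroup U (-s))
    (fun f => (continuous_freeGroup H.group f).comp continuous_neg)
    ((couplingOp g Ω lam).continuous.comp (HZ.continuous f))

/-- The reservoir component of the coupled evolution. -/
theorem IsCoupled.snd_apply (hh : IsCoupled h0 g Ω lam h) (H : IsSpectral h0 U)
    (HZ : IsUnitaryGroupOf h Z) (f : WithLp 2 (ℂ × E)) (t : ℝ) :
    (Z t f).snd = U t (f.snd + (I * lam) •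
      spectralApply h0 (truncFourier (amp Z f) t) g) := by
  have h1 := congrArg (fun x : WithLp 2 (ℂ × E) => U t x.snd) (hh.duhamel H HZ f t)
  simp only [freeGroup_snd, H.group.apply_apply_neg] at h1
  rw [h1, WithLp.add_snd, WithLp.smul_snd]
  have h2 := (WithLp.sndL 2 ℂ ℂ E).intervalIntegral_comp_comm
    ((continuous_duhamel (g := g) (Ω := Ω) (lam := lam) H HZ f).intervalIntegrable (μ := volume) 0 t)
  simp only [WithLp.sndL_apply] at h2
  rw [← h2, ← H.integral_smul_apply_neg g (continuous_amp HZ f) (norm_amp_le f) t, mul_smul]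
  refine congrArg (fun x : E => U t (f.snd + I • x)) ?_
  rw [← intervalIntegral.integral_smul]
  refine intervalIntegral.integral_congr fun s _ => ?_
  simp only [freeGroup_snd, couplingOp_snd, map_smul, smul_smul, amp]

theorem IsCoupled.hasDerivAt_amp (hh : IsCoupled h0 g Ω lam h) (H : IsSpectral h0 U)
    (HZ : IsUnitaryGroupOf h Z) (f : WithLp 2 (ℂ × E)) (t : ℝ) :
    HasDerivAt (amp Z f) (I * (Ω * amp Z f t + lam * ⟪g, (Z t f).snd⟫_ℂ)) t := by
  have hc := continuous_duhamel (g := g) (Ω := Ω) (lam := lam) H HZ f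
  have h1 : ∀ t, amp Z f t = f.fst + I * ∫ s in (0 : ℝ)..t,
      (Ω * amp Z f s + lam * ⟪g, (Z s f).snd⟫_ℂ) := by
    intro t
    have h2 := congrArg (fun x : WithLp 2 (ℂ × E) => x.fst) (hh.duhamel H HZ f t)
    simp only [freeGroup_fst] at h2
    have h3 := (WithLp.fstL 2 ℂ ℂ E).intervalIntegral_comp_comm
      (hc.intervalIntegrable (μ := volume) 0 t)
    simp only [WithLp.fstL_apply] at h3
    rw [amp, h2, WithLp.add_fst, WithLp.smul_fst, ← h3]
    rfl
  have hc' : Continuous fun s => (Ω * amp Z f s + lam * ⟪g, (Z s f).snd⟫_ℂ) :=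
    (WithLp.fstL 2 ℂ ℂ E).continuous.comp hc
  have h4 := ((intervalIntegral.integral_hasDerivAt_right (hc'.intervalIntegrable 0 t)
      hc'.stronglyMeasurable.stronglyMeasurableAtFilter hc'.continuousAt).const_mul
      I).const_add f.fst
  exact h4.congr_of_eventuallyEq (Eventually.of_forall h1)

/-- `η(z) = z - Ω - λ² ∫ (z - ν)⁻¹ dμ(ν)`. -/
def etaFn (μ : Measure ℝ) (Ω lam : ℝ) (z : ℂ) : ℂ :=
  z - Ω - (lam : ℂ) ^ 2 * ∫ ν : ℝ, (z - (ν : ℂ))⁻¹ ∂μ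

theorem etaFn_eq (H : IsSpectral h0 U) {z : ℂ} (hz : z.im ≠ 0) :
    etaFn (spectralMeasure h0 g) Ω lam z = z - Ω - (lam : ℂ) ^ 2 * ⟪g, resolventVec h0 z g⟫_ℂ := by
  rw [(IsSpectral.IsProj.self H g).inner_resolventVec H hz, etaFn]
  simp

theorem inner_resolventVec_self_im (H : IsSpectral h0 U) {z : ℂ} (hz : z.im ≠ 0) :
    (⟪g, resolventVec h0 z g⟫_ℂ).im = -z.im * ‖resolventVec h0 z g‖ ^ 2 := by
  obtain ⟨a, ha, ha'⟩ := H.exists_resolvent hz g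
  have h1 := H.im_mul_norm_sq z a
  rw [ha', ha, ← inner_conj_symm, Complex.conj_im] at h1
  linarith

theorem etaFn_im (H : IsSpectral h0 U) {z : ℂ} (hz : z.im ≠ 0) :
    (etaFn (spectralMeasure h0 g) Ω lam z).im =
      z.im * (1 + lam ^ 2 * ‖resolventVec h0 z g‖ ^ 2) := by
  rw [etaFn_eq H hz, Complex.sub_im, Complex.sub_im, Complex.ofReal_im, ← Complex.ofReal_pow,
    Complex.im_ofReal_mul, inner_resolventVec_self_im H hz]
  ring

theorem etaFn_ne_zero (H : IsSpectral h0 U) {z : ℂ} (hz : z.im ≠ 0) :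
    etaFn (spectralMeasure h0 g) Ω lam z ≠ 0 := by
  intro h1
  have h2 := etaFn_im (g := g) (Ω := Ω) (lam := lam) H hz
  rw [h1, Complex.zero_im] at h2
  have : (0 : ℝ) < 1 + lam ^ 2 * ‖resolventVec h0 z g‖ ^ 2 := by positivity
  exact (mul_ne_zero hz this.ne') h2.symm

/-- `F(z; f) = c + λ ⟨g, (z - h₀)⁻¹ ψ⟩`. -/
def ampNum (h0 : E →ₗ.[ℂ] E) (g : E) (lam : ℝ) (f : WithLp 2 (ℂ × E)) (z : ℂ) : ℂ :=
  f.fst + lam * ⟪g, resolventVec h0 z f.snd⟫_ℂ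

/-- The resolvent of the coupled operator. -/
theorem IsCoupled.exists_resolvent (hh : IsCoupled h0 g Ω lam h) (H : IsSpectral h0 U)
    (f : WithLp 2 (ℂ × E)) {z : ℂ} (hz : z.im ≠ 0) : ∃ ξ : WithLp 2 (ℂ × E),
      (ξ, z • ξ - f) ∈ h.graph ∧
      ξ.fst = ampNum h0 g lam f z / etaFn (spectralMeasure h0 g) Ω lam z := by
  have hη := etaFn_ne_zero (g := g) (Ω := Ω) (lam := lam) H hz
  set u := ampNum h0 g lam f z / etaFn (spectralMeasure h0 g) Ω lam z with hu
  have hu' : u * etaFn (spectralMeasure h0 g) Ω lam z = ampNum h0 g lam f z :=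
    div_mul_cancel₀ _ hη
  obtain ⟨a, ha, ha'⟩ := H.exists_resolvent hz (f.snd + ((lam : ℂ) * u) • g)
  refine ⟨WithLp.toLp 2 (u, (a : E)), (hh _ _).2 ⟨?_, ?_⟩, rfl⟩
  · have h1 : z • (a : E) - f.snd - ((lam : ℂ) * u) • g = h0 a := by
      rw [sub_sub, ← ha']
      abel
    have h2 := h0.mem_graph a
    rw [← h1] at h2
    exact h2
  · change z * u - f.fst = Ω * u + lam * ⟪g, (a : E)⟫_ℂ
    rw [ha, H.resolventVec_add hz, H.resolventVec_smul hz, inner_add_right, inner_smul_right]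
    rw [etaFn_eq H hz, ampNum] at hu'
    linear_combination hu'

theorem norm_exp_neg_I_mul_complex (z : ℂ) (t : ℝ) :
    ‖Complex.exp (-(I * z * t))‖ = Real.exp (z.im * t) := by
  rw [Complex.norm_exp]
  simp

theorem integrableOn_laplace {c : ℝ → ℂ} (hc : Continuous c) {B : ℝ} (hB : ∀ t, ‖c t‖ ≤ B) {z : ℂ}
    (hz : z.im < 0) :
    IntegrableOn (fun t : ℝ => Complex.exp (-(I * z * t)) * c t) (Set.Ioi 0) := by
  refine Integrable.mono' ((integrableOn_exp_mul_Ioi hz 0).mul_const B)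
    (Continuous.aestronglyMeasurable (by fun_prop)) (Eventually.of_forall fun t => ?_)
  rw [norm_mul, norm_exp_neg_I_mul_complex]
  gcongr
  exact hB t

/-- The Laplace transform of the amplitude. -/
theorem IsCoupled.laplace_amp (hh : IsCoupled h0 g Ω lam h) (H : IsSpectral h0 U)
    (HZ : IsUnitaryGroupOf h Z) (f : WithLp 2 (ℂ × E)) {z : ℂ} (hz : z.im < 0) :
    ∫ t in Set.Ioi (0 : ℝ), Complex.exp (-(I * z * t)) * amp Z f t =
      -I * (ampNum h0 g lam f z / etaFn (spectralMeasure h0 g) Ω lam z) := by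
  obtain ⟨ξ, hξ, hu⟩ := hh.exists_resolvent H f hz.ne
  have hd : ∀ t : ℝ, HasDerivAt (fun t : ℝ => Complex.exp (-(I * z * t)) * amp Z ξ t)
      (-I * (Complex.exp (-(I * z * t)) * amp Z f t)) t := by
    intro t
    have h1 : HasDerivAt (fun t : ℝ => Complex.exp (-(I * z * t)))
        (Complex.exp (-(I * z * t)) * (-(I * z))) t := by
      have h2 : HasDerivAt (fun t : ℝ => -(I * z * (t : ℂ))) (-(I * z)) t := by
        have h2' := ((Complex.ofRealCLM.hasDerivAt (x := t)).const_mul (I * z)).fun_neg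
        simpa using h2'
      exact h2.cexp
    have h3 : HasDerivAt (amp Z ξ) (I * (z * amp Z ξ t - amp Z f t)) t := by
      have h4 := (hasDerivAt_withLp_prod.1 (HZ.hasDerivAt hξ t)).1
      refine h4.congr_deriv ?_
      simp [amp]
    refine (h1.mul h3).congr_deriv ?_
    ring
  have hint := integrableOn_laplace (continuous_amp HZ f) (norm_amp_le f) hz
  have hlim : Tendsto (fun t : ℝ => Complex.exp (-(I * z * t)) * amp Z ξ t) atTop (𝓝 0) := by
    rw [tendsto_zero_iff_norm_tendsto_zero]
    have h5 : Tendsto (fun t : ℝ => Real.exp (z.im * t) * ‖ξ‖) atTop (𝓝 0) := by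
      have h6 : Tendsto (fun t : ℝ => z.im * t) atTop atBot :=
        tendsto_id.const_mul_atTop_of_neg hz
      simpa using (Real.tendsto_exp_atBot.comp h6).mul_const ‖ξ‖
    refine squeeze_zero (fun _ => norm_nonneg _) (fun t => ?_) h5
    rw [norm_mul, norm_exp_neg_I_mul_complex]
    gcongr
    exact norm_amp_le ξ t
  have h7 := integral_Ioi_of_hasDerivAt_of_tendsto (hd 0).continuousAt.continuousWithinAt
    (fun t _ => hd t) (hint.const_mul (-I)) hlim
  rw [integral_const_mul] at h7
  simp only [Complex.ofReal_zero, mul_zero, neg_zero, Complex.exp_zero, one_mul, zero_sub,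
    amp_zero HZ, hu] at h7
  linear_combination I * h7 + (∫ t in Set.Ioi (0 : ℝ),
    Complex.exp (-(I * z * t)) * amp Z f t) * Complex.I_mul_I

end

end Coupled

end

section

/-! ### Boundary values of resolvents -/

section BoundaryValues

variable {E : Type} [NormedAddCommGroup E] [InnerProductSpace ℂ E] [CompleteSpace E]
  {h0 : E →ₗ.[ℂ] E} {U : ℝ → E ≃ₗᵢ[ℂ] E} {g : E} {Ω lam : ℝ}

theorem IsSpectral.tendsto_resolventVec_point (H : IsSpectral h0 U) {w : ℂ} (hw : w.im ≠ 0)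
    (χ : E) : Tendsto (fun z => resolventVec h0 z χ) (𝓝 w) (𝓝 (resolventVec h0 w χ)) := by
  rw [tendsto_iff_norm_sub_tendsto_zero]
  have h1 : Tendsto (fun z : ℂ => ‖w - z‖ * (|z.im|⁻¹ * (|w.im|⁻¹ * ‖χ‖))) (𝓝 w) (𝓝 0) := by
    have h2 : ContinuousAt (fun z : ℂ => ‖w - z‖ * (|z.im|⁻¹ * (|w.im|⁻¹ * ‖χ‖))) w := by
      have : |w.im| ≠ 0 := abs_ne_zero.2 hw
      have h3 : ContinuousAt (fun z : ℂ => |z.im|) w := by fun_prop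
      have h4 : ContinuousAt (fun z : ℂ => ‖w - z‖) w := by fun_prop
      exact h4.mul ((h3.inv₀ this).mul continuousAt_const)
    have h5 := h2.tendsto
    simpa using h5
  have h6 : ∀ᶠ z in 𝓝 w, z.im ≠ 0 := Complex.continuous_im.continuousAt.eventually_ne hw
  refine tendsto_of_tendsto_of_tendsto_of_le_of_le' tendsto_const_nhds h1
    (Eventually.of_forall fun _ => norm_nonneg _) ?_
  filter_upwards [h6] with z hz
  rw [H.resolventVec_identity hz hw, norm_smul]
  gcongr
  exact (H.norm_resolventVec_le hz _).trans (by gcongr; exact H.norm_resolventVec_le hw _)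

theorem IsSpectral.hasDerivAt_inner_resolventVec (H : IsSpectral h0 U) (ψ : E) {w : ℂ}
    (hw : w.im ≠ 0) : HasDerivAt (fun z => ⟪g, resolventVec h0 z ψ⟫_ℂ)
      (-⟪g, resolventVec h0 w (resolventVec h0 w ψ)⟫_ℂ) w := by
  rw [hasDerivAt_iff_tendsto_slope]
  have h1 := (tendsto_const_nhds (x := g)).inner (𝕜 := ℂ)
    (H.tendsto_resolventVec_point hw (resolventVec h0 w ψ))
  refine (h1.neg.mono_left nhdsWithin_le_nhds).congr' ?_
  have h6 : ∀ᶠ z in 𝓝 w, z.im ≠ 0 := Complex.continuous_im.continuousAt.eventually_ne hw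
  filter_upwards [h6.filter_mono nhdsWithin_le_nhds, self_mem_nhdsWithin] with z hz hzw
  have hne : z - w ≠ 0 := sub_ne_zero.2 hzw
  rw [slope, vsub_eq_sub, ← inner_sub_right, H.resolventVec_identity hz hw, inner_smul_right,
    smul_eq_mul]
  field_simp
  ring

theorem IsSpectral.differentiableAt_inner_resolventVec (H : IsSpectral h0 U) (ψ : E) {w : ℂ}
    (hw : w.im ≠ 0) : DifferentiableAt ℂ (fun z => ⟪g, resolventVec h0 z ψ⟫_ℂ) w :=
  (H.hasDerivAt_inner_resolventVec ψ hw).differentiableAt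

theorem ae_exists_boundary_value_lower {G : ℂ → ℂ} {B : ℝ}
    (hd : ∀ z : ℂ, z.im < 0 → DifferentiableAt ℂ G z) (hB : ∀ z : ℂ, z.im < 0 → ‖G z‖ ≤ B) :
    ∀ᵐ x : ℝ, ∃ w : ℂ,
      Tendsto (fun ε : ℝ => G ((x : ℂ) - ε * I)) (𝓝[>] 0) (𝓝 w) := by
  have h1 := ae_exists_boundary_value (H := fun z => G (-z)) (B := B)
    (fun z hz => by
      have h2 : DifferentiableAt ℂ G (-z) := hd _ (by simpa using hz)
      exact (h2.comp z differentiableAt_id.neg).differentiableWithinAt)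
    (fun z hz => hB _ (by simpa using hz))
  have h2 := (Measure.measurePreserving_neg (volume : Measure ℝ)).quasiMeasurePreserving.ae h1
  filter_upwards [h2] with x hx
  obtain ⟨w, hw⟩ := hx
  refine ⟨w, hw.congr fun ε => ?_⟩
  congr 1
  push_cast
  ring

/-- The matrix elements of the resolvent between `g` and `ψ` are bounded. -/
def ResBounded (h0 : E →ₗ.[ℂ] E) (g ψ : E) : Prop :=
  ∃ C : ℝ, ∀ z : ℂ, z.im ≠ 0 → ‖⟪g, resolventVec h0 z ψ⟫_ℂ‖ ≤ C

theorem spectralMeasure_le_volume (H : IsSpectral h0 U) (hg : ResBounded h0 g g) :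
    ∃ C : ℝ, spectralMeasure h0 g ≤ ENNReal.ofReal C • volume := by
  obtain ⟨C, hC⟩ := hg
  have := H.isFiniteMeasure g
  refine ⟨C / Real.pi, measure_le_of_poisson_le fun x ε hε => ?_⟩
  have hz : ((x : ℂ) + ε * I).im ≠ 0 := by simpa using hε.ne'
  have h1 := inner_resolventVec_self_im (g := g) H hz
  have h2 : ∫ ν, ε / ((x - ν) ^ 2 + ε ^ 2) ∂(spectralMeasure h0 g) =
      ε * ‖resolventVec h0 ((x : ℂ) + ε * I) g‖ ^ 2 := by
    rw [← H.integral_poisson_eq g x hε, ← integral_const_mul]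
    rfl
  have h3 := (Complex.abs_im_le_norm _).trans (hC _ hz)
  have h4 : ((x : ℂ) + ε * I).im = ε := by simp
  rw [h1, h4, neg_mul, abs_neg] at h3
  rw [h2]
  exact (le_abs_self _).trans h3

theorem etaFn_conj (μ : Measure ℝ) (z : ℂ) :
    etaFn μ Ω lam ((starRingEnd ℂ) z) = (starRingEnd ℂ) (etaFn μ Ω lam z) := by
  simp only [etaFn, map_sub, map_mul, map_pow, Complex.conj_ofReal, ← integral_conj, map_inv₀]

theorem differentiableAt_etaFn (H : IsSpectral h0 U) {z : ℂ} (hz : z.im ≠ 0) :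
    DifferentiableAt ℂ (etaFn (spectralMeasure h0 g) Ω lam) z := by
  have h1 : DifferentiableAt ℂ
      (fun z => z - Ω - (lam : ℂ) ^ 2 * ⟪g, resolventVec h0 z g⟫_ℂ) z :=
    (differentiableAt_id.sub_const _).sub
      ((H.differentiableAt_inner_resolventVec g hz).const_mul _)
  refine h1.congr_of_eventuallyEq ?_
  filter_upwards [Complex.continuous_im.continuousAt.eventually_ne hz] with w hw
  exact etaFn_eq H hw

/-- The boundary values of `η` control `η` in the half planes. -/
theorem le_norm_etaFn (H : IsSpectral h0 U) {κ : ℝ} (hκ : 0 < κ)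
    (hb : ∀ᵐ x : ℝ, ∃ w : ℂ, κ ≤ ‖w‖ ∧ Tendsto (fun ε : ℝ =>
      etaFn (spectralMeasure h0 g) Ω lam ((x : ℂ) + ε * I)) (𝓝[>] 0) (𝓝 w))
    {z : ℂ} (hz : z.im ≠ 0) : κ ≤ ‖etaFn (spectralMeasure h0 g) Ω lam z‖ := by
  set η := etaFn (spectralMeasure h0 g) Ω lam with hη
  have key : ∀ z : ℂ, 0 < z.im → κ ≤ ‖η z‖ := by
    intro z hz
    have him : ∀ w : ℂ, 0 < w.im → 0 < (η w).im := by
      intro w hw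
      rw [hη, etaFn_im H hw.ne']
      positivity
    have h1 : ∀ τ : ℝ, 0 < τ → τ < κ → κ - 2 * τ ≤ ‖η z‖ := by
      intro τ hτ hτκ
      have hlow : ∀ w : ℂ, 0 < w.im → τ ≤ ‖η w + τ * I‖ := by
        intro w hw
        have h2 := Complex.abs_im_le_norm (η w + τ * I)
        have h3 : (η w + τ * I).im = (η w).im + τ := by simp
        rw [h3, abs_of_pos (by linarith [him w hw])] at h2
        linarith [him w hw]
      have hne : ∀ w : ℂ, 0 < w.im → η w + τ * I ≠ 0 := fun w hw =>
        norm_pos_iff.1 (hτ.trans_le (hlow w hw))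
      have h4 := norm_le_of_ae_boundary_le (H := fun w => (η w + τ * I)⁻¹)
        (B := τ⁻¹) (C := (κ - τ)⁻¹)
        (fun w hw => by
          have h5 : DifferentiableAt ℂ η w := differentiableAt_etaFn H (ne_of_gt hw)
          exact ((h5.add_const _).inv (hne w hw)).differentiableWithinAt)
        (fun w hw => by
          rw [norm_inv]
          exact inv_anti₀ hτ (hlow w hw))
        (by
          filter_upwards [hb] with x hx
          obtain ⟨w, hw, hlim⟩ := hx
          have h6 : κ - τ ≤ ‖w + τ * I‖ := by
            have h7 := norm_sub_norm_le w (-(τ * I))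
            rw [norm_neg, sub_neg_eq_add, norm_mul, Complex.norm_I, mul_one, Complex.norm_real,
              Real.norm_of_nonneg hτ.le] at h7
            linarith
          have h8 : w + τ * I ≠ 0 := norm_pos_iff.1 ((sub_pos.2 hτκ).trans_le h6)
          refine ⟨(w + τ * I)⁻¹, ?_, (hlim.add_const _).inv₀ h8⟩
          rw [norm_inv]
          exact inv_anti₀ (sub_pos.2 hτκ) h6)
        hz
      rw [norm_inv] at h4
      have h9 := (inv_le_inv₀ (norm_pos_iff.2 (hne z hz)) (sub_pos.2 hτκ)).1 h4
      have h10 := norm_add_le (η z) (τ * I)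
      rw [norm_mul, Complex.norm_I, mul_one, Complex.norm_real, Real.norm_of_nonneg hτ.le] at h10
      linarith
    refine le_of_forall_pos_lt_add fun δ hδ => ?_
    have h11 := h1 (min (κ / 2) (δ / 4)) (by positivity) (by
      have := min_le_left (κ / 2) (δ / 4)
      linarith)
    have := min_le_right (κ / 2) (δ / 4)
    linarith
  rcases lt_or_gt_of_ne hz with h1 | h1
  · have h2 := key ((starRingEnd ℂ) z) (by simpa using h1)
    rwa [hη, etaFn_conj, RCLike.norm_conj] at h2
  · exact key z h1

theorem exists_one_add_norm_le_etaFn (H : IsSpectral h0 U) (hg : ResBounded h0 g g) {κ : ℝ}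
    (hκ : 0 < κ) (hη : ∀ z : ℂ, z.im ≠ 0 → κ ≤ ‖etaFn (spectralMeasure h0 g) Ω lam z‖) :
    ∃ D : ℝ, 0 < D ∧ ∀ z : ℂ, z.im ≠ 0 →
      1 + ‖z‖ ≤ D * ‖etaFn (spectralMeasure h0 g) Ω lam z‖ := by
  obtain ⟨C, hC⟩ := hg
  have hC0 : 0 ≤ C := (norm_nonneg _).trans (hC I (by simp))
  refine ⟨1 + (1 + |Ω| + lam ^ 2 * C) / κ, by positivity, fun z hz => ?_⟩
  have h1 := hη z hz
  have h2 : z = etaFn (spectralMeasure h0 g) Ω lam z + Ω +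
      (lam : ℂ) ^ 2 * ⟪g, resolventVec h0 z g⟫_ℂ := by
    rw [etaFn_eq H hz]
    ring
  have h3 : ‖z‖ ≤ ‖etaFn (spectralMeasure h0 g) Ω lam z‖ + |Ω| + lam ^ 2 * C := by
    conv_lhs => rw [h2]
    refine (norm_add₃_le).trans ?_
    rw [Complex.norm_real, norm_mul, norm_pow, Complex.norm_real, Real.norm_eq_abs,
      Real.norm_eq_abs, sq_abs]
    gcongr
    exact hC z hz
  have h4 : (1 + |Ω| + lam ^ 2 * C) ≤
      (1 + |Ω| + lam ^ 2 * C) / κ * ‖etaFn (spectralMeasure h0 g) Ω lam z‖ := by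
    rw [div_mul_eq_mul_div, le_div_iff₀ hκ]
    gcongr
  linarith

theorem norm_inv_sub_le_inv_abs {x ν : ℝ} (hx : x ≤ 0) (hν : 0 ≤ ν) (hne : ν - x ≠ 0) (ε : ℝ) :
    ‖((x : ℂ) + ε * I - (ν : ℂ))⁻¹‖ ≤ (ν - x)⁻¹ := by
  rw [norm_inv]
  have h0 : 0 < ν - x := lt_of_le_of_ne (by linarith) (Ne.symm hne)
  refine inv_anti₀ h0 ?_
  have h1 := Complex.abs_re_le_norm ((x : ℂ) + ε * I - (ν : ℂ))
  have h2 : ((x : ℂ) + ε * I - (ν : ℂ)).re = x - ν := by simp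
  rw [h2, abs_sub_comm, abs_of_pos h0] at h1
  exact h1

/-- `η` extends continuously to the closed negative half line. -/
theorem tendsto_etaFn_of_nonpos (μ : Measure ℝ) {x : ℝ} (hx : x ≤ 0)
    (hμ : ∀ᵐ ν ∂μ, 0 ≤ ν ∧ ν - x ≠ 0) (hi : Integrable (fun ν => (ν - x)⁻¹) μ) :
    Tendsto (fun ε : ℝ => etaFn μ Ω lam ((x : ℂ) + ε * I)) (𝓝[>] 0)
      (𝓝 (etaFn μ Ω lam x)) := by
  have h1 : Tendsto (fun ε : ℝ => ∫ ν : ℝ, ((x : ℂ) + ε * I - (ν : ℂ))⁻¹ ∂μ) (𝓝[>] 0)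
      (𝓝 (∫ ν : ℝ, ((x : ℂ) - (ν : ℂ))⁻¹ ∂μ)) := by
    refine tendsto_integral_filter_of_dominated_convergence (fun ν => (ν - x)⁻¹)
      (Eventually.of_forall fun ε => Measurable.aestronglyMeasurable (by fun_prop))
      (Eventually.of_forall fun ε => ?_) hi ?_
    · filter_upwards [hμ] with ν hν
      exact norm_inv_sub_le_inv_abs hx hν.1 hν.2 ε
    · filter_upwards [hμ] with ν hν
      have h2 : Tendsto (fun ε : ℝ => (x : ℂ) + ε * I - (ν : ℂ)) (𝓝[>] 0)
          (𝓝 ((x : ℂ) - (ν : ℂ))) := by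
        have h3 : ContinuousAt (fun ε : ℝ => (x : ℂ) + ε * I - (ν : ℂ)) 0 := by fun_prop
        have h4 := h3.tendsto
        simp only [Complex.ofReal_zero, zero_mul, add_zero] at h4
        exact h4.mono_left nhdsWithin_le_nhds
      refine h2.inv₀ ?_
      rw [← Complex.ofReal_sub]
      have := hν.2
      exact_mod_cast fun h : x - ν = 0 => this (by linarith)
  have h5 : Tendsto (fun ε : ℝ => (x : ℂ) + ε * I) (𝓝[>] 0) (𝓝 (x : ℂ)) := by
    have h3 : ContinuousAt (fun ε : ℝ => (x : ℂ) + ε * I) 0 := by fun_prop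
    have h4 := h3.tendsto
    simp only [Complex.ofReal_zero, zero_mul, add_zero] at h4
    exact h4.mono_left nhdsWithin_le_nhds
  exact (h5.sub_const _).sub (h1.const_mul _)

/-- `η(0)` is real and negative. -/
theorem etaFn_zero_le (H : IsSpectral h0 U) (hg : InvFinite h0 g) {κ : ℝ} (hκ : 0 < κ)
    (hη : ∀ z : ℂ, z.im ≠ 0 → κ ≤ ‖etaFn (spectralMeasure h0 g) Ω lam z‖) (hΩ : 0 < Ω) :
    -Ω + lam ^ 2 * ∫ ν, ν⁻¹ ∂(spectralMeasure h0 g) ≤ -κ := by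
  set μ := spectralMeasure h0 g with hμ
  have := H.isFiniteMeasure g
  let e : ℝ → ℝ := fun x => x - Ω + lam ^ 2 * ∫ ν, (ν - x)⁻¹ ∂μ
  have he : ∀ x : ℝ, etaFn μ Ω lam x = (e x : ℂ) := by
    intro x
    simp only [etaFn, e]
    push_cast
    rw [← integral_complex_ofReal, ← sub_neg_eq_add, ← mul_neg, ← integral_neg]
    congr 3
    ext ν
    push_cast
    rw [← inv_neg, neg_sub]
  have hae : ∀ x : ℝ, x ≤ 0 → ∀ᵐ ν ∂μ, 0 ≤ ν ∧ ν - x ≠ 0 := by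
    intro x hx
    filter_upwards [hg.ae_pos] with ν hν
    exact ⟨hν.le, by linarith [hν] |> fun h : 0 < ν - x => h.ne'⟩
  have hbd : ∀ x : ℝ, x ≤ 0 → ∀ᵐ ν ∂μ, ‖(ν - x)⁻¹‖ ≤ ν⁻¹ := by
    intro x hx
    filter_upwards [hg.ae_pos] with ν hν
    rw [Real.norm_of_nonneg (inv_nonneg.2 (by linarith))]
    exact inv_anti₀ hν (by linarith)
  have hint : ∀ x : ℝ, x ≤ 0 → Integrable (fun ν => (ν - x)⁻¹) μ := fun x hx =>
    hg.integrable.mono' (Measurable.aestronglyMeasurable (by fun_prop)) (hbd x hx)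
  have habs : ∀ x : ℝ, x ≤ 0 → κ ≤ |e x| := by
    intro x hx
    have h1 := (tendsto_etaFn_of_nonpos (Ω := Ω) (lam := lam) μ hx (hae x hx) (hint x hx)).norm
    rw [he, Complex.norm_real, Real.norm_eq_abs] at h1
    refine ge_of_tendsto h1 ?_
    filter_upwards [self_mem_nhdsWithin] with ε hε
    exact hη _ (by simpa using (ne_of_gt hε))
  have hcont : ContinuousOn e (Set.Iic 0) := by
    have h2 : ContinuousOn (fun x => ∫ ν, (ν - x)⁻¹ ∂μ) (Set.Iic 0) := by
      intro x hx
      refine tendsto_integral_filter_of_dominated_convergence (fun ν => ν⁻¹)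
        (Eventually.of_forall fun y => Measurable.aestronglyMeasurable (by fun_prop)) ?_
        hg.integrable ?_
      · filter_upwards [self_mem_nhdsWithin] with y hy
        exact hbd y hy
      · filter_upwards [hae x hx] with ν hν
        have h3 : ContinuousAt (fun y : ℝ => (ν - y)⁻¹) x :=
          ContinuousAt.inv₀ (by fun_prop) hν.2
        exact h3.tendsto.mono_left nhdsWithin_le_nhds
    exact (continuousOn_id.sub continuousOn_const).add (continuousOn_const.mul h2)
  have he0 : e 0 = -Ω + lam ^ 2 * ∫ ν, ν⁻¹ ∂μ := by simp [e]
  rw [← he0]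
  by_contra hcon
  push Not at hcon
  have h4 : κ ≤ e 0 := by
    rcases le_abs.1 (habs 0 le_rfl) with h | h
    · exact h
    · linarith
  set M := lam ^ 2 * μ.real Set.univ with hM
  have hM0 : 0 ≤ M := by positivity
  set x₀ : ℝ := -(1 + M) with hx₀
  have h5 : e x₀ < 0 := by
    have h6 : ∫ ν, (ν - x₀)⁻¹ ∂μ ≤ ∫ _, (1 + M)⁻¹ ∂μ := by
      refine integral_mono_ae (hint x₀ (by linarith)) (integrable_const _) ?_
      filter_upwards [hg.ae_pos] with ν hν
      exact inv_anti₀ (by linarith) (by linarith)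
    rw [integral_const, smul_eq_mul] at h6
    have h7 : lam ^ 2 * ∫ ν, (ν - x₀)⁻¹ ∂μ ≤ M * (1 + M)⁻¹ := by
      rw [hM, mul_assoc]
      exact mul_le_mul_of_nonneg_left h6 (sq_nonneg _)
    have h8 : M * (1 + M)⁻¹ ≤ 1 := by
      rw [← div_eq_mul_inv, div_le_one (by linarith)]
      linarith
    simp only [e]
    linarith
  have h9 : (0 : ℝ) ∈ e '' Set.Icc x₀ 0 := by
    refine intermediate_value_Icc (by linarith) (hcont.mono Set.Icc_subset_Iic_self) ?_
    exact ⟨h5.le, by linarith⟩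
  obtain ⟨x, hx, hx0⟩ := h9
  have h10 := habs x hx.2
  rw [hx0, abs_zero] at h10
  linarith

end BoundaryValues

end

section

/-! ### Square integrability of functions with a bounded Laplace transform -/

section Laplace

theorem lintegral_le_of_tendsto_of_tendsto {X : Type*} [MeasurableSpace X] {μ : Measure X}
    {f : ℕ → X → ℝ≥0∞} {F : X → ℝ≥0∞} {b : ℕ → ℝ≥0∞} {C : ℝ≥0∞}
    (hf : ∀ n, AEMeasurable (f n) μ)
    (hlim : ∀ᵐ x ∂μ, Tendsto (fun n => f n x) atTop (𝓝 (F x)))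
    (hb : ∀ n, ∫⁻ x, f n x ∂μ ≤ b n) (hC : Tendsto b atTop (𝓝 C)) : ∫⁻ x, F x ∂μ ≤ C := by
  calc ∫⁻ x, F x ∂μ = ∫⁻ x, liminf (fun n => f n x) atTop ∂μ :=
        lintegral_congr_ae (by filter_upwards [hlim] with x hx using hx.liminf_eq.symm)
    _ ≤ liminf (fun n => ∫⁻ x, f n x ∂μ) atTop := lintegral_liminf_le' hf
    _ ≤ liminf b atTop := liminf_le_liminf (Eventually.of_forall hb)
    _ = C := hC.liminf_eq

theorem lintegral_le_of_tendsto_of_le {X : Type*} [MeasurableSpace X] {μ : Measure X}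
    {f : ℕ → X → ℝ≥0∞} {F : X → ℝ≥0∞} {C : ℝ≥0∞} (hf : ∀ n, AEMeasurable (f n) μ)
    (hlim : ∀ᵐ x ∂μ, Tendsto (fun n => f n x) atTop (𝓝 (F x)))
    (hb : ∀ n, ∫⁻ x, f n x ∂μ ≤ C) : ∫⁻ x, F x ∂μ ≤ C :=
  lintegral_le_of_tendsto_of_tendsto hf hlim hb tendsto_const_nhds

theorem memLp_two_of_integrable_of_bound {w : ℝ → ℂ} {C : ℝ} (hw : Integrable w)
    (hC : ∀ s, ‖w s‖ ≤ C) : MemLp w 2 := by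
  rw [memLp_two_iff_integrable_sq_norm hw.1]
  refine (hw.norm.const_mul C).mono' (hw.1.norm.pow 2) (Eventually.of_forall fun s => ?_)
  rw [Real.norm_of_nonneg (sq_nonneg _), sq]
  gcongr
  exact hC s

theorem measurable_fourier {w : ℝ → ℂ} (hw : Measurable w) :
    Measurable fun ν : ℝ => ∫ s : ℝ, Complex.exp (-(I * s * ν)) * w s := by
  have h1 : Measurable fun p : ℝ × ℝ => Complex.exp (-(I * p.2 * p.1)) * w p.2 := by
    fun_prop
  exact (h1.stronglyMeasurable.integral_prod_right' (ν := volume)).measurable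

variable {c : ℝ → ℂ} {B : ℝ}

/-- `1_{(t,∞)}(s) e^{-εs} c(s)`. -/
def dampedTail (c : ℝ → ℂ) (t ε s : ℝ) : ℂ :=
  (Set.Ioi t).indicator (fun s : ℝ => Complex.exp (-(ε * s : ℝ)) * c s) s

theorem measurable_dampedTail (hc : Continuous c) (t ε : ℝ) : Measurable (dampedTail c t ε) := by
  have := hc.measurable
  exact Measurable.indicator (by fun_prop) measurableSet_Ioi

theorem norm_dampedTail_le (hB : ∀ s, ‖c s‖ ≤ B) (t ε s : ℝ) :
    ‖dampedTail c t ε s‖ ≤ (Set.Ioi t).indicator (fun s => Real.exp (-ε * s) * B) s := by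
  unfold dampedTail
  by_cases hs : s ∈ Set.Ioi t
  · rw [Set.indicator_of_mem hs, Set.indicator_of_mem hs, norm_mul, Complex.norm_exp]
    simp only [Complex.neg_re, Complex.ofReal_re, neg_mul]
    gcongr
    exact hB s
  · rw [Set.indicator_of_notMem hs, Set.indicator_of_notMem hs, norm_zero]

theorem integrable_dampedTail (hc : Continuous c) (hB : ∀ s, ‖c s‖ ≤ B) (t : ℝ) {ε : ℝ}
    (hε : 0 < ε) : Integrable (dampedTail c t ε) := by
  have h0 : IntegrableOn (fun s => Real.exp (-ε * s) * B) (Set.Ioi t) :=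
    (integrableOn_exp_mul_Ioi (neg_lt_zero.2 hε) t).mul_const B
  have h1 := h0.integrable_indicator measurableSet_Ioi
  exact h1.mono' (measurable_dampedTail hc t ε).aestronglyMeasurable
    (Eventually.of_forall (norm_dampedTail_le hB t ε))

theorem memLp_dampedTail (hc : Continuous c) (hB : ∀ s, ‖c s‖ ≤ B) {t ε : ℝ} (ht : 0 ≤ t)
    (hε : 0 < ε) : MemLp (dampedTail c t ε) 2 := by
  have hB0 : 0 ≤ B := (norm_nonneg _).trans (hB 0)
  refine memLp_two_of_integrable_of_bound (integrable_dampedTail hc hB t hε) (C := B) fun s => ?_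
  refine (norm_dampedTail_le hB t ε s).trans ?_
  by_cases hs : s ∈ Set.Ioi t
  · rw [Set.indicator_of_mem hs]
    refine mul_le_of_le_one_left hB0 (Real.exp_le_one_iff.2 ?_)
    have : 0 ≤ ε * s := mul_nonneg hε.le (ht.trans (le_of_lt hs))
    linarith
  · rwa [Set.indicator_of_notMem hs]

theorem lintegral_dampedTail_le {t ε : ℝ} (ht : 0 ≤ t) (hε : 0 < ε) :
    ∫⁻ s, ‖dampedTail c t ε s‖ₑ ^ 2 ≤ ∫⁻ s in Set.Ioi t, ‖c s‖ₑ ^ 2 := by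
  rw [← lintegral_indicator measurableSet_Ioi]
  refine lintegral_mono fun s => ?_
  unfold dampedTail
  by_cases hs : s ∈ Set.Ioi t
  · rw [Set.indicator_of_mem hs, Set.indicator_of_mem hs]
    gcongr
    rw [enorm_mul, ← ofReal_norm (Complex.exp _), Complex.norm_exp]
    refine mul_le_of_le_one_left zero_le ?_
    rw [← ENNReal.ofReal_one]
    refine ENNReal.ofReal_le_ofReal (Real.exp_le_one_iff.2 ?_)
    have : 0 ≤ ε * s := mul_nonneg hε.le (ht.trans (le_of_lt hs))
    simpa using this
  · rw [Set.indicator_of_notMem hs, Set.indicator_of_notMem hs]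
    simp

theorem integral_dampedTail (hc : Continuous c) (hB : ∀ s, ‖c s‖ ≤ B) {t ε : ℝ} (ht : 0 ≤ t)
    (hε : 0 < ε) (ν : ℝ) :
    ∫ s : ℝ, Complex.exp (-(I * s * ν)) * dampedTail c t ε s =
      (∫ s in Set.Ioi (0 : ℝ), Complex.exp (-(I * ((ν : ℂ) - ε * I) * s)) * c s) -
      ∫ s in (0 : ℝ)..t, Complex.exp (-(I * ((ν : ℂ) - ε * I) * s)) * c s := by
  have hz : ((ν : ℂ) - ε * I).im < 0 := by simpa using hε
  have h1 := integrableOn_laplace hc hB hz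
  have e1 : (fun s : ℝ => Complex.exp (-(I * s * ν)) * dampedTail c t ε s) =
      (Set.Ioi t).indicator
        (fun s : ℝ => Complex.exp (-(I * ((ν : ℂ) - ε * I) * s)) * c s) := by
    ext s
    unfold dampedTail
    by_cases hs : s ∈ Set.Ioi t
    · rw [Set.indicator_of_mem hs, Set.indicator_of_mem hs, ← mul_assoc, ← Complex.exp_add]
      congr 2
      push_cast
      linear_combination -((ε : ℂ) * s) * Complex.I_mul_I
    · rw [Set.indicator_of_notMem hs, Set.indicator_of_notMem hs, mul_zero]
  rw [e1, integral_indicator measurableSet_Ioi, intervalIntegral.integral_of_le ht,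
    ← Set.Ioc_union_Ioi_eq_Ioi ht, setIntegral_union Set.Ioc_disjoint_Ioi_same measurableSet_Ioi
      (h1.mono_set Set.Ioc_subset_Ioi_self) (h1.mono_set (Set.Ioi_subset_Ioi ht))]
  abel

theorem tendsto_one_div_nhdsGT : Tendsto (fun n : ℕ => 1 / ((n : ℝ) + 1)) atTop (𝓝[>] 0) :=
  tendsto_nhdsWithin_iff.2 ⟨tendsto_one_div_add_atTop_nhds_zero_nat,
    Eventually.of_forall fun n => Set.mem_Ioi.2 (by positivity)⟩

/-- A bounded function whose Laplace transform is `O(1/|z|)` up to the boundary is square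
integrable. -/
theorem lintegral_sq_lt_top_of_laplace (hc : Continuous c) (hB : ∀ s, ‖c s‖ ≤ B) {K : ℝ}
    (hK : ∀ z : ℂ, z.im < 0 →
      ‖∫ s in Set.Ioi (0 : ℝ), Complex.exp (-(I * z * s)) * c s‖ ≤ K / (1 + ‖z‖)) :
    ∫⁻ s in Set.Ioi (0 : ℝ), ‖c s‖ₑ ^ 2 < ∞ := by
  set M : ℝ≥0∞ := ∫⁻ ν : ℝ, ENNReal.ofReal (K ^ 2 * (1 + ν ^ 2)⁻¹) with hM
  have hMfin : M < ∞ := (integrable_inv_one_add_sq.const_mul (K ^ 2)).lintegral_lt_top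
  have hpi : ENNReal.ofReal (2 * Real.pi) ≠ 0 := by
    simpa using Real.pi_pos
  have h1 : ∀ ε : ℝ, 0 < ε → ∫⁻ s, ‖dampedTail c 0 ε s‖ₑ ^ 2 ≤
      (ENNReal.ofReal (2 * Real.pi))⁻¹ * M := by
    intro ε hε
    have h2 := lintegral_fourier_sq (integrable_dampedTail hc hB 0 hε)
      (memLp_dampedTail hc hB le_rfl hε)
    have h3 : ∫⁻ ν : ℝ, ‖∫ s : ℝ, Complex.exp (-(I * s * ν)) * dampedTail c 0 ε s‖ₑ ^ 2 ≤
        M := by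
      refine lintegral_mono fun ν => ?_
      rw [integral_dampedTail hc hB le_rfl hε, intervalIntegral.integral_same, sub_zero,
        ← ofReal_norm, ← ENNReal.ofReal_pow (norm_nonneg _)]
      refine ENNReal.ofReal_le_ofReal ?_
      have hz : ((ν : ℂ) - ε * I).im < 0 := by simpa using hε
      have h4 := hK _ hz
      have h5 : |ν| ≤ ‖(ν : ℂ) - ε * I‖ := by
        have := Complex.abs_re_le_norm ((ν : ℂ) - ε * I)
        simpa using this
      calc _ ≤ (K / (1 + ‖(ν : ℂ) - ε * I‖)) ^ 2 := by gcongr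
        _ = K ^ 2 * ((1 + ‖(ν : ℂ) - ε * I‖) ^ 2)⁻¹ := by rw [div_pow, div_eq_mul_inv]
        _ ≤ _ := by
          gcongr
          rw [← sq_abs ν]
          nlinarith [abs_nonneg ν, norm_nonneg ((ν : ℂ) - ε * I)]
    rw [h2] at h3
    rw [← ENNReal.mul_le_mul_iff_right hpi ENNReal.ofReal_ne_top, ← mul_assoc,
      ENNReal.mul_inv_cancel hpi ENNReal.ofReal_ne_top, one_mul]
    exact h3
  rw [← lintegral_indicator measurableSet_Ioi]
  refine lt_of_le_of_lt (lintegral_le_of_tendsto_of_le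
    (f := fun n : ℕ => fun s => ‖dampedTail c 0 (1 / ((n : ℝ) + 1)) s‖ₑ ^ 2)
    (fun n => ((measurable_dampedTail hc 0 _).enorm.pow_const 2).aemeasurable)
    (Eventually.of_forall fun s => ?_) fun n => h1 _ (by positivity))
    (ENNReal.mul_lt_top (ENNReal.inv_lt_top.2 (pos_iff_ne_zero.2 hpi)) hMfin)
  by_cases hs : s ∈ Set.Ioi (0 : ℝ)
  · simp only [dampedTail, Set.indicator_of_mem hs]
    have h6 : Tendsto (fun ε : ℝ => Complex.exp (-(ε * s : ℝ)) * c s) (𝓝 0) (𝓝 (c s)) := by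
      have h7 : ContinuousAt (fun ε : ℝ => Complex.exp (-(ε * s : ℝ)) * c s) 0 := by fun_prop
      simpa using h7.tendsto
    exact ((ENNReal.continuous_pow 2).tendsto _).comp ((continuous_enorm.tendsto _).comp
      (h6.comp tendsto_one_div_add_atTop_nhds_zero_nat))
  · simp only [dampedTail, Set.indicator_of_notMem hs]
    simp

theorem lintegral_truncFourier_add_le (hc : Continuous c) (hB : ∀ s, ‖c s‖ ≤ B) {u : ℂ → ℂ}
    {Hm : ℝ → ℂ}
    (hu : ∀ z : ℂ, z.im < 0 →
      ∫ s in Set.Ioi (0 : ℝ), Complex.exp (-(I * z * s)) * c s = -I * u z)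
    (hH : ∀ᵐ ν : ℝ, Tendsto (fun ε : ℝ => u ((ν : ℂ) - ε * I)) (𝓝[>] 0) (𝓝 (Hm ν)))
    {t : ℝ} (ht : 0 ≤ t) :
    ∫⁻ ν, ‖truncFourier c t ν + I * Hm ν‖ₑ ^ 2 ≤
      ENNReal.ofReal (2 * Real.pi) * ∫⁻ s in Set.Ioi t, ‖c s‖ₑ ^ 2 := by
  refine lintegral_le_of_tendsto_of_le (f := fun n : ℕ => fun ν : ℝ =>
    ‖∫ s : ℝ, Complex.exp (-(I * s * ν)) * dampedTail c t (1 / ((n : ℝ) + 1)) s‖ₑ ^ 2)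
    (fun n => ((measurable_fourier (measurable_dampedTail hc t _)).enorm.pow_const 2).aemeasurable)
    ?_ fun n => ?_
  · filter_upwards [hH] with ν hν
    have h1 : Tendsto (fun ε : ℝ => -I * u ((ν : ℂ) - ε * I) -
        ∫ s in (0 : ℝ)..t, Complex.exp (-(I * ((ν : ℂ) - ε * I) * s)) * c s)
        (𝓝[>] 0) (𝓝 (-I * Hm ν - truncFourier c t ν)) := by
      refine (hν.const_mul _).sub ?_
      have h2 : Continuous fun ε : ℝ => ∫ s in (0 : ℝ)..t,
          Complex.exp (-(I * ((ν : ℂ) - ε * I) * s)) * c s :=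
        intervalIntegral.continuous_parametric_intervalIntegral_of_continuous'
          (by fun_prop) 0 t
      have h3 := (h2.tendsto 0).mono_left (nhdsWithin_le_nhds (s := Set.Ioi 0))
      have h4 : ∫ s in (0 : ℝ)..t, Complex.exp (-(I * ((ν : ℂ) -
          ((0 : ℝ) : ℂ) * I) * s)) * c s = truncFourier c t ν := by
        refine intervalIntegral.integral_congr fun s _ => ?_
        simp only [Complex.ofReal_zero, zero_mul, sub_zero]
        ring_nf
      rwa [h4] at h3
    have h5 := h1.comp tendsto_one_div_nhdsGT
    have h6 := ((ENNReal.continuous_pow 2).tendsto _).comp ((continuous_enorm.tendsto _).comp h5)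
    have h7 : ‖-I * Hm ν - truncFourier c t ν‖ₑ =
        ‖truncFourier c t ν + I * Hm ν‖ₑ := by
      rw [← enorm_neg]
      congr 1
      ring
    rw [h7] at h6
    refine h6.congr fun n => ?_
    have hn : (0 : ℝ) < 1 / ((n : ℝ) + 1) := by positivity
    simp only [Function.comp_apply]
    rw [integral_dampedTail hc hB ht hn, hu _ (by
      rw [Complex.sub_im, Complex.ofReal_im, Complex.im_ofReal_mul, Complex.I_im]
      linarith)]
  · have hn : (0 : ℝ) < 1 / ((n : ℝ) + 1) := by positivity
    rw [lintegral_fourier_sq (integrable_dampedTail hc hB t hn) (memLp_dampedTail hc hB ht hn)]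
    exact mul_le_mul_right (lintegral_dampedTail_le ht hn) _

theorem lintegral_truncFourier_sub_le (hc : Continuous c) {s t : ℝ} (hst : s ≤ t) :
    ∫⁻ ν, ‖truncFourier c t ν - truncFourier c s ν‖ₑ ^ 2 ≤
      ENNReal.ofReal (2 * Real.pi) * ∫⁻ r in Set.Ioi s, ‖c r‖ₑ ^ 2 := by
  set w : ℝ → ℂ := (Set.Ioc s t).indicator c with hw
  have h1 : Integrable w :=
    ((hc.integrableOn_Icc (a := s) (b := t)).mono_set Set.Ioc_subset_Icc_self).integrable_indicator
      measurableSet_Ioc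
  obtain ⟨C, hC⟩ := isCompact_Icc.exists_bound_of_continuousOn (hc.continuousOn (s := Set.Icc s t))
  have hC0 : 0 ≤ C := (norm_nonneg _).trans (hC s ⟨le_rfl, hst⟩)
  have h2 : MemLp w 2 := by
    refine memLp_two_of_integrable_of_bound h1 (C := C) fun r => ?_
    by_cases hr : r ∈ Set.Ioc s t
    · rw [hw, Set.indicator_of_mem hr]
      exact hC r (Set.Ioc_subset_Icc_self hr)
    · rwa [hw, Set.indicator_of_notMem hr, norm_zero]
  have e : ∀ ν : ℝ, truncFourier c t ν - truncFourier c s ν =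
      ∫ r : ℝ, Complex.exp (-(I * r * ν)) * w r := by
    intro ν
    have hcont : Continuous fun r : ℝ => Complex.exp (-(I * r * ν)) * c r := by fun_prop
    rw [truncFourier, truncFourier, intervalIntegral.integral_interval_sub_left
      (hcont.intervalIntegrable _ _) (hcont.intervalIntegrable _ _),
      intervalIntegral.integral_of_le hst, ← integral_indicator measurableSet_Ioc]
    congr 1
    ext r
    by_cases hr : r ∈ Set.Ioc s t
    · rw [hw, Set.indicator_of_mem hr, Set.indicator_of_mem hr]
    · rw [hw, Set.indicator_of_notMem hr, Set.indicator_of_notMem hr, mul_zero]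
  simp only [e]
  rw [lintegral_fourier_sq h1 h2, ← lintegral_indicator measurableSet_Ioi]
  gcongr with r
  by_cases hr : r ∈ Set.Ioc s t
  · rw [hw, Set.indicator_of_mem hr, Set.indicator_of_mem (Set.Ioc_subset_Ioi_self hr)]
  · rw [hw, Set.indicator_of_notMem hr]
    simp

theorem tendsto_lintegral_Ioi_sq (hfin : ∫⁻ s in Set.Ioi (0 : ℝ), ‖c s‖ₑ ^ 2 < ∞) :
    Tendsto (fun t : ℝ => ∫⁻ s in Set.Ioi t, ‖c s‖ₑ ^ 2) atTop (𝓝 0) := by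
  set m := volume.withDensity fun s => ‖c s‖ₑ ^ 2 with hm
  have e : ∀ t : ℝ, ∫⁻ s in Set.Ioi t, ‖c s‖ₑ ^ 2 = m (Set.Ioi t) := fun t =>
    (withDensity_apply _ measurableSet_Ioi).symm
  simp only [e] at hfin ⊢
  have h1 := tendsto_measure_iInter_atTop (μ := m) (s := fun t : ℝ => Set.Ioi t)
    (fun t => measurableSet_Ioi.nullMeasurableSet) (fun a b hab => Set.Ioi_subset_Ioi hab)
    ⟨0, hfin.ne⟩
  have h2 : ⋂ t : ℝ, Set.Ioi t = ∅ := by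
    ext x
    simp only [Set.mem_iInter, Set.mem_Ioi, Set.mem_empty_iff_false, iff_false, not_forall, not_lt]
    exact ⟨x, le_rfl⟩
  rwa [h2, measure_empty] at h1

theorem tendsto_zero_of_sq_integrable {c' : ℝ → ℂ} {B' : ℝ} (hB : ∀ s, ‖c s‖ ≤ B)
    (hd : ∀ t, HasDerivAt c (c' t) t) (hB' : ∀ t, ‖c' t‖ ≤ B') (hc' : Continuous c')
    (hfin : ∫⁻ s in Set.Ioi (0 : ℝ), ‖c s‖ₑ ^ 2 < ∞) : Tendsto c atTop (𝓝 0) := by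
  have hc : Continuous c := continuous_iff_continuousAt.2 fun t => (hd t).continuousAt
  have hi : IntegrableOn (fun s => ‖c s‖ ^ 2) (Set.Ioi 0) := by
    refine ⟨(by fun_prop : Continuous fun s => ‖c s‖ ^ 2).aestronglyMeasurable, ?_⟩
    refine lt_of_eq_of_lt (lintegral_congr fun s => ?_) hfin
    rw [enorm_pow, enorm_norm]
  have h1 : ∀ t, HasDerivAt (fun t => c t ^ 4) (4 * c t ^ 3 * c' t) t := fun t => by
    have := (hd t).fun_pow 4
    simpa using this
  have hB0 : 0 ≤ B := (norm_nonneg _).trans (hB 0)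
  have hB0' : 0 ≤ B' := (norm_nonneg _).trans (hB' 0)
  have h2 : Tendsto (fun t => c t ^ 4) atTop (𝓝 0) := by
    refine tendsto_zero_of_hasDerivAt_of_integrableOn_Ioi (a := 0) (fun t _ => h1 t) ?_ ?_
    · refine (hi.const_mul (4 * B * B')).mono' (Continuous.aestronglyMeasurable (by fun_prop))
        (Eventually.of_forall fun s => ?_)
      rw [norm_mul, norm_mul, norm_pow]
      calc ‖(4 : ℂ)‖ * ‖c s‖ ^ 3 * ‖c' s‖ = 4 * ‖c s‖ * ‖c' s‖ * ‖c s‖ ^ 2 := by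
            rw [Complex.norm_ofNat]; ring
        _ ≤ _ := by
            gcongr
            · exact hB s
            · exact hB' s
    · refine (hi.const_mul (B ^ 2)).mono' (Continuous.aestronglyMeasurable (by fun_prop))
        (Eventually.of_forall fun s => ?_)
      rw [norm_pow]
      calc ‖c s‖ ^ 4 = ‖c s‖ ^ 2 * ‖c s‖ ^ 2 := by ring
        _ ≤ _ := by
            gcongr
            exact hB s
  rw [tendsto_zero_iff_norm_tendsto_zero] at h2 ⊢
  have h3 := (Real.continuous_rpow_const (q := (1 / 4 : ℝ)) (by norm_num)).tendsto 0 |>.comp h2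
  rw [Real.zero_rpow (by norm_num)] at h3
  refine h3.congr fun t => ?_
  simp only [Function.comp_apply, norm_pow]
  rw [← Real.rpow_natCast, ← Real.rpow_mul (norm_nonneg _)]
  norm_num

end Laplace

end

section

/-! ### The energy form -/

section Energy

variable {E : Type} [NormedAddCommGroup E] [InnerProductSpace ℂ E] [CompleteSpace E]
  {h0 : E →ₗ.[ℂ] E} {U : ℝ → E ≃ₗᵢ[ℂ] E} {g : E} {Ω lam : ℝ}
  {h : WithLp 2 (ℂ × E) →ₗ.[ℂ] WithLp 2 (ℂ × E)}
  {Z : ℝ → WithLp 2 (ℂ × E) ≃ₗᵢ[ℂ] WithLp 2 (ℂ × E)}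

namespace IsSpectral

theorem IsProj.sub (H : IsSpectral h0 U) {ψ ξ : E} {m m' : ℝ → ℂ} (h1 : IsProj h0 g ψ m)
    (h2 : IsProj h0 g ξ m') : IsProj h0 g (ψ - ξ) (fun ν => m ν - m' ν) := by
  have h3 := h1.add H (h2.smul (-1))
  simpa [sub_eq_add_neg] using h3

theorem IsProj.inner_eq (H : IsSpectral h0 U) {ψ : E} {m : ℝ → ℂ} (h1 : IsProj h0 g ψ m)
    {k : ℝ → ℂ} (hk : MemLp k 2 (spectralMeasure h0 g)) :
    ⟪BoseNESS.spectralApply h0 k g, ψ⟫_ℂ =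
      ⟪BoseNESS.spectralApply h0 k g, BoseNESS.spectralApply h0 m g⟫_ℂ := by
  rw [h1.2 k hk, H.inner_spectralApply hk h1.1]

theorem IsProj.eLpNorm_le (H : IsSpectral h0 U) {ψ : E} {m : ℝ → ℂ} (h1 : IsProj h0 g ψ m) :
    eLpNorm m 2 (spectralMeasure h0 g) ≤ ‖ψ‖ₑ := by
  rw [← H.enorm_spectralApply h1.1]
  have h2 := h1.inner_eq H h1.1
  set x := BoseNESS.spectralApply h0 m g
  have h3 : ‖x‖ ^ 2 ≤ ‖x‖ * ‖ψ‖ := by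
    have h4 := norm_inner_le_norm (𝕜 := ℂ) x ψ
    rw [h2, inner_self_eq_norm_sq_to_K, norm_pow, RCLike.norm_ofReal, abs_norm] at h4
    exact h4
  have h5 : ‖x‖ ≤ ‖ψ‖ := by
    rcases (norm_nonneg x).eq_or_lt with h6 | h6
    · rw [← h6]
      exact norm_nonneg _
    · rw [sq] at h3
      exact le_of_mul_le_mul_left h3 h6
  exact enorm_le_iff_norm_le.2 h5

theorem IsProj.ae_eq (H : IsSpectral h0 U) {ψ : E} {m m' : ℝ → ℂ} (h1 : IsProj h0 g ψ m)
    (h2 : IsProj h0 g ψ m') : m =ᵐ[spectralMeasure h0 g] m' := by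
  have h3 := (h1.sub H h2).eLpNorm_le H
  rw [sub_self, enorm_zero, nonpos_iff_eq_zero] at h3
  have h3' : eLpNorm (m - m') 2 (spectralMeasure h0 g) = 0 := h3
  rw [eLpNorm_eq_zero_iff (h1.1.1.sub h2.1.1) (by norm_num)] at h3'
  filter_upwards [h3'] with ν hν
  exact sub_eq_zero.1 hν

theorem IsProj.congr {ψ : E} {m m' : ℝ → ℂ} (h1 : IsProj h0 g ψ m)
    (e : m =ᵐ[spectralMeasure h0 g] m') : IsProj h0 g ψ m' := by
  refine ⟨(memLp_congr_ae e).1 h1.1, fun k hk => ?_⟩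
  rw [h1.2 k hk]
  refine integral_congr_ae ?_
  filter_upwards [e] with ν hν
  rw [hν]

/-- A vector of the domain, written with the resolvent at `i`. -/
theorem eq_resolventVec_of_graph (H : IsSpectral h0 U) {χ ζ : E} (hχ : (χ, ζ) ∈ h0.graph) :
    χ = resolventVec h0 I (I • χ - ζ) := by
  obtain ⟨y, hy, hy'⟩ := (LinearPMap.mem_graph_iff _).1 hχ
  simp only at hy hy'
  subst hy hy'
  exact (H.resolventVec_eq (by simp) rfl).symm

/-- The projection to a cyclic subspace intertwines `h` with multiplication by `ν`. -/
theorem IsProj.of_graph (H : IsSpectral h0 U) {χ ζ : E} (hχ : (χ, ζ) ∈ h0.graph) {m : ℝ → ℂ}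
    (hm : IsProj h0 g χ m) : IsProj h0 g ζ (fun ν => (ν : ℂ) * m ν) := by
  obtain ⟨p, hp⟩ := H.exists_isProj g (I • χ - ζ)
  have hI : I.im ≠ 0 := by simp
  have h1 := hp.resolventVec H hI
  rw [← H.eq_resolventVec_of_graph hχ] at h1
  have h2 := ((hm.smul I).sub H hp)
  rw [sub_sub_cancel] at h2
  refine h2.congr ?_
  filter_upwards [hm.ae_eq H h1] with ν hν
  have h3 := sub_ofReal_ne_zero hI ν
  have h4 : p ν = (I - ν) * m ν := by
    rw [hν]
    field_simp
  rw [h4]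
  ring

theorem graph_spectralApply_resolvent (H : IsSpectral h0 U) (ξ : E) :
    (resolventVec h0 I ξ, I • resolventVec h0 I ξ - ξ) ∈ h0.graph := by
  obtain ⟨a, ha, ha'⟩ := H.exists_resolvent (z := I) (by simp) ξ
  have h1 := h0.mem_graph a
  have h2 : h0 a = I • (a : E) - ξ := by
    rw [← ha']
    abel
  rwa [h2, ha] at h1

theorem inner_graph_nonneg (H : IsSpectral h0 U) {χ ζ : E} (hχ : (χ, ζ) ∈ h0.graph) :
    0 ≤ (⟪χ, ζ⟫_ℂ).re := by
  set ξ := I • χ - ζ with hξ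
  have hI : I.im ≠ 0 := by simp
  have := H.isFiniteMeasure ξ
  have h1 : IsProj h0 ξ χ (fun ν : ℝ => (I - (ν : ℂ))⁻¹ * 1) := by
    rw [H.eq_resolventVec_of_graph hχ]
    exact (IsProj.self H ξ).resolventVec H hI
  have h2 := h1.of_graph H hχ
  have h3 : χ = BoseNESS.spectralApply h0 (fun ν : ℝ => (I - (ν : ℂ))⁻¹) ξ := by
    rw [H.spectralApply_inv_sub ξ hI]
    exact H.eq_resolventVec_of_graph hχ
  have h4 : ⟪χ, ζ⟫_ℂ = ∫ ν : ℝ, (starRingEnd ℂ) ((I - (ν : ℂ))⁻¹) *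
      ((ν : ℂ) * ((I - (ν : ℂ))⁻¹ * 1)) ∂(spectralMeasure h0 ξ) := by
    rw [← h2.2 _ (memLp_inv_sub_ofReal _ hI), ← h3]
  have h5 : ∀ ν : ℝ, (starRingEnd ℂ) ((I - (ν : ℂ))⁻¹) *
      ((ν : ℂ) * ((I - (ν : ℂ))⁻¹ * 1)) =
      ((ν * ‖(I - (ν : ℂ))⁻¹‖ ^ 2 : ℝ) : ℂ) := by
    intro ν
    rw [mul_one, mul_left_comm, RCLike.conj_mul]
    push_cast
    rfl
  simp only [h5] at h4
  rw [h4, integral_complex_ofReal, Complex.ofReal_re]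
  refine integral_nonneg_of_ae ?_
  filter_upwards [H.ae_nonneg ξ] with ν hν
  exact mul_nonneg hν (sq_nonneg _)

theorem inner_graph_ge (H : IsSpectral h0 U) {χ ζ : E} (hχ : (χ, ζ) ∈ h0.graph) {m : ℝ → ℂ}
    (hm : IsProj h0 g χ m) :
    ∫ ν : ℝ, ν * ‖m ν‖ ^ 2 ∂(spectralMeasure h0 g) ≤ (⟪χ, ζ⟫_ℂ).re := by
  have hI : I.im ≠ 0 := by simp
  have hζ := hm.of_graph H hχ
  set x := BoseNESS.spectralApply h0 m g with hx
  set y := BoseNESS.spectralApply h0 (fun ν : ℝ => (ν : ℂ) * m ν) g with hy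
  have hxy : (x, y) ∈ h0.graph := by
    have hp : MemLp (fun ν : ℝ => I * m ν - (ν : ℂ) * m ν) 2 (spectralMeasure h0 g) :=
      (hm.1.const_mul _).sub hζ.1
    have h1 := H.graph_spectralApply_resolvent (BoseNESS.spectralApply h0
      (fun ν : ℝ => I * m ν - (ν : ℂ) * m ν) g)
    have h2 : resolventVec h0 I (BoseNESS.spectralApply h0
        (fun ν : ℝ => I * m ν - (ν : ℂ) * m ν) g) = x := by
      rw [H.resolventVec_spectralApply hp hI, hx]
      congr 1
      ext ν
      have := sub_ofReal_ne_zero hI ν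
      field_simp
    rw [h2, H.spectralApply_fun_sub (hm.1.const_mul _) hζ.1, H.spectralApply_fun_smul hm.1,
      sub_sub_cancel] at h1
    exact h1
  have hsub : (χ - x, ζ - y) ∈ h0.graph := h0.graph.sub_mem hχ hxy
  have h3 := H.inner_graph_nonneg hsub
  have e1 : ⟪x, ζ⟫_ℂ = ⟪x, y⟫_ℂ := hζ.inner_eq H hm.1
  have e2 : ⟪χ, y⟫_ℂ = ⟪x, y⟫_ℂ := by
    rw [← inner_conj_symm, hm.inner_eq H hζ.1, inner_conj_symm]
  have e3 : ⟪x, y⟫_ℂ = ((∫ ν : ℝ, ν * ‖m ν‖ ^ 2 ∂(spectralMeasure h0 g) : ℝ) : ℂ) := by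
    rw [hx, hy, H.inner_spectralApply hm.1 hζ.1, ← integral_complex_ofReal]
    congr 1
    ext ν
    rw [mul_left_comm, RCLike.conj_mul]
    push_cast
    rfl
  rw [inner_sub_left, inner_sub_right, inner_sub_right, e1, e2, e3] at h3
  simp only [Complex.sub_re, Complex.ofReal_re] at h3
  linarith

end IsSpectral

open IsSpectral

/-- `-η(0) = Ω - λ² ∫ ν⁻¹ dμ(ν)`. -/
def gap (μ : Measure ℝ) (Ω lam : ℝ) : ℝ := Ω - lam ^ 2 * ∫ ν, ν⁻¹ ∂μ

/-- The energy form of the coupled system dominates the form of `h₀⁻¹`. -/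
theorem IsCoupled.energy_ge (hh : IsCoupled h0 g Ω lam h) (H : IsSpectral h0 U)
    (hg : InvFinite h0 g) {u f : WithLp 2 (ℂ × E)} (hu : (u, f) ∈ h.graph) {n : ℝ → ℂ}
    (hn : IsProj h0 g f.snd n) :
    Integrable (fun ν => ‖n ν‖ ^ 2 * ν⁻¹) (spectralMeasure h0 g) ∧
    ∫ ν, ‖n ν‖ ^ 2 * ν⁻¹ ∂(spectralMeasure h0 g) + gap (spectralMeasure h0 g) Ω lam * ‖u.fst‖ ^ 2 ≤
      (⟪u, f⟫_ℂ).re := by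
  have := H.isFiniteMeasure g
  obtain ⟨hg1, hfst⟩ := (hh _ _).1 hu
  obtain ⟨m, hm⟩ := H.exists_isProj g u.snd
  set a := u.fst with ha
  have h1 := hm.of_graph H hg1
  have h2 : IsProj h0 g f.snd (fun ν : ℝ => (ν : ℂ) * m ν + (lam * a) * 1) := by
    have h3 := h1.add H ((IsProj.self H g).smul ((lam : ℂ) * a))
    rwa [sub_add_cancel] at h3
  have hae := hn.ae_eq H h2
  have hpt : ∀ᵐ ν ∂(spectralMeasure h0 g), ‖n ν‖ ^ 2 * ν⁻¹ = ν * ‖m ν‖ ^ 2 +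
      2 * lam * ((starRingEnd ℂ) a * m ν).re + lam ^ 2 * ‖a‖ ^ 2 * ν⁻¹ := by
    filter_upwards [hae, hg.ae_pos] with ν hν hpos
    rw [hν, ← Complex.normSq_eq_norm_sq, ← Complex.normSq_eq_norm_sq, ← Complex.normSq_eq_norm_sq,
      Complex.normSq_apply, Complex.normSq_apply, Complex.normSq_apply]
    simp only [Complex.add_re, Complex.add_im, Complex.mul_re, Complex.mul_im, Complex.ofReal_re,
      Complex.ofReal_im, Complex.one_re, Complex.one_im, Complex.conj_re, Complex.conj_im]
    field_simp
    ring
  have hi1 : Integrable (fun ν : ℝ => ν * ‖m ν‖ ^ 2) (spectralMeasure h0 g) := by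
    have h4 := (hm.1.star.integrable_mul h1.1).re
    refine h4.congr (Eventually.of_forall fun ν => ?_)
    simp only [Pi.star_apply, Pi.mul_apply, RCLike.star_def]
    have h5 : (starRingEnd ℂ) (m ν) * ((ν : ℂ) * m ν) = ((ν * ‖m ν‖ ^ 2 : ℝ) : ℂ) := by
      rw [mul_left_comm, RCLike.conj_mul]
      push_cast
      rfl
    rw [h5]
    exact Complex.ofReal_re _
  have hm1 : Integrable m (spectralMeasure h0 g) := hm.1.integrable (by norm_num)
  have hi2' : Integrable (fun ν : ℝ => (starRingEnd ℂ) a * m ν) (spectralMeasure h0 g) :=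
    hm1.const_mul _
  have hi2 : Integrable (fun ν : ℝ => 2 * lam * ((starRingEnd ℂ) a * m ν).re)
      (spectralMeasure h0 g) := hi2'.re.const_mul _
  have hi3 : Integrable (fun ν : ℝ => lam ^ 2 * ‖a‖ ^ 2 * ν⁻¹) (spectralMeasure h0 g) :=
    hg.integrable.const_mul _
  have hi12 : Integrable (fun ν : ℝ => ν * ‖m ν‖ ^ 2 +
      2 * lam * ((starRingEnd ℂ) a * m ν).re) (spectralMeasure h0 g) := hi1.add hi2
  refine ⟨(hi12.add hi3).congr (by filter_upwards [hpt] with ν hν using hν.symm), ?_⟩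
  rw [integral_congr_ae hpt, integral_add hi12 hi3, integral_add hi1 hi2,
    integral_const_mul, integral_const_mul]
  have e1 : ∫ ν, ((starRingEnd ℂ) a * m ν).re ∂(spectralMeasure h0 g) =
      ((starRingEnd ℂ) a * ⟪g, u.snd⟫_ℂ).re := by
    have h5 := hm.2 (fun _ => 1) (memLp_const 1)
    rw [H.spectralApply_one] at h5
    simp only [map_one, one_mul] at h5
    rw [h5, ← integral_const_mul]
    exact integral_re hi2'
  have h6 := H.inner_graph_ge hg1 hm
  rw [WithLp.prod_inner_apply]
  simp only [WithLp.ofLp_fst, WithLp.ofLp_snd, RCLike.inner_apply]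
  rw [e1, gap, hfst]
  rw [inner_sub_right, inner_smul_right] at h6
  have e2 : ((Ω * a + lam * ⟪g, u.snd⟫_ℂ) * (starRingEnd ℂ) a + ⟪u.snd, f.snd⟫_ℂ).re =
      Ω * ‖a‖ ^ 2 + lam * ((starRingEnd ℂ) a * ⟪g, u.snd⟫_ℂ).re + (⟪u.snd, f.snd⟫_ℂ).re := by
    rw [← Complex.normSq_eq_norm_sq, Complex.normSq_apply]
    simp only [Complex.add_re, Complex.mul_re, Complex.mul_im, Complex.ofReal_re, Complex.add_im,
      Complex.ofReal_im, Complex.conj_re, Complex.conj_im]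
    ring
  have e3 : ((lam : ℂ) * a * ⟪u.snd, g⟫_ℂ).re =
      lam * ((starRingEnd ℂ) a * ⟪g, u.snd⟫_ℂ).re := by
    rw [← inner_conj_symm u.snd g]
    simp only [Complex.mul_re, Complex.mul_im, Complex.ofReal_re, Complex.ofReal_im,
      Complex.conj_re, Complex.conj_im]
    ring
  rw [Complex.sub_re, e3] at h6
  rw [e2]
  nlinarith [h6]

/-! ### Decay of the level amplitude -/

/-- The measure `ν⁻¹ dμ(ν)`. -/
def weightedMeasure (μ : Measure ℝ) : Measure ℝ := μ.withDensity fun ν => (ENNReal.ofReal ν)⁻¹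

theorem weightedMeasure_ac (μ : Measure ℝ) : weightedMeasure μ ≪ μ :=
  withDensity_absolutelyContinuous _ _

theorem InvFinite.lintegral_weightedMeasure (hg : InvFinite h0 g) (k : ℝ → ℝ≥0∞) :
    ∫⁻ ν, k ν ∂(weightedMeasure (spectralMeasure h0 g)) =
      ∫⁻ ν, k ν * (ENNReal.ofReal ν)⁻¹ ∂(spectralMeasure h0 g) := by
  rw [weightedMeasure, lintegral_withDensity_eq_lintegral_mul_non_measurable _
    measurable_inv_ofReal]
  · simp only [Pi.mul_apply, mul_comm]
  · filter_upwards [hg.ae_pos] with ν hν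
    simpa using hν

theorem InvFinite.eLpNorm_weightedMeasure (hg : InvFinite h0 g) (k : ℝ → ℂ) :
    eLpNorm k 2 (weightedMeasure (spectralMeasure h0 g)) ^ 2 =
      ∫⁻ ν, ‖k ν‖ₑ ^ 2 * (ENNReal.ofReal ν)⁻¹ ∂(spectralMeasure h0 g) := by
  rw [eLpNorm_two_sq, hg.lintegral_weightedMeasure]

theorem InvFinite.isFiniteMeasure (hg : InvFinite h0 g) :
    IsFiniteMeasure (weightedMeasure (spectralMeasure h0 g)) :=
  isFiniteMeasure_withDensity hg.ne

theorem enorm_sq_mul_inv_ofReal (k : ℂ) {ν : ℝ} (hν : 0 < ν) :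
    ‖k‖ₑ ^ 2 * (ENNReal.ofReal ν)⁻¹ = ENNReal.ofReal (‖k‖ ^ 2 * ν⁻¹) := by
  rw [ENNReal.ofReal_mul (by positivity), ENNReal.ofReal_inv_of_pos hν,
    ENNReal.ofReal_pow (norm_nonneg _), ofReal_norm]

theorem InvFinite.eLpNorm_weightedMeasure_le (hg : InvFinite h0 g) {k : ℝ → ℂ}
    (hi : Integrable (fun ν => ‖k ν‖ ^ 2 * ν⁻¹) (spectralMeasure h0 g)) {C : ℝ}
    (hC : ∫ ν, ‖k ν‖ ^ 2 * ν⁻¹ ∂(spectralMeasure h0 g) ≤ C) :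
    eLpNorm k 2 (weightedMeasure (spectralMeasure h0 g)) ^ 2 ≤ ENNReal.ofReal C := by
  rw [hg.eLpNorm_weightedMeasure]
  refine le_trans (le_of_eq ?_) (ENNReal.ofReal_le_ofReal hC)
  rw [ofReal_integral_eq_lintegral_ofReal hi]
  · refine lintegral_congr_ae ?_
    filter_upwards [hg.ae_pos] with ν hν using enorm_sq_mul_inv_ofReal _ hν
  · filter_upwards [hg.ae_pos] with ν hν
    change 0 ≤ ‖k ν‖ ^ 2 * ν⁻¹
    positivity

theorem IsSpectral.memLp_exp_mul {μ : Measure ℝ} {k : ℝ → ℂ} (hk : MemLp k 2 μ) (t : ℝ) :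
    MemLp (fun ν : ℝ => Complex.exp (I * t * ν) * k ν) 2 μ := by
  refine hk.of_le ?_ (Eventually.of_forall fun ν => le_of_eq ?_)
  · exact (Continuous.aestronglyMeasurable (by fun_prop)).mul hk.1
  · rw [norm_mul, mul_assoc, mul_comm I, ← Complex.ofReal_mul,
      Complex.norm_exp_ofReal_mul_I, one_mul]

theorem IsSpectral.apply_spectralApply (H : IsSpectral h0 U) {k : ℝ → ℂ}
    (hk : MemLp k 2 (spectralMeasure h0 g)) (t : ℝ) : U t (spectralApply h0 k g) =
      spectralApply h0 (fun ν : ℝ => Complex.exp (I * t * ν) * k ν) g := by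
  rw [← H.spectralApply_exp, H.spectralApply_spectralApply hk (by fun_prop)
    (memLp_exp_mul hk t)]

theorem IsSpectral.IsProj.apply (H : IsSpectral h0 U) {ψ : E} {m : ℝ → ℂ}
    (hm : IsProj h0 g ψ m) (t : ℝ) :
    IsProj h0 g (U t ψ) (fun ν : ℝ => Complex.exp (I * t * ν) * m ν) := by
  refine ⟨IsSpectral.memLp_exp_mul hm.1 t, fun k hk => ?_⟩
  have h1 := H.group.inner_apply_left (-t) (BoseNESS.spectralApply h0 k g) ψ
  rw [neg_neg] at h1
  rw [← h1, H.apply_spectralApply hk, hm.2 _ (IsSpectral.memLp_exp_mul hk (-t))]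
  refine integral_congr_ae (Eventually.of_forall fun ν => ?_)
  simp only [map_mul, ← Complex.exp_conj, Complex.conj_I, Complex.conj_ofReal]
  push_cast
  ring_nf

/-- The hypotheses on a level coupled to a reservoir under which its amplitude decays. -/
structure IsDecaying (h0 : E →ₗ.[ℂ] E) (U : ℝ → E ≃ₗᵢ[ℂ] E) (g : E) (Ω lam : ℝ)
    (h : WithLp 2 (ℂ × E) →ₗ.[ℂ] WithLp 2 (ℂ × E))
    (Z : ℝ → WithLp 2 (ℂ × E) ≃ₗᵢ[ℂ] WithLp 2 (ℂ × E)) : Prop where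
  spectral : IsSpectral h0 U
  coupled : IsCoupled h0 g Ω lam h
  group : IsUnitaryGroupOf h Z
  resBounded : ResBounded h0 g g
  invFinite : InvFinite h0 g
  pos : 0 < Ω
  coupling_ne : lam ≠ 0
  eta : ∃ κ > 0, ∀ z : ℂ, z.im ≠ 0 → κ ≤ ‖etaFn (spectralMeasure h0 g) Ω lam z‖

/-- `⟨g, (z - h)⁻¹ ψ⟩` is bounded on the lower half plane. -/
def LowerBounded (h0 : E →ₗ.[ℂ] E) (g ψ : E) : Prop :=
  ∃ C : ℝ, ∀ z : ℂ, z.im < 0 → ‖⟪g, resolventVec h0 z ψ⟫_ℂ‖ ≤ C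

theorem LowerBounded.sub (H : IsSpectral h0 U) {ψ ξ : E} (hψ : LowerBounded h0 g ψ)
    (hξ : LowerBounded h0 g ξ) : LowerBounded h0 g (ψ - ξ) := by
  obtain ⟨C, hC⟩ := hψ
  obtain ⟨D, hD⟩ := hξ
  refine ⟨C + D, fun z hz => ?_⟩
  rw [H.resolventVec_sub hz.ne, inner_sub_right]
  exact (norm_sub_le _ _).trans (add_le_add (hC z hz) (hD z hz))

theorem LowerBounded.smul (H : IsSpectral h0 U) {ψ : E} (hψ : LowerBounded h0 g ψ) (c : ℂ) :
    LowerBounded h0 g (c • ψ) := by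
  obtain ⟨C, hC⟩ := hψ
  refine ⟨‖c‖ * C, fun z hz => ?_⟩
  rw [H.resolventVec_smul hz.ne, inner_smul_right, norm_mul]
  gcongr
  exact hC z hz

theorem LowerBounded.resolventVec (H : IsSpectral h0 U) {ψ : E} (hψ : LowerBounded h0 g ψ) {w : ℂ}
    (hw : 0 < w.im) : LowerBounded h0 g (resolventVec h0 w ψ) := by
  obtain ⟨C, hC⟩ := hψ
  refine ⟨w.im⁻¹ * (C + ‖⟪g, BoseNESS.resolventVec h0 w ψ⟫_ℂ‖), fun z hz => ?_⟩
  have h1 := congrArg (fun x => ⟪g, x⟫_ℂ) (H.resolventVec_identity hz.ne hw.ne' ψ)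
  simp only [inner_sub_right, inner_smul_right] at h1
  have h2 : w.im ≤ ‖w - z‖ := by
    refine le_trans ?_ ((le_abs_self _).trans (Complex.abs_im_le_norm (w - z)))
    rw [Complex.sub_im]
    linarith
  have h3 := norm_sub_le ⟪g, BoseNESS.resolventVec h0 z ψ⟫_ℂ ⟪g, BoseNESS.resolventVec h0 w ψ⟫_ℂ
  rw [h1, norm_mul] at h3
  rw [inv_mul_eq_div, le_div_iff₀ hw]
  calc _ ≤ ‖w - z‖ * ‖⟪g, BoseNESS.resolventVec h0 z (BoseNESS.resolventVec h0 w ψ)⟫_ℂ‖ := by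
        rw [mul_comm]
        gcongr
    _ ≤ _ := h3.trans (by gcongr; exact hC z hz)

namespace IsDecaying

theorem gap_pos (D : IsDecaying h0 U g Ω lam h Z) : 0 < gap (spectralMeasure h0 g) Ω lam := by
  obtain ⟨κ, hκ, hη⟩ := D.eta
  have := etaFn_zero_le D.spectral D.invFinite hκ hη D.pos
  rw [gap]
  linarith

theorem lintegral_amp_lt_top (D : IsDecaying h0 U g Ω lam h Z) {f : WithLp 2 (ℂ × E)}
    (hf : LowerBounded h0 g f.snd) : ∫⁻ s in Set.Ioi (0 : ℝ), ‖amp Z f s‖ₑ ^ 2 < ∞ := by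
  obtain ⟨C, hC⟩ := hf
  obtain ⟨κ, hκ, hη⟩ := D.eta
  obtain ⟨A, hA, hA'⟩ := exists_one_add_norm_le_etaFn D.spectral D.resBounded hκ hη
  refine lintegral_sq_lt_top_of_laplace (K := (‖f.fst‖ + |lam| * C) * A)
    (continuous_amp D.group f) (norm_amp_le f) fun z hz => ?_
  rw [D.coupled.laplace_amp D.spectral D.group f hz, norm_mul, norm_neg, Complex.norm_I, one_mul,
    norm_div]
  have h1 : ‖ampNum h0 g lam f z‖ ≤ ‖f.fst‖ + |lam| * C := by
    refine (norm_add_le _ _).trans ?_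
    rw [norm_mul, Complex.norm_real, Real.norm_eq_abs]
    gcongr
    exact hC z hz
  have h2 : 0 < ‖etaFn (spectralMeasure h0 g) Ω lam z‖ := hκ.trans_le (hη z hz.ne)
  rw [div_le_div_iff₀ h2 (by positivity), mul_assoc]
  exact mul_le_mul h1 (hA' z hz.ne) (by positivity) ((norm_nonneg _).trans h1)

theorem tendsto_amp (D : IsDecaying h0 U g Ω lam h Z) {f : WithLp 2 (ℂ × E)}
    (hf : LowerBounded h0 g f.snd) : Tendsto (amp Z f) atTop (𝓝 0) := by
  refine tendsto_zero_of_sq_integrable (norm_amp_le f)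
    (D.coupled.hasDerivAt_amp D.spectral D.group f)
    (B' := |Ω| * ‖f‖ + |lam| * (‖g‖ * ‖f‖)) (fun t => ?_) ?_ (D.lintegral_amp_lt_top hf)
  · rw [norm_mul, Complex.norm_I, one_mul]
    refine (norm_add_le _ _).trans ?_
    rw [norm_mul, norm_mul, Complex.norm_real, Complex.norm_real, Real.norm_eq_abs,
      Real.norm_eq_abs]
    gcongr
    · exact norm_amp_le f t
    · refine (norm_inner_le_norm _ _).trans ?_
      gcongr
      exact (norm_snd_le _).trans_eq ((Z t).norm_map f)
  · have h1 := continuous_amp D.group f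
    have h2 : Continuous fun t => (Z t f).snd :=
      (WithLp.sndL 2 ℂ ℂ E).continuous.comp (D.group.continuous f)
    fun_prop

/-- The projection to the cyclic subspace of `g` of the reservoir component in the interaction
picture. -/
theorem isProj_snd (D : IsDecaying h0 U g Ω lam h Z) {f : WithLp 2 (ℂ × E)} {m : ℝ → ℂ}
    (hm : IsProj h0 g f.snd m) (t : ℝ) :
    IsProj h0 g (U (-t) (Z t f).snd)
      (fun ν => m ν + I * lam * truncFourier (amp Z f) t ν) := by
  have := D.spectral.isFiniteMeasure g
  rw [D.coupled.snd_apply D.spectral D.group, D.spectral.group.apply_neg_apply]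
  exact hm.add D.spectral ((IsProj.spectralApply_self D.spectral
    (IsSpectral.memLp_truncFourier _ (continuous_amp D.group f) (norm_amp_le f) t)).smul _)

theorem isProj_snd' (D : IsDecaying h0 U g Ω lam h Z) {f : WithLp 2 (ℂ × E)} {m : ℝ → ℂ}
    (hm : IsProj h0 g f.snd m) (t : ℝ) :
    IsProj h0 g (Z t f).snd (fun ν => Complex.exp (I * t * ν) *
      (m ν + I * lam * truncFourier (amp Z f) t ν)) := by
  have h1 := (D.isProj_snd hm t).apply D.spectral t
  rwa [D.spectral.group.apply_apply_neg] at h1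

end IsDecaying

/-! ### Approximation by vectors in the range of the coupled operator -/

/-- The point `i/(j+1)`. -/
def imPoint (j : ℕ) : ℂ := ((1 / ((j : ℝ) + 1) : ℝ) : ℂ) * I

theorem imPoint_im (j : ℕ) : (imPoint j).im = 1 / ((j : ℝ) + 1) := by
  rw [imPoint, Complex.im_ofReal_mul, Complex.I_im, mul_one]

theorem imPoint_im_pos (j : ℕ) : 0 < (imPoint j).im := by
  rw [imPoint_im]
  positivity

theorem tendsto_imPoint : Tendsto imPoint atTop (𝓝 0) := by
  have h1 : Tendsto (fun j : ℕ => ((1 / ((j : ℝ) + 1) : ℝ) : ℂ) * I) atTop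
      (𝓝 (((0 : ℝ) : ℂ) * I)) :=
    ((Complex.continuous_ofReal.tendsto _).comp tendsto_one_div_add_atTop_nhds_zero_nat).mul_const _
  rwa [Complex.ofReal_zero, zero_mul] at h1

theorem norm_inv_imPoint_sub_le (j : ℕ) {ν : ℝ} (hν : 0 < ν) :
    ‖(imPoint j - (ν : ℂ))⁻¹‖ ≤ ν⁻¹ := by
  rw [norm_inv]
  refine inv_anti₀ hν ?_
  refine le_trans ?_ (Complex.abs_re_le_norm _)
  simp [imPoint, abs_of_pos hν]

theorem tendsto_inv_imPoint_sub {ν : ℝ} (hν : 0 < ν) :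
    Tendsto (fun j => (imPoint j - (ν : ℂ))⁻¹) atTop (𝓝 (-(ν : ℂ)⁻¹)) := by
  have h1 : Tendsto (fun j => imPoint j - (ν : ℂ)) atTop (𝓝 (0 - (ν : ℂ))) :=
    tendsto_imPoint.sub_const _
  have h2 := h1.inv₀ (by simpa using hν.ne')
  rwa [zero_sub, inv_neg] at h2

/-- `‖(R(z) - R(w)) ψ‖` in the form sense, for `z`, `w` on the imaginary axis. -/
theorem IsSpectral.inner_resolventVec_sub (H : IsSpectral h0 U) (ψ : E) {z w : ℂ} (hz : z.im ≠ 0)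
    (hw : w.im ≠ 0) :
    ⟪resolventVec h0 z ψ - resolventVec h0 w ψ,
      z • resolventVec h0 z ψ - w • resolventVec h0 w ψ⟫_ℂ =
      ((∫ ν : ℝ, ν * ‖(z - (ν : ℂ))⁻¹ - (w - (ν : ℂ))⁻¹‖ ^ 2 ∂(spectralMeasure h0 ψ) : ℝ) : ℂ) := by
  have := H.isFiniteMeasure ψ
  have hz1 := memLp_inv_sub_ofReal (spectralMeasure h0 ψ) hz
  have hw1 := memLp_inv_sub_ofReal (spectralMeasure h0 ψ) hw
  rw [← H.spectralApply_inv_sub ψ hz, ← H.spectralApply_inv_sub ψ hw,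
    ← H.spectralApply_fun_smul hz1, ← H.spectralApply_fun_smul hw1,
    ← H.spectralApply_fun_sub hz1 hw1,
    ← H.spectralApply_fun_sub (hz1.const_mul _) (hw1.const_mul _),
    H.inner_spectralApply (n := fun ν : ℝ => (z - (ν : ℂ))⁻¹ - (w - (ν : ℂ))⁻¹)
      (n' := fun ν : ℝ => z * (z - (ν : ℂ))⁻¹ - w * (w - (ν : ℂ))⁻¹) (hz1.sub hw1)
      ((hz1.const_mul _).sub (hw1.const_mul _)), ← integral_complex_ofReal]
  congr 1
  ext ν
  have e1 := sub_ofReal_ne_zero hz ν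
  have e2 := sub_ofReal_ne_zero hw ν
  have e3 : z * (z - (ν : ℂ))⁻¹ - w * (w - (ν : ℂ))⁻¹ =
      (ν : ℂ) * ((z - (ν : ℂ))⁻¹ - (w - (ν : ℂ))⁻¹) := by
    field_simp
    ring
  rw [e3, mul_left_comm, RCLike.conj_mul]
  push_cast
  rfl

theorem InvFinite.tendsto_integral_mul_sq {ψ : E} (hψ : InvFinite h0 ψ) {a : ℕ → ℝ → ℂ}
    {a' : ℝ → ℂ} (ha : ∀ j, Measurable (a j)) (hb : ∀ j ν, 0 < ν → ‖a j ν‖ ≤ 2 * ν⁻¹)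
    (hlim : ∀ ν, 0 < ν → Tendsto (fun j => a j ν) atTop (𝓝 (a' ν))) :
    Tendsto (fun j => ∫ ν : ℝ, ν * ‖a j ν‖ ^ 2 ∂(spectralMeasure h0 ψ)) atTop
      (𝓝 (∫ ν : ℝ, ν * ‖a' ν‖ ^ 2 ∂(spectralMeasure h0 ψ))) := by
  refine tendsto_integral_of_dominated_convergence (fun ν => 4 * ν⁻¹) (fun j => ?_)
    (hψ.integrable.const_mul 4) (fun j => ?_) ?_
  · exact (measurable_id.mul ((ha j).norm.pow_const 2)).aestronglyMeasurable
  · filter_upwards [hψ.ae_pos] with ν hν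
    rw [norm_mul, norm_pow, norm_norm, Real.norm_of_nonneg hν.le]
    calc ν * ‖a j ν‖ ^ 2 ≤ ν * (2 * ν⁻¹) ^ 2 := by
          gcongr
          exact hb j ν hν
      _ = 4 * ν⁻¹ := by
          field_simp
          norm_num
  · filter_upwards [hψ.ae_pos] with ν hν
    exact ((hlim ν hν).norm.pow 2).const_mul ν

theorem IsSpectral.tendsto_smul_resolventVec (H : IsSpectral h0 U) {ψ : E} (hψ : InvFinite h0 ψ) :
    Tendsto (fun j => imPoint j • resolventVec h0 (imPoint j) ψ) atTop (𝓝 0) := by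
  have := H.isFiniteMeasure ψ
  have hz : ∀ j, (imPoint j).im ≠ 0 := fun j => (imPoint_im_pos j).ne'
  have h1 : ∀ j, ‖imPoint j • resolventVec h0 (imPoint j) ψ‖ ^ 2 =
      ∫ ν : ℝ, ‖imPoint j * (imPoint j - (ν : ℂ))⁻¹‖ ^ 2 ∂(spectralMeasure h0 ψ) := by
    intro j
    have h2 := memLp_inv_sub_ofReal (spectralMeasure h0 ψ) (hz j)
    rw [← H.spectralApply_inv_sub ψ (hz j), ← H.spectralApply_fun_smul h2,
      H.norm_spectralApply_sq (h2.const_mul _)]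
  have h3 : Tendsto (fun j => ∫ ν : ℝ, ‖imPoint j * (imPoint j - (ν : ℂ))⁻¹‖ ^ 2
      ∂(spectralMeasure h0 ψ)) atTop (𝓝 (∫ _ : ℝ, (0 : ℝ) ∂(spectralMeasure h0 ψ))) := by
    refine tendsto_integral_of_dominated_convergence (fun _ => 1) (fun j => ?_)
      (integrable_const 1) (fun j => Eventually.of_forall fun ν => ?_) ?_
    · exact Measurable.aestronglyMeasurable (by fun_prop)
    · rw [norm_pow, norm_norm, norm_mul, norm_inv, ← div_eq_mul_inv]
      have h4 : ‖imPoint j‖ ≤ ‖imPoint j - (ν : ℂ)‖ := by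
        have h5 : ‖imPoint j‖ = |(imPoint j - (ν : ℂ)).im| := by
          rw [Complex.sub_im, Complex.ofReal_im, sub_zero, imPoint_im, imPoint, norm_mul,
            Complex.norm_I, mul_one, Complex.norm_real, Real.norm_eq_abs]
        rw [h5]
        exact Complex.abs_im_le_norm _
      exact pow_le_one₀ (by positivity) (div_le_one_of_le₀ h4 (norm_nonneg _))
    · filter_upwards [hψ.ae_pos] with ν hν
      have h6 := ((tendsto_imPoint.mul (tendsto_inv_imPoint_sub hν)).norm).pow 2
      simpa using h6
  rw [tendsto_zero_iff_norm_tendsto_zero]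
  simp only [← h1, integral_zero] at h3
  have h7 := h3.sqrt
  simpa [Real.sqrt_sq] using h7

theorem IsSpectral.IsProj.integrable_inv_mul (H : IsSpectral h0 U) {ψ : E} {m : ℝ → ℂ}
    (hm : IsProj h0 g ψ m) (hg : InvFinite h0 g) (hψ : InvFinite h0 ψ) :
    Integrable (fun ν : ℝ => (ν : ℂ)⁻¹ * m ν) (spectralMeasure h0 g) := by
  refine (hg.memLp_sqrt.integrable_mul (hm.memLp_inv_sqrt_mul H hg hψ)).congr ?_
  filter_upwards [hg.ae_pos] with ν hν
  rw [Pi.mul_apply, ← mul_assoc, ← Complex.ofReal_mul, ← mul_inv, Real.mul_self_sqrt hν.le,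
    Complex.ofReal_inv]

theorem IsSpectral.IsProj.tendsto_inner_resolventVec (H : IsSpectral h0 U) {ψ : E} {m : ℝ → ℂ}
    (hm : IsProj h0 g ψ m) (hg : InvFinite h0 g) (hψ : InvFinite h0 ψ) :
    Tendsto (fun j => ⟪g, BoseNESS.resolventVec h0 (imPoint j) ψ⟫_ℂ) atTop
      (𝓝 (-∫ ν : ℝ, (ν : ℂ)⁻¹ * m ν ∂(spectralMeasure h0 g))) := by
  have hi := hm.integrable_inv_mul H hg hψ
  have h1 : ∀ j, ⟪g, BoseNESS.resolventVec h0 (imPoint j) ψ⟫_ℂ =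
      ∫ ν : ℝ, (imPoint j - (ν : ℂ))⁻¹ * m ν ∂(spectralMeasure h0 g) :=
    fun j => hm.inner_resolventVec H (imPoint_im_pos j).ne'
  simp only [h1]
  rw [← integral_neg]
  refine tendsto_integral_of_dominated_convergence (fun ν => ‖(ν : ℂ)⁻¹ * m ν‖) (fun j => ?_)
    hi.norm (fun j => ?_) ?_
  · exact (Measurable.aestronglyMeasurable (by fun_prop)).mul hm.1.1
  · filter_upwards [hg.ae_pos] with ν hν
    rw [norm_mul, norm_mul]
    refine mul_le_mul_of_nonneg_right ?_ (norm_nonneg _)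
    refine (norm_inv_imPoint_sub_le j hν).trans_eq ?_
    rw [norm_inv, Complex.norm_real, Real.norm_of_nonneg hν.le]
  · filter_upwards [hg.ae_pos] with ν hν
    have := (tendsto_inv_imPoint_sub hν).mul_const (m ν)
    rwa [neg_mul] at this

/-- The level component of `h⁻¹ f`. -/
def invAmp (h0 : E →ₗ.[ℂ] E) (g : E) (Ω lam : ℝ) (f : WithLp 2 (ℂ × E)) (m : ℝ → ℂ) : ℂ :=
  (f.fst - lam * ∫ ν : ℝ, (ν : ℂ)⁻¹ * m ν ∂(spectralMeasure h0 g)) /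
    (gap (spectralMeasure h0 g) Ω lam : ℂ)

theorem IsDecaying.exists_approx (D : IsDecaying h0 U g Ω lam h Z) {f : WithLp 2 (ℂ × E)}
    {m : ℝ → ℂ} (hm : IsProj h0 g f.snd m) (hf : InvFinite h0 f.snd)
    (hb : LowerBounded h0 g f.snd) :
    ∃ (u F : ℕ → WithLp 2 (ℂ × E)) (p : ℕ → ℝ → ℂ) (ρ : ℕ → ℝ),
      (∀ j, (u j, F j) ∈ h.graph) ∧ (∀ j, (u j).fst = invAmp h0 g Ω lam f m) ∧
      (∀ j, LowerBounded h0 g (u j).snd) ∧ Tendsto F atTop (𝓝 f) ∧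
      (∀ j, IsProj h0 g (F j).snd (p j)) ∧
      (∀ᵐ ν ∂(spectralMeasure h0 g), Tendsto (fun j => p j ν) atTop (𝓝 (m ν))) ∧
      Tendsto ρ atTop (𝓝 0) ∧
      ∀ j, Tendsto (fun i => (⟪u i - u j, F i - F j⟫_ℂ).re) atTop (𝓝 (ρ j)) := by
  have H := D.spectral
  have hg := D.invFinite
  set a := invAmp h0 g Ω lam f m with ha
  set ψ := f.snd - ((lam : ℂ) * a) • g with hψ
  have hfin : InvFinite h0 ψ := by
    rw [hψ, sub_eq_add_neg, ← neg_smul]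
    exact hf.add H (hg.smul H _)
  have hlb : LowerBounded h0 g ψ := by
    obtain ⟨C, hC⟩ := D.resBounded
    exact hb.sub H (LowerBounded.smul H ⟨C, fun z hz => hC z hz.ne⟩ _)
  have hz : ∀ j, (imPoint j).im ≠ 0 := fun j => (imPoint_im_pos j).ne'
  have hm' : IsProj h0 g ψ (fun ν => m ν - (lam * a) * 1) :=
    hm.sub H ((IsProj.self H g).smul _)
  set r : ℕ → E := fun j => resolventVec h0 (imPoint j) ψ with hr
  refine ⟨fun j => WithLp.toLp 2 (a, -r j), fun j => WithLp.toLp 2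
    ((Ω : ℂ) * a + lam * ⟪g, -r j⟫_ℂ, f.snd - imPoint j • r j),
    fun j ν => m ν - imPoint j * ((imPoint j - (ν : ℂ))⁻¹ * (m ν - (lam * a) * 1)),
    fun j => ∫ ν : ℝ, ν * ‖-(ν : ℂ)⁻¹ - (imPoint j - (ν : ℂ))⁻¹‖ ^ 2 ∂(spectralMeasure h0 ψ),
    fun j => ?_, fun j => rfl, fun j => ?_, ?_, fun j => ?_, ?_, ?_, fun j => ?_⟩
  · refine (D.coupled _ _).2 ⟨?_, rfl⟩
    change (-r j, f.snd - imPoint j • r j - ((lam : ℂ) * a) • g) ∈ h0.graph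
    obtain ⟨x, hx, hx'⟩ := H.exists_resolvent (hz j) ψ
    have h1 := h0.graph.neg_mem (h0.mem_graph x)
    have h2 : -h0 x = f.snd - imPoint j • r j - ((lam : ℂ) * a) • g := by
      have h3 : h0 x = imPoint j • r j - ψ := by
        rw [← hx', hx]
        abel
      rw [h3, hψ]
      abel
    rw [← h2, hr]
    simp only
    rw [← hx]
    exact h1
  · have h1 := (hlb.resolventVec H (imPoint_im_pos j)).smul H (-1)
    rwa [neg_one_smul] at h1
  · have h1 : Tendsto (fun j => (Ω : ℂ) * a + lam * ⟪g, -r j⟫_ℂ) atTop (𝓝 f.fst) := by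
      have h2 := hm'.tendsto_inner_resolventVec H hg hfin
      have h3 := ((h2.neg.const_mul (lam : ℂ)).const_add ((Ω : ℂ) * a))
      simp only [inner_neg_right]
      refine h3.trans (le_of_eq (congrArg 𝓝 ?_))
      have hi := hm.integrable_inv_mul H hg hf
      have hi1 := (IsProj.self H g).integrable_inv_mul H hg hg
      have e1 : ∫ ν : ℝ, (ν : ℂ)⁻¹ * (m ν - lam * a * 1) ∂(spectralMeasure h0 g) =
          ∫ ν : ℝ, (ν : ℂ)⁻¹ * m ν ∂(spectralMeasure h0 g) -
            lam * a * ((∫ ν : ℝ, ν⁻¹ ∂(spectralMeasure h0 g) : ℝ) : ℂ) := by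
        rw [← integral_complex_ofReal, ← integral_const_mul, ← integral_sub hi]
        · congr 1
          ext ν
          push_cast
          ring
        · refine (hi1.const_mul ((lam : ℂ) * a)).congr (Eventually.of_forall fun ν => ?_)
          simp
      have hgap : (gap (spectralMeasure h0 g) Ω lam : ℂ) ≠ 0 :=
        Complex.ofReal_ne_zero.2 D.gap_pos.ne'
      have e2 : a * (gap (spectralMeasure h0 g) Ω lam : ℂ) =
          f.fst - lam * ∫ ν : ℝ, (ν : ℂ)⁻¹ * m ν ∂(spectralMeasure h0 g) :=
        div_mul_cancel₀ _ hgap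
      rw [gap, Complex.ofReal_sub, Complex.ofReal_mul, Complex.ofReal_pow] at e2
      rw [neg_neg, e1]
      linear_combination e2
    have h2 : Tendsto (fun j => f.snd - imPoint j • r j) atTop (𝓝 f.snd) := by
      have := (H.tendsto_smul_resolventVec hfin).const_sub f.snd
      rwa [sub_zero] at this
    exact ((WithLp.prod_continuous_toLp 2 ℂ E).tendsto _).comp (h1.prodMk_nhds h2)
  · exact hm.sub H ((hm'.resolventVec H (hz j)).smul _)
  · filter_upwards [hg.ae_pos] with ν hν
    have h1 := tendsto_imPoint.mul ((tendsto_inv_imPoint_sub hν).mul_const (m ν - (lam * a) * 1))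
    have h2 := h1.const_sub (m ν)
    rwa [zero_mul, sub_zero] at h2
  · have h1 := hfin.tendsto_integral_mul_sq (a := fun j ν => -(ν : ℂ)⁻¹ - (imPoint j - (ν : ℂ))⁻¹)
      (a' := fun ν => -(ν : ℂ)⁻¹ - (-(ν : ℂ)⁻¹)) (fun j => by fun_prop) (fun j ν hν => ?_)
      (fun ν hν => (tendsto_inv_imPoint_sub hν).const_sub _)
    · simpa using h1
    · refine (norm_sub_le _ _).trans ?_
      rw [norm_neg, norm_inv, Complex.norm_real, Real.norm_of_nonneg hν.le, two_mul]
      gcongr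
      exact norm_inv_imPoint_sub_le j hν
  · have h1 := hfin.tendsto_integral_mul_sq
      (a := fun i ν => (imPoint i - (ν : ℂ))⁻¹ - (imPoint j - (ν : ℂ))⁻¹)
      (a' := fun ν => -(ν : ℂ)⁻¹ - (imPoint j - (ν : ℂ))⁻¹) (fun i => by fun_prop)
      (fun i ν hν => ?_) (fun ν hν => (tendsto_inv_imPoint_sub hν).sub_const _)
    · refine h1.congr fun i => ?_
      have h2 := H.inner_resolventVec_sub ψ (hz i) (hz j)
      rw [WithLp.prod_inner_apply]
      have e1 : (-r i - -r j) = -(r i - r j) := by abel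
      have e2 : (f.snd - imPoint i • r i) - (f.snd - imPoint j • r j) =
        -(imPoint i • r i - imPoint j • r j) := by abel
      simp only [WithLp.ofLp_sub, Prod.fst_sub, Prod.snd_sub, sub_self, inner_zero_left, zero_add,
        e1, e2, inner_neg_neg]
      rw [h2, Complex.ofReal_re]
    · refine (norm_sub_le _ _).trans ?_
      rw [two_mul]
      exact add_le_add (norm_inv_imPoint_sub_le i hν) (norm_inv_imPoint_sub_le j hν)

/-! ### Convergence in the energy norm -/

/-- The reservoir component, projected to the cyclic subspace of `g`, in the interaction
picture. -/
def resFn (Z : ℝ → WithLp 2 (ℂ × E) ≃ₗᵢ[ℂ] WithLp 2 (ℂ × E)) (lam : ℝ) (f : WithLp 2 (ℂ × E))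
    (m : ℝ → ℂ) (t ν : ℝ) : ℂ := m ν + I * lam * truncFourier (amp Z f) t ν

theorem truncFourier_amp_sub (HZ : IsUnitaryGroupOf h Z) (f f' : WithLp 2 (ℂ × E)) (t ν : ℝ) :
    truncFourier (amp Z (f - f')) t ν =
      truncFourier (amp Z f) t ν - truncFourier (amp Z f') t ν := by
  have h1 := continuous_amp HZ f
  have h2 := continuous_amp HZ f'
  rw [truncFourier, truncFourier, truncFourier, ← intervalIntegral.integral_sub]
  · simp only [amp_sub, mul_sub]
  · exact Continuous.intervalIntegrable (by fun_prop) _ _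
  · exact Continuous.intervalIntegrable (by fun_prop) _ _

theorem resFn_sub (HZ : IsUnitaryGroupOf h Z) (f f' : WithLp 2 (ℂ × E)) (m m' : ℝ → ℂ)
    (t ν : ℝ) : resFn Z lam (f - f') (fun ν => m ν - m' ν) t ν =
      resFn Z lam f m t ν - resFn Z lam f' m' t ν := by
  rw [resFn, resFn, resFn, truncFourier_amp_sub HZ]
  ring

theorem tendsto_truncFourier_amp (HZ : IsUnitaryGroupOf h Z) {F : ℕ → WithLp 2 (ℂ × E)}
    {f : WithLp 2 (ℂ × E)} (hF : Tendsto F atTop (𝓝 f)) (t ν : ℝ) :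
    Tendsto (fun j => truncFourier (amp Z (F j)) t ν) atTop (𝓝 (truncFourier (amp Z f) t ν)) := by
  rw [tendsto_iff_norm_sub_tendsto_zero]
  simp only [← truncFourier_amp_sub HZ]
  have h1 := (tendsto_iff_norm_sub_tendsto_zero.1 hF).mul_const |t|
  rw [zero_mul] at h1
  exact squeeze_zero (fun _ => norm_nonneg _) (fun j => norm_truncFourier_le (norm_amp_le _) t ν) h1

theorem truncFourier_zero (c : ℝ → ℂ) (t : ℝ) : truncFourier c t 0 = ∫ s in (0 : ℝ)..t, c s := by
  simp [truncFourier]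

theorem IsUnitaryGroupOf.amp_eq_of_graph (HZ : IsUnitaryGroupOf h Z) {u f : WithLp 2 (ℂ × E)}
    (hu : (u, f) ∈ h.graph) (t : ℝ) :
    amp Z u t = u.fst + I * truncFourier (amp Z f) t 0 := by
  have h1 : ∀ s, HasDerivAt (amp Z u) (I * amp Z f s) s := fun s =>
    (hasDerivAt_withLp_prod.1 (HZ.hasDerivAt hu s)).1
  have h2 := intervalIntegral.integral_eq_sub_of_hasDerivAt (a := 0) (b := t) (fun s _ => h1 s)
    ((continuous_const.mul (continuous_amp HZ f)).intervalIntegrable _ _)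
  rw [intervalIntegral.integral_const_mul, amp_zero HZ] at h2
  rw [truncFourier_zero, h2]
  ring

theorem lintegral_mul_le_eLpNorm {X : Type*} [MeasurableSpace X] {μ : Measure X} {k n : X → ℂ}
    (hk : AEStronglyMeasurable k μ) (hn : AEStronglyMeasurable n μ) :
    ∫⁻ x, ‖k x‖ₑ * ‖n x‖ₑ ∂μ ≤ eLpNorm k 2 μ * eLpNorm n 2 μ := by
  have h1 := ENNReal.lintegral_mul_le_Lp_mul_Lq μ Real.HolderConjugate.two_two hk.enorm hn.enorm
  rw [eLpNorm_eq_lintegral_rpow_enorm_toReal (by norm_num) (by norm_num),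
    eLpNorm_eq_lintegral_rpow_enorm_toReal (by norm_num) (by norm_num)]
  simpa using h1

theorem le_rpow_half_of_sq_le {a b : ℝ≥0∞} (hab : a ^ 2 ≤ b) : a ≤ b ^ (1 / 2 : ℝ) := by
  rw [one_div, ENNReal.le_rpow_inv_iff (by norm_num)]
  simpa using hab

namespace IsDecaying

theorem energy_le (D : IsDecaying h0 U g Ω lam h Z) {u f : WithLp 2 (ℂ × E)}
    (hu : (u, f) ∈ h.graph) {m : ℝ → ℂ} (hm : IsProj h0 g f.snd m) (t : ℝ) :
    eLpNorm (resFn Z lam f m t) 2 (weightedMeasure (spectralMeasure h0 g)) ^ 2 ≤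
        ENNReal.ofReal (⟪u, f⟫_ℂ).re ∧
      gap (spectralMeasure h0 g) Ω lam * ‖amp Z u t‖ ^ 2 ≤ (⟪u, f⟫_ℂ).re := by
  obtain ⟨h1, h2⟩ := D.coupled.energy_ge D.spectral D.invFinite (D.group.map_mem_graph hu t)
    (D.isProj_snd' hm t)
  rw [(Z t).inner_map_map] at h2
  have h3 : ∀ ν : ℝ, ‖Complex.exp (I * t * ν) *
      (m ν + I * lam * truncFourier (amp Z f) t ν)‖ = ‖resFn Z lam f m t ν‖ := by
    intro ν
    rw [norm_mul, mul_assoc, mul_comm I, ← Complex.ofReal_mul,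
      Complex.norm_exp_ofReal_mul_I, one_mul]
    rfl
  simp only [h3] at h1 h2
  have h4 : 0 ≤ ∫ ν, ‖resFn Z lam f m t ν‖ ^ 2 * ν⁻¹ ∂(spectralMeasure h0 g) := by
    refine integral_nonneg_of_ae ?_
    filter_upwards [D.invFinite.ae_pos] with ν hν
    change 0 ≤ ‖resFn Z lam f m t ν‖ ^ 2 * ν⁻¹
    positivity
  have h5 : 0 ≤ gap (spectralMeasure h0 g) Ω lam * ‖(Z t u).fst‖ ^ 2 :=
    mul_nonneg D.gap_pos.le (sq_nonneg _)
  exact ⟨D.invFinite.eLpNorm_weightedMeasure_le h1 (by linarith), by rw [amp]; linarith⟩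

theorem measurable_resFn (D : IsDecaying h0 U g Ω lam h Z) (f : WithLp 2 (ℂ × E)) {m : ℝ → ℂ}
    (hm : MemLp m 2 (spectralMeasure h0 g)) (t : ℝ) :
    AEStronglyMeasurable (resFn Z lam f m t) (spectralMeasure h0 g) :=
  hm.1.add (Continuous.aestronglyMeasurable
    (continuous_const.mul (continuous_truncFourier (continuous_amp D.group f) t)))

theorem measurable_resFn' (D : IsDecaying h0 U g Ω lam h Z) (f : WithLp 2 (ℂ × E)) {m : ℝ → ℂ}
    (hm : MemLp m 2 (spectralMeasure h0 g)) (t : ℝ) :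
    AEStronglyMeasurable (resFn Z lam f m t) (weightedMeasure (spectralMeasure h0 g)) :=
  (D.measurable_resFn f hm t).mono_ac (weightedMeasure_ac _)

theorem energy_limit (D : IsDecaying h0 U g Ω lam h Z) {f f' : WithLp 2 (ℂ × E)}
    {m m' : ℝ → ℂ} {u F : ℕ → WithLp 2 (ℂ × E)} {u' : WithLp 2 (ℂ × E)} {p : ℕ → ℝ → ℂ} {ρ : ℝ}
    (hu : ∀ j, (u j, F j) ∈ h.graph) (hu' : (u', f') ∈ h.graph) (hfst : ∀ j, (u j).fst = u'.fst)
    (hF : Tendsto F atTop (𝓝 f)) (hp : ∀ j, IsProj h0 g (F j).snd (p j))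
    (hm' : IsProj h0 g f'.snd m')
    (hlim : ∀ᵐ ν ∂(spectralMeasure h0 g), Tendsto (fun j => p j ν) atTop (𝓝 (m ν)))
    (hρ : Tendsto (fun i => (⟪u i - u', F i - f'⟫_ℂ).re) atTop (𝓝 ρ)) (t : ℝ) :
    eLpNorm (resFn Z lam f m t - resFn Z lam f' m' t) 2
        (weightedMeasure (spectralMeasure h0 g)) ^ 2 ≤ ENNReal.ofReal ρ ∧
      gap (spectralMeasure h0 g) Ω lam *
        ‖truncFourier (amp Z f) t 0 - truncFourier (amp Z f') t 0‖ ^ 2 ≤ ρ := by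
  have hgr : ∀ i, (u i - u', F i - f') ∈ h.graph := fun i => h.graph.sub_mem (hu i) hu'
  have hpr : ∀ i, IsProj h0 g (F i - f').snd (fun ν => p i ν - m' ν) := fun i =>
    (hp i).sub D.spectral hm'
  have hen := fun i => D.energy_le (hgr i) (hpr i) t
  constructor
  · rw [eLpNorm_two_sq]
    refine lintegral_le_of_tendsto_of_tendsto
      (f := fun i ν => ‖resFn Z lam (F i - f') (fun ν => p i ν - m' ν) t ν‖ₑ ^ 2) (fun i => ?_) ?_
      (fun i => ?_) (ENNReal.tendsto_ofReal hρ)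
    · exact (D.measurable_resFn' _ (hpr i).1 t).enorm.pow_const 2
    · filter_upwards [weightedMeasure_ac _ hlim] with ν hν
      simp only [resFn_sub D.group, Pi.sub_apply]
      have h1 : Tendsto (fun i => resFn Z lam (F i) (p i) t ν) atTop (𝓝 (resFn Z lam f m t ν)) :=
        hν.add ((tendsto_truncFourier_amp D.group hF t ν).const_mul _)
      exact ((ENNReal.continuous_pow 2).tendsto _).comp (h1.sub_const _).enorm
    · rw [← eLpNorm_two_sq]
      exact (hen i).1
  · have h1 : ∀ i, gap (spectralMeasure h0 g) Ω lam *
        ‖truncFourier (amp Z (F i)) t 0 - truncFourier (amp Z f') t 0‖ ^ 2 ≤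
          (⟪u i - u', F i - f'⟫_ℂ).re := by
      intro i
      have h2 := (hen i).2
      rw [D.group.amp_eq_of_graph (hgr i), WithLp.sub_fst, hfst, sub_self, zero_add, norm_mul,
        Complex.norm_I, one_mul, truncFourier_amp_sub D.group] at h2
      exact h2
    exact le_of_tendsto_of_tendsto' ((((tendsto_truncFourier_amp D.group hF t 0).sub_const
      _).norm.pow 2).const_mul _) hρ h1

theorem eLpNorm_mul_sq_le (D : IsDecaying h0 U g Ω lam h Z) {d : ℝ → ℂ}
    (hd : AEStronglyMeasurable d (spectralMeasure h0 g)) :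
    eLpNorm (fun ν : ℝ => (ν : ℂ) * d ν) 2 (weightedMeasure (spectralMeasure h0 g)) ^ 2 ≤
      eLpNorm d 2 (spectralMeasure h0 g) *
        eLpNorm (fun ν : ℝ => (ν : ℂ) * d ν) 2 (spectralMeasure h0 g) := by
  rw [D.invFinite.eLpNorm_weightedMeasure]
  refine le_trans (le_of_eq (lintegral_congr_ae ?_)) (lintegral_mul_le_eLpNorm hd
    ((Continuous.aestronglyMeasurable (by fun_prop)).mul hd))
  filter_upwards [D.invFinite.ae_pos] with ν hν
  have h1 : ‖(ν : ℂ)‖ₑ = ENNReal.ofReal ν := by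
    rw [← ofReal_norm, Complex.norm_real, Real.norm_of_nonneg hν.le]
  have h2 : ENNReal.ofReal ν ≠ 0 := by simpa using hν
  rw [enorm_mul, h1, mul_pow, sq, sq, mul_comm, mul_assoc, ← mul_assoc _ (ENNReal.ofReal ν),
    ← mul_assoc, ← mul_assoc, ENNReal.inv_mul_cancel h2 ENNReal.ofReal_ne_top, one_mul]
  ring

theorem cauchy_of_graph (D : IsDecaying h0 U g Ω lam h Z) {u f : WithLp 2 (ℂ × E)}
    (hu : (u, f) ∈ h.graph) (hb : LowerBounded h0 g u.snd) {m : ℝ → ℂ}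
    (hm : IsProj h0 g f.snd m) {ε : ℝ≥0∞} (hε : 0 < ε) :
    ∀ᶠ s in atTop, ∀ t, s ≤ t → eLpNorm (resFn Z lam f m t - resFn Z lam f m s) 2
      (weightedMeasure (spectralMeasure h0 g)) ≤ ε := by
  have H := D.spectral
  have := H.isFiniteMeasure g
  have := D.invFinite.isFiniteMeasure
  obtain ⟨C, hC⟩ := spectralMeasure_le_volume H D.resBounded
  obtain ⟨q, hq⟩ := H.exists_isProj g u.snd
  have hfin := D.lintegral_amp_lt_top hb
  set μ := spectralMeasure h0 g with hμ
  set A := amp Z u with hA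
  set y : ℝ → E := fun t => U (-t) ((Z t f).snd - ((lam : ℂ) * A t) • g) with hy
  set K : ℝ≥0∞ := ENNReal.ofReal (2 * (‖f‖ + |lam| * ‖u‖ * ‖g‖)) with hK
  set e : ℝ → ℝ → ℂ := fun t ν => (lam * A t) * (Complex.exp (I * ((-t : ℝ) : ℂ) * ν) * 1)
    with he
  set d : ℝ → ℝ → ℝ → ℂ := fun s t ν =>
    I * lam * (truncFourier A t ν - truncFourier A s ν) with hd
  have hgraph : ∀ t, (U (-t) (Z t u).snd, y t) ∈ h0.graph := fun t =>
    H.group.map_mem_graph ((D.coupled _ _).1 (D.group.map_mem_graph hu t)).1 (-t)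
  have hyn : ∀ t, ‖y t‖ ≤ ‖f‖ + |lam| * ‖u‖ * ‖g‖ := by
    intro t
    rw [hy, LinearIsometryEquiv.norm_map]
    refine (norm_sub_le _ _).trans (add_le_add ((norm_snd_le _).trans_eq ((Z t).norm_map f)) ?_)
    rw [norm_smul, norm_mul, Complex.norm_real, Real.norm_eq_abs]
    gcongr
    exact norm_amp_le u t
  have hproj : ∀ t, IsProj h0 g (y t) (fun ν => resFn Z lam f m t ν - e t ν) := by
    intro t
    have h1 := (D.isProj_snd hm t).sub H
      (((IsProj.self H g).apply H (-t)).smul ((lam : ℂ) * A t))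
    rw [← map_smul, ← map_sub] at h1
    exact h1
  have hdm : ∀ s t, AEStronglyMeasurable (d s t) μ := fun s t =>
    Continuous.aestronglyMeasurable (continuous_const.mul
      ((continuous_truncFourier (continuous_amp D.group u) t).sub
        (continuous_truncFourier (continuous_amp D.group u) s)))
  have hνd : ∀ s t, IsProj h0 g (y t - y s) (fun ν : ℝ => (ν : ℂ) * d s t ν) := by
    intro s t
    have h1 := ((D.isProj_snd hq t).sub H (D.isProj_snd hq s)).of_graph H
      (h0.graph.sub_mem (hgraph t) (hgraph s))
    refine h1.congr (Eventually.of_forall fun ν => ?_)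
    simp only [hd]
    ring
  have hae : ∀ s t, resFn Z lam f m t - resFn Z lam f m s =ᵐ[μ]
      (fun ν : ℝ => (ν : ℂ) * d s t ν) + (e t - e s) := by
    intro s t
    filter_upwards [(hνd s t).ae_eq H ((hproj t).sub H (hproj s))] with ν hν
    simp only [Pi.add_apply, Pi.sub_apply]
    rw [hν]
    ring
  have hνd_norm : ∀ s t, eLpNorm (fun ν : ℝ => (ν : ℂ) * d s t ν) 2 μ ≤ K := by
    intro s t
    refine ((hνd s t).eLpNorm_le H).trans ?_
    rw [hK, ← ofReal_norm]
    refine ENNReal.ofReal_le_ofReal ((norm_sub_le _ _).trans ?_)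
    linarith [hyn t, hyn s]
  set L : ℝ≥0∞ := ‖lam‖ₑ ^ 2 * (ENNReal.ofReal C * ENNReal.ofReal (2 * Real.pi)) with hL
  have hd_norm : ∀ s t, s ≤ t → eLpNorm (d s t) 2 μ ^ 2 ≤
      L * ∫⁻ r in Set.Ioi s, ‖A r‖ₑ ^ 2 := by
    intro s t hst
    rw [eLpNorm_two_sq]
    refine (lintegral_mono' hC le_rfl).trans ?_
    rw [lintegral_smul_measure]
    have h1 : ∀ ν, ‖d s t ν‖ₑ ^ 2 =
        ‖lam‖ₑ ^ 2 * ‖truncFourier A t ν - truncFourier A s ν‖ₑ ^ 2 := by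
      intro ν
      have hI : ‖I‖ₑ = 1 := by rw [← ofReal_norm]; simp
      have hl : ‖(lam : ℂ)‖ₑ = ‖lam‖ₑ := by rw [← ofReal_norm, ← ofReal_norm, Complex.norm_real]
      simp only [hd]
      rw [enorm_mul, enorm_mul, hI, one_mul, mul_pow, hl]
    simp only [h1]
    rw [lintegral_const_mul' _ _ (by finiteness), hL, smul_eq_mul]
    calc ENNReal.ofReal C * (‖lam‖ₑ ^ 2 *
          ∫⁻ ν, ‖truncFourier A t ν - truncFourier A s ν‖ₑ ^ 2)
        ≤ ENNReal.ofReal C * (‖lam‖ₑ ^ 2 *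
          (ENNReal.ofReal (2 * Real.pi) * ∫⁻ r in Set.Ioi s, ‖A r‖ₑ ^ 2)) := by
          gcongr
          exact lintegral_truncFourier_sub_le (continuous_amp D.group u) hst
      _ = _ := by ring
  have he_norm : ∀ t, eLpNorm (e t) 2 (weightedMeasure μ) ≤
      ‖(lam : ℂ) * A t‖ₑ * eLpNorm (fun _ : ℝ => (1 : ℂ)) 2 (weightedMeasure μ) := by
    intro t
    refine (eLpNorm_const_smul_le (c := (lam : ℂ) * A t)
      (f := fun ν : ℝ => Complex.exp (I * ((-t : ℝ) : ℂ) * ν) * 1)).trans_eq ?_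
    congr 1
    refine eLpNorm_congr_norm_ae (Eventually.of_forall fun ν => ?_)
    rw [mul_one, mul_assoc, mul_comm I, ← Complex.ofReal_mul,
      Complex.norm_exp_ofReal_mul_I, norm_one]
  have hε4 : 0 < ε / 2 / 2 := ENNReal.half_pos (ENNReal.half_pos hε.ne').ne'
  have hev1 : ∀ᶠ s in atTop, ((L * ∫⁻ r in Set.Ioi s, ‖A r‖ₑ ^ 2) ^ (1 / 2 : ℝ) * K) ^
      (1 / 2 : ℝ) ≤ ε / 2 := by
    have h1 := ENNReal.Tendsto.const_mul (a := L) (tendsto_lintegral_Ioi_sq hfin)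
      (Or.inr (by finiteness))
    have h2 := ((ENNReal.continuous_rpow_const (y := (1 / 2 : ℝ))).tendsto _).comp h1
    rw [mul_zero, ENNReal.zero_rpow_of_pos (by norm_num)] at h2
    have h3 := ENNReal.Tendsto.mul_const (b := K) h2 (Or.inr (by finiteness))
    have h4 := ((ENNReal.continuous_rpow_const (y := (1 / 2 : ℝ))).tendsto _).comp h3
    rw [zero_mul, ENNReal.zero_rpow_of_pos (by norm_num)] at h4
    exact ENNReal.tendsto_nhds_zero.1 h4 _ (ENNReal.half_pos hε.ne')
  have hev2 : ∀ᶠ s in atTop, ‖(lam : ℂ) * A s‖ₑ *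
      eLpNorm (fun _ : ℝ => (1 : ℂ)) 2 (weightedMeasure μ) ≤ ε / 2 / 2 := by
    have h1 := ((D.tendsto_amp hb).const_mul (lam : ℂ)).enorm
    rw [mul_zero, enorm_zero] at h1
    have h2 := ENNReal.Tendsto.mul_const (b := eLpNorm (fun _ : ℝ => (1 : ℂ)) 2
      (weightedMeasure μ)) h1 (Or.inr (memLp_const (1 : ℂ)).2.ne)
    rw [zero_mul] at h2
    exact ENNReal.tendsto_nhds_zero.1 h2 _ hε4
  filter_upwards [hev1, eventually_forall_ge_atTop.2 hev2] with s hs1 hs2 t hst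
  rw [eLpNorm_congr_ae (weightedMeasure_ac μ (hae s t))]
  have he_meas : ∀ t, AEStronglyMeasurable (e t) (weightedMeasure μ) := fun t =>
    Continuous.aestronglyMeasurable (by simp only [he]; fun_prop)
  refine (eLpNorm_add_le (((Continuous.aestronglyMeasurable (by fun_prop)).mul
    (hdm s t)).mono_ac (weightedMeasure_ac _)) ((he_meas t).sub (he_meas s)) (by norm_num)).trans ?_
  rw [← ENNReal.add_halves ε]
  refine add_le_add ?_ ?_
  · refine le_trans (le_rpow_half_of_sq_le ((D.eLpNorm_mul_sq_le (hdm s t)).trans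
      (mul_le_mul' (le_rpow_half_of_sq_le (hd_norm s t hst)) (hνd_norm s t)))) hs1
  · refine (eLpNorm_sub_le (he_meas t) (he_meas s) (by norm_num)).trans ?_
    rw [← ENNReal.add_halves (ε / 2)]
    exact add_le_add ((he_norm t).trans (hs2 t hst)) ((he_norm s).trans (hs2 s le_rfl))

end IsDecaying

/-! ### The limit of the reservoir component -/

/-- `Hm` is the boundary value of `F/η` from below. -/
def IsBoundaryQuotient (h0 : E →ₗ.[ℂ] E) (g : E) (Ω lam : ℝ) (f : WithLp 2 (ℂ × E)) (Hm : ℝ → ℂ) :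
    Prop :=
  ∀ᵐ ν : ℝ, Tendsto (fun ε : ℝ => ampNum h0 g lam f ((ν : ℂ) - ε * I) /
    etaFn (spectralMeasure h0 g) Ω lam ((ν : ℂ) - ε * I)) (𝓝[>] 0) (𝓝 (Hm ν))

theorem sub_mul_I_im (ν ε : ℝ) : ((ν : ℂ) - ε * I).im = -ε := by simp

namespace IsDecaying

theorem aestronglyMeasurable_quotient (D : IsDecaying h0 U g Ω lam h Z) {f : WithLp 2 (ℂ × E)}
    {Hm : ℝ → ℂ} (hH : IsBoundaryQuotient h0 g Ω lam f Hm) : AEStronglyMeasurable Hm volume := by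
  refine aestronglyMeasurable_of_tendsto_ae atTop (f := fun (j : ℕ) (ν : ℝ) =>
    ampNum h0 g lam f ((ν : ℂ) - ((1 / ((j : ℝ) + 1) : ℝ) : ℂ) * I) /
    etaFn (spectralMeasure h0 g) Ω lam ((ν : ℂ) - ((1 / ((j : ℝ) + 1) : ℝ) : ℂ) * I))
    (fun j => ?_) (by filter_upwards [hH] with ν hν using hν.comp tendsto_one_div_nhdsGT)
  have him : ∀ ν : ℝ, ((ν : ℂ) - ((1 / ((j : ℝ) + 1) : ℝ) : ℂ) * I).im ≠ 0 := by
    intro ν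
    rw [sub_mul_I_im]
    have : 0 < 1 / ((j : ℝ) + 1) := by positivity
    exact (neg_neg_of_pos this).ne
  refine Continuous.aestronglyMeasurable (continuous_iff_continuousAt.2 fun ν => ?_)
  have hc : ContinuousAt (fun ν : ℝ => (ν : ℂ) - ((1 / ((j : ℝ) + 1) : ℝ) : ℂ) * I) ν :=
    Continuous.continuousAt (by fun_prop)
  have h1 : ContinuousAt (ampNum h0 g lam f)
      ((ν : ℂ) - ((1 / ((j : ℝ) + 1) : ℝ) : ℂ) * I) :=
    continuousAt_const.add (continuousAt_const.mul
      (D.spectral.differentiableAt_inner_resolventVec f.snd (him ν)).continuousAt)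
  have h2 := (differentiableAt_etaFn (g := g) (Ω := Ω) (lam := lam) D.spectral
    (him ν)).continuousAt
  exact ContinuousAt.div (h1.comp_of_eq hc rfl) (h2.comp_of_eq hc rfl)
    (etaFn_ne_zero D.spectral (him ν))

theorem spectralMeasure_ac (D : IsDecaying h0 U g Ω lam h Z) : spectralMeasure h0 g ≪ volume := by
  obtain ⟨C, hC⟩ := spectralMeasure_le_volume D.spectral D.resBounded
  exact (Measure.absolutelyContinuous_of_le hC).trans Measure.smul_absolutelyContinuous

theorem tendsto_truncFourier (D : IsDecaying h0 U g Ω lam h Z) {f : WithLp 2 (ℂ × E)}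
    (hb : LowerBounded h0 g f.snd) {Hm : ℝ → ℂ} (hH : IsBoundaryQuotient h0 g Ω lam f Hm) :
    Tendsto (fun t => eLpNorm (truncFourier (amp Z f) t - fun ν => -I * Hm ν) 2
      (spectralMeasure h0 g)) atTop (𝓝 0) := by
  obtain ⟨C, hC⟩ := spectralMeasure_le_volume D.spectral D.resBounded
  have h1 := tendsto_lintegral_Ioi_sq (D.lintegral_amp_lt_top hb)
  have h2 := ENNReal.Tendsto.const_mul (a := ENNReal.ofReal C * ENNReal.ofReal (2 * Real.pi)) h1
      (Or.inr (by finiteness))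
  have h3 := ((ENNReal.continuous_rpow_const (y := (1 / 2 : ℝ))).tendsto _).comp h2
  rw [mul_zero, ENNReal.zero_rpow_of_pos (by norm_num)] at h3
  refine tendsto_of_tendsto_of_tendsto_of_le_of_le' tendsto_const_nhds h3
    (Eventually.of_forall fun _ => zero_le) ?_
  filter_upwards [eventually_ge_atTop 0] with t ht
  refine le_rpow_half_of_sq_le ?_
  rw [eLpNorm_two_sq]
  refine (lintegral_mono' hC le_rfl).trans ?_
  rw [lintegral_smul_measure, smul_eq_mul]
  beta_reduce
  rw [mul_assoc]
  gcongr
  refine le_trans (le_of_eq ?_) (lintegral_truncFourier_add_le (continuous_amp D.group f)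
    (norm_amp_le f) (fun z hz => D.coupled.laplace_amp D.spectral D.group f hz) hH ht)
  refine lintegral_congr fun ν => ?_
  rw [Pi.sub_apply, neg_mul, sub_neg_eq_add]

theorem memLp_quotient (D : IsDecaying h0 U g Ω lam h Z) {f : WithLp 2 (ℂ × E)}
    (hb : LowerBounded h0 g f.snd) {Hm : ℝ → ℂ} (hH : IsBoundaryQuotient h0 g Ω lam f Hm) :
    MemLp Hm 2 (spectralMeasure h0 g) := by
  have := D.spectral.isFiniteMeasure g
  have hmeas := (D.aestronglyMeasurable_quotient hH).mono_ac D.spectralMeasure_ac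
  obtain ⟨t, ht⟩ := ((D.tendsto_truncFourier hb hH).eventually_lt_const
    (show (0 : ℝ≥0∞) < 1 by norm_num)).exists
  have h1 := IsSpectral.memLp_truncFourier (spectralMeasure h0 g) (continuous_amp D.group f)
    (norm_amp_le f) t
  have h2 : MemLp (truncFourier (amp Z f) t - fun ν => -I * Hm ν) 2
      (spectralMeasure h0 g) :=
    ⟨h1.1.sub (aestronglyMeasurable_const.mul hmeas), ht.trans (by norm_num)⟩
  refine ((h1.sub h2).const_mul I).ae_eq (Eventually.of_forall fun ν => ?_)
  simp only [Pi.sub_apply, sub_sub_cancel]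
  rw [neg_mul, mul_neg, ← mul_assoc, Complex.I_mul_I]
  ring

theorem cauchy_weighted (D : IsDecaying h0 U g Ω lam h Z) {f : WithLp 2 (ℂ × E)}
    (hb : LowerBounded h0 g f.snd) (hf : InvFinite h0 f.snd) {m : ℝ → ℂ}
    (hm : IsProj h0 g f.snd m) {ε : ℝ≥0∞} (hε : 0 < ε) :
    ∀ᶠ s in atTop, ∀ t, s ≤ t → eLpNorm (resFn Z lam f m t - resFn Z lam f m s) 2
      (weightedMeasure (spectralMeasure h0 g)) ≤ ε := by
  obtain ⟨u, F, p, ρ, hu, hfst, hlb, hF, hp, hlim, hρ, hen⟩ := D.exists_approx hm hf hb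
  have hε2 : 0 < ε / 2 := ENNReal.half_pos hε.ne'
  have hε4 : 0 < ε / 2 / 2 := ENNReal.half_pos hε2.ne'
  have h1 : Tendsto (fun j => ENNReal.ofReal (ρ j) ^ (1 / 2 : ℝ)) atTop (𝓝 0) := by
    have h2 := ((ENNReal.continuous_rpow_const (y := (1 / 2 : ℝ))).tendsto _).comp
      (ENNReal.tendsto_ofReal hρ)
    rwa [ENNReal.ofReal_zero, ENNReal.zero_rpow_of_pos (by norm_num)] at h2
  obtain ⟨j, hj⟩ := (ENNReal.tendsto_nhds_zero.1 h1 _ hε4).exists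
  have h2 : ∀ t, eLpNorm (resFn Z lam f m t - resFn Z lam (F j) (p j) t) 2
      (weightedMeasure (spectralMeasure h0 g)) ≤ ε / 2 / 2 := fun t =>
    (le_rpow_half_of_sq_le (D.energy_limit hu (hu j) (fun i => (hfst i).trans (hfst j).symm) hF hp
      (hp j) hlim (hen j) t).1).trans hj
  filter_upwards [D.cauchy_of_graph (hu j) (hlb j) (hp j) hε2] with s hs t hst
  have hm1 := fun t => D.measurable_resFn' f hm.1 t
  have hm2 := fun t => D.measurable_resFn' (F j) (hp j).1 t
  have h3 : resFn Z lam f m t - resFn Z lam f m s =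
      ((resFn Z lam f m t - resFn Z lam (F j) (p j) t) -
        (resFn Z lam f m s - resFn Z lam (F j) (p j) s)) +
      (resFn Z lam (F j) (p j) t - resFn Z lam (F j) (p j) s) := by abel
  rw [h3]
  refine (eLpNorm_add_le (((hm1 t).sub (hm2 t)).sub ((hm1 s).sub (hm2 s)))
    ((hm2 t).sub (hm2 s)) (by norm_num)).trans ?_
  rw [← ENNReal.add_halves ε]
  refine add_le_add ((eLpNorm_sub_le ((hm1 t).sub (hm2 t)) ((hm1 s).sub (hm2 s))
    (by norm_num)).trans ?_) (hs t hst)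
  rw [← ENNReal.add_halves (ε / 2)]
  exact add_le_add (h2 t) (h2 s)

theorem tendsto_truncFourier_weighted (D : IsDecaying h0 U g Ω lam h Z) {f : WithLp 2 (ℂ × E)}
    (hb : LowerBounded h0 g f.snd) (hf : InvFinite h0 f.snd) {Hm : ℝ → ℂ}
    (hH : IsBoundaryQuotient h0 g Ω lam f Hm) :
    Tendsto (fun t => eLpNorm (truncFourier (amp Z f) t - fun ν => -I * Hm ν) 2
      (weightedMeasure (spectralMeasure h0 g))) atTop (𝓝 0) := by
  obtain ⟨m, hm⟩ := D.spectral.exists_isProj g f.snd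
  have hmeas := (D.memLp_quotient hb hH).1
  have hmeasI : AEStronglyMeasurable (fun ν => -I * Hm ν) (spectralMeasure h0 g) :=
    aestronglyMeasurable_const.mul hmeas
  have htf := fun t => (continuous_truncFourier (continuous_amp D.group f) t)
  have h1 : Tendsto (fun n : ℕ => eLpNorm (truncFourier (amp Z f) n - fun ν => -I * Hm ν) 2
      (spectralMeasure h0 g)) atTop (𝓝 0) :=
    (D.tendsto_truncFourier hb hH).comp tendsto_natCast_atTop_atTop
  obtain ⟨ns, hns, hae⟩ := (tendstoInMeasure_of_tendsto_eLpNorm (by norm_num)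
    (fun n : ℕ => (htf n).aestronglyMeasurable) hmeasI h1).exists_seq_tendsto_ae
  have hlam : ‖I * (lam : ℂ)‖ₑ ≠ 0 := by
    simpa using D.coupling_ne
  rw [ENNReal.tendsto_nhds_zero]
  intro ε hε
  have hε' : 0 < ‖I * (lam : ℂ)‖ₑ * ε := by
    rw [pos_iff_ne_zero]
    exact mul_ne_zero hlam hε.ne'
  filter_upwards [D.cauchy_weighted hb hf hm hε'] with s hs
  have h2 : ∀ t, s ≤ t → eLpNorm (truncFourier (amp Z f) t - truncFourier (amp Z f) s) 2
      (weightedMeasure (spectralMeasure h0 g)) ≤ ε := by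
    intro t hst
    have h3 := hs t hst
    have h4 : resFn Z lam f m t - resFn Z lam f m s = (I * (lam : ℂ)) •
        (truncFourier (amp Z f) t - truncFourier (amp Z f) s) := by
      ext ν
      simp only [Pi.sub_apply, Pi.smul_apply, smul_eq_mul, resFn]
      ring
    rw [h4, eLpNorm_const_smul] at h3
    exact (ENNReal.mul_le_mul_iff_right hlam (by finiteness)).1 h3
  have h5 : eLpNorm (truncFourier (amp Z f) s - fun ν => -I * Hm ν) 2
      (weightedMeasure (spectralMeasure h0 g)) ^ 2 ≤ ε ^ 2 := by
    obtain ⟨N, hN⟩ := exists_nat_ge s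
    rw [eLpNorm_two_sq]
    refine lintegral_le_of_tendsto_of_le (f := fun (n : ℕ) ν =>
      ‖truncFourier (amp Z f) s ν - truncFourier (amp Z f) (ns (n + N) : ℝ) ν‖ₑ ^ 2)
      (fun n => ?_) ?_ (fun n => ?_)
    · exact (((htf _).sub (htf _)).aestronglyMeasurable).enorm.pow_const 2
    · filter_upwards [weightedMeasure_ac _ hae] with ν hν
      have h6 := (hν.comp (tendsto_add_atTop_nat N)).const_sub (truncFourier (amp Z f) s ν)
      exact ((ENNReal.continuous_pow 2).tendsto _).comp h6.enorm
    · have h7 : s ≤ (ns (n + N) : ℝ) := by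
        refine hN.trans (Nat.cast_le.2 ?_)
        exact (Nat.le_add_left N n).trans (hns.id_le _)
      have h8 := h2 _ h7
      rw [eLpNorm_sub_comm] at h8
      have h9 := pow_le_pow_left' h8 2
      rwa [eLpNorm_two_sq] at h9
  exact (ENNReal.pow_le_pow_left_iff (by norm_num)).1 h5

theorem tendsto_integral_amp (D : IsDecaying h0 U g Ω lam h Z) {f : WithLp 2 (ℂ × E)}
    (hb : LowerBounded h0 g f.snd) (hf : InvFinite h0 f.snd) {m : ℝ → ℂ}
    (hm : IsProj h0 g f.snd m) :
    Tendsto (fun t => I * ∫ s in (0 : ℝ)..t, amp Z f s) atTop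
      (𝓝 (-invAmp h0 g Ω lam f m)) := by
  obtain ⟨u, F, p, ρ, hu, hfst, hlb, hF, hp, hlim, hρ, hen⟩ := D.exists_approx hm hf hb
  have hgap := D.gap_pos
  rw [Metric.tendsto_atTop']
  intro ε hε
  have h1 : Tendsto (fun j => Real.sqrt (ρ j / gap (spectralMeasure h0 g) Ω lam)) atTop (𝓝 0) := by
    have := (hρ.div_const (gap (spectralMeasure h0 g) Ω lam)).sqrt
    rwa [zero_div, Real.sqrt_zero] at this
  obtain ⟨j, hj⟩ := (h1.eventually_lt_const (half_pos hε)).exists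
  obtain ⟨T, hT⟩ := (Metric.tendsto_atTop'.1 (D.tendsto_amp (hlb j))) (ε / 2) (half_pos hε)
  refine ⟨T, fun t ht => ?_⟩
  have h2 := hT t ht
  rw [dist_zero_right, D.group.amp_eq_of_graph (hu j), hfst] at h2
  have h3 := (D.energy_limit hu (hu j) (fun i => (hfst i).trans (hfst j).symm) hF hp
      (hp j) hlim (hen j) t).2
  have h4 : ‖truncFourier (amp Z f) t 0 - truncFourier (amp Z (F j)) t 0‖ < ε / 2 := by
    refine lt_of_le_of_lt (Real.le_sqrt_of_sq_le ?_) hj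
    rw [le_div_iff₀ hgap, mul_comm]
    exact h3
  rw [dist_eq_norm, ← truncFourier_zero]
  have h5 : I * truncFourier (amp Z f) t 0 - -invAmp h0 g Ω lam f m =
      I * (truncFourier (amp Z f) t 0 - truncFourier (amp Z (F j)) t 0) +
      (invAmp h0 g Ω lam f m + I * truncFourier (amp Z (F j)) t 0) := by ring
  rw [h5]
  refine (norm_add_le _ _).trans_lt ?_
  rw [norm_mul, Complex.norm_I, one_mul]
  linarith

end IsDecaying

end Energy

end

section

/-! ### Free particles -/

section Generator

variable {E : Type} [NormedAddCommGroup E] [InnerProductSpace ℂ E]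

/-- A unitary group whose generator extends `i h`, where `i - h` is surjective, has
generator `i h`. -/
theorem mem_graph_iff_of_surj {h : E →ₗ.[ℂ] E} {U : ℝ → E ≃ₗᵢ[ℂ] E}
    (h0 : U 0 = LinearIsometryEquiv.refl ℂ E)
    (hd : ∀ x : h.domain, HasDerivAt (fun t => U t (x : E)) (I • h x) 0)
    (hs : ∀ ψ : E, ∃ ξ : h.domain, I • (ξ : E) - h ξ = ψ) (f ξ : E) :
    (f, ξ) ∈ h.graph ↔ HasDerivAt (fun t => U t f) (I • ξ) 0 := by
  constructor
  · intro hf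
    obtain ⟨y, hy, hy'⟩ := (LinearPMap.mem_graph_iff _).1 hf
    simp only at hy hy'
    subst hy hy'
    exact hd y
  · intro hf
    obtain ⟨y, hy⟩ := hs (I • f - ξ)
    set x := f - (y : E) with hx
    have h1 : HasDerivAt (fun t => U t x) (-x) 0 := by
      have h2 := hf.sub (hd y)
      have h3 : I • ξ - I • h y = -x := by
        have h4 : h y = I • (y : E) - (I • f - ξ) := by
          rw [← hy]
          abel
        rw [h4, ← smul_sub, hx]
        have h5 : ξ - (I • (y : E) - (I • f - ξ)) = I • (f - (y : E)) := by
          rw [smul_sub]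
          abel
        rw [h5, smul_smul, Complex.I_mul_I, neg_one_smul]
      rw [h3] at h2
      refine h2.congr_of_eventuallyEq (Eventually.of_forall fun t => ?_)
      simp [hx]
    have h6 := (HasDerivAt.inner ℂ h1 h1)
    have h7 : (fun t => ⟪U t x, U t x⟫_ℂ) = fun _ => ⟪x, x⟫_ℂ := by
      ext t
      exact (U t).inner_map_map x x
    rw [h7] at h6
    have h8 := h6.unique (hasDerivAt_const (0 : ℝ) _)
    rw [h0] at h8
    simp only [LinearIsometryEquiv.coe_refl, id_eq, inner_neg_right, inner_neg_left] at h8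
    have h9 : ⟪x, x⟫_ℂ = 0 := by
      have : (-2 : ℂ) * ⟪x, x⟫_ℂ = 0 := by rw [← h8]; ring
      simpa using this
    have h10 : f = y := sub_eq_zero.1 (inner_self_eq_zero.1 h9)
    have h11 : ξ = h y := by
      rw [h10] at hy
      exact (sub_right_injective hy).symm
    rw [h10, h11]
    exact h.mem_graph y

/-- The compatibility of a weight with the dynamics of a reservoir. -/
structure IsInvariantWeight (h : E →ₗ.[ℂ] E) (U : ℝ → E ≃ₗᵢ[ℂ] E) (D : Set E) (w : E → ℂ) :
    Prop where
  add : ∀ ψ ∈ D, ∀ ξ ∈ D, ψ + ξ ∈ D ∧ w (ψ + ξ) = w ψ + w ξ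
  smul : ∀ (c : ℂ), ∀ ψ ∈ D, c • ψ ∈ D ∧ w (c • ψ) = c * w ψ
  apply : ∀ (t : ℝ), ∀ ψ ∈ D, U t ψ ∈ D ∧ w (U t ψ) = w ψ
  integral : ∀ (c : ℝ → ℂ) (B : ℝ), Continuous c → (∀ s, ‖c s‖ ≤ B) → ∀ (t : ℝ), ∀ ψ ∈ D,
    spectralApply h (truncFourier c t) ψ ∈ D ∧
      w (spectralApply h (truncFourier c t) ψ) = (∫ s in (0 : ℝ)..t, c s) * w ψ

end Generator

section Euclidean

variable {d : ℕ}

/-- The kinetic energy `|p|²/2`. -/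
def energy (p : EuclideanSpace ℝ (Fin d)) : ℝ := ‖p‖ ^ 2 / 2

theorem continuous_energy : Continuous (energy (d := d)) := by
  unfold energy
  fun_prop

theorem energy_nonneg (p : EuclideanSpace ℝ (Fin d)) : 0 ≤ energy p := by
  unfold energy
  positivity

theorem memLp_bounded_mul {X : Type*} [MeasurableSpace X] {μ : Measure X} {k ψ : X → ℂ}
    (hk : AEStronglyMeasurable k μ) {C : ℝ} (hC : ∀ x, ‖k x‖ ≤ C) (hψ : MemLp ψ 2 μ) :
    MemLp (fun x => k x * ψ x) 2 μ :=
  hψ.of_le_mul (hk.mul hψ.1) (Eventually.of_forall fun x => by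
    rw [norm_mul]
    gcongr
    exact hC x)

/-- The phase `e^{it|p|²/2}`. -/
def phase (t : ℝ) (p : EuclideanSpace ℝ (Fin d)) : ℂ := Complex.exp (I * t * energy p)

theorem continuous_phase (t : ℝ) : Continuous (phase (d := d) t) := by
  have := continuous_energy (d := d)
  unfold phase
  fun_prop

theorem norm_phase (t : ℝ) (p : EuclideanSpace ℝ (Fin d)) : ‖phase t p‖ = 1 := by
  rw [phase, mul_assoc, mul_comm, ← Complex.ofReal_mul, Complex.norm_exp_ofReal_mul_I]

theorem memLp_phase_mul (t : ℝ) (ψ : EuclSpace d) :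
    MemLp (fun p => phase t p * ψ p) 2 volume :=
  memLp_bounded_mul (continuous_phase t).aestronglyMeasurable (fun p => (norm_phase t p).le)
    (Lp.memLp ψ)

/-- Multiplication by the phase `e^{it|p|²/2}`. -/
def phaseIsometry (t : ℝ) : EuclSpace d →ₗᵢ[ℂ] EuclSpace d where
  toFun ψ := (memLp_phase_mul t ψ).toLp _
  map_add' ψ ξ := by
    refine Lp.ext ?_
    filter_upwards [MemLp.coeFn_toLp (memLp_phase_mul t (ψ + ξ)),
      MemLp.coeFn_toLp (memLp_phase_mul t ψ), MemLp.coeFn_toLp (memLp_phase_mul t ξ),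
      Lp.coeFn_add ψ ξ, Lp.coeFn_add ((memLp_phase_mul t ψ).toLp _)
        ((memLp_phase_mul t ξ).toLp _)] with p h1 h2 h3 h4 h5
    rw [h1, h5, Pi.add_apply, h2, h3, h4, Pi.add_apply, mul_add]
  map_smul' c ψ := by
    refine Lp.ext ?_
    filter_upwards [MemLp.coeFn_toLp (memLp_phase_mul t (c • ψ)),
      MemLp.coeFn_toLp (memLp_phase_mul t ψ), Lp.coeFn_smul c ψ,
      Lp.coeFn_smul c ((memLp_phase_mul t ψ).toLp _)] with p h1 h2 h4 h5
    rw [RingHom.id_apply, h1, h5, Pi.smul_apply, h2, h4, Pi.smul_apply, smul_eq_mul, smul_eq_mul,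
      mul_left_comm]
  norm_map' ψ := by
    change ‖(memLp_phase_mul t ψ).toLp _‖ = _
    rw [Lp.norm_toLp, Lp.norm_def]
    congr 1
    refine eLpNorm_congr_norm_ae (Eventually.of_forall fun p => ?_)
    rw [norm_mul, norm_phase, one_mul]

theorem coeFn_phaseIsometry (t : ℝ) (ψ : EuclSpace d) :
    phaseIsometry t ψ =ᵐ[volume] fun p => phase t p * ψ p :=
  MemLp.coeFn_toLp (memLp_phase_mul t ψ)

theorem phase_add (s t : ℝ) (p : EuclideanSpace ℝ (Fin d)) :
    phase (s + t) p = phase s p * phase t p := by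
  rw [phase, phase, phase, ← Complex.exp_add]
  push_cast
  ring_nf

theorem phase_zero (p : EuclideanSpace ℝ (Fin d)) : phase 0 p = 1 := by simp [phase]

theorem phaseIsometry_add (s t : ℝ) (ψ : EuclSpace d) :
    phaseIsometry (s + t) ψ = phaseIsometry s (phaseIsometry t ψ) := by
  refine Lp.ext ?_
  filter_upwards [coeFn_phaseIsometry (s + t) ψ, coeFn_phaseIsometry t ψ,
    coeFn_phaseIsometry s (phaseIsometry t ψ)] with p h1 h2 h3
  rw [h1, h3, h2, phase_add, mul_assoc]

theorem phaseIsometry_zero (ψ : EuclSpace d) : phaseIsometry 0 ψ = ψ := by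
  refine Lp.ext ?_
  filter_upwards [coeFn_phaseIsometry 0 ψ] with p h1
  rw [h1, phase_zero, one_mul]

/-- The unitary group of `euclHam d`. -/
def euclGroup (t : ℝ) : EuclSpace d ≃ₗᵢ[ℂ] EuclSpace d where
  toLinearEquiv := LinearEquiv.ofLinearMap (phaseIsometry t).toLinearMap
    (phaseIsometry (-t)).toLinearMap
    (LinearMap.ext fun ψ => by
      change phaseIsometry t (phaseIsometry (-t) ψ) = ψ
      rw [← phaseIsometry_add, add_neg_cancel, phaseIsometry_zero])
    (LinearMap.ext fun ψ => by
      change phaseIsometry (-t) (phaseIsometry t ψ) = ψ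
      rw [← phaseIsometry_add, neg_add_cancel, phaseIsometry_zero])
  norm_map' := (phaseIsometry t).norm_map

theorem coeFn_euclGroup (t : ℝ) (ψ : EuclSpace d) :
    euclGroup t ψ =ᵐ[volume] fun p => phase t p * ψ p := coeFn_phaseIsometry t ψ

theorem coeFn_euclHam (x : (euclHam d).domain) :
    euclHam d x =ᵐ[volume] fun p => (energy p : ℂ) * (x : EuclSpace d) p :=
  MemLp.coeFn_toLp x.2

theorem norm_sq_eq_integral (ψ : EuclSpace d) : ‖ψ‖ ^ 2 = ∫ p, ‖ψ p‖ ^ 2 := by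
  have h1 := norm_toLp_sq (Lp.memLp ψ)
  rwa [Lp.toLp_coeFn] at h1

theorem integrable_norm_sq (ψ : EuclSpace d) : Integrable fun p => ‖ψ p‖ ^ 2 :=
  (Lp.memLp ψ).integrable_norm_pow (by norm_num)

theorem continuous_euclGroup (ψ : EuclSpace d) : Continuous fun t => euclGroup t ψ := by
  refine continuous_iff_continuousAt.2 fun t => ?_
  rw [ContinuousAt, tendsto_iff_norm_sub_tendsto_zero]
  have h1 : ∀ s, ‖euclGroup s ψ - euclGroup t ψ‖ ^ 2 = ∫ p, ‖(phase s p - phase t p) * ψ p‖ ^ 2 := by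
    intro s
    rw [norm_sq_eq_integral]
    refine integral_congr_ae ?_
    filter_upwards [Lp.coeFn_sub (euclGroup s ψ) (euclGroup t ψ), coeFn_euclGroup s ψ,
      coeFn_euclGroup t ψ] with p h1 h2 h3
    rw [h1, Pi.sub_apply, h2, h3, sub_mul]
  have h2 : Tendsto (fun s => ∫ p, ‖(phase s p - phase t p) * ψ p‖ ^ 2) (𝓝 t)
      (𝓝 (∫ p, ‖(phase t p - phase t p) * ψ p‖ ^ 2)) := by
    refine tendsto_integral_filter_of_dominated_convergence (fun p => 4 * ‖ψ p‖ ^ 2)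
      (Eventually.of_forall fun s => ?_) (Eventually.of_forall fun s =>
        Eventually.of_forall fun p => ?_) ((integrable_norm_sq ψ).const_mul 4)
      (Eventually.of_forall fun p => ?_)
    · exact ((((continuous_phase s).sub (continuous_phase t)).aestronglyMeasurable.mul
        (Lp.memLp ψ).1).norm).pow 2
    · rw [norm_pow, norm_norm, norm_mul, mul_pow]
      gcongr
      have h3 : ‖phase s p - phase t p‖ ≤ 2 := by
        refine (norm_sub_le _ _).trans ?_
        rw [norm_phase, norm_phase]
        norm_num
      calc ‖phase s p - phase t p‖ ^ 2 ≤ 2 ^ 2 := by gcongr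
        _ = 4 := by norm_num
    · have h4 : Continuous fun s : ℝ => ‖(phase s p - phase t p) * ψ p‖ ^ 2 := by
        unfold phase
        fun_prop
      exact h4.tendsto t
  simp only [← h1, sub_self, zero_mul, norm_zero] at h2
  rw [zero_pow (by norm_num), integral_zero] at h2
  have h5 := h2.sqrt
  simpa [Real.sqrt_sq] using h5

theorem norm_exp_sub_one_le (x : ℝ) : ‖Complex.exp (I * x) - 1‖ ≤ |x| := by
  have := Real.norm_exp_I_mul_ofReal_sub_one_le (x := x)
  simpa using this

theorem hasDerivAt_euclGroup (x : (euclHam d).domain) :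
    HasDerivAt (fun t => euclGroup t (x : EuclSpace d)) (I • euclHam d x) 0 := by
  rw [hasDerivAt_iff_tendsto_slope_zero, tendsto_iff_norm_sub_tendsto_zero]
  have hx := integrable_norm_sq (euclHam d x)
  set ψ : EuclSpace d := (x : EuclSpace d) with hψ
  set q : ℝ → EuclideanSpace ℝ (Fin d) → ℂ := fun t p =>
    ((t⁻¹ : ℝ) : ℂ) * (phase t p - 1) * ψ p - I * (energy p * ψ p) with hq
  have h1 : ∀ t : ℝ, ‖t⁻¹ • (euclGroup (0 + t) ψ - euclGroup 0 ψ) - I • euclHam d x‖ ^ 2 =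
      ∫ p, ‖q t p‖ ^ 2 := by
    intro t
    rw [norm_sq_eq_integral, zero_add]
    refine integral_congr_ae ?_
    filter_upwards [Lp.coeFn_sub (t⁻¹ • (euclGroup t ψ - euclGroup 0 ψ)) (I • euclHam d x),
      Lp.coeFn_smul t⁻¹ (euclGroup t ψ - euclGroup 0 ψ), Lp.coeFn_smul I (euclHam d x),
      Lp.coeFn_sub (euclGroup t ψ) (euclGroup 0 ψ), coeFn_euclGroup t ψ,
      coeFn_euclGroup 0 ψ, coeFn_euclHam x] with p h1 h2 h3 h4 h5 h6 h7
    rw [h1, Pi.sub_apply, h2, h3, Pi.smul_apply, Pi.smul_apply, h4, Pi.sub_apply, h5, h6, h7,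
      phase_zero, hq, Complex.real_smul, smul_eq_mul]
    congr 2
    ring
  have h2 : Tendsto (fun t => ∫ p, ‖q t p‖ ^ 2) (𝓝[≠] 0)
      (𝓝 (∫ _ : EuclideanSpace ℝ (Fin d), (0 : ℝ))) := by
    refine tendsto_integral_filter_of_dominated_convergence (fun p => 4 * ‖euclHam d x p‖ ^ 2)
      (Eventually.of_forall fun t => ?_) (Eventually.of_forall fun t => ?_) (hx.const_mul 4)
      (Eventually.of_forall fun p => ?_)
    · have hc := continuous_phase (d := d) t
      have hc' := continuous_energy (d := d)
      refine AEStronglyMeasurable.pow (AEStronglyMeasurable.norm ?_) 2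
      refine AEStronglyMeasurable.sub (AEStronglyMeasurable.mul
        (Continuous.aestronglyMeasurable (by fun_prop)) (Lp.memLp ψ).1)
        (aestronglyMeasurable_const.mul (AEStronglyMeasurable.mul
          (Continuous.aestronglyMeasurable (by fun_prop)) (Lp.memLp ψ).1))
    · filter_upwards [coeFn_euclHam x] with p hp
      rw [hp, norm_pow, norm_norm, hq, ← hψ]
      have h3 : ‖((t⁻¹ : ℝ) : ℂ) * (phase t p - 1) * ψ p‖ ≤ energy p * ‖ψ p‖ := by
        rw [norm_mul]
        gcongr
        rw [norm_mul, Complex.norm_real, phase, mul_assoc, ← Complex.ofReal_mul]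
        rcases eq_or_ne t 0 with rfl | ht
        · simp [energy_nonneg]
        · calc ‖t⁻¹‖ * ‖Complex.exp (I * ((t * energy p : ℝ) : ℂ)) - 1‖
              ≤ ‖t⁻¹‖ * |t * energy p| := by
                gcongr
                exact norm_exp_sub_one_le _
            _ = energy p := by
                rw [norm_inv, Real.norm_eq_abs, abs_mul, abs_of_nonneg (energy_nonneg p),
                  ← mul_assoc, inv_mul_cancel₀ (abs_ne_zero.2 ht), one_mul]
      have h4 : ‖(energy p : ℂ) * ψ p‖ = energy p * ‖ψ p‖ := by
        rw [norm_mul, Complex.norm_real, Real.norm_of_nonneg (energy_nonneg p)]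
      have h5 : ‖((t⁻¹ : ℝ) : ℂ) * (phase t p - 1) * ψ p - I * (energy p * ψ p)‖ ≤
          2 * (energy p * ‖ψ p‖) := by
        refine (norm_sub_le _ _).trans ?_
        rw [norm_mul I, Complex.norm_I, one_mul, h4, two_mul]
        gcongr
      rw [h4]
      calc _ ≤ (2 * (energy p * ‖ψ p‖)) ^ 2 := by gcongr
        _ = _ := by ring
    · have h6 : HasDerivAt (fun t : ℝ => phase t p) (I * energy p) 0 := by
        have h7 : HasDerivAt (fun t : ℝ => I * t * energy p) (I * 1 * energy p) 0 :=
          ((Complex.ofRealCLM.hasDerivAt (x := (0 : ℝ))).const_mul I).mul_const _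
        refine h7.cexp.congr_deriv ?_
        simp
      rw [hasDerivAt_iff_tendsto_slope_zero] at h6
      have h8 : Tendsto (fun t => q t p) (𝓝[≠] 0) (𝓝 0) := by
        have h9 := (h6.mul_const (ψ p)).sub_const (I * (energy p * ψ p))
        have h10 : I * (energy p : ℂ) * ψ p - I * (energy p * ψ p) = 0 := by ring
        rw [h10] at h9
        refine h9.congr fun t => ?_
        simp only [hq, zero_add, phase_zero, Complex.real_smul]
      have h11 := h8.norm.pow 2
      rwa [norm_zero, zero_pow (by norm_num)] at h11
  simp only [← h1, integral_zero] at h2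
  have h5 := h2.sqrt
  simpa [Real.sqrt_sq] using h5

theorem euclHam_symm : IsSymm (euclHam d) := by
  intro x y
  rw [L2.inner_def, L2.inner_def]
  refine integral_congr_ae ?_
  filter_upwards [coeFn_euclHam x, coeFn_euclHam y] with p h1 h2
  rw [h1, h2, RCLike.inner_apply, RCLike.inner_apply, map_mul, Complex.conj_ofReal]
  ring

theorem norm_inv_sub_energy_le {z : ℂ} (hz : z.im ≠ 0) (p : EuclideanSpace ℝ (Fin d)) :
    ‖(z - (energy p : ℂ))⁻¹‖ ≤ |z.im|⁻¹ := by
  rw [norm_inv]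
  refine inv_anti₀ (abs_pos.2 hz) ?_
  have := Complex.abs_im_le_norm (z - (energy p : ℂ))
  simpa using this

theorem memLp_inv_sub_energy_mul {z : ℂ} (hz : z.im ≠ 0) (ψ : EuclSpace d) :
    MemLp (fun p => (z - (energy p : ℂ))⁻¹ * ψ p) 2 volume := by
  have := continuous_energy (d := d)
  exact memLp_bounded_mul (Measurable.aestronglyMeasurable (by fun_prop))
    (norm_inv_sub_energy_le hz) (Lp.memLp ψ)

theorem exists_euclHam_resolvent {z : ℂ} (hz : z.im ≠ 0) (ψ : EuclSpace d) :
    ∃ ξ : (euclHam d).domain, z • (ξ : EuclSpace d) - euclHam d ξ = ψ ∧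
      (ξ : EuclSpace d) = (memLp_inv_sub_energy_mul hz ψ).toLp _ := by
  set ξ : EuclSpace d := (memLp_inv_sub_energy_mul hz ψ).toLp _ with hξ
  have h1 := MemLp.coeFn_toLp (memLp_inv_sub_energy_mul hz ψ)
  have h2 : kinetic ξ =ᵐ[volume] (z • ξ - ψ : EuclSpace d) := by
    filter_upwards [h1, Lp.coeFn_sub (z • ξ) ψ, Lp.coeFn_smul z ξ] with p h1 h2 h3
    rw [h2, Pi.sub_apply, h3, Pi.smul_apply]
    change (energy p : ℂ) * ξ p = _
    rw [h1, smul_eq_mul]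
    have := sub_ofReal_ne_zero hz (energy p)
    field_simp
    ring
  have hdom : ξ ∈ (euclHam d).domain := (memLp_congr_ae h2).2 (Lp.memLp _)
  refine ⟨⟨ξ, hdom⟩, ?_, rfl⟩
  have h3 : euclHam d ⟨ξ, hdom⟩ = z • ξ - ψ := by
    refine Lp.ext ?_
    exact (MemLp.coeFn_toLp (show MemLp (kinetic ξ) 2 volume from hdom)).trans h2
  rw [h3]
  exact sub_sub_cancel _ _

end Euclidean

end

section

section EuclideanRep

variable {d : ℕ}

/-- The measure `⟨g, E(·) g⟩` of `euclHam d`. -/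
def euclMeasure (g : EuclSpace d) : Measure ℝ :=
  (volume.withDensity fun p => ‖g p‖ₑ ^ 2).map energy

theorem measurable_enorm_sq (g : EuclSpace d) : Measurable fun p => ‖g p‖ₑ ^ 2 :=
  (Lp.stronglyMeasurable g).enorm.pow_const 2

theorem lintegral_euclMeasure (g : EuclSpace d) {k : ℝ → ℝ≥0∞} (hk : Measurable k) :
    ∫⁻ ν, k ν ∂(euclMeasure g) = ∫⁻ p, ‖g p‖ₑ ^ 2 * k (energy p) := by
  rw [euclMeasure, lintegral_map hk continuous_energy.measurable,
    lintegral_withDensity_eq_lintegral_mul _ (measurable_enorm_sq g) (g := fun p => k (energy p))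
      (hk.comp continuous_energy.measurable)]
  rfl

theorem ae_of_ae_euclMeasure {g : EuclSpace d} {P : ℝ → Prop} (h : ∀ᵐ ν ∂(euclMeasure g), P ν) :
    ∀ᵐ p, g p = 0 ∨ P (energy p) := by
  have h1 := ae_of_ae_map continuous_energy.aemeasurable h
  rw [ae_withDensity_iff (measurable_enorm_sq g)] at h1
  filter_upwards [h1] with p hp
  rw [or_iff_not_imp_left]
  intro h2
  exact hp (by simpa using h2)

theorem eLpNorm_comp_energy_mul (g : EuclSpace d) (F : Lp ℂ 2 (euclMeasure g)) :
    eLpNorm (fun p => F (energy p) * g p) 2 volume = eLpNorm F 2 (euclMeasure g) := by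
  refine (ENNReal.pow_right_strictMono (n := 2) (by norm_num)).injective ?_
  beta_reduce
  rw [eLpNorm_two_sq, eLpNorm_two_sq,
    lintegral_euclMeasure g ((Lp.stronglyMeasurable F).enorm.pow_const 2)]
  refine lintegral_congr fun p => ?_
  rw [enorm_mul, mul_pow, mul_comm]

theorem memLp_comp_energy_mul (g : EuclSpace d) (F : Lp ℂ 2 (euclMeasure g)) :
    MemLp (fun p => F (energy p) * g p) 2 volume := by
  refine ⟨(((Lp.stronglyMeasurable F).comp_measurable continuous_energy.measurable).mul
    (Lp.stronglyMeasurable g)).aestronglyMeasurable, ?_⟩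
  rw [eLpNorm_comp_energy_mul]
  exact (Lp.memLp F).2

theorem norm_comp_energy_mul (g : EuclSpace d) (F : Lp ℂ 2 (euclMeasure g)) :
    ‖(memLp_comp_energy_mul g F).toLp _‖ = ‖F‖ := by
  rw [Lp.norm_toLp, Lp.norm_def, eLpNorm_comp_energy_mul]

theorem toLp_eq_of_ae {g : EuclSpace d} {F : Lp ℂ 2 (euclMeasure g)} {n : ℝ → ℂ}
    (h : F =ᵐ[euclMeasure g] n) {ξ : EuclSpace d} (hξ : ξ =ᵐ[volume] fun p => n (energy p) * g p) :
    (memLp_comp_energy_mul g F).toLp _ = ξ := by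
  refine Lp.ext ?_
  filter_upwards [MemLp.coeFn_toLp (memLp_comp_energy_mul g F), ae_of_ae_euclMeasure h, hξ]
    with p h1 h2 h3
  rw [h1, h3]
  rcases h2 with h2 | h2
  · rw [h2, mul_zero, mul_zero]
  · rw [h2]

/-- The spectral representation of `euclHam d`. -/
def euclRep (g : EuclSpace d) : SpectralRep (euclHam d) g where
  μ := euclMeasure g
  finite := by
    have : IsFiniteMeasure ((volume : Measure (EuclideanSpace ℝ (Fin d))).withDensity
        fun p => ‖g p‖ₑ ^ 2) := by
      refine isFiniteMeasure_withDensity ?_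
      rw [← eLpNorm_two_sq]
      exact ENNReal.pow_ne_top (Lp.memLp g).2.ne
    exact Measure.isFiniteMeasure_map _ _
  J :=
    { toFun := fun F => (memLp_comp_energy_mul g F).toLp _
      map_add' := fun F F' => by
        refine toLp_eq_of_ae (Lp.coeFn_add F F') ?_
        filter_upwards [Lp.coeFn_add ((memLp_comp_energy_mul g F).toLp _)
          ((memLp_comp_energy_mul g F').toLp _), MemLp.coeFn_toLp (memLp_comp_energy_mul g F),
          MemLp.coeFn_toLp (memLp_comp_energy_mul g F')] with p h1 h2 h3
        rw [h1, Pi.add_apply, h2, h3, Pi.add_apply, add_mul]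
      map_smul' := fun c F => by
        refine toLp_eq_of_ae (Lp.coeFn_smul c F) ?_
        filter_upwards [Lp.coeFn_smul c ((memLp_comp_energy_mul g F).toLp _),
          MemLp.coeFn_toLp (memLp_comp_energy_mul g F)] with p h1 h2
        rw [RingHom.id_apply, h1, Pi.smul_apply, h2, Pi.smul_apply, smul_eq_mul, smul_eq_mul,
          mul_assoc]
      norm_map' := norm_comp_energy_mul g }
  map_resolvent := fun z hz F hF => by
    obtain ⟨ξ, h1, h2⟩ := exists_euclHam_resolvent hz g
    rw [euclHam_symm.resolventVec_eq hz h1]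
    refine toLp_eq_of_ae hF ?_
    rw [h2]
    exact MemLp.coeFn_toLp _

theorem isSpectral_euclHam : IsSpectral (euclHam d) euclGroup where
  group :=
    { zero := LinearIsometryEquiv.ext fun ψ => phaseIsometry_zero ψ
      add := phaseIsometry_add
      continuous := continuous_euclGroup
      generator := mem_graph_iff_of_surj (LinearIsometryEquiv.ext fun ψ => phaseIsometry_zero ψ)
        hasDerivAt_euclGroup fun ψ => by
          obtain ⟨ξ, h1, -⟩ := exists_euclHam_resolvent (z := I) (by simp) ψ
          exact ⟨ξ, h1⟩ }
  symm := euclHam_symm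
  surj := fun z hz ψ => by
    obtain ⟨ξ, h1, -⟩ := exists_euclHam_resolvent hz ψ
    exact ⟨ξ, h1⟩
  rep := fun g => by
    refine ⟨euclRep g, ?_, fun t F hF => toLp_eq_of_ae hF (coeFn_euclGroup t g)⟩
    change euclMeasure g (Set.Iio 0) = 0
    rw [euclMeasure, Measure.map_apply continuous_energy.measurable measurableSet_Iio]
    have : energy (d := d) ⁻¹' Set.Iio 0 = ∅ :=
      Set.eq_empty_of_forall_notMem fun p hp => (energy_nonneg p).not_gt hp
    rw [this, measure_empty]

theorem spectralApply_euclHam_ae (g : EuclSpace d) {n : ℝ → ℂ}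
    (hn : MemLp n 2 (spectralMeasure (euclHam d) g)) :
    (spectralApply (euclHam d) n g : EuclSpace d) =ᵐ[volume] fun p => n (energy p) * g p := by
  have h1 := isSpectral_euclHam.spectralMeasure_eq (euclRep g)
  rw [h1] at hn
  rw [← isSpectral_euclHam.J_eq_spectralApply (euclRep g) hn]
  refine (MemLp.coeFn_toLp (memLp_comp_energy_mul g (hn.toLp n))).trans ?_
  filter_upwards [ae_of_ae_euclMeasure (g := g) (MemLp.coeFn_toLp hn)] with p h2
  rcases h2 with h2 | h2
  · rw [h2, mul_zero, mul_zero]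
  · exact congrArg (· * g p) h2

instance neBot_nhds_inf_ae : (𝓝 (0 : EuclideanSpace ℝ (Fin d)) ⊓ ae volume).NeBot := by
  refine ⟨fun h => ?_⟩
  rw [inf_eq_bot_iff] at h
  obtain ⟨s, hs, t, ht, hst⟩ := h
  have h1 : volume s = 0 := by
    refine measure_mono_null (t := tᶜ) ?_ (mem_ae_iff.1 ht)
    exact (Set.disjoint_iff_inter_eq_empty.2 hst).subset_compl_right
  exact (Measure.measure_pos_of_mem_nhds volume hs).ne' h1

theorem diracValue_eq {ψ : EuclSpace d} {a : ℂ} (h : Tendsto ψ (𝓝 0 ⊓ ae volume) (𝓝 a)) :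
    diracValue d ψ = a := h.limUnder_eq

theorem tendsto_diracValue {ψ : EuclSpace d} (h : ψ ∈ diracDomain d) :
    Tendsto ψ (𝓝 0 ⊓ ae volume) (𝓝 (diracValue d ψ)) := by
  obtain ⟨a, ha⟩ := h
  rwa [diracValue_eq ha]

theorem diracDomain_of_tendsto {ψ : EuclSpace d} {k : EuclideanSpace ℝ (Fin d) → ℂ} {a : ℂ}
    (e : ψ =ᵐ[volume] k) (h : Tendsto k (𝓝 0 ⊓ ae volume) (𝓝 a)) :
    ψ ∈ diracDomain d ∧ diracValue d ψ = a := by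
  have h1 : Tendsto ψ (𝓝 0 ⊓ ae volume) (𝓝 a) :=
    h.congr' (EventuallyEq.symm (e.filter_mono inf_le_right))
  exact ⟨⟨a, h1⟩, diracValue_eq h1⟩

theorem energy_zero : energy (0 : EuclideanSpace ℝ (Fin d)) = 0 := by simp [energy]

theorem isInvariantWeight_dirac :
    IsInvariantWeight (euclHam d) euclGroup (diracDomain d) (diracValue d) where
  add ψ hψ ξ hξ := diracDomain_of_tendsto (Lp.coeFn_add ψ ξ)
    ((tendsto_diracValue hψ).add (tendsto_diracValue hξ))
  smul c ψ hψ := diracDomain_of_tendsto (Lp.coeFn_smul c ψ) ((tendsto_diracValue hψ).const_smul c)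
  apply t ψ hψ := by
    refine diracDomain_of_tendsto (coeFn_euclGroup t ψ) ?_
    have h1 := (((continuous_phase (d := d) t).tendsto 0).mono_left
      (inf_le_left (b := ae volume))).mul (tendsto_diracValue hψ)
    have h2 : phase t (0 : EuclideanSpace ℝ (Fin d)) = 1 := by simp [phase, energy_zero]
    rwa [h2, one_mul] at h1
  integral c B hc hB t ψ hψ := by
    have := isSpectral_euclHam.isFiniteMeasure ψ
    refine diracDomain_of_tendsto (spectralApply_euclHam_ae ψ
      (IsSpectral.memLp_truncFourier _ hc hB t)) ?_
    have h1 := ((((continuous_truncFourier hc t).comp (continuous_energy (d := d))).tendsto 0).mono_left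
      (inf_le_left (b := ae volume))).mul (tendsto_diracValue hψ)
    rwa [Function.comp_apply, energy_zero, truncFourier_zero] at h1

end EuclideanRep

end

section

/-! ### Bounded self-adjoint operators -/

section BoundedOperator

variable {E : Type} [NormedAddCommGroup E] [InnerProductSpace ℂ E] [CompleteSpace E]
  {H : E →L[ℂ] E}

/-- The continuous functional calculus of a self-adjoint operator. -/
def calc0 (ha : IsSelfAdjoint H) : C(spectrum ℂ H, ℂ) →⋆ₐ[ℂ] (E →L[ℂ] E) :=
  cfcHom (ha.isStarNormal : IsStarNormal H)

theorem continuous_calc0 (ha : IsSelfAdjoint H) : Continuous (calc0 ha) :=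
  cfcHom_continuous (R := ℂ) (a := H) _

/-- The function `x ↦ n(re x)` on the spectrum. -/
def onSpectrum (H : E →L[ℂ] E) {n : ℝ → ℂ} (hn : Continuous n) : C(spectrum ℂ H, ℂ) :=
  ⟨fun x => n (x : ℂ).re, by fun_prop⟩

theorem calc0_id (ha : IsSelfAdjoint H) :
    calc0 ha (onSpectrum H Complex.continuous_ofReal) = H := by
  have h1 : onSpectrum H Complex.continuous_ofReal =
      (ContinuousMap.id ℂ).restrict (spectrum ℂ H) := by
    ext x
    exact (ha.mem_spectrum_eq_re x.2).symm
  rw [h1]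
  exact cfcHom_id (R := ℂ) _

theorem inner_calc0 (ha : IsSelfAdjoint H) (g : E) (k : C(spectrum ℂ H, ℂ)) :
    ⟪calc0 ha k g, calc0 ha k g⟫_ℂ = ⟪g, calc0 ha (star k * k) g⟫_ℂ := by
  rw [map_mul, map_star, ContinuousLinearMap.star_eq_adjoint, mul_apply_eq_comp,
    ContinuousLinearMap.adjoint_inner_right]

/-- A real function as a complex function. -/
def toComplex {X : Type*} [TopologicalSpace X] (k : C(X, ℝ)) : C(X, ℂ) :=
  ⟨fun x => (k x : ℂ), by fun_prop⟩

/-- The positive functional `k ↦ ⟨g, k(H) g⟩`. -/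
def expectation (ha : IsSelfAdjoint H) (g : E) :
    CompactlySupportedContinuousMap (spectrum ℂ H) ℝ →ₚ[ℝ] ℝ :=
  PositiveLinearMap.mk₀
    { toFun := fun k => (⟪g, calc0 ha (toComplex k.toContinuousMap) g⟫_ℂ).re
      map_add' := fun k n => by
        have : toComplex (k + n).toContinuousMap =
            toComplex k.toContinuousMap + toComplex n.toContinuousMap := by
          ext x
          exact Complex.ofReal_add _ _
        rw [this, map_add, add_apply, inner_add_right, Complex.add_re]
      map_smul' := fun c k => by
        have : toComplex (c • k).toContinuousMap = (c : ℂ) • toComplex k.toContinuousMap := by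
          ext x
          exact Complex.ofReal_mul _ _
        rw [this, map_smul, smul_apply, inner_smul_right, Complex.re_ofReal_mul]
        rfl }
    fun k hk => by
      change 0 ≤ (⟪g, calc0 ha (toComplex k.toContinuousMap) g⟫_ℂ).re
      set s : C(spectrum ℂ H, ℂ) := ⟨fun x => ((Real.sqrt (k x) : ℝ) : ℂ), by fun_prop⟩ with hs
      have h1 : toComplex k.toContinuousMap = star s * s := by
        ext x
        change ((k x : ℝ) : ℂ) = (starRingEnd ℂ) ((Real.sqrt (k x) : ℝ) : ℂ) *
          ((Real.sqrt (k x) : ℝ) : ℂ)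
        rw [Complex.conj_ofReal, ← Complex.ofReal_mul, Real.mul_self_sqrt (hk x)]
      rw [h1, ← inner_calc0]
      exact inner_self_nonneg (𝕜 := ℂ)

/-- The spectral measure on the complex spectrum. -/
def spectrumMeasure (ha : IsSelfAdjoint H) (g : E) : Measure (spectrum ℂ H) :=
  RealRMK.rieszMeasure (expectation ha g)

instance (ha : IsSelfAdjoint H) (g : E) : (spectrumMeasure ha g).Regular :=
  RealRMK.regular_rieszMeasure _

theorem norm_calc0_sq (ha : IsSelfAdjoint H) (g : E) (k : C(spectrum ℂ H, ℂ)) :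
    ‖calc0 ha k g‖ ^ 2 = ∫ x, ‖k x‖ ^ 2 ∂(spectrumMeasure ha g) := by
  set q : CompactlySupportedContinuousMap (spectrum ℂ H) ℝ :=
    CompactlySupportedContinuousMap.continuousMapEquiv ⟨fun x => ‖k x‖ ^ 2, by fun_prop⟩ with hq
  have h1 := RealRMK.integral_rieszMeasure (expectation ha g) q
  have h2 : toComplex q.toContinuousMap = star k * k := by
    ext x
    change ((‖k x‖ ^ 2 : ℝ) : ℂ) = (starRingEnd ℂ) (k x) * k x
    rw [RCLike.conj_mul]
    push_cast
    rfl
  have h3 : expectation ha g q = ‖calc0 ha k g‖ ^ 2 := by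
    change (⟪g, calc0 ha (toComplex q.toContinuousMap) g⟫_ℂ).re = _
    rw [h2, ← inner_calc0, inner_self_eq_norm_sq_to_K]
    norm_cast
  rw [← h3, ← h1]
  rfl

theorem norm_calc0 (ha : IsSelfAdjoint H) (g : E) (k : C(spectrum ℂ H, ℂ)) :
    ‖calc0 ha k g‖ = ‖ContinuousMap.toLp (E := ℂ) 2 (spectrumMeasure ha g) ℂ k‖ := by
  have hk : MemLp k 2 (spectrumMeasure ha g) :=
    (Lp.memLp (ContinuousMap.toLp (E := ℂ) 2 (spectrumMeasure ha g) ℂ k)).ae_eq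
      (ContinuousMap.coeFn_toLp _ k)
  have h1 := norm_toLp_sq hk
  have h2 : hk.toLp k = ContinuousMap.toLp (E := ℂ) 2 (spectrumMeasure ha g) ℂ k :=
    Lp.ext ((MemLp.coeFn_toLp hk).trans (ContinuousMap.coeFn_toLp _ k).symm)
  rw [h2, ← norm_calc0_sq] at h1
  exact ((sq_eq_sq₀ (norm_nonneg _) (norm_nonneg _)).1 h1).symm

/-- The linear map `k ↦ k(H) g`. -/
def calcVec (ha : IsSelfAdjoint H) (g : E) : C(spectrum ℂ H, ℂ) →ₗ[ℂ] E where
  toFun k := calc0 ha k g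
  map_add' k n := by rw [map_add, add_apply]
  map_smul' c k := by rw [map_smul, smul_apply, RingHom.id_apply]

theorem toLp_denseRange_spectrum (ha : IsSelfAdjoint H) (g : E) :
    DenseRange (ContinuousMap.toLp (E := ℂ) 2 (spectrumMeasure ha g) ℂ) :=
  ContinuousMap.toLp_denseRange ℂ (spectrumMeasure ha g) ℂ (by norm_num)

/-- The bounded extension of `k ↦ k(H) g`. -/
def spectrumMap (ha : IsSelfAdjoint H) (g : E) : Lp ℂ 2 (spectrumMeasure ha g) →L[ℂ] E :=
  (calcVec ha g).extendOfNorm (ContinuousMap.toLp (E := ℂ) 2 (spectrumMeasure ha g) ℂ).toLinearMap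

theorem spectrumMap_toLp (ha : IsSelfAdjoint H) (g : E) (k : C(spectrum ℂ H, ℂ)) :
    spectrumMap ha g (ContinuousMap.toLp (E := ℂ) 2 (spectrumMeasure ha g) ℂ k) =
      calc0 ha k g :=
  LinearMap.extendOfNorm_eq (toLp_denseRange_spectrum ha g)
    ⟨1, fun k => by rw [one_mul]; exact (norm_calc0 ha g k).le⟩ k

/-- The isometry `k ↦ k(H) g`. -/
def spectrumIsometry (ha : IsSelfAdjoint H) (g : E) : Lp ℂ 2 (spectrumMeasure ha g) →ₗᵢ[ℂ] E where
  toLinearMap := (spectrumMap ha g).toLinearMap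
  norm_map' := by
    refine (toLp_denseRange_spectrum ha g).induction ?_ ?_
    · rintro _ ⟨k, rfl⟩
      rw [ContinuousLinearMap.coe_coe, spectrumMap_toLp, norm_calc0]
    · exact isClosed_eq (spectrumMap ha g).continuous.norm continuous_norm

theorem measurePreserving_re (ha : IsSelfAdjoint H) (g : E) :
    MeasurePreserving (fun x : spectrum ℂ H => (x : ℂ).re) (spectrumMeasure ha g)
      ((spectrumMeasure ha g).map fun x : spectrum ℂ H => (x : ℂ).re) :=
  ⟨Continuous.measurable (by fun_prop), rfl⟩

/-- The isometry `n ↦ n(H) g` on the square-integrable functions on the line. -/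
def lineIsometry (ha : IsSelfAdjoint H) (g : E) :
    Lp ℂ 2 ((spectrumMeasure ha g).map fun x : spectrum ℂ H => (x : ℂ).re) →ₗᵢ[ℂ] E :=
  (spectrumIsometry ha g).comp (Lp.compMeasurePreservingₗᵢ ℂ _ (measurePreserving_re ha g))

theorem lineIsometry_apply (ha : IsSelfAdjoint H) (g : E) {n : ℝ → ℂ} (hn : Continuous n)
    {F : Lp ℂ 2 ((spectrumMeasure ha g).map fun x : spectrum ℂ H => (x : ℂ).re)}
    (hF : F =ᵐ[(spectrumMeasure ha g).map fun x : spectrum ℂ H => (x : ℂ).re] n) :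
    lineIsometry ha g F = calc0 ha (onSpectrum H hn) g := by
  rw [← spectrumMap_toLp]
  change spectrumMap ha g (Lp.compMeasurePreserving _ (measurePreserving_re ha g) F) = _
  congr 1
  refine Lp.ext ((Lp.coeFn_compMeasurePreserving F _).trans
    (EventuallyEq.trans ?_ (ContinuousMap.coeFn_toLp _ _).symm))
  exact ae_of_ae_map (measurePreserving_re ha g).measurable.aemeasurable hF

/-- The operator `H` as a partially defined operator. -/
abbrev fullPMap (H : E →L[ℂ] E) : E →ₗ.[ℂ] E := LinearMap.toPMap (H : E →ₗ[ℂ] E) ⊤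

theorem isSymm_fullPMap (ha : IsSelfAdjoint H) : IsSymm (fullPMap H) := fun x y =>
  (ContinuousLinearMap.isSelfAdjoint_iff_isSymmetric.1 ha) x y

theorem smul_sub_calc0 (ha : IsSelfAdjoint H) {z : ℂ} (hz : z.im ≠ 0) (g : E) :
    z • calc0 ha (onSpectrum H (continuous_inv_sub_ofReal hz)) g -
      H (calc0 ha (onSpectrum H (continuous_inv_sub_ofReal hz)) g) = g := by
  set k := onSpectrum H (continuous_inv_sub_ofReal hz) with hk
  set i := onSpectrum H Complex.continuous_ofReal with hi
  have h1 : z • k - i * k = 1 := by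
    ext x
    change z * (z - (((x : ℂ).re : ℝ) : ℂ))⁻¹ -
      (((x : ℂ).re : ℝ) : ℂ) * (z - (((x : ℂ).re : ℝ) : ℂ))⁻¹ = 1
    rw [← sub_mul, mul_inv_cancel₀ (sub_ofReal_ne_zero hz _)]
  have h2 := congrArg (fun T : E →L[ℂ] E => T g) (congrArg (calc0 ha) h1)
  rw [map_sub, map_smul, map_mul, map_one, calc0_id] at h2
  exact h2

/-- The spectral representation of a bounded self-adjoint operator. -/
def boundedRep (ha : IsSelfAdjoint H) (g : E) : SpectralRep (fullPMap H) g where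
  μ := (spectrumMeasure ha g).map fun x : spectrum ℂ H => (x : ℂ).re
  finite := Measure.isFiniteMeasure_map _ _
  J := lineIsometry ha g
  map_resolvent := fun z hz F hF => by
    rw [lineIsometry_apply ha g (continuous_inv_sub_ofReal hz) hF]
    exact ((isSymm_fullPMap ha).resolventVec_eq (ξ := ⟨_, Submodule.mem_top⟩) hz
      (smul_sub_calc0 ha hz g)).symm

/-- The unitary group `e^{itH}`. -/
def expGroup (ha : IsSelfAdjoint H) (t : ℝ) : E ≃ₗᵢ[ℂ] E :=
  Unitary.linearIsometryEquiv (selfAdjoint.expUnitary (t • ⟨H, ha⟩))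

theorem expGroup_apply (ha : IsSelfAdjoint H) (t : ℝ) (ψ : E) :
    expGroup ha t ψ = NormedSpace.exp ((I * t) • H) ψ := by
  have h1 : I • (t • H) = (I * t) • H := by
    rw [mul_smul]
    rfl
  rw [← h1]
  rfl

theorem calc0_exp (ha : IsSelfAdjoint H) (t : ℝ) :
    calc0 ha (onSpectrum H (n := fun ν => Complex.exp (I * t * ν)) (by fun_prop)) =
      NormedSpace.exp ((I * t) • H) := by
  let +nondep : NormedAlgebra ℚ (E →L[ℂ] E) := .restrictScalars ℚ ℂ _
  let +nondep : NormedAlgebra ℚ C(spectrum ℂ H, ℂ) := .restrictScalars ℚ ℂ _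
  have h1 : onSpectrum H (n := fun ν => Complex.exp (I * t * ν)) (by fun_prop) =
      NormedSpace.exp ((I * (t : ℂ)) • onSpectrum H Complex.continuous_ofReal) := by
    ext x
    have h2 := NormedSpace.map_exp (ContinuousMap.evalStarAlgHom ℂ ℂ x)
      (continuous_eval_const x)
      ((I * (t : ℂ)) • onSpectrum H Complex.continuous_ofReal)
    refine Eq.trans ?_ h2.symm
    rw [← Complex.exp_eq_exp_ℂ]
    rfl
  rw [h1, NormedSpace.map_exp (calc0 ha) (continuous_calc0 ha), map_smul, calc0_id]

theorem hasDerivAt_expGroup (ha : IsSelfAdjoint H) (ψ : E) :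
    HasDerivAt (fun t => expGroup ha t ψ) (I • H ψ) 0 := by
  have h1 := hasDerivAt_exp_smul_const (𝕂 := ℝ) (I • H) (0 : ℝ)
  have h2 := (((ContinuousLinearMap.apply ℂ E ψ).restrictScalars ℝ).hasFDerivAt).comp_hasDerivAt
    (0 : ℝ) h1
  refine (h2.congr_of_eventuallyEq (Eventually.of_forall fun t => ?_)).congr_deriv ?_
  · rw [expGroup_apply, mul_comm, mul_smul]
    rfl
  · rw [zero_smul, NormedSpace.exp_zero, one_mul]
    rfl

theorem expGroup_zero (ha : IsSelfAdjoint H) : expGroup ha 0 = LinearIsometryEquiv.refl ℂ E :=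
  LinearIsometryEquiv.ext fun ψ => by
    rw [expGroup_apply, Complex.ofReal_zero, mul_zero, zero_smul, NormedSpace.exp_zero]
    rfl

theorem isSpectral_bounded (ha : IsSelfAdjoint H) (hpos : ∀ x ∈ spectrum ℂ H, 0 ≤ x.re) :
    IsSpectral (fullPMap H) (expGroup ha) where
  group :=
    { zero := expGroup_zero ha
      add := fun s t ψ => by
        let +nondep : NormedAlgebra ℚ (E →L[ℂ] E) := .restrictScalars ℚ ℂ _
        rw [expGroup_apply, expGroup_apply, expGroup_apply, Complex.ofReal_add, mul_add, add_smul,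
          NormedSpace.exp_add_of_commute (((Commute.refl H).smul_left _).smul_right _)]
        rfl
      continuous := fun ψ => by
        let +nondep : NormedAlgebra ℚ (E →L[ℂ] E) := .restrictScalars ℚ ℂ _
        simp only [expGroup_apply]
        have h1 : Continuous fun t : ℝ => NormedSpace.exp ((I * t) • H) :=
          NormedSpace.exp_continuous.comp (by fun_prop)
        exact h1.clm_apply continuous_const
      generator := mem_graph_iff_of_surj (expGroup_zero ha) (fun x => hasDerivAt_expGroup ha x)
        fun ψ => ⟨⟨_, Submodule.mem_top⟩, smul_sub_calc0 ha (by simp) ψ⟩ }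
  symm := isSymm_fullPMap ha
  surj := fun z hz ψ => ⟨⟨_, Submodule.mem_top⟩, smul_sub_calc0 ha hz ψ⟩
  rep := fun g => by
    refine ⟨boundedRep ha g, ?_, fun t F hF => ?_⟩
    · change ((spectrumMeasure ha g).map fun x : spectrum ℂ H => (x : ℂ).re) (Set.Iio 0) = 0
      rw [Measure.map_apply (measurePreserving_re ha g).measurable measurableSet_Iio]
      have : (fun x : spectrum ℂ H => (x : ℂ).re) ⁻¹' Set.Iio 0 = ∅ :=
        Set.eq_empty_of_forall_notMem fun x hx => (hpos x x.2).not_gt hx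
      rw [this, measure_empty]
    · refine (lineIsometry_apply ha g (by fun_prop) hF).trans ?_
      rw [calc0_exp, expGroup_apply]

end BoundedOperator

end

section

/-! ### Graphs -/

section Graph

variable {V : Type} {G : SimpleGraph V} [G.LocallyFinite]

theorem enorm_sum_neighbors_eq (F : V → ℝ≥0∞) (x : V) :
    ∑ y ∈ G.neighborFinset x, F y = ∑' y, (G.neighborSet x).indicator F y := by
  rw [tsum_eq_sum (s := G.neighborFinset x)]
  · refine Finset.sum_congr rfl fun y hy => ?_
    rw [Set.indicator_of_mem (show y ∈ G.neighborSet x from (G.mem_neighborFinset x y).1 hy)]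
  · intro y hy
    rw [Set.indicator_of_notMem]
    rwa [G.mem_neighborFinset] at hy

theorem tsum_mul_sum_neighbors (v F : V → ℝ≥0∞) :
    ∑' x, v x * ∑ y ∈ G.neighborFinset x, F y = ∑' y, F y * ∑ x ∈ G.neighborFinset y, v x := by
  simp only [enorm_sum_neighbors_eq, ← ENNReal.tsum_mul_left]
  rw [ENNReal.tsum_comm]
  refine tsum_congr fun y => tsum_congr fun x => ?_
  by_cases h : G.Adj x y
  · rw [Set.indicator_of_mem (show y ∈ G.neighborSet x from h),
      Set.indicator_of_mem (show x ∈ G.neighborSet y from h.symm), mul_comm]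
  · rw [Set.indicator_of_notMem (show y ∉ G.neighborSet x from h),
      Set.indicator_of_notMem (show x ∉ G.neighborSet y from fun h' => h h'.symm), mul_zero,
      mul_zero]

theorem sum_neighbors_sq_le {D : ℕ} (hD : ∀ x, (G.neighborFinset x).card ≤ D)
    (f : VertexSpace V) (s : Finset V) :
    ∑ x ∈ s, ‖∑ y ∈ G.neighborFinset x, f y‖ ^ (2 : ℝ≥0∞).toReal ≤
      (D * ‖f‖) ^ (2 : ℝ≥0∞).toReal := by
  classical
  have e2 : (2 : ℝ≥0∞).toReal = ((2 : ℕ) : ℝ) := by simp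
  simp only [e2, Real.rpow_natCast]
  calc ∑ x ∈ s, ‖∑ y ∈ G.neighborFinset x, f y‖ ^ 2
      ≤ ∑ x ∈ s, D * ∑ y ∈ G.neighborFinset x, ‖f y‖ ^ 2 := by
        refine Finset.sum_le_sum fun x _ => ?_
        calc ‖∑ y ∈ G.neighborFinset x, f y‖ ^ 2 ≤ (∑ y ∈ G.neighborFinset x, ‖f y‖) ^ 2 := by
              gcongr
              exact norm_sum_le _ _
          _ ≤ (G.neighborFinset x).card * ∑ y ∈ G.neighborFinset x, ‖f y‖ ^ 2 :=
              sq_sum_le_card_mul_sum_sq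
          _ ≤ D * ∑ y ∈ G.neighborFinset x, ‖f y‖ ^ 2 := by
              gcongr
              exact hD x
    _ = D * ∑ y ∈ (s.biUnion fun x => G.neighborFinset x), ∑ x ∈ s ∩ G.neighborFinset y, ‖f y‖ ^ 2 := by
        rw [← Finset.mul_sum]
        congr 1
        refine Finset.sum_comm' fun x y => ?_
        simp only [Finset.mem_biUnion, Finset.mem_inter, SimpleGraph.mem_neighborFinset]
        exact ⟨fun h => ⟨⟨h.1, h.2.symm⟩, x, h.1, h.2⟩, fun h => ⟨h.1.1, h.1.2.symm⟩⟩
    _ ≤ D * ∑ y ∈ (s.biUnion fun x => G.neighborFinset x), D * ‖f y‖ ^ 2 := by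
        gcongr with y _
        rw [Finset.sum_const, nsmul_eq_mul]
        gcongr
        exact (Finset.card_le_card Finset.inter_subset_right).trans (hD y)
    _ = D ^ 2 * ∑ y ∈ (s.biUnion fun x => G.neighborFinset x), ‖f y‖ ^ 2 := by
        rw [← Finset.mul_sum]
        ring
    _ ≤ D ^ 2 * ‖f‖ ^ 2 := by
        gcongr
        have h1 := lp.sum_rpow_le_norm_rpow (p := 2) (by simp) f
          (s.biUnion fun x => G.neighborFinset x)
        simpa only [e2, Real.rpow_natCast] using h1
    _ = (D * ‖f‖) ^ 2 := by ring

/-- The operator `f ↦ (x ↦ ∑_{y ∼ x} f(y))`. -/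
def neighborOp {D : ℕ} (hD : ∀ x, (G.neighborFinset x).card ≤ D) :
    VertexSpace V →L[ℂ] VertexSpace V :=
  LinearMap.mkContinuous
    { toFun := fun f => ⟨fun x => ∑ y ∈ G.neighborFinset x, f y,
        memℓp_gen' (sum_neighbors_sq_le hD f)⟩
      map_add' := fun f f' => by
        ext x
        exact Finset.sum_add_distrib
      map_smul' := fun c f => by
        ext x
        exact (Finset.mul_sum _ _ _).symm } D fun f =>
    lp.norm_le_of_forall_sum_le (by simp) (by positivity) (sum_neighbors_sq_le hD f)

theorem neighborOp_apply {D : ℕ} (hD : ∀ x, (G.neighborFinset x).card ≤ D) (f : VertexSpace V)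
    (x : V) : neighborOp hD f x = ∑ y ∈ G.neighborFinset x, f y := rfl

theorem isAdjacencyOperator_iff (A : VertexSpace V →L[ℂ] VertexSpace V) :
    IsAdjacencyOperator G A ↔ ∀ f x, A f x = ∑ y ∈ G.neighborFinset x, f y := by
  classical
  constructor
  · intro hA f x
    have h1 := (lp.hasSum_single (p := 2) (by norm_num) f).mapL
      ((lp.evalCLM ℂ (fun _ : V => ℂ) 2 x).comp A)
    have h2 : ∀ y, ((lp.evalCLM ℂ (fun _ : V => ℂ) 2 x).comp A) (lp.single 2 y (f y)) =
        if y ∈ G.neighborFinset x then f y else 0 := by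
      intro y
      have h3 := hA x y
      rw [lp.inner_single_left] at h3
      have h4 : (lp.single 2 y (f y) : VertexSpace V) = f y • lp.single 2 y (1 : ℂ) := by
        ext z
        simp [lp.single_apply, Pi.single_apply]
      rw [h4, map_smul]
      change f y * (A (lp.single 2 y (1 : ℂ)) x) = _
      simp only [RCLike.inner_apply, map_one, mul_one] at h3
      by_cases hxy : G.Adj x y
      · rw [h3, if_pos hxy, if_pos ((G.mem_neighborFinset x y).2 hxy), mul_one]
      · rw [h3, if_neg hxy, if_neg (mt (G.mem_neighborFinset x y).1 hxy), mul_zero]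
    simp only [h2] at h1
    refine (h1.unique (hasSum_sum_of_ne_finset_zero (s := G.neighborFinset x) ?_)).trans ?_
    · intro y hy
      rw [if_neg hy]
    · exact Finset.sum_congr rfl fun y hy => by rw [if_pos hy]
  · intro hA x y
    rw [lp.inner_single_left, hA]
    simp only [RCLike.inner_apply, map_one, mul_one, lp.single_apply, Pi.single_apply,
      Finset.sum_ite_eq', SimpleGraph.mem_neighborFinset]

theorem adjacencyOperator_apply {D : ℕ} (hD : ∀ x, (G.neighborFinset x).card ≤ D)
    (f : VertexSpace V) (x : V) : adjacencyOperator G f x = ∑ y ∈ G.neighborFinset x, f y := by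
  have h1 : ∃ A, IsAdjacencyOperator G A :=
    ⟨neighborOp hD, (isAdjacencyOperator_iff _).2 (neighborOp_apply hD)⟩
  have h2 := h1.choose_spec
  have h3 : adjacencyOperator G = h1.choose := dif_pos h1
  rw [h3]
  exact (isAdjacencyOperator_iff _).1 h2 f x

theorem isSelfAdjoint_adjacencyOperator {D : ℕ} (hD : ∀ x, (G.neighborFinset x).card ≤ D) :
    IsSelfAdjoint (adjacencyOperator G) := by
  classical
  have h1 := (isAdjacencyOperator_iff (G := G) (adjacencyOperator G)).2 (adjacencyOperator_apply hD)
  have h2 : IsAdjacencyOperator G (star (adjacencyOperator G)) := by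
    intro x y
    rw [ContinuousLinearMap.star_eq_adjoint, ContinuousLinearMap.adjoint_inner_right,
      ← inner_conj_symm]
    have h3 := h1 y x
    rw [G.adj_comm] at h3
    convert congrArg (starRingEnd ℂ) h3 using 1
    split_ifs <;> simp
  refine ContinuousLinearMap.ext fun f => ?_
  ext x
  rw [(isAdjacencyOperator_iff _).1 h2, adjacencyOperator_apply hD]

end Graph

end

section

section GraphWeight

variable {V : Type}

/-- The norm of `ψ` in the weighted space `ℓ¹(v)`, possibly infinite. -/
def weightNorm (v : V → ℝ) (ψ : VertexSpace V) : ℝ≥0∞ := ∑' x, ‖(v x : ℂ) * ψ x‖ₑ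

theorem summable_iff_weightNorm {v : V → ℝ} (hv : ∀ x, 0 < v x) (ψ : VertexSpace V) :
    (Summable fun x => v x * ‖ψ x‖) ↔ weightNorm v ψ ≠ ∞ := by
  rw [weightNorm, tsum_enorm_ne_top_iff_summable_norm]
  refine summable_congr fun x => ?_
  rw [norm_mul, Complex.norm_real, Real.norm_of_nonneg (hv x).le]

theorem weightNorm_smul (v : V → ℝ) (c : ℂ) (ψ : VertexSpace V) :
    weightNorm v (c • ψ) = ‖c‖ₑ * weightNorm v ψ := by
  rw [weightNorm, weightNorm, ← ENNReal.tsum_mul_left]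
  refine tsum_congr fun x => ?_
  rw [← enorm_mul]
  congr 1
  exact mul_left_comm _ _ _

theorem weightNorm_add_le (v : V → ℝ) (ψ ξ : VertexSpace V) :
    weightNorm v (ψ + ξ) ≤ weightNorm v ψ + weightNorm v ξ := by
  rw [weightNorm, weightNorm, weightNorm, ← ENNReal.tsum_add]
  refine ENNReal.tsum_le_tsum fun x => ?_
  change ‖(v x : ℂ) * (ψ x + ξ x)‖ₑ ≤ _
  rw [mul_add]
  exact enorm_add_le _ _

/-- A series of vectors converging absolutely in `ℓ¹(v)` may be paired with `v` termwise. -/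
theorem weight_hasSum (v : V → ℝ) {f : ℕ → VertexSpace V} {ξ : VertexSpace V} (hf : HasSum f ξ)
    (hs : ∑' n, weightNorm v (f n) ≠ ∞) :
    weightNorm v ξ ≠ ∞ ∧ ∑' x, (v x : ℂ) * ξ x = ∑' n, ∑' x, (v x : ℂ) * f n x := by
  have h1 : Summable (Function.uncurry fun n x => (v x : ℂ) * f n x) := by
    refine Summable.of_norm (tsum_enorm_ne_top_iff_summable_norm.1 ?_)
    exact fun h => hs ((ENNReal.tsum_prod (f := fun n x => ‖(v x : ℂ) * f n x‖ₑ)).symm.trans h)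
  have h2 : ∀ x, ∑' n, (v x : ℂ) * f n x = v x * ξ x := fun x => by
    have h3 := (hf.mapL (lp.evalCLM ℂ (fun _ : V => ℂ) 2 x)).mul_left (v x : ℂ)
    exact h3.tsum_eq
  constructor
  · refine tsum_enorm_ne_top_iff_summable_norm.2 ?_
    have h4 := h1.prod_symm.prod.norm
    refine h4.congr fun x => ?_
    rw [← h2]
    rfl
  · rw [← h1.tsum_comm]
    exact tsum_congr fun x => (h2 x).symm

variable {G : SimpleGraph V} [G.LocallyFinite] {v : V → ℝ} {r : ℝ}
  {A : VertexSpace V →L[ℂ] VertexSpace V}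

/-- `v` is a positive eigenvector of the adjacency operator `A` with eigenvalue `r`. -/
structure IsPerronWeight (G : SimpleGraph V) [G.LocallyFinite] (v : V → ℝ) (r : ℝ)
    (A : VertexSpace V →L[ℂ] VertexSpace V) : Prop where
  nonneg : 0 ≤ r
  pos : ∀ x, 0 < v x
  eigen : ∀ x, ∑ y ∈ G.neighborFinset x, v y = r * v x
  adj : ∀ f x, A f x = ∑ y ∈ G.neighborFinset x, f y

theorem IsPerronWeight.enorm_eq (P : IsPerronWeight G v r A) (x : V) :
    ‖(v x : ℂ)‖ₑ = ENNReal.ofReal (v x) := by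
  rw [← ofReal_norm, Complex.norm_real, Real.norm_of_nonneg (P.pos x).le]

theorem weightNorm_adjacency_le (P : IsPerronWeight G v r A) (ψ : VertexSpace V) :
    ∑' x, ENNReal.ofReal (v x) * ∑ y ∈ G.neighborFinset x, ‖ψ y‖ₑ ≤
        ENNReal.ofReal r * weightNorm v ψ ∧
      weightNorm v (A ψ) ≤ ENNReal.ofReal r * weightNorm v ψ := by
  have h1 : ∑' x, ENNReal.ofReal (v x) * ∑ y ∈ G.neighborFinset x, ‖ψ y‖ₑ ≤
      ENNReal.ofReal r * weightNorm v ψ := by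
    rw [tsum_mul_sum_neighbors, weightNorm, ← ENNReal.tsum_mul_left]
    refine ENNReal.tsum_le_tsum fun x => ?_
    rw [← ENNReal.ofReal_sum_of_nonneg fun y _ => (P.pos y).le, P.eigen, ENNReal.ofReal_mul' (P.pos x).le,
      enorm_mul, P.enorm_eq]
    exact le_of_eq (by ring)
  refine ⟨h1, le_trans (ENNReal.tsum_le_tsum fun x => ?_) h1⟩
  rw [P.adj, enorm_mul, P.enorm_eq]
  gcongr
  exact enorm_sum_le _ _

theorem weight_adjacency (P : IsPerronWeight G v r A) {ψ : VertexSpace V}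
    (hψ : weightNorm v ψ ≠ ∞) :
    ∑' x, (v x : ℂ) * A ψ x = r * ∑' x, (v x : ℂ) * ψ x := by
  have h1 : Summable (Function.uncurry fun x y =>
      (v x : ℂ) * (G.neighborSet x).indicator ψ y) := by
    refine Summable.of_norm (tsum_enorm_ne_top_iff_summable_norm.1 (ne_top_of_le_ne_top
      (ENNReal.mul_ne_top ENNReal.ofReal_ne_top hψ)
      (le_trans (le_of_eq ?_) (weightNorm_adjacency_le P ψ).1)))
    refine (tsum_congr fun p => ?_).trans ((ENNReal.tsum_prod (f := fun x y =>
      ENNReal.ofReal (v x) * (G.neighborSet x).indicator (fun y => ‖ψ y‖ₑ) y)).trans ?_)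
    rotate_left
    · simp only [enorm_sum_neighbors_eq, ENNReal.tsum_mul_left]
    · simp only [Function.uncurry, enorm_mul, P.enorm_eq]
      congr 1
      by_cases hp : p.2 ∈ G.neighborSet p.1 <;> simp [hp]
  have h2 : ∀ x, ∑' y, (v x : ℂ) * (G.neighborSet x).indicator ψ y = v x * A ψ x := fun x => by
    rw [P.adj, Finset.mul_sum, tsum_eq_sum (s := G.neighborFinset x)]
    · refine Finset.sum_congr rfl fun y hy => ?_
      rw [Set.indicator_of_mem (show y ∈ G.neighborSet x from (G.mem_neighborFinset x y).1 hy)]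
    · intro y hy
      rw [Set.indicator_of_notMem, mul_zero]
      rwa [G.mem_neighborFinset] at hy
  have h3 : ∀ y, ∑' x, (v x : ℂ) * (G.neighborSet x).indicator ψ y = r * (v y * ψ y) := fun y => by
    have h4 : ((∑ x ∈ G.neighborFinset y, v x : ℝ) : ℂ) = r * v y := by
      rw [P.eigen]
      push_cast
      rfl
    rw [← mul_assoc, ← h4, Complex.ofReal_sum, Finset.sum_mul,
      tsum_eq_sum (s := G.neighborFinset y)]
    · refine Finset.sum_congr rfl fun x hx => ?_
      rw [Set.indicator_of_mem (show y ∈ G.neighborSet x from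
        ((G.mem_neighborFinset y x).1 hx).symm)]
    · intro x hx
      rw [Set.indicator_of_notMem, mul_zero]
      exact fun h => hx ((G.mem_neighborFinset y x).2 (G.adj_symm h))
  calc ∑' x, (v x : ℂ) * A ψ x = ∑' x, ∑' y, (v x : ℂ) * (G.neighborSet x).indicator ψ y :=
        tsum_congr fun x => (h2 x).symm
    _ = ∑' y, ∑' x, (v x : ℂ) * (G.neighborSet x).indicator ψ y := h1.tsum_comm.symm
    _ = _ := by rw [tsum_congr h3, tsum_mul_left]

variable {H : VertexSpace V →L[ℂ] VertexSpace V}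

theorem weightNorm_pow_le (P : IsPerronWeight G v r A) (hH : ∀ f, H f = (r : ℂ) • f - A f)
    (n : ℕ) (ψ : VertexSpace V) :
    weightNorm v ((H ^ n) ψ) ≤ ENNReal.ofReal (2 * r) ^ n * weightNorm v ψ := by
  induction n generalizing ψ with
  | zero => simp
  | succ n ih =>
    rw [pow_succ, mul_apply_eq_comp, pow_succ, mul_assoc]
    refine (ih _).trans (mul_le_mul_right ?_ _)
    rw [hH, sub_eq_add_neg, ← neg_one_smul ℂ (A ψ)]
    refine (weightNorm_add_le _ _ _).trans ?_
    rw [weightNorm_smul, weightNorm_smul, enorm_neg, enorm_one, one_mul, ← ofReal_norm,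
      Complex.norm_real, Real.norm_of_nonneg P.nonneg, two_mul, ENNReal.ofReal_add P.nonneg P.nonneg, add_mul]
    gcongr
    exact (weightNorm_adjacency_le P ψ).2

theorem weight_pow_succ (P : IsPerronWeight G v r A) (hH : ∀ f, H f = (r : ℂ) • f - A f)
    (n : ℕ) {ψ : VertexSpace V} (hψ : weightNorm v ψ ≠ ∞) :
    ∑' x, (v x : ℂ) * (H ^ (n + 1)) ψ x = 0 := by
  have h1 : weightNorm v ((H ^ n) ψ) ≠ ∞ := ne_top_of_le_ne_top
    (ENNReal.mul_ne_top (ENNReal.pow_ne_top ENNReal.ofReal_ne_top) hψ)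
    (weightNorm_pow_le P hH n ψ)
  have h2 : weightNorm v (A ((H ^ n) ψ)) ≠ ∞ := ne_top_of_le_ne_top
    (ENNReal.mul_ne_top ENNReal.ofReal_ne_top h1) (weightNorm_adjacency_le P _).2
  rw [pow_succ', mul_apply_eq_comp, hH]
  have h3 : ∀ x, (v x : ℂ) * ((r : ℂ) • (H ^ n) ψ - A ((H ^ n) ψ) : VertexSpace V) x =
      r * (v x * (H ^ n) ψ x) - v x * A ((H ^ n) ψ) x := fun x => by
    change (v x : ℂ) * (r * (H ^ n) ψ x - A ((H ^ n) ψ) x) = _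
    ring
  rw [tsum_congr h3, Summable.tsum_sub, tsum_mul_left, weight_adjacency P h1, sub_self]
  · exact (Summable.of_norm (tsum_enorm_ne_top_iff_summable_norm.1 h1)).mul_left _
  · exact Summable.of_norm (tsum_enorm_ne_top_iff_summable_norm.1 h2)

theorem weight_powerSeries (P : IsPerronWeight G v r A) (hH : ∀ f, H f = (r : ℂ) • f - A f)
    {ψ ξ : VertexSpace V} (hψ : weightNorm v ψ ≠ ∞) {a : ℕ → ℂ}
    (ha : Summable fun n => ‖a n‖ * (2 * r) ^ n) (hξ : HasSum (fun n => a n • (H ^ n) ψ) ξ) :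
    weightNorm v ξ ≠ ∞ ∧ ∑' x, (v x : ℂ) * ξ x = a 0 * ∑' x, (v x : ℂ) * ψ x := by
  have hr := P.nonneg
  have h1 : ∑' n, weightNorm v (a n • (H ^ n) ψ) ≠ ∞ := by
    refine ne_top_of_le_ne_top (b := ∑' n, ENNReal.ofReal (‖a n‖ * (2 * r) ^ n) * weightNorm v ψ)
      ?_ (ENNReal.tsum_le_tsum fun n => ?_)
    · rw [ENNReal.tsum_mul_right]
      exact ENNReal.mul_ne_top ha.tsum_ofReal_ne_top hψ
    · rw [weightNorm_smul, ENNReal.ofReal_mul (norm_nonneg _), ofReal_norm,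
        ENNReal.ofReal_pow (by positivity), mul_assoc]
      gcongr
      exact weightNorm_pow_le P hH n ψ
  refine ⟨(weight_hasSum v hξ h1).1, ?_⟩
  have h2 : ∀ n, ∑' x, (v x : ℂ) * (a n • (H ^ n) ψ : VertexSpace V) x =
      a n * ∑' x, (v x : ℂ) * (H ^ n) ψ x := fun n => by
    rw [← tsum_mul_left]
    exact tsum_congr fun x => mul_left_comm _ _ _
  rw [(weight_hasSum v hξ h1).2, tsum_congr h2, tsum_eq_single 0]
  · rfl
  · intro n hn
    obtain ⟨k, rfl⟩ := Nat.exists_eq_succ_of_ne_zero hn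
    rw [weight_pow_succ P hH k hψ, mul_zero]

theorem hasSum_expGroup (ha : IsSelfAdjoint H) (t : ℝ) (ψ : VertexSpace V) :
    HasSum (fun n : ℕ => ((n.factorial : ℂ)⁻¹ * (I * t) ^ n) • (H ^ n) ψ)
      (expGroup ha t ψ) := by
  rw [expGroup_apply]
  refine ((NormedSpace.exp_series_hasSum_exp' (𝕂 := ℂ) ((I * t) • H)).mapL
    (ContinuousLinearMap.apply ℂ (VertexSpace V) ψ)).congr_fun fun n => ?_
  rw [smul_pow, smul_smul]
  rfl

theorem isInvariantWeight_graph (P : IsPerronWeight G v r A) (hH : ∀ f, H f = (r : ℂ) • f - A f)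
    (ha : IsSelfAdjoint H) (hs : IsSpectral (fullPMap H) (expGroup ha)) :
    IsInvariantWeight (fullPMap H) (expGroup ha) {ψ | Summable fun x => v x * ‖ψ x‖}
      fun ψ => ∑' x, (v x : ℂ) * ψ x where
  add ψ hψ ξ hξ := by
    simp only [Set.mem_ofPred_eq, summable_iff_weightNorm P.pos] at *
    refine ⟨ne_top_of_le_ne_top (ENNReal.add_ne_top.2 ⟨hψ, hξ⟩) (weightNorm_add_le _ _ _), ?_⟩
    rw [← Summable.tsum_add (Summable.of_norm (tsum_enorm_ne_top_iff_summable_norm.1 hψ))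
      (Summable.of_norm (tsum_enorm_ne_top_iff_summable_norm.1 hξ))]
    exact tsum_congr fun x => mul_add _ _ _
  smul c ψ hψ := by
    simp only [Set.mem_ofPred_eq, summable_iff_weightNorm P.pos] at *
    refine ⟨?_, ?_⟩
    · rw [weightNorm_smul]
      exact ENNReal.mul_ne_top enorm_ne_top hψ
    · rw [← tsum_mul_left]
      exact tsum_congr fun x => mul_left_comm _ _ _
  apply t ψ hψ := by
    simp only [Set.mem_ofPred_eq, summable_iff_weightNorm P.pos] at *
    have h1 := weight_powerSeries P hH hψ ?_ (hasSum_expGroup ha t ψ)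
    · simpa using h1
    · refine (Real.summable_pow_div_factorial (|t| * (2 * r))).congr fun n => ?_
      simp only [norm_mul, norm_inv, norm_pow, Complex.norm_natCast, Complex.norm_I, one_mul,
        Complex.norm_real, Real.norm_eq_abs]
      ring
  integral c B hc hB t ψ hψ := by
    simp only [Set.mem_ofPred_eq, summable_iff_weightNorm P.pos] at *
    have hr := P.nonneg
    have hB0 : 0 ≤ B := (norm_nonneg _).trans (hB 0)
    have hle : ∀ n : ℕ, ∀ s ∈ Set.uIoc 0 t,
        ‖c s * ((n.factorial : ℂ)⁻¹ * (I * (-s : ℝ)) ^ n)‖ ≤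
          B * (|t| ^ n / n.factorial) := fun n s hs => by
      have h1 : |s| ≤ |t| := by
        simpa using Set.abs_sub_left_of_mem_uIcc (Set.uIoc_subset_uIcc hs)
      rw [norm_mul]
      refine mul_le_mul (hB s) ?_ (norm_nonneg _) hB0
      simp only [norm_mul, norm_inv, norm_pow, Complex.norm_natCast, Complex.norm_I, one_mul,
        Complex.norm_real, norm_neg, Real.norm_eq_abs]
      rw [inv_mul_eq_div]
      gcongr
    have hpow : ∀ n : ℕ, ‖(H ^ n) ψ‖ ≤ ‖H‖ ^ n * ‖ψ‖ := fun n => by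
      induction n with
      | zero => simp
      | succ n ih =>
        rw [pow_succ', mul_apply_eq_comp, pow_succ', mul_assoc]
        exact (H.le_opNorm _).trans (by gcongr)
    have h1 : HasSum (fun n : ℕ => (∫ s in (0 : ℝ)..t,
        c s * ((n.factorial : ℂ)⁻¹ * (I * (-s : ℝ)) ^ n)) • (H ^ n) ψ)
        (BoseNESS.spectralApply (fullPMap H) (truncFourier c t) ψ) := by
      rw [← hs.integral_smul_apply_neg ψ hc hB t]
      have h2 := intervalIntegral.hasSum_integral_of_dominated_convergence (μ := volume)
        (a := 0) (b := t) (f := fun s => c s • expGroup ha (-s) ψ) (F := fun (n : ℕ) s =>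
          (c s * ((n.factorial : ℂ)⁻¹ * (I * (-s : ℝ)) ^ n)) • (H ^ n) ψ)
        (fun n _ => B * (|t| ^ n / n.factorial) * (‖H‖ ^ n * ‖ψ‖)) ?_ ?_ ?_ ?_ ?_
      · simp only [intervalIntegral.integral_smul_const] at h2
        exact h2
      · intro n
        exact Continuous.aestronglyMeasurable (by fun_prop)
      · intro n
        refine Eventually.of_forall fun s hs => ?_
        rw [norm_smul]
        refine mul_le_mul (hle n s hs) ?_ (norm_nonneg _) (by positivity)
        exact hpow n
      · refine Eventually.of_forall fun s _ => ?_
        refine ((Real.summable_pow_div_factorial (|t| * ‖H‖)).mul_left (B * ‖ψ‖)).congr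
          fun n => ?_
        ring
      · exact intervalIntegrable_const
      · refine Eventually.of_forall fun s _ => ?_
        simp only [mul_smul (c s)]
        exact (hasSum_expGroup ha (-s) ψ).const_smul (c s)
    have h2 := weight_powerSeries P hH hψ ?_ h1
    · simpa using h2
    · refine Summable.of_nonneg_of_le (fun n => by positivity) (fun n => mul_le_mul_of_nonneg_right
        (intervalIntegral.norm_integral_le_of_norm_le_const (hle n)) (by positivity)) ?_
      refine ((Real.summable_pow_div_factorial (|t| * (2 * r))).mul_left (B * |t|)).congr
        fun n => ?_
      rw [sub_zero]
      ring

end GraphWeight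

/-! ### The reservoirs -/

theorem exists_group_graph (Γ : PFGraph) : ∃ U, IsSpectral (graphHam Γ) U ∧
    IsInvariantWeight (graphHam Γ) U {ψ | Summable fun x => Γ.v x * ‖ψ x‖}
      fun ψ => ∑' x, (Γ.v x : ℂ) * ψ x := by
  obtain ⟨D, hD⟩ := Γ.bounded_degree
  have hfin : ∀ x, (Γ.G.neighborSet x).Finite := fun x =>
    Set.finite_of_encard_le_coe (hD x)
  let _ : Γ.G.LocallyFinite := fun x => (hfin x).fintype
  have hcard : ∀ x, (Γ.G.neighborFinset x).card ≤ D := fun x => by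
    have h1 := hD x
    rw [← Γ.G.coe_neighborFinset, Set.encard_coe_eq_coe_finsetCard] at h1
    exact_mod_cast h1
  have hsa := isSelfAdjoint_adjacencyOperator hcard
  have hr : (spectralRadius ℂ (adjacencyOperator Γ.G)).toReal = ‖adjacencyOperator Γ.G‖ := by
    rw [hsa.spectralRadius_eq_nnnorm]
    rfl
  have he : ∀ x, ∑ y ∈ Γ.G.neighborFinset x, Γ.v y = ‖adjacencyOperator Γ.G‖ * Γ.v x := fun x => by
    rw [← hr, ← Γ.v_eigen, ← finsum_mem_coe_finset, Γ.G.coe_neighborFinset]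
  have ha : IsSelfAdjoint ((‖adjacencyOperator Γ.G‖ : ℂ) •
      ContinuousLinearMap.id ℂ (VertexSpace Γ.V) - adjacencyOperator Γ.G) := by
    refine IsSelfAdjoint.sub (IsSelfAdjoint.smul ?_ (IsSelfAdjoint.one _)) hsa
    exact Complex.conj_ofReal _
  have hs := isSpectral_bounded ha fun x hx => by
    have h1 : (‖adjacencyOperator Γ.G‖ : ℂ) • ContinuousLinearMap.id ℂ (VertexSpace Γ.V) =
      algebraMap ℂ (VertexSpace Γ.V →L[ℂ] VertexSpace Γ.V) ‖adjacencyOperator Γ.G‖ :=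
      (Algebra.algebraMap_eq_smul_one _).symm
    rw [h1, ← spectrum.singleton_sub_eq] at hx
    obtain ⟨_, rfl, y, hy, rfl⟩ := hx
    have h2 := spectrum.norm_le_norm_mul_of_mem hy
    have h3 : ‖(1 : VertexSpace Γ.V →L[ℂ] VertexSpace Γ.V)‖ ≤ 1 := ContinuousLinearMap.norm_id_le
    have h4 := (Complex.re_le_norm y).trans (h2.trans
      (mul_le_mul_of_nonneg_left h3 (norm_nonneg _)))
    simp only [Complex.sub_re, Complex.ofReal_re]
    linarith
  exact ⟨expGroup ha, hs, isInvariantWeight_graph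
    ⟨norm_nonneg _, Γ.v_pos, he, adjacencyOperator_apply hcard⟩ (fun f => rfl) ha hs⟩

instance : (R : Reservoir) → CompleteSpace R.Space
  | .euclidean d _ => inferInstanceAs (CompleteSpace (EuclSpace d))
  | .graph Γ => inferInstanceAs (CompleteSpace (VertexSpace Γ.V))

theorem Reservoir.exists_group (R : Reservoir) : ∃ U, IsSpectral R.ham U ∧
    IsInvariantWeight R.ham U R.weightDomain R.weight := by
  cases R with
  | euclidean d hd => exact ⟨euclGroup, isSpectral_euclHam, isInvariantWeight_dirac⟩
  | graph Γ => exact exists_group_graph Γ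

end

section

/-- The unitary group of a reservoir. -/
def Reservoir.group (R : Reservoir) : ℝ → R.Space ≃ₗᵢ[ℂ] R.Space := R.exists_group.choose

theorem Reservoir.isSpectral (R : Reservoir) : IsSpectral R.ham R.group :=
  R.exists_group.choose_spec.1

theorem Reservoir.isInvariantWeight (R : Reservoir) :
    IsInvariantWeight R.ham R.group R.weightDomain R.weight := R.exists_group.choose_spec.2

namespace Model

variable {N : ℕ} (M : Model N)

/-- The form factors as a vector of `⊕ₖ 𝔎ₖ`. -/
def gVec : M.ResSpace := WithLp.toLp 2 M.g

/-- The free Hamiltonian `h₀₀` of the reservoirs. -/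
abbrev freeHam : M.ResSpace →ₗ.[ℂ] M.ResSpace := sumHam M.h0

/-- The unitary group of `h₀₀`. -/
abbrev freeGroup : ℝ → M.ResSpace ≃ₗᵢ[ℂ] M.ResSpace := sumGroup fun k => (M.res k).group

/-- The spectral measure `⟨g, E₀(·) g⟩`. -/
abbrev gMeasure : Measure ℝ := spectralMeasure M.freeHam M.gVec

theorem isSpectral_h0 (k : Fin N) : IsSpectral (M.h0 k) (M.res k).group := (M.res k).isSpectral

theorem isSpectral_freeHam : IsSpectral M.freeHam M.freeGroup := isSpectral_sum M.isSpectral_h0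

theorem gMeasure_eq : M.gMeasure = ∑ k, spectralMeasure (M.h0 k) (M.g k) :=
  spectralMeasure_sumHam M.isSpectral_h0 M.gVec

theorem spectralMeasure_le_gMeasure (k : Fin N) :
    spectralMeasure (M.h0 k) (M.g k) ≤ M.gMeasure := by
  rw [gMeasure_eq]
  exact Finset.single_le_sum (f := fun k => spectralMeasure (M.h0 k) (M.g k))
    (fun _ _ => Measure.zero_le _) (Finset.mem_univ k)

theorem isCoupled : IsCoupled M.freeHam M.gVec M.Ω M.lam M.h := by
  intro f ξ
  rw [mem_sumHam_graph, LinearPMap.mem_graph_iff]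
  constructor
  · rintro ⟨y, rfl, rfl⟩
    refine ⟨fun k => ?_, ?_⟩
    · rw [LinearPMap.mem_graph_iff]
      refine ⟨⟨(y : M.OneParticle).snd k, y.2 k⟩, rfl, ?_⟩
      exact (add_sub_cancel_right _ _).symm
    · rw [PiLp.inner_apply]
      rfl
  · rintro ⟨h1, h2⟩
    choose x hx hx' using fun k => (LinearPMap.mem_graph_iff _).1 (h1 k)
    have hmem : ∀ k, f.snd k ∈ (M.h0 k).domain := fun k => by
      have e : (x k : (M.res k).Space) = f.snd k := hx k
      rw [← e]
      exact (x k).2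
    refine ⟨⟨f, hmem⟩, rfl, withLp_prod_ext ?_ (PiLp.ext fun k => ?_)⟩
    · rw [PiLp.inner_apply] at h2
      exact h2.symm
    · have h3 : x k = ⟨f.snd k, hmem k⟩ := Subtype.ext (hx k)
      have h4 := hx' k
      rw [h3] at h4
      change M.h0 k ⟨f.snd k, _⟩ + ((M.lam : ℂ) * f.fst) • M.g k = ξ.snd k
      rw [h4]
      exact sub_add_cancel _ _

theorem η_eq {z : ℂ} (hz : ∀ k, Integrable (fun ν : ℝ => (z - (ν : ℂ))⁻¹)
    (spectralMeasure (M.h0 k) (M.g k))) : M.η z = etaFn M.gMeasure M.Ω M.lam z := by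
  rw [η, etaFn, gMeasure_eq, integral_finsetSum_measure fun k _ => hz k]

theorem η_eq_of_im {z : ℂ} (hz : z.im ≠ 0) : M.η z = etaFn M.gMeasure M.Ω M.lam z :=
  M.η_eq fun k => by
    have := (M.isSpectral_h0 k).isFiniteMeasure (M.g k)
    exact (memLp_inv_sub_ofReal _ hz).integrable (by norm_num)

theorem inner_gVec_resolventVec {z : ℂ} (hz : z.im ≠ 0) (ψ : M.ResSpace) :
    ⟪M.gVec, resolventVec M.freeHam z ψ⟫_ℂ = ∑ k, ⟪M.g k, resolventVec (M.h0 k) z (ψ k)⟫_ℂ := by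
  rw [PiLp.inner_apply]
  exact Finset.sum_congr rfl fun k _ => by rw [resolventVec_sumHam_apply M.isSpectral_h0 hz]; rfl

theorem Freg_eq (f : M.OneParticle) (ν : ℝ) {ε : ℝ} (hε : 0 < ε) :
    M.Freg f ν ε = ampNum M.freeHam M.gVec M.lam f ((ν : ℂ) - ε * I) := by
  rw [Freg, ampNum, M.inner_gVec_resolventVec (by rw [sub_mul_I_im]; exact (neg_neg_of_pos hε).ne)]

theorem resBounded_of_abs {ψ : M.ResSpace} (hψ : ∀ k, Abs (M.h0 k) (ψ k) (M.g k)) :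
    ResBounded M.freeHam M.gVec ψ := by
  choose C hC using hψ
  refine ⟨∑ k, C k, fun z hz => ?_⟩
  rw [M.inner_gVec_resolventVec hz]
  refine (norm_sum_le _ _).trans (Finset.sum_le_sum fun k _ => ?_)
  rw [(M.isSpectral_h0 k).inner_resolventVec hz, ← inner_conj_symm, RCLike.norm_conj]
  rcases hz.lt_or_gt with h | h
  · have e : (starRingEnd ℂ) z = (z.re : ℂ) + ((-z.im : ℝ) : ℂ) * I := by
      apply Complex.ext <;> simp
    rw [e]
    exact (hC k z.re (-z.im) (neg_pos.2 h)).1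
  · have e : (starRingEnd ℂ) z = (z.re : ℂ) - (z.im : ℂ) * I := by
      apply Complex.ext <;> simp
    rw [e]
    exact (hC k z.re z.im h).2

theorem ae_ηPlus_lim (hA : M.CondA) : ∀ᵐ x : ℝ, Tendsto (fun ε : ℝ =>
    etaFn M.gMeasure M.Ω M.lam ((x : ℂ) + ε * I)) (𝓝[>] 0) (𝓝 (M.ηPlus x)) := by
  have H := M.isSpectral_freeHam
  obtain ⟨C, hC⟩ := M.resBounded_of_abs (ψ := M.gVec) hA
  have h1 := ae_exists_boundary_value (B := C)
    (H := fun z => ⟪M.gVec, resolventVec M.freeHam z M.gVec⟫_ℂ)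
    (fun z hz => (H.differentiableAt_inner_resolventVec M.gVec
      (ne_of_gt hz)).differentiableWithinAt) fun z hz => hC z hz.ne'
  filter_upwards [h1] with x ⟨w, hw⟩
  have hx : Tendsto (fun ε : ℝ => (x : ℂ) + ε * I) (𝓝[>] 0) (𝓝 x) := by
    have h2 : Continuous fun ε : ℝ => (x : ℂ) + ε * I := by fun_prop
    simpa using (h2.tendsto 0).mono_left nhdsWithin_le_nhds
  have h3 : Tendsto (fun ε : ℝ => etaFn M.gMeasure M.Ω M.lam ((x : ℂ) + ε * I))
      (𝓝[>] 0) (𝓝 (x - M.Ω - (M.lam : ℂ) ^ 2 * w)) := by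
    refine ((hx.sub_const _).sub (hw.const_mul _)).congr' ?_
    filter_upwards [self_mem_nhdsWithin] with ε hε
    rw [etaFn_eq H (by simpa using ne_of_gt hε)]
  have h4 : M.ηPlus x = x - M.Ω - (M.lam : ℂ) ^ 2 * w := by
    refine Tendsto.limUnder_eq (h3.congr' ?_)
    filter_upwards [self_mem_nhdsWithin] with ε hε
    rw [M.η_eq_of_im (by simpa using ne_of_gt hε)]
  rw [h4]
  exact h3

theorem exists_le_norm_etaFn (hA : M.CondA) (hB : M.CondB) :
    ∃ κ > 0, ∀ z : ℂ, z.im ≠ 0 → κ ≤ ‖etaFn M.gMeasure M.Ω M.lam z‖ := by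
  obtain ⟨h1, h2⟩ := hB
  have h3 := h2.2
  rw [eLpNorm_exponent_top] at h3
  set b := (eLpNormEssSup (fun x => (M.ηPlus x)⁻¹) volume).toReal with hb
  have hb0 : 0 ≤ b := ENNReal.toReal_nonneg
  refine ⟨(b + 1)⁻¹, by positivity, fun z hz => ?_⟩
  refine le_norm_etaFn M.isSpectral_freeHam (by positivity) ?_ hz
  filter_upwards [h1, M.ae_ηPlus_lim hA, enorm_ae_le_eLpNormEssSup
    (fun x => (M.ηPlus x)⁻¹) volume] with x h4 h5 h6
  refine ⟨_, ?_, h5⟩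
  have h7 : ‖(M.ηPlus x)⁻¹‖ ≤ b := by
    rw [← toReal_enorm]
    exact ENNReal.toReal_mono h3.ne h6
  rw [norm_inv] at h7
  exact inv_le_of_inv_le₀ (norm_pos_iff.2 h4) (h7.trans (by linarith))

theorem invFinite_of_mem_boseDomain {k : Fin N} {ψ : (M.res k).Space}
    (hψ : ψ ∈ boseDomain (M.h0 k) (M.β k) 0) : InvFinite (M.h0 k) ψ :=
  invFinite_of_boseDomain (M.isSpectral_h0 k) (M.β_pos k) hψ

/-- Conditions (A), (B) and (D). -/
structure Regular : Prop where
  condA : M.CondA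
  condB : M.CondB
  condD : M.CondD

theorem isDecaying (hR : M.Regular) :
    IsDecaying M.freeHam M.freeGroup M.gVec M.Ω M.lam M.h (unitaryGroup M.h) where
  spectral := M.isSpectral_freeHam
  coupled := M.isCoupled
  group := M.isCoupled.isUnitaryGroupOf M.isSpectral_freeHam.group
  resBounded := M.resBounded_of_abs hR.condA
  invFinite := invFinite_sumHam M.isSpectral_h0 fun k => M.invFinite_of_mem_boseDomain (hR.condD k).2
  pos := M.Ω_pos
  coupling_ne := M.lam_pos.ne'
  eta := M.exists_le_norm_etaFn hR.condA hR.condB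

end Model

end

section

section BoseConvergence

variable {E : Type} [NormedAddCommGroup E] [InnerProductSpace ℂ E] [CompleteSpace E]
  {h : E →ₗ.[ℂ] E} {U : ℝ → E ≃ₗᵢ[ℂ] E} {g ψ : E}

/-- The measure `(1 + ν⁻¹) dμ(ν)`. -/
def formMeasure (μ : Measure ℝ) : Measure ℝ := μ + weightedMeasure μ

theorem le_formMeasure (μ : Measure ℝ) : μ ≤ formMeasure μ :=
  Measure.le_add_right le_rfl

theorem weightedMeasure_le_formMeasure (μ : Measure ℝ) : weightedMeasure μ ≤ formMeasure μ :=
  Measure.le_add_left le_rfl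

theorem formMeasure_mono {μ ρ : Measure ℝ} (hμ : μ ≤ ρ) : formMeasure μ ≤ formMeasure ρ := by
  refine add_le_add hμ (Measure.le_iff.2 fun s hs => ?_)
  rw [weightedMeasure, weightedMeasure, withDensity_apply _ hs, withDensity_apply _ hs]
  exact lintegral_mono' (Measure.restrict_mono le_rfl hμ) le_rfl

theorem eLpNorm_formMeasure_sq (μ : Measure ℝ) (k : ℝ → ℂ) : eLpNorm k 2 (formMeasure μ) ^ 2 =
    eLpNorm k 2 μ ^ 2 + eLpNorm k 2 (weightedMeasure μ) ^ 2 := by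
  simp only [eLpNorm_two_sq]
  exact lintegral_add_measure _ _ _

theorem tendsto_zero_of_sq_le {α : Type*} {l : Filter α} {a b : α → ℝ≥0∞}
    (hab : ∀ t, a t ^ 2 ≤ b t) (hb : Tendsto b l (𝓝 0)) : Tendsto a l (𝓝 0) := by
  have h1 := (ENNReal.continuous_rpow_const (y := 1 / 2)).tendsto 0 |>.comp hb
  rw [ENNReal.zero_rpow_of_pos (by norm_num)] at h1
  exact tendsto_of_tendsto_of_tendsto_of_le_of_le tendsto_const_nhds h1 (fun _ => zero_le)
    fun t => le_rpow_half_of_sq_le (hab t)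

theorem InvFinite.eLpNorm_sqrtBose_mul_le (hg : InvFinite h g) {β μ : ℝ} (hβ : 0 < β)
    (hμ : μ ≤ 0) {d : ℝ → ℂ} (hd : AEStronglyMeasurable d (spectralMeasure h g)) :
    eLpNorm (fun ν => (sqrtBose β μ ν : ℂ) * d ν) 2 (spectralMeasure h g) ^ 2 ≤
      ENNReal.ofReal (β⁻¹ + 1) * eLpNorm d 2 (formMeasure (spectralMeasure h g)) ^ 2 := by
  rw [eLpNorm_formMeasure_sq, hg.eLpNorm_weightedMeasure, eLpNorm_two_sq, eLpNorm_two_sq, mul_add,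
    ← lintegral_const_mul' _ _ ENNReal.ofReal_ne_top,
    ← lintegral_const_mul' _ _ ENNReal.ofReal_ne_top,
    ← lintegral_add_left' ((hd.enorm.pow_const 2).const_mul _)]
  refine lintegral_mono_ae ?_
  filter_upwards [hg.ae_pos] with ν hν
  have h1 : 0 ≤ bose β μ ν := bose_nonneg hβ hμ hν.le
  have h2 : ‖(sqrtBose β μ ν : ℂ) * d ν‖ₑ ^ 2 = ENNReal.ofReal (bose β μ ν + 1 / 2) * ‖d ν‖ₑ ^ 2 := by
    rw [enorm_mul, mul_pow]
    congr 1
    rw [← ofReal_norm, ← ENNReal.ofReal_pow (norm_nonneg _), Complex.norm_real, Real.norm_eq_abs,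
      sq_abs, sqrtBose, Real.sq_sqrt (by positivity)]
  rw [h2, show ENNReal.ofReal (β⁻¹ + 1) * ‖d ν‖ₑ ^ 2 +
    ENNReal.ofReal (β⁻¹ + 1) * (‖d ν‖ₑ ^ 2 * (ENNReal.ofReal ν)⁻¹) =
    ENNReal.ofReal (β⁻¹ + 1) * (1 + (ENNReal.ofReal ν)⁻¹) * ‖d ν‖ₑ ^ 2 by ring]
  gcongr
  rw [← ENNReal.ofReal_inv_of_pos hν, ← ENNReal.ofReal_one,
    ← ENNReal.ofReal_add zero_le_one (by positivity), ← ENNReal.ofReal_mul (by positivity)]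
  refine ENNReal.ofReal_le_ofReal ((add_le_add_left (bose_le hβ hμ hν) _).trans ?_)
  have h3 : 0 < β⁻¹ := by positivity
  have h4 : 0 < ν⁻¹ := by positivity
  rw [mul_inv]
  nlinarith

variable {ρ : Measure ℝ}

theorem InvFinite.memLp_sqrtBose_mul (hg : InvFinite h g) {β μ : ℝ} (hβ : 0 < β) (hμ : μ ≤ 0)
    (hρ : spectralMeasure h g ≤ ρ) {k : ℝ → ℂ} (hk : MemLp k 2 (formMeasure ρ)) :
    MemLp (fun ν => (sqrtBose β μ ν : ℂ) * k ν) 2 (spectralMeasure h g) := by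
  have h1 := hk.mono_measure (formMeasure_mono hρ)
  refine ⟨(measurable_sqrtBose β μ).aestronglyMeasurable.mul
    (h1.mono_measure (le_formMeasure _)).1, ?_⟩
  have h2 := (hg.eLpNorm_sqrtBose_mul_le hβ hμ
    (h1.mono_measure (le_formMeasure _)).1).trans_lt
    (ENNReal.mul_lt_top ENNReal.ofReal_lt_top (ENNReal.pow_lt_top h1.2))
  contrapose! h2
  rw [top_le_iff.1 h2]
  simp

theorem InvFinite.spectralApply_of_memLp (H : IsSpectral h U) (hg : InvFinite h g)
    (hρ : spectralMeasure h g ≤ ρ) {k : ℝ → ℂ} (hk : MemLp k 2 (formMeasure ρ)) :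
    InvFinite h (BoseNESS.spectralApply h k g) := by
  have h1 := hk.mono_measure (formMeasure_mono hρ)
  refine InvFinite.spectralApply H (h1.mono_measure (le_formMeasure _)) ?_
  rw [← hg.eLpNorm_weightedMeasure]
  exact ENNReal.pow_lt_top (h1.mono_measure (weightedMeasure_le_formMeasure _)).2

theorem tendsto_boseForm (H : IsSpectral h U) (hg : InvFinite h g) (hψ : InvFinite h ψ) {β μ : ℝ}
    (hβ : 0 < β) (hμ : μ ≤ 0) {l : Filter ℝ} (hρ : spectralMeasure h g ≤ ρ) {k : ℝ → ℝ → ℂ}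
    {k' : ℝ → ℂ} (hk : ∀ t, MemLp (k t) 2 (formMeasure ρ)) (hk' : MemLp k' 2 (formMeasure ρ))
    (hlim : Tendsto (fun t => eLpNorm (k t - k') 2 (formMeasure ρ)) l (𝓝 0)) (c : ℂ) :
    Tendsto (fun t => boseForm h β μ (ψ + c • spectralApply h (k t) g)) l
      (𝓝 (boseForm h β μ (ψ + c • spectralApply h k' g))) := by
  have hm : ∀ {k : ℝ → ℂ}, MemLp k 2 (formMeasure ρ) → MemLp k 2 (spectralMeasure h g) := fun hk =>
    hk.mono_measure (hρ.trans (le_formMeasure ρ))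
  have h1 : ∀ {k : ℝ → ℂ}, MemLp k 2 (formMeasure ρ) → boseForm h β μ (ψ + c • spectralApply h k g) =
      ‖spectralApply h (fun ν => (sqrtBose β μ ν : ℂ)) ψ +
        c • spectralApply h (fun ν => (sqrtBose β μ ν : ℂ) * k ν) g‖ ^ 2 := fun {k} hk => by
    have h2 := InvFinite.spectralApply_of_memLp H hg hρ hk
    have i1 := H.isFiniteMeasure ψ
    have i2 := H.isFiniteMeasure (spectralApply h k g)
    rw [(hψ.add H (h2.smul H c)).boseForm_eq H hβ hμ,
      H.spectralApply_add (hψ.memLp_sqrtBose hβ hμ) (H.memLp_smul c (h2.memLp_sqrtBose hβ hμ)),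
      H.spectralApply_smul c (h2.memLp_sqrtBose hβ hμ),
      H.spectralApply_spectralApply (hm hk) (measurable_sqrtBose β μ)
        (hg.memLp_sqrtBose_mul hβ hμ hρ hk)]
  rw [h1 hk']
  simp only [h1 (hk _)]
  refine (((tendsto_iff_edist_tendsto_0.2 ?_).const_smul c).const_add _).norm.pow 2
  simp only [edist_eq_enorm_sub]
  refine tendsto_zero_of_sq_le (b := fun t => ENNReal.ofReal (β⁻¹ + 1) *
    eLpNorm (k t - k') 2 (formMeasure ρ) ^ 2) (fun t => ?_) ?_
  · rw [← H.spectralApply_fun_sub (hg.memLp_sqrtBose_mul hβ hμ hρ (hk t))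
      (hg.memLp_sqrtBose_mul hβ hμ hρ hk')]
    simp only [← mul_sub]
    rw [H.enorm_spectralApply (n := fun ν => (sqrtBose β μ ν : ℂ) * (k t ν - k' ν))
      (hg.memLp_sqrtBose_mul hβ hμ hρ ((hk t).sub hk'))]
    refine (hg.eLpNorm_sqrtBose_mul_le hβ hμ ((hm (hk t)).1.sub (hm hk').1)).trans ?_
    gcongr
    exact formMeasure_mono hρ
  · have h3 := ENNReal.Tendsto.const_mul (a := ENNReal.ofReal (β⁻¹ + 1)) (ENNReal.Tendsto.pow (n := 2) hlim)
      (Or.inr ENNReal.ofReal_ne_top)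
    simpa using h3

end BoseConvergence

namespace Model

variable {N : ℕ} (M : Model N) {f : M.OneParticle}

theorem resBounded_of_mem (hf : f ∈ M.goodVectors) : ResBounded M.freeHam M.gVec f.snd :=
  M.resBounded_of_abs fun k => (hf k).1

theorem lowerBounded_of_mem (hf : f ∈ M.goodVectors) : LowerBounded M.freeHam M.gVec f.snd := by
  obtain ⟨C, hC⟩ := M.resBounded_of_mem hf
  exact ⟨C, fun z hz => hC z hz.ne⟩

theorem invFinite_of_mem (hf : f ∈ M.goodVectors) : InvFinite M.freeHam f.snd :=
  invFinite_sumHam M.isSpectral_h0 fun k => M.invFinite_of_mem_boseDomain (hf k).2.2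

theorem invFinite_g (hR : M.Regular) (k : Fin N) : InvFinite (M.h0 k) (M.g k) :=
  M.invFinite_of_mem_boseDomain (hR.condD k).2

theorem tendsto_sub_mul_I (x : ℝ) :
    Tendsto (fun ε : ℝ => (x : ℂ) - ε * I) (𝓝[>] 0) (𝓝 x) := by
  have h2 : Continuous fun ε : ℝ => (x : ℂ) - ε * I := by fun_prop
  simpa using (h2.tendsto 0).mono_left nhdsWithin_le_nhds

theorem ae_lim_inner {ψ : M.ResSpace} (hψ : ResBounded M.freeHam M.gVec ψ) :
    ∀ᵐ x : ℝ, ∃ w : ℂ, Tendsto (fun ε : ℝ =>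
      ⟪M.gVec, resolventVec M.freeHam ((x : ℂ) - ε * I) ψ⟫_ℂ) (𝓝[>] 0) (𝓝 w) := by
  obtain ⟨C, hC⟩ := hψ
  exact ae_exists_boundary_value_lower
    (G := fun z => ⟪M.gVec, resolventVec M.freeHam z ψ⟫_ℂ)
    (fun z hz => M.isSpectral_freeHam.differentiableAt_inner_resolventVec ψ hz.ne)
    fun z hz => hC z hz.ne

theorem ae_F_lim (hf : f ∈ M.goodVectors) :
    ∀ᵐ ν : ℝ, Tendsto (fun ε => M.Freg f ν ε) (𝓝[>] 0) (𝓝 (M.F f ν)) := by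
  filter_upwards [M.ae_lim_inner (M.resBounded_of_mem hf)] with ν ⟨w, hw⟩
  have h1 : Tendsto (fun ε => M.Freg f ν ε) (𝓝[>] 0) (𝓝 (f.fst + M.lam * w)) := by
    refine ((hw.const_mul (M.lam : ℂ)).const_add f.fst).congr' ?_
    filter_upwards [self_mem_nhdsWithin] with ε hε
    rw [M.Freg_eq f ν hε]
    rfl
  rwa [show M.F f ν = _ from h1.limUnder_eq]

theorem sub_mul_I_im_ne (ν : ℝ) {ε : ℝ} (hε : 0 < ε) : ((ν : ℂ) - ε * I).im ≠ 0 := by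
  rw [sub_mul_I_im]
  exact (neg_neg_of_pos hε).ne

theorem ae_ηMinus_lim (hR : M.Regular) : ∀ᵐ ν : ℝ,
    Tendsto (fun ε : ℝ => M.η ((ν : ℂ) - ε * I)) (𝓝[>] 0) (𝓝 (M.ηMinus ν)) := by
  filter_upwards [M.ae_lim_inner (M.resBounded_of_abs (ψ := M.gVec) hR.condA)] with ν ⟨w, hw⟩
  have h1 : Tendsto (fun ε : ℝ => M.η ((ν : ℂ) - ε * I)) (𝓝[>] 0)
      (𝓝 (ν - M.Ω - (M.lam : ℂ) ^ 2 * w)) := by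
    refine (((tendsto_sub_mul_I ν).sub_const _).sub (hw.const_mul _)).congr' ?_
    filter_upwards [self_mem_nhdsWithin] with ε hε
    rw [M.η_eq_of_im (sub_mul_I_im_ne ν hε),
      etaFn_eq M.isSpectral_freeHam (sub_mul_I_im_ne ν hε)]
  rwa [show M.ηMinus ν = _ from h1.limUnder_eq]

theorem isBoundaryQuotient (hR : M.Regular) (hf : f ∈ M.goodVectors) :
    IsBoundaryQuotient M.freeHam M.gVec M.Ω M.lam f fun ν => M.F f ν / M.ηMinus ν := by
  obtain ⟨κ, hκ, h1⟩ := M.exists_le_norm_etaFn hR.condA hR.condB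
  filter_upwards [M.ae_F_lim hf, M.ae_ηMinus_lim hR] with ν h2 h3
  have h4 : M.ηMinus ν ≠ 0 := by
    have h5 := ge_of_tendsto h3.norm (b := κ) (by
      filter_upwards [self_mem_nhdsWithin] with ε hε
      rw [M.η_eq_of_im (sub_mul_I_im_ne ν hε)]
      exact h1 _ (sub_mul_I_im_ne ν hε))
    exact norm_pos_iff.1 (hκ.trans_le h5)
  refine (h2.div h3 h4).congr' ?_
  filter_upwards [self_mem_nhdsWithin] with ε hε
  rw [Pi.div_apply, M.Freg_eq f ν hε, M.η_eq_of_im (sub_mul_I_im_ne ν hε)]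

theorem isFiniteMeasure_formMeasure (hR : M.Regular) : IsFiniteMeasure (formMeasure M.gMeasure) := by
  have i1 : IsFiniteMeasure M.gMeasure := M.isSpectral_freeHam.isFiniteMeasure M.gVec
  have i2 : IsFiniteMeasure (weightedMeasure M.gMeasure) :=
    (invFinite_sumHam M.isSpectral_h0 fun k => M.invFinite_g hR k :
      InvFinite M.freeHam M.gVec).isFiniteMeasure
  unfold formMeasure
  infer_instance

/-- The amplitude of the small system in the evolved vector `e^{ith} f`. -/
abbrev amplitude (f : M.OneParticle) : ℝ → ℂ := amp (unitaryGroup M.h) f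

theorem memLp_truncFourier_amplitude (hR : M.Regular)
    (f : M.OneParticle) (t : ℝ) :
    MemLp (truncFourier (M.amplitude f) t) 2 (formMeasure M.gMeasure) := by
  have := M.isFiniteMeasure_formMeasure hR
  exact IsSpectral.memLp_truncFourier _ (continuous_amp (M.isDecaying hR).group f)
    (norm_amp_le f) t

theorem tendsto_truncFourier_amplitude (hR : M.Regular)
    (hf : f ∈ M.goodVectors) :
    Tendsto (fun t => eLpNorm (truncFourier (M.amplitude f) t -
      fun ν => -I * (M.F f ν / M.ηMinus ν)) 2 (formMeasure M.gMeasure)) atTop (𝓝 0) := by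
  have D := M.isDecaying hR
  have h1 := ENNReal.Tendsto.pow (n := 2) (D.tendsto_truncFourier (M.lowerBounded_of_mem hf)
    (M.isBoundaryQuotient hR hf))
  have h2 := ENNReal.Tendsto.pow (n := 2) (D.tendsto_truncFourier_weighted
    (M.lowerBounded_of_mem hf) (M.invFinite_of_mem hf) (M.isBoundaryQuotient hR hf))
  refine tendsto_zero_of_sq_le (fun t => (eLpNorm_formMeasure_sq _ _).le) ?_
  simpa using h1.add h2

theorem memLp_quotient (hR : M.Regular) (hf : f ∈ M.goodVectors) :
    MemLp (fun ν => M.F f ν / M.ηMinus ν) 2 (formMeasure M.gMeasure) := by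
  have D := M.isDecaying hR
  have h0 := D.memLp_quotient (M.lowerBounded_of_mem hf) (M.isBoundaryQuotient hR hf)
  have hm : AEStronglyMeasurable (fun ν => M.F f ν / M.ηMinus ν) (formMeasure M.gMeasure) :=
    h0.1.add_measure (h0.1.mono_ac (weightedMeasure_ac _))
  obtain ⟨t, ht⟩ := ((tendsto_order.1 (M.tendsto_truncFourier_amplitude hR hf)).2 1
    one_pos).exists
  have h1 := M.memLp_truncFourier_amplitude hR f t
  have h2 : MemLp (truncFourier (M.amplitude f) t -
      fun ν => -I * (M.F f ν / M.ηMinus ν)) 2 (formMeasure M.gMeasure) :=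
    ⟨h1.1.sub (hm.const_mul _), ht.trans ENNReal.one_lt_top⟩
  refine ((h2.sub h1).const_mul (-I)).ae_eq (Eventually.of_forall fun ν => ?_)
  simp only [Pi.sub_apply]
  linear_combination (-(M.F f ν / M.ηMinus ν)) * Complex.I_sq

end Model

end

section

section WeylRelations

variable {K : Type} [NormedAddCommGroup K] [InnerProductSpace ℂ K]

theorem W_mul (f g : K) : W f * W g = (Circle.exp (-(symp f g) / 2) : ℂ) • W (f + g) :=
  Subtype.ext (weyl_mul f g)

theorem W_zero : W (0 : K) = 1 := Subtype.ext weyl_zero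

end WeylRelations

namespace Model

variable {N : ℕ} (M : Model N) {f : M.OneParticle}
  {ω : weylAlgebra (Set.univ : Set M.OneParticle) →L[ℂ] ℂ}

theorem continuous_smallSystem (hC : M.CondC ω) : Continuous fun c : ℂ => ω (W (M.vec c 0)) := by
  have h1 := (hC.1 2 ![1, I]).continuous.comp
    (show Continuous fun c : ℂ => (![c.re, c.im] : Fin 2 → ℝ) from
      continuous_pi fun j => by fin_cases j <;> simp <;> fun_prop)
  have h2 : ∀ c : ℂ, (c.re : ℂ) • M.vec 1 0 + (c.im : ℂ) • M.vec I 0 = M.vec c 0 := by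
    intro c
    refine withLp_prod_ext ?_ ?_
    · change (c.re : ℂ) * 1 + (c.im : ℂ) * I = c
      rw [mul_one, Complex.re_add_im]
    · refine PiLp.ext fun k => ?_
      change (c.re : ℂ) • (0 : (M.res k).Space) + (c.im : ℂ) • (0 : (M.res k).Space) = 0
      simp
  have h3 : ∀ c : ℂ, ω (W (M.vec c 0)) =
      ((Circle.exp (-(symp ((c.re : ℂ) • M.vec 1 0) ((c.im : ℂ) • M.vec I 0)) / 2) : ℂ))⁻¹ *
        correlation ω (fun j => M.vec ((![1, I] : Fin 2 → ℂ) j) 0) ![c.re, c.im] := by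
    intro c
    have h4 : correlation ω (fun j => M.vec ((![1, I] : Fin 2 → ℂ) j) 0) ![c.re, c.im] =
        ω (W ((c.re : ℂ) • M.vec 1 0) * W ((c.im : ℂ) • M.vec I 0)) := by
      simp [correlation, List.ofFn_succ]
    rw [h4, W_mul, map_smul, h2, smul_eq_mul, inv_mul_cancel_left₀ (Circle.coe_ne_zero _)]
  simp only [h3]
  refine Continuous.mul (Continuous.inv₀ ?_ fun c => Circle.coe_ne_zero _) h1
  simp only [Circle.coe_exp, symp]
  have : Continuous fun c : ℂ => ⟪(c.re : ℂ) • M.vec 1 0, (c.im : ℂ) • M.vec I 0⟫_ℂ := by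
    fun_prop
  fun_prop

theorem snd_evolved (hR : M.Regular) (f : M.OneParticle) (t : ℝ)
    (l : Fin N) : (unitaryGroup M.h t f).snd l = (M.res l).group t (f.snd l +
      (I * M.lam) • spectralApply (M.h0 l) (truncFourier (M.amplitude f) t) (M.g l)) := by
  have D := M.isDecaying hR
  rw [D.coupled.snd_apply D.spectral D.group]
  change (M.res l).group t (f.snd l + (I * M.lam) •
    spectralApply M.freeHam (truncFourier (M.amplitude f) t) M.gVec l) = _
  rw [spectralApply_sumHam_apply M.isSpectral_h0 ((M.memLp_truncFourier_amplitude hR f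
    t).mono_measure (le_formMeasure _))]
  rfl

theorem φ_eq (hR : M.Regular) (hf : f ∈ M.goodVectors) (l : Fin N) :
    M.φ f l = f.snd l + (I * M.lam) • spectralApply (M.h0 l)
      (fun ν => -I * (M.F f ν / M.ηMinus ν)) (M.g l) := by
  rw [φ, (M.isSpectral_h0 l).spectralApply_fun_smul ((M.memLp_quotient hR hf).mono_measure
    ((M.spectralMeasure_le_gMeasure l).trans (le_formMeasure _))), smul_smul]
  congr 2
  linear_combination (M.lam : ℂ) * Complex.I_sq

theorem invFinite_component (hR : M.Regular) (hf : f ∈ M.goodVectors) {k : ℝ → ℂ}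
    (hk : MemLp k 2 (formMeasure M.gMeasure)) (c : ℂ) (l : Fin N) :
    InvFinite (M.h0 l) (f.snd l + c • spectralApply (M.h0 l) k (M.g l)) :=
  (M.invFinite_of_mem_boseDomain (hf l).2.2).add (M.isSpectral_h0 l)
    ((InvFinite.spectralApply_of_memLp (M.isSpectral_h0 l) (M.invFinite_g hR l)
      (M.spectralMeasure_le_gMeasure l) hk).smul (M.isSpectral_h0 l) c)

theorem invFinite_φ (hR : M.Regular) (hf : f ∈ M.goodVectors)
    (l : Fin N) : InvFinite (M.h0 l) (M.φ f l) := by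
  rw [M.φ_eq hR hf]
  exact M.invFinite_component hR hf ((M.memLp_quotient hR hf).const_mul _) _ l

theorem η_zero_eq (hR : M.Regular) : M.η 0 = -(gap M.gMeasure M.Ω M.lam : ℂ) := by
  rw [M.η_eq fun k => ?_, etaFn, gap]
  · have h1 : ∀ ν : ℝ, ((0 : ℂ) - ν)⁻¹ = -((ν⁻¹ : ℝ) : ℂ) := fun ν => by
      rw [zero_sub, inv_neg, Complex.ofReal_inv]
    simp only [h1, integral_neg]
    rw [integral_complex_ofReal]
    push_cast
    ring
  · refine ((M.invFinite_g hR k).integrable.ofReal (𝕜 := ℂ)).neg.congr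
      (Eventually.of_forall fun ν => ?_)
    simp only [Pi.neg_apply, zero_sub, inv_neg]
    congr 1
    exact Complex.ofReal_inv ν

theorem wellDefined (hR : M.Regular) (hf : f ∈ M.goodVectors) :
    M.WellDefined f where
  F_lim := M.ae_F_lim hf
  η_lim := M.ae_ηMinus_lim hR
  memLp l := (M.memLp_quotient hR hf).mono_measure
    ((M.spectralMeasure_le_gMeasure l).trans (le_formMeasure _))
  φ_mem l := (M.invFinite_φ hR hf l).mem_boseDomain (M.β_pos l) le_rfl
  η_zero := by
    rw [M.η_zero_eq hR, neg_ne_zero]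
    exact_mod_cast (M.isDecaying hR).gap_pos.ne'

theorem weight_evolved (hR : M.Regular) (hf : f ∈ M.goodVectors)
    (t : ℝ) (l : Fin N) : (unitaryGroup M.h t f).snd l ∈ (M.res l).weightDomain ∧
      (M.res l).weight ((unitaryGroup M.h t f).snd l) = (M.res l).weight (f.snd l) +
        M.lam * (I * ∫ s in (0 : ℝ)..t, M.amplitude f s) * (M.res l).weight (M.g l) := by
  have w := (M.res l).isInvariantWeight
  have h1 := w.integral _ _ (continuous_amp (M.isDecaying hR).group f) (norm_amp_le f) t
    (M.g l) (hR.condD l).1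
  have h2 := w.smul (I * M.lam) _ h1.1
  have h3 := w.add _ (hf l).2.1 _ h2.1
  have h4 := w.apply t _ h3.1
  rw [M.snd_evolved hR]
  refine ⟨h4.1, ?_⟩
  rw [h4.2, h3.2, h2.2, h1.2]
  ring

theorem invFinite_evolved (hR : M.Regular) (hf : f ∈ M.goodVectors)
    (t : ℝ) (l : Fin N) : InvFinite (M.h0 l) ((unitaryGroup M.h t f).snd l) := by
  rw [M.snd_evolved hR]
  exact (M.invFinite_component hR hf (M.memLp_truncFourier_amplitude hR f t) _ l).apply
    (M.isSpectral_h0 l) t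

theorem state_evolved (hω : M.IsInitialState ω) (hR : M.Regular)
    (hf : f ∈ M.goodVectors) (t : ℝ) : ω (M.α t (W f)) = ω (W (M.vec (M.amplitude f t) 0)) *
      ∏ l, (Complex.exp (-(1 / 2) * (boseForm (M.h0 l) (M.β l) (M.μ l) (f.snd l +
        (I * M.lam) • spectralApply (M.h0 l) (truncFourier (M.amplitude f) t) (M.g l)) : ℂ)) *
        Complex.exp (I * (M.Θ l ((M.res l).weight (f.snd l) +
        M.lam * (I * ∫ s in (0 : ℝ)..t, M.amplitude f s) *
          (M.res l).weight (M.g l)) : ℂ))) := by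
  have h1 : ∀ l, (unitaryGroup M.h t f).snd l ∈
      (M.res l).weightDomain ∩ boseDomain (M.h0 l) (M.β l) (M.μ l) := fun l =>
    ⟨(M.weight_evolved hR hf t l).1,
      (M.invFinite_evolved hR hf t l).mem_boseDomain (M.β_pos l) (M.μ_nonpos l)⟩
  have h2 : unitaryGroup M.h t f =
      M.vec (M.amplitude f t) fun l => (unitaryGroup M.h t f).snd l := rfl
  rw [α, bogoliubov_W, h2, hω.product _ _ h1]
  congr 1
  refine Finset.prod_congr rfl fun l _ => ?_
  rw [hω.reservoir l _ (h1 l), (M.weight_evolved hR hf t l).2, boseForm, boseForm,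
    M.snd_evolved hR, (M.isSpectral_h0 l).spectralMeasure_apply]

/-- The limit of `ω(α_t(W(f)))` along a filter, in terms of the limits of the amplitude, of its
integral and of its truncated Fourier transform. -/
theorem tendsto_state_evolved (hω : M.IsInitialState ω) (hR : M.Regular) (hC : M.CondC ω) (hf : f ∈ M.goodVectors) {F : Filter ℝ} {k : ℝ → ℂ} {a b : ℂ}
    (hk : MemLp k 2 (formMeasure M.gMeasure))
    (hlim : Tendsto (fun t => eLpNorm (truncFourier (M.amplitude f) t - k) 2
      (formMeasure M.gMeasure)) F (𝓝 0)) (ha : Tendsto (M.amplitude f) F (𝓝 a))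
    (hb : Tendsto (fun t => I * ∫ s in (0 : ℝ)..t, M.amplitude f s) F (𝓝 b)) :
    Tendsto (fun t => ω (M.α t (W f))) F (𝓝 (ω (W (M.vec a 0)) *
      ∏ l, (Complex.exp (-(1 / 2) * (boseForm (M.h0 l) (M.β l) (M.μ l) (f.snd l +
        (I * M.lam) • spectralApply (M.h0 l) k (M.g l)) : ℂ)) *
        Complex.exp (I * (M.Θ l ((M.res l).weight (f.snd l) +
        M.lam * b * (M.res l).weight (M.g l)) : ℂ))))) := by
  simp only [M.state_evolved hω hR hf]
  refine (((M.continuous_smallSystem hC).tendsto a).comp ha).mul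
    (tendsto_finsetProd _ fun l _ => Tendsto.mul ?_ ?_)
  · have h1 := tendsto_boseForm (M.isSpectral_h0 l) (M.invFinite_g hR l)
      (M.invFinite_of_mem_boseDomain (hf l).2.2) (M.β_pos l) (M.μ_nonpos l)
      (M.spectralMeasure_le_gMeasure l) (M.memLp_truncFourier_amplitude hR f) hk hlim
      (I * M.lam)
    exact (((Complex.continuous_ofReal.tendsto _).comp h1).const_mul _).cexp
  · have h2 : Continuous (M.Θ l) := LinearMap.continuous_of_finiteDimensional _
    exact (((Complex.continuous_ofReal.tendsto _).comp ((h2.tendsto _).comp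
      (((hb.const_mul (M.lam : ℂ)).mul_const _).const_add _))).const_mul _).cexp

theorem continuous_state_evolved (hω : M.IsInitialState ω) (hR : M.Regular) (hC : M.CondC ω) (hf : f ∈ M.goodVectors) :
    Continuous fun t => ω (M.α t (W f)) := by
  have hc := continuous_amp (M.isDecaying hR).group f
  refine continuous_iff_continuousAt.2 fun t₀ => ?_
  have h1 := M.tendsto_state_evolved (F := 𝓝 t₀) hω hR hC hf
    (M.memLp_truncFourier_amplitude hR f t₀) ?_ (hc.tendsto t₀) (b := I *
      ∫ s in (0 : ℝ)..t₀, M.amplitude f s) ?_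
  · rw [← M.state_evolved hω hR hf] at h1
    exact h1
  · have i1 := M.isFiniteMeasure_formMeasure hR
    have h2 : ∀ t, eLpNorm (truncFourier (M.amplitude f) t - truncFourier (M.amplitude f) t₀) 2
        (formMeasure M.gMeasure) ≤ formMeasure M.gMeasure Set.univ ^ (2 : ℝ≥0∞).toReal⁻¹ *
          ENNReal.ofReal (‖f‖ * |t - t₀|) := fun t => by
      refine eLpNorm_le_of_ae_bound (Eventually.of_forall fun ν => ?_)
      have h3 : ∀ s, Continuous fun r : ℝ =>
        Complex.exp (-(I * r * s)) * M.amplitude f r := fun s => by fun_prop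
      rw [Pi.sub_apply, truncFourier, truncFourier, intervalIntegral.integral_interval_sub_left
        ((h3 ν).intervalIntegrable _ _) ((h3 ν).intervalIntegrable _ _)]
      refine intervalIntegral.norm_integral_le_of_norm_le_const fun r _ => ?_
      rw [norm_mul, norm_exp_neg_I_mul, one_mul]
      exact norm_amp_le f r
    refine tendsto_of_tendsto_of_tendsto_of_le_of_le tendsto_const_nhds ?_ (fun _ => zero_le) h2
    have h4 : Tendsto (fun t => ENNReal.ofReal (‖f‖ * |t - t₀|)) (𝓝 t₀) (𝓝 0) := by
      have h5 : Continuous fun t => ENNReal.ofReal (‖f‖ * |t - t₀|) :=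
        ENNReal.continuous_ofReal.comp (by fun_prop)
      simpa using h5.tendsto t₀
    have h6 := ENNReal.Tendsto.const_mul
      (a := formMeasure M.gMeasure Set.univ ^ (2 : ℝ≥0∞).toReal⁻¹) h4 (Or.inr ?_)
    · simpa using h6
    · exact ENNReal.rpow_ne_top_of_nonneg (by simp) (measure_ne_top _ _)
  · exact ((intervalIntegral.continuous_primitive
      (fun a b => hc.intervalIntegrable a b) 0).tendsto t₀).const_mul _

theorem weightφ_eq (hR : M.Regular) (hf : f ∈ M.goodVectors)
    {m : ℝ → ℂ} (hm : IsSpectral.IsProj M.freeHam M.gVec f.snd m) (l : Fin N) :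
    (M.res l).weight (f.snd l) + M.lam * -invAmp M.freeHam M.gVec M.Ω M.lam f m *
      (M.res l).weight (M.g l) = M.weightφ f l := by
  have D := M.isDecaying hR
  have h1 : (gap M.gMeasure M.Ω M.lam : ℂ) ≠ 0 := by exact_mod_cast D.gap_pos.ne'
  have h2 := invForm_sumHam M.isSpectral_h0 (g := M.gVec) (ψ := f.snd) (fun k => M.invFinite_g hR k)
    fun k => M.invFinite_of_mem_boseDomain (hf k).2.2
  rw [hm.invForm_eq D.spectral D.invFinite (M.invFinite_of_mem hf)] at h2
  change _ = ∑ k, invForm (M.h0 k) (M.g k) (f.snd k) at h2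
  rw [weightφ, M.η_zero_eq hR, invAmp, h2]
  field_simp
  ring

theorem tendsto_state (hω : M.IsInitialState ω) (hR : M.Regular) (hC : M.CondC ω) (hf : f ∈ M.goodVectors) :
    Tendsto (fun t => ω (M.α t (W f))) atTop
      (𝓝 (Complex.exp (-(1 / 2) * (M.S f : ℂ) + I * (M.Λ f : ℂ)))) := by
  have D := M.isDecaying hR
  obtain ⟨m, hm⟩ := D.spectral.exists_isProj M.gVec f.snd
  have h1 := M.tendsto_state_evolved hω hR hC hf
    ((M.memLp_quotient hR hf).const_mul (-I))
    (M.tendsto_truncFourier_amplitude hR hf) (D.tendsto_amp (M.lowerBounded_of_mem hf))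
    (D.tendsto_integral_amp (M.lowerBounded_of_mem hf) (M.invFinite_of_mem hf) hm)
  have h2 : M.vec 0 0 = 0 := rfl
  simp only [M.weightφ_eq hR hf hm, ← M.φ_eq hR hf, h2, W_zero, hω.isState.one,
    one_mul] at h1
  convert h1 using 2
  rw [S, Λ, Finset.prod_mul_distrib, ← Complex.exp_sum, ← Complex.exp_sum, Complex.exp_add]
  push_cast
  rw [Finset.mul_sum, Finset.mul_sum]

end Model

end

section

namespace Model

variable {N : ℕ} (M : Model N)

theorem abs_add {E : Type} [NormedAddCommGroup E] [InnerProductSpace ℂ E] {h : E →ₗ.[ℂ] E}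
    {ψ ξ g : E} (hψ : Abs h ψ g) (hξ : Abs h ξ g) : Abs h (ψ + ξ) g := by
  obtain ⟨C, hC⟩ := hψ
  obtain ⟨C', hC'⟩ := hξ
  refine ⟨C + C', fun ν ε hε => ?_⟩
  simp only [inner_add_left]
  exact ⟨(norm_add_le _ _).trans (add_le_add (hC ν ε hε).1 (hC' ν ε hε).1),
    (norm_add_le _ _).trans (add_le_add (hC ν ε hε).2 (hC' ν ε hε).2)⟩

theorem abs_smul {E : Type} [NormedAddCommGroup E] [InnerProductSpace ℂ E] {h : E →ₗ.[ℂ] E}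
    {ψ g : E} (c : ℂ) (hψ : Abs h ψ g) : Abs h (c • ψ) g := by
  obtain ⟨C, hC⟩ := hψ
  refine ⟨‖c‖ * C, fun ν ε hε => ?_⟩
  simp only [inner_smul_left, norm_mul, RCLike.norm_conj]
  exact ⟨mul_le_mul_of_nonneg_left (hC ν ε hε).1 (norm_nonneg _),
    mul_le_mul_of_nonneg_left (hC ν ε hε).2 (norm_nonneg _)⟩

theorem smul_mem_good (c : ℂ) {f : M.OneParticle} (hf : f ∈ M.goodVectors) :
    c • f ∈ M.goodVectors := fun k =>
  ⟨abs_smul c (hf k).1, ((M.res k).isInvariantWeight.smul c _ (hf k).2.1).1,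
    ((M.invFinite_of_mem_boseDomain (hf k).2.2).smul (M.isSpectral_h0 k) c).mem_boseDomain
      (M.β_pos k) le_rfl⟩

/-- The subspace `ℂ ⊕ 𝔨`. -/
def goodSubmodule (hR : M.Regular) : Submodule ℂ M.OneParticle where
  carrier := M.goodVectors
  zero_mem' := by
    have h1 : M.vec 0 M.g ∈ M.goodVectors := fun k => ⟨hR.condA k, hR.condD k⟩
    have h2 := M.smul_mem_good 0 h1
    rwa [zero_smul] at h2
  add_mem' ha hb k :=
    ⟨abs_add (ha k).1 (hb k).1, ((M.res k).isInvariantWeight.add _ (ha k).2.1 _ (hb k).2.1).1,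
      ((M.invFinite_of_mem_boseDomain (ha k).2.2).add (M.isSpectral_h0 k)
        (M.invFinite_of_mem_boseDomain (hb k).2.2)).mem_boseDomain (M.β_pos k) le_rfl⟩
  smul_mem' c _ hf := M.smul_mem_good c hf

variable {M} {f f' : M.OneParticle}

theorem ae_F_add (hR : M.Regular) (hf : f ∈ M.goodVectors)
    (hf' : f' ∈ M.goodVectors) : ∀ᵐ ν : ℝ, M.F (f + f') ν = M.F f ν + M.F f' ν := by
  filter_upwards [M.ae_F_lim hf, M.ae_F_lim hf',
    M.ae_F_lim ((M.goodSubmodule hR).add_mem hf hf')] with ν h1 h2 h3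
  refine tendsto_nhds_unique h3 ((h1.add h2).congr' ?_)
  filter_upwards [self_mem_nhdsWithin] with ε hε
  rw [M.Freg_eq _ ν hε, M.Freg_eq _ ν hε, M.Freg_eq _ ν hε]
  simp only [ampNum, WithLp.add_fst, WithLp.add_snd,
    M.isSpectral_freeHam.resolventVec_add (sub_mul_I_im_ne ν hε), inner_add_right]
  ring

theorem ae_F_smul (c : ℂ) (hf : f ∈ M.goodVectors) :
    ∀ᵐ ν : ℝ, M.F (c • f) ν = c * M.F f ν := by
  filter_upwards [M.ae_F_lim hf, M.ae_F_lim (M.smul_mem_good c hf)] with ν h1 h3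
  refine tendsto_nhds_unique h3 ((h1.const_mul c).congr' ?_)
  filter_upwards [self_mem_nhdsWithin] with ε hε
  rw [M.Freg_eq _ ν hε, M.Freg_eq _ ν hε]
  simp only [ampNum, WithLp.smul_fst, WithLp.smul_snd, smul_eq_mul,
    M.isSpectral_freeHam.resolventVec_smul (sub_mul_I_im_ne ν hε), inner_smul_right]
  ring

theorem spectralMeasure_ac_volume (hR : M.Regular) (l : Fin N) :
    spectralMeasure (M.h0 l) (M.g l) ≪ volume :=
  (Measure.absolutelyContinuous_of_le (M.spectralMeasure_le_gMeasure l)).trans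
    (M.isDecaying hR).spectralMeasure_ac

theorem φ_add (hR : M.Regular) (hf : f ∈ M.goodVectors)
    (hf' : f' ∈ M.goodVectors) (l : Fin N) : M.φ (f + f') l = M.φ f l + M.φ f' l := by
  have H := M.isSpectral_h0 l
  have h1 : (fun ν => M.F (f + f') ν / M.ηMinus ν) =ᵐ[spectralMeasure (M.h0 l) (M.g l)]
      fun ν => M.F f ν / M.ηMinus ν + M.F f' ν / M.ηMinus ν := by
    filter_upwards [(spectralMeasure_ac_volume hR l).ae_le (ae_F_add hR hf hf')] with ν hν
    rw [hν, add_div]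
  rw [φ, φ, φ, H.spectralApply_congr h1, H.spectralApply_fun_add
    ((M.wellDefined hR hf).memLp l) ((M.wellDefined hR hf').memLp l), smul_add,
    WithLp.add_snd, PiLp.add_apply]
  abel

theorem φ_smul (hR : M.Regular) (c : ℂ) (hf : f ∈ M.goodVectors)
    (l : Fin N) : M.φ (c • f) l = c • M.φ f l := by
  have H := M.isSpectral_h0 l
  have h1 : (fun ν => M.F (c • f) ν / M.ηMinus ν) =ᵐ[spectralMeasure (M.h0 l) (M.g l)]
      fun ν => c * (M.F f ν / M.ηMinus ν) := by
    filter_upwards [(spectralMeasure_ac_volume hR l).ae_le (ae_F_smul c hf)] with ν hν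
    rw [hν, mul_div_assoc]
  rw [φ, φ, H.spectralApply_congr h1, H.spectralApply_fun_smul
    ((M.wellDefined hR hf).memLp l), smul_add, smul_comm, WithLp.smul_snd, PiLp.smul_apply]

/-- The linear map `f ↦ (𝒩(h₀_l) + 1/2)^{1/2} φ_l(f)`. -/
def formRoot (hR : M.Regular) (l : Fin N) :
    M.goodSubmodule hR →ₗ[ℂ] (M.res l).Space where
  toFun f := spectralApply (M.h0 l) (fun ν => (sqrtBose (M.β l) (M.μ l) ν : ℂ)) (M.φ f l)
  map_add' f f' := by
    have i1 := (M.isSpectral_h0 l).isFiniteMeasure (M.φ f l)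
    have i2 := (M.isSpectral_h0 l).isFiniteMeasure (M.φ f' l)
    rw [Submodule.coe_add, φ_add hR f.2 f'.2]
    exact (M.isSpectral_h0 l).spectralApply_add
      ((M.invFinite_φ hR f.2 l).memLp_sqrtBose (M.β_pos l) (M.μ_nonpos l))
      ((M.invFinite_φ hR f'.2 l).memLp_sqrtBose (M.β_pos l) (M.μ_nonpos l))
  map_smul' c f := by
    have i1 := (M.isSpectral_h0 l).isFiniteMeasure (M.φ f l)
    rw [Submodule.coe_smul, φ_smul hR c f.2]
    exact (M.isSpectral_h0 l).spectralApply_smul c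
      ((M.invFinite_φ hR f.2 l).memLp_sqrtBose (M.β_pos l) (M.μ_nonpos l))

/-- The linear functional `f ↦ ⟨v_l, φ_l(f)⟩`. -/
def weightFunctional (hR : M.Regular) (l : Fin N) :
    M.goodSubmodule hR →ₗ[ℂ] ℂ where
  toFun f := M.weightφ f l
  map_add' f f' := by
    have h1 : ∀ k, invForm (M.h0 k) (M.g k) ((f + f' : M.OneParticle).snd k) =
        invForm (M.h0 k) (M.g k) ((f : M.OneParticle).snd k) +
        invForm (M.h0 k) (M.g k) ((f' : M.OneParticle).snd k) := fun k => by
      rw [invForm, WithLp.add_snd, PiLp.add_apply, (M.isSpectral_h0 k).spectralApply_add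
        (M.invFinite_of_mem_boseDomain (f.2 k).2.2).memLp_sqrt
        (M.invFinite_of_mem_boseDomain (f'.2 k).2.2).memLp_sqrt, inner_add_right]
      rfl
    have h2 : (M.res l).weight ((f + f' : M.OneParticle).snd l) =
        (M.res l).weight ((f : M.OneParticle).snd l) +
        (M.res l).weight ((f' : M.OneParticle).snd l) :=
      ((M.res l).isInvariantWeight.add _ (f.2 l).2.1 _ (f'.2 l).2.1).2
    simp only [weightφ, Submodule.coe_add, h1, h2, WithLp.add_fst, Finset.sum_add_distrib]
    ring
  map_smul' c f := by
    have h1 : ∀ k, invForm (M.h0 k) (M.g k) ((c • f : M.OneParticle).snd k) =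
        c * invForm (M.h0 k) (M.g k) ((f : M.OneParticle).snd k) := fun k => by
      rw [invForm, WithLp.smul_snd, PiLp.smul_apply, (M.isSpectral_h0 k).spectralApply_smul c
        (M.invFinite_of_mem_boseDomain (f.2 k).2.2).memLp_sqrt, inner_smul_right]
      rfl
    have h2 : (M.res l).weight ((c • f : M.OneParticle).snd l) =
        c * (M.res l).weight ((f : M.OneParticle).snd l) :=
      ((M.res l).isInvariantWeight.smul c _ (f.2 l).2.1).2
    simp only [weightφ, Submodule.coe_smul, h1, h2, WithLp.smul_fst, ← Finset.mul_sum,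
      smul_eq_mul, RingHom.id_apply]
    ring

theorem isQuasiFree (hR : M.Regular) {ρ : M.goodAlgebra →L[ℂ] ℂ}
    (hρ : ∀ f (hf : f ∈ M.goodVectors), ρ ⟨weyl f, weyl_mem hf⟩ =
      Complex.exp (-(1 / 2) * (M.S f : ℂ) + I * (M.Λ f : ℂ))) : M.IsQuasiFree ρ := by
  let T := formRoot hR
  refine ⟨M.goodSubmodule hR, rfl, LinearMap.mk₂ ℝ (fun f f' => ∑ l, (⟪T l f, T l f'⟫_ℂ).re)
    ?_ ?_ ?_ ?_, ∑ l, M.Θ l ∘ₗ (weightFunctional hR l).restrictScalars ℝ, ?_, ?_⟩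
  · intro f f' f''
    simp only [map_add, inner_add_left, Complex.add_re, Finset.sum_add_distrib]
  · intro c f f'
    have h1 : ∀ l, T l (c • f) = (c : ℂ) • T l f := fun l => (T l).map_smul (c : ℂ) f
    simp only [h1, inner_smul_left, Complex.conj_ofReal, Complex.re_ofReal_mul, smul_eq_mul,
      Finset.mul_sum]
  · intro f f' f''
    simp only [map_add, inner_add_right, Complex.add_re, Finset.sum_add_distrib]
  · intro c f f'
    have h1 : ∀ l, T l (c • f') = (c : ℂ) • T l f' := fun l => (T l).map_smul (c : ℂ) f'
    simp only [h1, inner_smul_right, Complex.re_ofReal_mul, smul_eq_mul, Finset.mul_sum]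
  · intro f f'
    simp only [LinearMap.mk₂_apply]
    refine Finset.sum_congr rfl fun l _ => ?_
    rw [← inner_conj_symm, Complex.conj_re]
  · intro f hf
    have h1 : M.S f = ∑ l, (⟪T l f, T l f⟫_ℂ).re := by
      refine Finset.sum_congr rfl fun l _ => ?_
      rw [(M.invFinite_φ hR hf l).boseForm_eq (M.isSpectral_h0 l) (M.β_pos l)
        (M.μ_nonpos l)]
      exact (inner_self_eq_norm_sq (𝕜 := ℂ) (T l f)).symm
    have h2 : M.Λ f = (∑ l, M.Θ l ∘ₗ (weightFunctional hR l).restrictScalars ℝ :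
        M.goodSubmodule hR →ₗ[ℝ] ℝ) f := by
      rw [LinearMap.sum_apply]
      rfl
    rw [hρ f hf, h1, h2]
    rfl

end Model

end

section

section WeylSpan

variable {K : Type} [NormedAddCommGroup K] [InnerProductSpace ℂ K]

theorem adjoin_weyl_le_span (D : Submodule ℂ K) {a : RegSpace K →L[ℂ] RegSpace K}
    (ha : a ∈ StarAlgebra.adjoin ℂ (weyl '' (D : Set K))) :
    a ∈ Submodule.span ℂ (weyl '' (D : Set K)) := by
  induction ha using StarAlgebra.adjoin_induction with
  | mem x hx => exact Submodule.subset_span hx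
  | algebraMap r =>
    rw [Algebra.algebraMap_eq_smul_one, ← weyl_zero (K := K)]
    exact Submodule.smul_mem _ _ (Submodule.subset_span ⟨0, D.zero_mem, rfl⟩)
  | add x y _ _ hx hy => exact Submodule.add_mem _ hx hy
  | mul x y _ _ hx hy =>
    have h1 := Submodule.mul_mem_mul hx hy
    rw [Submodule.span_mul_span] at h1
    refine Submodule.span_le.2 ?_ h1
    rintro _ ⟨_, ⟨f, hf, rfl⟩, _, ⟨f', hf', rfl⟩, rfl⟩
    simp only [weyl_mul]
    exact Submodule.smul_mem _ _ (Submodule.subset_span ⟨f + f', D.add_mem hf hf', rfl⟩)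
  | star x hxa hx =>
    clear hxa
    induction hx using Submodule.span_induction with
    | mem x hx =>
      obtain ⟨f, hf, rfl⟩ := hx
      rw [star_weyl]
      exact Submodule.subset_span ⟨-f, D.neg_mem hf, rfl⟩
    | zero => rw [star_zero]; exact Submodule.zero_mem _
    | add x y _ _ hx hy => rw [star_add]; exact Submodule.add_mem _ hx hy
    | smul c x _ hx => rw [star_smul]; exact Submodule.smul_mem _ _ hx

theorem span_weyl_le (D : Set K) {a : RegSpace K →L[ℂ] RegSpace K}
    (ha : a ∈ Submodule.span ℂ (weyl '' D)) : a ∈ weylAlgebra D := by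
  have h1 : Submodule.span ℂ (weyl '' D) ≤ (weylAlgebra D).toSubalgebra.toSubmodule := by
    refine Submodule.span_le.2 ?_
    rintro _ ⟨f, hf, rfl⟩
    exact weyl_mem hf
  exact h1 ha

theorem norm_inclusion {S T : StarSubalgebra ℂ (RegSpace K →L[ℂ] RegSpace K)} (h : S ≤ T) (a : S) :
    ‖StarSubalgebra.inclusion h a‖ = ‖a‖ := rfl

theorem norm_permOp_le (U : K ≃ₗᵢ[ℂ] K) : ‖permOp U‖ ≤ 1 :=
  LinearIsometry.norm_toContinuousLinearMap_le _

theorem norm_bogoliubov_le (U : K ≃ₗᵢ[ℂ] K) (a : weylAlgebra (Set.univ : Set K)) :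
    ‖bogoliubov U a‖ ≤ ‖a‖ := by
  change ‖permOp U * (a : RegSpace K →L[ℂ] RegSpace K) * permOp U.symm‖ ≤
    ‖(a : RegSpace K →L[ℂ] RegSpace K)‖
  calc _ ≤ ‖permOp U‖ * ‖(a : RegSpace K →L[ℂ] RegSpace K)‖ * ‖permOp U.symm‖ :=
        (norm_mul_le _ _).trans (by gcongr; exact norm_mul_le _ _)
    _ ≤ 1 * ‖(a : RegSpace K →L[ℂ] RegSpace K)‖ * 1 := by
        gcongr <;> exact norm_permOp_le _
    _ = _ := by ring

end WeylSpan

/-- The Cesàro means of a convergent bounded continuous function converge to its limit. -/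
theorem tendsto_average {u : ℝ → ℂ} {L : ℂ} {C : ℝ} (hu : Continuous u) (hC : ∀ t, ‖u t‖ ≤ C)
    (hL : Tendsto u atTop (𝓝 L)) :
    Tendsto (fun T : ℝ => (T : ℂ)⁻¹ * ∫ t in (0 : ℝ)..T, u t) atTop (𝓝 L) := by
  have h1 : Tendsto (fun T : ℝ => ∫ s in (0 : ℝ)..1, u (T * s)) atTop
      (𝓝 (∫ _ in (0 : ℝ)..1, L)) := by
    refine intervalIntegral.tendsto_integral_filter_of_dominated_convergence (fun _ => C)
      (Eventually.of_forall fun T => (Continuous.aestronglyMeasurable (by fun_prop)))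
      (Eventually.of_forall fun T => Eventually.of_forall fun s _ => hC _)
      intervalIntegrable_const (Eventually.of_forall fun s hs => ?_)
    rw [Set.uIoc_of_le zero_le_one] at hs
    exact hL.comp (tendsto_id.atTop_mul_const hs.1)
  rw [intervalIntegral.integral_const, sub_zero, one_smul] at h1
  refine h1.congr' ?_
  filter_upwards [eventually_gt_atTop 0] with T hT
  rw [intervalIntegral.integral_comp_mul_left u hT.ne', mul_zero, mul_one, Complex.real_smul,
    Complex.ofReal_inv]

namespace Model

variable {N : ℕ} {M : Model N} {ω : weylAlgebra (Set.univ : Set M.OneParticle) →L[ℂ] ℂ}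

theorem evolved_add (t : ℝ) (a b : M.goodAlgebra) :
    M.evolved ω t (a + b) = M.evolved ω t a + M.evolved ω t b := by
  simp only [evolved, map_add]

theorem evolved_smul (t : ℝ) (c : ℂ) (a : M.goodAlgebra) :
    M.evolved ω t (c • a) = c * M.evolved ω t a := by
  simp only [evolved, map_smul, smul_eq_mul]

theorem norm_evolved_le (t : ℝ) (a : M.goodAlgebra) : ‖M.evolved ω t a‖ ≤ ‖ω‖ * ‖a‖ := by
  have h1 : ∀ b : weylAlgebra (Set.univ : Set M.OneParticle), ‖M.α t b‖ ≤ ‖b‖ := fun b => by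
    rw [α]
    exact norm_bogoliubov_le (unitaryGroup M.h t) b
  rw [evolved, ← norm_inclusion (weylAlgebra_mono (Set.subset_univ M.goodVectors)) a]
  exact (ω.le_opNorm _).trans (mul_le_mul_of_nonneg_left (h1 _) ω.opNorm_nonneg)

theorem evolved_weyl (t : ℝ) {f : M.OneParticle} (hf : f ∈ M.goodVectors) :
    M.evolved ω t ⟨weyl f, weyl_mem hf⟩ = ω (M.α t (W f)) := by
  have h1 : StarSubalgebra.inclusion (weylAlgebra_mono (Set.subset_univ M.goodVectors))
      ⟨weyl f, weyl_mem hf⟩ = W f := Subtype.ext rfl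
  rw [evolved, h1]

theorem norm_evolved_sub_le (t : ℝ) (a b : M.goodAlgebra) :
    ‖M.evolved ω t a - M.evolved ω t b‖ ≤ ‖ω‖ * ‖a - b‖ := by
  have h1 := evolved_add (ω := ω) t (a - b) b
  rw [sub_add_cancel] at h1
  rw [h1, add_sub_cancel_right]
  exact norm_evolved_le t _

/-- `t ↦ ω(α_t(a))` is continuous and has a limit as `t → ∞`. -/
def Relaxes (ω : weylAlgebra (Set.univ : Set M.OneParticle) →L[ℂ] ℂ) (a : M.goodAlgebra) : Prop :=
  (Continuous fun t => M.evolved ω t a) ∧ ∃ L, Tendsto (fun t => M.evolved ω t a) atTop (𝓝 L)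

theorem relaxes_of_approx {a : M.goodAlgebra}
    (h : ∀ δ > 0, ∃ b, ‖a - b‖ < δ ∧ Relaxes ω b) : Relaxes ω a := by
  have h' : ∀ ε > 0, ∃ b, (∀ t, ‖M.evolved ω t a - M.evolved ω t b‖ < ε) ∧ Relaxes ω b := by
    intro ε hε
    obtain ⟨b, hb, hr⟩ := h (ε / (‖ω‖ + 1)) (by positivity)
    refine ⟨b, fun t => (norm_evolved_sub_le t a b).trans_lt ?_, hr⟩
    rw [lt_div_iff₀ (by positivity)] at hb
    have h1 : 0 ≤ ‖a - b‖ := norm_nonneg _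
    linarith
  constructor
  · refine continuous_of_uniform_approx_of_continuous fun u hu => ?_
    obtain ⟨ε, hε, hu⟩ := Metric.mem_uniformity_dist.1 hu
    obtain ⟨b, hb, hr⟩ := h' ε hε
    exact ⟨_, hr.1, fun t => hu (by rw [dist_eq_norm]; exact hb t)⟩
  · refine cauchySeq_tendsto_of_complete (Metric.cauchySeq_iff'.2 fun ε hε => ?_)
    obtain ⟨b, hb, -, L, hL⟩ := h' (ε / 3) (by positivity)
    obtain ⟨T, hT⟩ := Metric.cauchySeq_iff'.1 hL.cauchySeq (ε / 3) (by positivity)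
    refine ⟨T, fun t ht => ?_⟩
    have h1 := hb t
    have h2 := hb T
    have h3 := hT t ht
    rw [← dist_eq_norm] at h1 h2
    calc _ ≤ dist (M.evolved ω t a) (M.evolved ω t b) + dist (M.evolved ω t b) (M.evolved ω T b)
          + dist (M.evolved ω T b) (M.evolved ω T a) := dist_triangle4 _ _ _ _
      _ < ε := by rw [dist_comm (M.evolved ω T b)]; linarith

theorem relaxes (hω : M.IsInitialState ω) (hR : M.Regular) (hC : M.CondC ω) (a : M.goodAlgebra) : Relaxes ω a := by
  have h1 : ∀ b ∈ Submodule.span ℂ (weyl '' M.goodVectors), ∀ hb' : b ∈ M.goodAlgebra,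
      Relaxes ω ⟨b, hb'⟩ := by
    intro b hb
    induction hb using Submodule.span_induction with
    | mem x hx =>
      obtain ⟨f, hf, rfl⟩ := hx
      intro _
      simp only [Relaxes, evolved_weyl _ hf]
      exact ⟨M.continuous_state_evolved hω hR hC hf, _, M.tendsto_state hω hR hC hf⟩
    | zero =>
      intro h0
      have h2 : ∀ t, M.evolved ω t ⟨0, h0⟩ = 0 := fun t => by
        have h3 := norm_evolved_le (ω := ω) t ⟨0, h0⟩
        simpa using h3
      simp only [Relaxes, h2]
      exact ⟨continuous_const, 0, tendsto_const_nhds⟩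
    | add x y hx hy ihx ihy =>
      intro h0
      have h2 : ∀ t, M.evolved ω t ⟨x + y, h0⟩ = M.evolved ω t ⟨x, span_weyl_le _ hx⟩ +
        M.evolved ω t ⟨y, span_weyl_le _ hy⟩ := fun t => by rw [← evolved_add]; rfl
      obtain ⟨h3, L, h4⟩ := ihx (span_weyl_le _ hx)
      obtain ⟨h5, L', h6⟩ := ihy (span_weyl_le _ hy)
      simp only [Relaxes, h2]
      exact ⟨h3.add h5, _, h4.add h6⟩
    | smul c x hx ihx =>
      intro h0
      have h2 : ∀ t, M.evolved ω t ⟨c • x, h0⟩ = c * M.evolved ω t ⟨x, span_weyl_le _ hx⟩ :=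
        fun t => by rw [← evolved_smul]; rfl
      obtain ⟨h3, L, h4⟩ := ihx (span_weyl_le _ hx)
      simp only [Relaxes, h2]
      exact ⟨h3.const_mul c, _, h4.const_mul c⟩
  refine relaxes_of_approx fun δ hδ => ?_
  have h2 : (a : RegSpace M.OneParticle →L[ℂ] RegSpace M.OneParticle) ∈
      closure (StarAlgebra.adjoin ℂ (weyl '' M.goodVectors) : Set _) := by
    rw [← StarSubalgebra.topologicalClosure_coe]
    exact a.2
  obtain ⟨b, hb, hab⟩ := Metric.mem_closure_iff.1 h2 δ hδ
  have hb' := adjoin_weyl_le_span (M.goodSubmodule hR) hb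
  refine ⟨⟨b, span_weyl_le _ hb'⟩, ?_, h1 b hb' _⟩
  rw [dist_eq_norm] at hab
  exact hab

theorem exists_limit_state (hω : M.IsInitialState ω) (hR : M.Regular) (hC : M.CondC ω) : ∃ ρ : M.goodAlgebra →L[ℂ] ℂ, IsState ρ ∧
      ∀ a, Tendsto (fun t => M.evolved ω t a) atTop (𝓝 (ρ a)) := by
  choose L hL using fun a => (relaxes hω hR hC a).2
  refine ⟨LinearMap.mkContinuous
    { toFun := L
      map_add' := fun a b => tendsto_nhds_unique (hL (a + b)) (by
        simp only [evolved_add]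
        exact (hL a).add (hL b))
      map_smul' := fun c a => tendsto_nhds_unique (hL (c • a)) (by
        simp only [evolved_smul]
        exact (hL a).const_mul c) } ‖ω‖ fun a =>
    le_of_tendsto' (hL a).norm fun t => norm_evolved_le t a, ⟨fun a => ?_, ?_⟩, hL⟩
  · refine ge_of_tendsto' (hL (star a * a)) fun t => ?_
    simp only [evolved, map_mul, map_star]
    exact hω.isState.nonneg _
  · refine tendsto_nhds_unique (hL 1) ?_
    simp only [evolved, map_one, hω.isState.one]
    exact tendsto_const_nhds

theorem isNESS_iff (hω : M.IsInitialState ω) (hR : M.Regular) (hC : M.CondC ω) {ωp : M.goodAlgebra →L[ℂ] ℂ} (hs : IsState ωp)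
    (hlim : ∀ a, Tendsto (fun t => M.evolved ω t a) atTop (𝓝 (ωp a)))
    (ρ : M.goodAlgebra →L[ℂ] ℂ) : M.IsNESS ω ρ ↔ ρ = ωp := by
  have h1 : Tendsto (fun (T : ℝ) (a : M.goodAlgebra) =>
      (T : ℂ)⁻¹ * ∫ t in (0 : ℝ)..T, M.evolved ω t a) atTop (𝓝 fun a => ωp a) :=
    tendsto_pi_nhds.2 fun a => tendsto_average (relaxes hω hR hC a).1
      (fun t => norm_evolved_le t a) (hlim a)
  constructor
  · rintro ⟨-, h2⟩
    have h3 : ClusterPt (fun a => ρ a) (𝓝 fun a => ωp a) := ClusterPt.mono h2 h1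
    exact ContinuousLinearMap.ext fun a => congrFun (eq_of_nhds_neBot h3) a
  · rintro rfl
    exact ⟨hs, h1.mapClusterPt⟩

end Model

end

end BoseNESS

end

theorem mainTheorem1 {N : ℕ} (M : BoseNESS.Model N)
    (ω₀ : BoseNESS.weylAlgebra (Set.univ : Set M.OneParticle) →L[ℂ] ℂ)
    (hω₀ : M.IsInitialState ω₀)
    (hA : M.CondA) (hB : M.CondB) (hC : M.CondC ω₀) (hD : M.CondD) :
    (∀ f ∈ M.goodVectors, M.WellDefined f ∧
      Tendsto (fun t : ℝ => ω₀ (M.α t (BoseNESS.W f))) atTop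
        (𝓝 (Complex.exp (-(1 / 2) * (M.S f : ℂ) + Complex.I * (M.Λ f : ℂ))))) ∧
    ∃ ωp : M.goodAlgebra →L[ℂ] ℂ, BoseNESS.IsState ωp ∧
      (∀ f (hf : f ∈ M.goodVectors), ωp ⟨BoseNESS.weyl f, BoseNESS.weyl_mem hf⟩ =
        Complex.exp (-(1 / 2) * (M.S f : ℂ) + Complex.I * (M.Λ f : ℂ))) ∧
      M.IsQuasiFree ωp ∧
      (∀ a : M.goodAlgebra, Tendsto (fun t : ℝ => M.evolved ω₀ t a) atTop (𝓝 (ωp a))) ∧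
      ∀ ρ : M.goodAlgebra →L[ℂ] ℂ, M.IsNESS ω₀ ρ ↔ ρ = ωp := by
  have hR : M.Regular := ⟨hA, hB, hD⟩
  refine ⟨fun f hf => ⟨M.wellDefined hR hf, M.tendsto_state hω₀ hR hC hf⟩, ?_⟩
  obtain ⟨ωp, hs, hlim⟩ := BoseNESS.Model.exists_limit_state hω₀ hR hC
  have hval : ∀ f (hf : f ∈ M.goodVectors), ωp ⟨BoseNESS.weyl f, BoseNESS.weyl_mem hf⟩ =
      Complex.exp (-(1 / 2) * (M.S f : ℂ) + Complex.I * (M.Λ f : ℂ)) := fun f hf => by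
    have h1 := hlim ⟨BoseNESS.weyl f, BoseNESS.weyl_mem hf⟩
    simp only [BoseNESS.Model.evolved_weyl _ hf] at h1
    exact tendsto_nhds_unique h1 (M.tendsto_state hω₀ hR hC hf)
  exact ⟨ωp, hs, hval, BoseNESS.Model.isQuasiFree hR hval, hlim,
    BoseNESS.Model.isNESS_iff hω₀ hR hC hs hlim⟩
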